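/- **Setting.** All systems consist of qubits. Let $n\ge 1$, $m\ge 0$, $d=2^n$, $d_\chi=2^m$. The logical system $L$, a reference $r$ and $A_1$ have $n$ qubits each, $A_2$ and $\bar A$ have $m$ qubits each, and the physical space is $\mathcal H_A\otimes\mathcal H_{\bar A}$ with $\mathcal H_A\cong\mathcal H_{A_1}\otimes\mathcal H_{A_2}$. A *skewed stabilizer code from which $A$ recovers the whole bulk* (so $\bar a$ is empty) consists of an encoding $V^{(0)}$ and Clifford unitaries $R_A^{(0)},R_{\bar A}^{(0)}$ with $$(R^{(0)}_A\otimes R^{(0)}_{\bar A})V^{(0)}|\psi\rangle=|\psi\rangle_{A_1}|\chi\rangle_{A_2\bar A}\quad\text{for all }\psi ,$$ where $|\chi\rangle$ is a stabilizer state with $\mathrm{Tr}_{\bar A}|\chi\rangle\langle\chi|=I_{A_2}/d_\chi$, and of a Hermitian operator $W$ on $\mathcal H_A\otimes\mathcal H_{\bar A}$. Its skewed encoding is $V^{(\epsilon)}=e^{i\epsilon W}V^{(0)}$. *Proto-area correction.* For local unitaries $R=(R_A,R_{\bar A})$ and a logical state $\sigma$, let $\sigma^{(R,\epsilon)}_{A_1A_2}$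 and $\sigma^{(R,\epsilon)}_{A_1}$ be the reduced states of $(R_A\otimes R_{\bar A})V^{(\epsilon)}\sigma V^{(\epsilon)\dagger}(R_A\otimes R_{\bar A})^\dagger$. With $D(\rho\|\xi)=\mathrm{Tr}\,\rho(\ln\rho-\ln\xi)$ put $$S_{corr}=D\big(\sigma^{(R,\epsilon)}_{A_1A_2}\big\|\sigma^{(R^{(0)},0)}_{A_1A_2}\big)-D\big(\sigma^{(R,\epsilon)}_{A_1}\big\|\sigma^{(R^{(0)},0)}_{A_1}\big),$$ and let $\langle S_{corr}\rangle$ be its average over $\sigma\mapsto U\sigma U^\dagger$ with $U$ Haar distributed on $\mathrm U(d)$. A recovery $R$ is *optimal* for $V^{(\epsilon)}$ if it maximizes, among all pairs of local unitaries, the coherent information $S(\omega_{A_1})-S(\omega_{A_1r})$, where $\omega_{A_1r}$ is the image of the maximally entangled state of $L$ and $r$ under the channel $\sigma\mapsto\sigma^{(R,\epsilon)}_{A_1}$. *Non-local magic.* For a pure state $\phi$ of $N$ qubits and $\alpha>1$ let $\mathcal M_\alpha(\phi)=\frac1{1-\alpha}\log\big(2^{-N}\sum_P|\langle\phi|P|\phi\rangle|^{2\alpha}\big)$,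 the sum being over the $4^N$ Pauli strings. Let $|V_R^{(\epsilon)}\rangle=\frac1{\sqrt d}\sum_i|i\rangle_r\otimes(R_A^{(0)}\otimes R^{(0)}_{\bar A})V^{(\epsilon)}|i\rangle$. For Hermitian operators $T_{XY}$, independent of $\epsilon$, on the pairs $X\ne Y$ of the subsystems $A_1,A_2,\bar A$, and an ordering of these subsystems, consider the limit of $\epsilon^{-2}\mathcal M_\alpha\big(\prod_{X<Y} e^{i\epsilon T_{XY}}|V_R^{(\epsilon)}\rangle\big)$ as $\epsilon\to0$. Let $\mu_\alpha$ be the infimum of these limits over all $T$ and all orderings, and let $\mathcal M^{NL}_\alpha(V^{(\epsilon)})=\epsilon^2\mu_\alpha$ be the (leading-order) perturbative tripartite non-local magic of the code. *Coupling and spectral function.* Let $W_R=(R_A^{(0)}\otimes R_{\bar A}^{(0)})W(R_A^{(0)}\otimes R_{\bar A}^{(0)})^\dagger$, $D=i\,d_\chi\mathrm{Tr}_{\bar A}[W_R,I_{A_1}\otimes|\chi\rangle\langle\chi|]$, $$c_2=\frac{d}{2d_\chi(d^2-1)}\Big(\mathrm{Tr}\,D^2-\frac1d\mathrm{Tr}_{A_2}\big((\mathrm{Tr}_{A_1}D)^2\big)\Big),\qquad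 f_2(\lambda)=\frac2d+\frac1{2d}\sum_{i\ne j}\frac{(\lambda_i+\lambda_j)^2}{\lambda_i-\lambda_j}\ln\frac{\lambda_i}{\lambda_j}-2,$$ with the limiting value $(\lambda_i+\lambda_j)^2/\lambda_i$ of a summand when $\lambda_i=\lambda_j$. **Theorem.** For every such code there is a real constant $K$, independent of $\alpha$ and of the logical state, such that for every real $\alpha>1$: 1. all the limits in the definition of $\mu_\alpha$ exist and their infimum $\mu_\alpha$ is attained; 2. the coupling is the non-local magic up to a prefactor: $c_2=\frac{\alpha-1}{\alpha}\big(1-\frac1{d^2}\big)^{-1}\mu_\alpha$; 3. for every positive definite logical density matrix $\sigma$, with spectrum $\lambda$, and every choice of optimal recoveries $R^*(\epsilon)$ for $V^{(\epsilon)}$, the averaged correction satisfies, as $\epsilon\to0$, $$\langle S_{corr}\rangle=\frac{\alpha-1}{2\alpha}\Big(1-\frac1{d^2}\Big)^{-1}\mathcal M^{NL}_\alpha(V^{(\epsilon)})\,f_2(\lambda)+K\epsilon^2+o(\epsilon^2).$$ The same holds, with the same $K$, if $r$ is also admitted as a fourth subsystem in the definition of $\mu_\alpha$. -/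

import Mathlib

open Matrix Filter Topology MeasureTheory Asymptotics
open scoped Kronecker ComplexOrder

noncomputable section

namespace SkewedCode

/-! ### Finite-dimensional states and entropies -/

section Entropies

variable {a b : Type} [Fintype a] [Fintype b] [DecidableEq a] [DecidableEq b]

/-- Partial trace over the second tensor factor. -/
def traceSnd (M : Matrix (a × b) (a × b) ℂ) : Matrix a a ℂ :=
  Matrix.of fun i j => ∑ k, M (i, k) (j, k)

/-- Partial trace over the first tensor factor. -/
def traceFst (M : Matrix (a × b) (a × b) ℂ) : Matrix b b ℂ :=
  Matrix.of fun i j => ∑ k, M (k, i) (k, j)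

/-- Von Neumann entropy `- Tr (ρ ln ρ)`. -/
def entropy (ρ : Matrix a a ℂ) : ℝ :=
  -(Matrix.trace (ρ * cfc Real.log ρ)).re

/-- Relative entropy `D(ρ ‖ ξ) = Tr (ρ (ln ρ - ln ξ))`, used for positive definite `ξ`. -/
def relEntropy (ρ ξ : Matrix a a ℂ) : ℝ :=
  (Matrix.trace (ρ * (cfc Real.log ρ - cfc Real.log ξ))).re

end Entropies

/-! ### The Haar probability measure on a unitary group -/

section Haar

variable {k : Type} [Fintype k] [DecidableEq k]

instance unitaryMeasurableSpace : MeasurableSpace (Matrix.unitaryGroup k ℂ) := borel _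

instance unitaryBorelSpace : BorelSpace (Matrix.unitaryGroup k ℂ) := ⟨rfl⟩

instance unitaryCompactSpace : CompactSpace (Matrix.unitaryGroup k ℂ) := by
  suffices hU : IsCompact ((Matrix.unitaryGroup k ℂ : Submonoid (Matrix k k ℂ)) :
      Set (Matrix k k ℂ)) from isCompact_iff_compactSpace.mp hU
  have hK : IsCompact (Set.univ.pi fun _ : k => Set.univ.pi fun _ : k =>
      Metric.closedBall (0 : ℂ) 1) :=
    isCompact_univ_pi fun _ => isCompact_univ_pi fun _ => isCompact_closedBall _ _
  refine IsCompact.of_isClosed_subset hK ?_ ?_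
  · have h : ((Matrix.unitaryGroup k ℂ : Submonoid (Matrix k k ℂ)) : Set (Matrix k k ℂ))
        = {U : Matrix k k ℂ | U * star U = 1} := by
      ext U
      exact Matrix.mem_unitaryGroup_iff
    rw [h]
    exact isClosed_eq (continuous_id.mul continuous_star) continuous_const
  · intro U hU i _ j _
    rw [mem_closedBall_zero_iff]
    exact entry_norm_bound_of_unitary hU i j

/-- The Haar probability measure: left invariant, with total mass one. -/
def haar : Measure (Matrix.unitaryGroup k ℂ) := Measure.haarMeasure ⊤

end Haar

/-! ### Qubits, Pauli strings, stabilizer Rényi entropy -/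

/-- The computational basis of `n` qubits. -/
abbrev Bits (n : ℕ) : Type := Fin n → Fin 2

/-- The Pauli matrices `I, X, Y, Z`. -/
def pauli : Fin 4 → Matrix (Fin 2) (Fin 2) ℂ :=
  ![1, !![0, 1; 1, 0], !![0, -Complex.I; Complex.I, 0], !![1, 0; 0, -1]]

section Qubits

variable {N : Type} [Fintype N] [DecidableEq N]

/-- The Pauli string `⨂ₖ pauli (p k)` on the qubits labelled by `N`. -/
def pauliString (p : N → Fin 4) : Matrix (N → Fin 2) (N → Fin 2) ℂ :=
  Matrix.of fun x y => ∏ k, pauli (p k) (x k) (y k)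

/-- A unitary is Clifford when it maps Pauli strings to Pauli strings up to sign. -/
def IsClifford (U : Matrix (N → Fin 2) (N → Fin 2) ℂ) : Prop :=
  U ∈ Matrix.unitaryGroup (N → Fin 2) ℂ ∧
    ∀ p : N → Fin 4, ∃ q : N → Fin 4,
      U * pauliString p * Uᴴ = pauliString q ∨ U * pauliString p * Uᴴ = -pauliString q

/-- A stabilizer state of `N` qubits: a unit vector stabilized, up to sign, by `2 ^ |N|` of the
Pauli strings. -/
def IsStabilizerState (ψ : (N → Fin 2) → ℂ) : Prop :=
  star ψ ⬝ᵥ ψ = 1 ∧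
    Nat.card {p : N → Fin 4 // pauliString p *ᵥ ψ = ψ ∨ pauliString p *ᵥ ψ = -ψ} =
      2 ^ Fintype.card N

/-- The stabilizer `α`-Rényi entropy
`(1 - α)⁻¹ log (2⁻ⁿ ∑ₚ |⟨ψ|P|ψ⟩| ^ (2 α))` of a pure state of `n = |N|` qubits. -/
def stabilizerRenyi (α : ℝ) (ψ : (N → Fin 2) → ℂ) : ℝ :=
  1 / (1 - α) * Real.log (((2 : ℝ) ^ Fintype.card N)⁻¹ *
    ∑ p : N → Fin 4, ‖star ψ ⬝ᵥ (pauliString p *ᵥ ψ)‖ ^ (2 * α))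

/-- `M = t ⊗ 1`, with `t` acting on the qubits in `S` and `1` on the other ones. -/
def SupportedOn (S : Set N) (M : Matrix (N → Fin 2) (N → Fin 2) ℂ) : Prop :=
  ∃ t : (S → Fin 2) → (S → Fin 2) → ℂ, ∀ x y : N → Fin 2,
    ((∀ q, q ∉ S → x q = y q) → M x y = t (fun q => x q) (fun q => y q)) ∧
    (¬ (∀ q, q ∉ S → x q = y q) → M x y = 0)

/-! ### Perturbative non-local magic

The qubits are distributed over subsystems `ι` by `part : N → ι`. -/

variable {ι : Type}

/-- The pairs `(lᵢ, lⱼ)`, `i < j`, in lexicographic order. -/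
def pairs : List ι → List (ι × ι)
  | [] => []
  | i :: l => l.map (fun j => (i, j)) ++ pairs l

/-- A family of Hermitian generators, `T i j` acting on the two subsystems `i ≠ j` only. -/
def IsTwoLocal (part : N → ι) (T : ι → ι → Matrix (N → Fin 2) (N → Fin 2) ℂ) : Prop :=
  ∀ i j, i ≠ j → (T i j).IsHermitian ∧ SupportedOn {q | part q = i ∨ part q = j} (T i j)

/-- `∏ exp (i ε T i j)` over the pairs of subsystems in the list `l`. -/
def twoLocalUnitary (l : List ι) (T : ι → ι → Matrix (N → Fin 2) (N → Fin 2) ℂ) (ε : ℝ) :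
    Matrix (N → Fin 2) (N → Fin 2) ℂ :=
  ((pairs l).map fun p => NormedSpace.exp ((Complex.I * (ε : ℂ)) • T p.1 p.2)).prod

/-- The stabilizer Rényi entropy of `ψ ε` after the two-local unitaries generated by `T`, divided
by `ε ^ 2`. -/
def scaledMagic (α : ℝ) (l : List ι) (T : ι → ι → Matrix (N → Fin 2) (N → Fin 2) ℂ)
    (ψ : ℝ → (N → Fin 2) → ℂ) (ε : ℝ) : ℝ :=
  stabilizerRenyi α (twoLocalUnitary l T ε *ᵥ ψ ε) / ε ^ 2

/-- The leading-order (`ε ^ 2`) coefficients of the magic that are reached by two-local unitaries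
on pairs of the subsystems in `L`, for all generators and all orderings of the subsystems. -/
def magicCoeffs (α : ℝ) (part : N → ι) (L : List ι) (ψ : ℝ → (N → Fin 2) → ℂ) : Set ℝ :=
  {c | ∃ (l : List ι) (T : ι → ι → Matrix (N → Fin 2) (N → Fin 2) ℂ),
    l.Perm L ∧ IsTwoLocal part T ∧ Tendsto (scaledMagic α l T ψ) (𝓝[≠] 0) (𝓝 c)}

/-- The coefficient of `ε ^ 2` in the perturbative non-local magic. -/
def nonlocalMagicCoeff (α : ℝ) (part : N → ι) (L : List ι) (ψ : ℝ → (N → Fin 2) → ℂ) : ℝ :=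
  sInf (magicCoeffs α part L ψ)

/-- The perturbative non-local magic, at leading order in `ε`. -/
def nonlocalMagic (α : ℝ) (part : N → ι) (L : List ι) (ψ : ℝ → (N → Fin 2) → ℂ) (ε : ℝ) : ℝ :=
  ε ^ 2 * nonlocalMagicCoeff α part L ψ

end Qubits

/-! ### Codes, recovery and proto-area correction

The physical space is `A ⊗ Ā` with `A ≅ A₁ ⊗ A₂`. The systems `r`, `L` (logical) and `A₁` have `n`
qubits each, `A₂` and `Ā` have `m` qubits each. -/

/-- Basis of `(A₁ ⊗ A₂) ⊗ Ā`. -/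
abbrev Phys (n m : ℕ) : Type := (Bits n × Bits m) × Bits m

/-- A local recovery: a unitary on `A` and a unitary on `Ā`. -/
abbrev Recovery (n m : ℕ) : Type :=
  Matrix.unitaryGroup (Bits n × Bits m) ℂ × Matrix.unitaryGroup (Bits m) ℂ

section Codes

variable {n m : ℕ}

/-- The operator `R_A ⊗ R_Ā`. -/
def Recovery.op (R : Recovery n m) : Matrix (Phys n m) (Phys n m) ℂ :=
  (R.1 : Matrix (Bits n × Bits m) (Bits n × Bits m) ℂ) ⊗ₖ (R.2 : Matrix (Bits m) (Bits m) ℂ)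

/-- The map `|ψ⟩ ↦ |ψ⟩_{A₁} |χ⟩_{A₂ Ā}`. -/
def attach (χ : Bits m × Bits m → ℂ) : Matrix (Phys n m) (Bits n) ℂ :=
  Matrix.of fun p i => if p.1.1 = i then χ (p.1.2, p.2) else 0

/-- The recovered state on `A = A₁ A₂` of the code with encoding `V`. -/
def recoveredA (V : Matrix (Phys n m) (Bits n) ℂ) (R : Recovery n m)
    (σ : Matrix (Bits n) (Bits n) ℂ) : Matrix (Bits n × Bits m) (Bits n × Bits m) ℂ :=
  traceSnd (R.op * (V * σ * Vᴴ) * R.opᴴ)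

/-- The encode-and-recover channel from the logical system to `A₁`. -/
def recoveredA₁ (V : Matrix (Phys n m) (Bits n) ℂ) (R : Recovery n m)
    (σ : Matrix (Bits n) (Bits n) ℂ) : Matrix (Bits n) (Bits n) ℂ :=
  traceSnd (recoveredA V R σ)

/-- The image on `A₁ r` of the maximally entangled state of the logical system and `r` under the
encode-and-recover channel. -/
def channelState (V : Matrix (Phys n m) (Bits n) ℂ) (R : Recovery n m) :
    Matrix (Bits n × Bits n) (Bits n × Bits n) ℂ :=
  Matrix.of fun x y => ((2 : ℂ) ^ n)⁻¹ * recoveredA₁ V R (Matrix.single x.2 y.2 1) x.1 y.1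

/-- The coherent information of the encode-and-recover channel. -/
def coherentInfo (V : Matrix (Phys n m) (Bits n) ℂ) (R : Recovery n m) : ℝ :=
  entropy (traceSnd (channelState V R)) - entropy (channelState V R)

/-- `R` maximizes the coherent information among all local recovery unitaries. -/
def IsOptimalRecovery (V : Matrix (Phys n m) (Bits n) ℂ) (R : Recovery n m) : Prop :=
  ∀ R' : Recovery n m, coherentInfo V R' ≤ coherentInfo V R

/-- Choi state `2 ^ (-n / 2) ∑ᵢ |i⟩_r V |i⟩` of `V`, on the qubits of `r`, `A₁`, `A₂`, `Ā`
in this order. -/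
def choi (V : Matrix (Phys n m) (Bits n) ℂ) :
    ((Fin n ⊕ Fin n ⊕ Fin m ⊕ Fin m) → Fin 2) → ℂ :=
  fun x => ((Real.sqrt ((2 : ℝ) ^ n))⁻¹ : ℂ) *
    V ((fun k => x (.inr (.inl k)), fun k => x (.inr (.inr (.inl k)))),
      fun k => x (.inr (.inr (.inr k)))) (fun k => x (.inl k))

end Codes

/-- The subsystems of the Choi state. -/
inductive Party : Type
  | r | A₁ | A₂ | Abar

/-- The subsystem to which a qubit of the Choi state belongs. -/
def party (n m : ℕ) : (Fin n ⊕ Fin n ⊕ Fin m ⊕ Fin m) → Party :=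
  Sum.elim (fun _ => .r) (Sum.elim (fun _ => .A₁) (Sum.elim (fun _ => .A₂) (fun _ => .Abar)))

/-- A stabilizer code from which `A` recovers the whole logical system, together with the Hermitian
generator `W` of a skewing. -/
structure SkewedStabilizerCode (n m : ℕ) where
  /-- the exact encoding map -/
  enc₀ : Matrix (Phys n m) (Bits n) ℂ
  /-- the recovery unitaries of the exact code -/
  rec₀ : Recovery n m
  /-- the resource state on `A₂ Ā` -/
  χ : Bits m × Bits m → ℂ
  /-- the skewing matrix -/
  W : Matrix (Phys n m) (Phys n m) ℂ
  isClifford_A : IsClifford (Matrix.reindex (Equiv.sumArrowEquivProdArrow _ _ _).symm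
    (Equiv.sumArrowEquivProdArrow _ _ _).symm
    (rec₀.1 : Matrix (Bits n × Bits m) (Bits n × Bits m) ℂ))
  isClifford_Abar : IsClifford (rec₀.2 : Matrix (Bits m) (Bits m) ℂ)
  isStabilizer_χ : IsStabilizerState (χ ∘ Equiv.sumArrowEquivProdArrow (Fin m) (Fin m) (Fin 2))
  /-- the entanglement spectrum of `χ` is flat, of full rank `2 ^ m` -/
  flat_χ : traceSnd (Matrix.vecMulVec χ (star χ)) = ((2 : ℂ) ^ m)⁻¹ • 1
  exact_recovery : rec₀.op * enc₀ = attach χ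
  isHermitian_W : W.IsHermitian

namespace SkewedStabilizerCode

variable {n m : ℕ} (C : SkewedStabilizerCode n m)

/-- The skewed encoding `V^(ε) = exp (i ε W) V^(0)`. -/
def enc (ε : ℝ) : Matrix (Phys n m) (Bits n) ℂ :=
  NormedSpace.exp ((Complex.I * (ε : ℂ)) • C.W) * C.enc₀

/-- The proto-area correction at the logical state `σ`, when `R` is the recovery of the skewed
code: boundary minus bulk relative entropy between the recovered skewed and exact states. -/
def sCorr (ε : ℝ) (R : Recovery n m) (σ : Matrix (Bits n) (Bits n) ℂ) : ℝ :=
  relEntropy (recoveredA (C.enc ε) R σ) (recoveredA C.enc₀ C.rec₀ σ) -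
    relEntropy (recoveredA₁ (C.enc ε) R σ) (recoveredA₁ C.enc₀ C.rec₀ σ)

/-- The proto-area correction averaged over the logical states `U σ Uᴴ`. -/
def avgSCorr (ε : ℝ) (R : Recovery n m) (σ : Matrix (Bits n) (Bits n) ℂ) : ℝ :=
  ∫ U : Matrix.unitaryGroup (Bits n) ℂ,
    C.sCorr ε R ((U : Matrix (Bits n) (Bits n) ℂ) * σ * (U : Matrix (Bits n) (Bits n) ℂ)ᴴ) ∂haar

/-- The Choi state of the skewed code, after the recovery unitaries of the exact code. -/
def choiState (ε : ℝ) : ((Fin n ⊕ Fin n ⊕ Fin m ⊕ Fin m) → Fin 2) → ℂ :=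
  choi (C.rec₀.op * C.enc ε)

/-- The skewing matrix in the frame of the exact recovery. -/
def WR : Matrix (Phys n m) (Phys n m) ℂ := C.rec₀.op * C.W * C.rec₀.opᴴ

/-- The matrix `D = i d_χ Tr_Ā [W_R, 1 ⊗ |χ⟩⟨χ|]` on `A₁ A₂`. -/
def D : Matrix (Bits n × Bits m) (Bits n × Bits m) ℂ :=
  (Complex.I * (2 : ℂ) ^ m) •
    traceSnd (C.WR * (attach C.χ * (attach C.χ)ᴴ) - (attach C.χ * (attach C.χ)ᴴ) * C.WR)

/-- The coupling `c₂`, with `d = 2 ^ n` and `d_χ = 2 ^ m`. -/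
def c₂ : ℝ :=
  (2 : ℝ) ^ n / (2 * (2 : ℝ) ^ m * (((2 : ℝ) ^ n) ^ 2 - 1)) *
    ((Matrix.trace (C.D * C.D)).re -
      1 / (2 : ℝ) ^ n * (Matrix.trace (traceFst C.D * traceFst C.D)).re)

end SkewedStabilizerCode

/-- `(ln a - ln b) / (a - b)`, with its limit `1 / a` at `b = a`. -/
def logSlope (a b : ℝ) : ℝ := if a = b then 1 / a else (Real.log a - Real.log b) / (a - b)

/-- `f₂(λ) = 2 / d + (2 d)⁻¹ ∑_{i ≠ j} (λᵢ + λⱼ)² / (λᵢ - λⱼ) ln (λᵢ / λⱼ) - 2`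
for a spectrum of `d` eigenvalues. -/
def f₂ {k : Type} [Fintype k] [DecidableEq k] (lam : k → ℝ) : ℝ :=
  2 / Fintype.card k +
    (∑ i, ∑ j, if i = j then 0 else
      1 / (2 * (Fintype.card k : ℝ)) * ((lam i + lam j) ^ 2 * logSlope (lam i) (lam j))) - 2

end SkewedCode

end

/-! Because χ is maximally entangled between A₂ and Ā, every map from L to A₁A₂Ā is M ⊗ 1 applied to
the exact encoding |ψ⟩|χ⟩, for an operator M on A₁A₂ (`opOf`, `vecOp`). In this picture the skewed
code is M = 1 + iεX + o(ε) with X = `skewOp`, and D = i(X − X†) is the first-order change of the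
Gram operator M†M. Let N = `gapOp` be the component of D orthogonal to all operators 1 ⊗ g, and
`gap` = ‖N‖² / (4 d d_χ). One number governs everything: c₂ is 2 `gap` / (1 − 1/d²) (`c₂_eq`), μ_α
is 2α/(α−1) times `gap` (`nonlocalMagicCoeff_eq`), and `gap` · ε² is to leading order the least
entanglement infidelity of any local recovery.

Magic. Near a state whose Pauli expectations are 0 or ±1, the stabilizer Rényi entropy is 2α/(α−1)
ε² times the variance of the first-order velocity (`tendsto_stabilizerRenyi`): Pauli strings of zero
expectation only enter at order ε^(2α). A generator on a pair of subsystems becomes a Hermitian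
operator on A₁A₂, except for the pairs A₂Ā and rA₁, which give 1 ⊗ g and h ⊗ 1. Now N is Hermitian
and both its partial traces vanish, so it is orthogonal to the velocities of all these generators,
and Cauchy-Schwarz gives the lower bound (`gap_le_velocityVariance`). Cancelling the Hermitian part
of X on A₁A₂ and the mean of D on A₂Ā attains it (`velocityVariance_optGen`). Admitting r changes
nothing, since N is orthogonal to its directions as well.

Correction. The logarithm of the exact bulk state is ln σ ⊗ 1 minus a constant, so S_corr = S(A₁) −
S(A₁A₂) + ln d_χ, where S(A₁A₂) does not see the recovery (`sCorr_eq_entropy`). Each negative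
entropy is written as a form quadratic in the deviation from the exact state plus a linear term
(`neg_entropy_eq_kleinDiv`), and the Haar average of the linear term is affine in the entanglement
fidelity (`exists_integral_linPart`).

The reference recovery `skewRec` has infidelity `gap` · ε² + o(ε²). For an optimal recovery let θ be
one minus the largest eigenvalue of its Choi state. The entropy of that state is −θ ln θ up to O(θ),
and comparing coherent informations with `skewRec` gives θ ≤ (`gap` + o(1)) ε²
(`eventually_one_sub_eigenvalue_le`). Hence one unitary on A₁, which no entropy sees, brings the
channel within O(ε²) of the identity (`exists_unitary_correction`). Together with the bound
`eventually_le_one_sub_fid`, uniform over all recoveries, the infidelity becomes `gap` · ε² + o(ε²)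
too. So the linear terms cancel and the quadratic form on A₁ is O(ε⁴). There remains the quadratic
form on A₁A₂ at the derivative ½{D, σ ⊗ 1/d_χ}, whose average follows from the second moments of Uᴴ
B U (`conjMoment_eq`): it is (c₂/2) f₂ plus the state-independent `areaShift`. -/

namespace SkewedCode

/-! ### Functional calculus of Hermitian matrices and the entropy -/

section FunctionalCalculus

variable {k l : Type} [Fintype k] [DecidableEq k] [Fintype l] [DecidableEq l]

theorem continuousOn_spectrum (f : ℝ → ℝ) (A : Matrix k k ℂ) : ContinuousOn f (spectrum ℝ A) :=
  A.finite_real_spectrum.continuousOn f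

open scoped Matrix.Norms.L2Operator in
theorem continuousOn_cfc_hermitian {X : Type*} [TopologicalSpace X] {f : ℝ → ℝ}
    (hf : Continuous f) {a : X → Matrix k k ℂ} {s : Set X} (ha : ContinuousOn a s)
    (h : ∀ x ∈ s, (a x).IsHermitian) : ContinuousOn (fun x => cfc f (a x)) s :=
  ContinuousOn.cfc_of_mem_nhdsSet (s := Set.univ) f Filter.univ_mem ha
    (fun x hx => (h x hx).isSelfAdjoint) hf.continuousOn

theorem cfc_unitary_conj (f : ℝ → ℝ) {A U : Matrix k k ℂ} (hA : A.IsHermitian)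
    (hU : U ∈ unitaryGroup k ℂ) : cfc f (U * A * Uᴴ) = U * cfc f A * Uᴴ := by
  have h := StarAlgHomClass.map_cfc (S := ℝ) (Unitary.conjStarAlgAut ℝ (Matrix k k ℂ) ⟨U, hU⟩) f A
    (continuousOn_spectrum f A) (by
      have h : ∀ x, Unitary.conjStarAlgAut ℝ (Matrix k k ℂ) ⟨U, hU⟩ x = U * x * star U :=
        fun x => Unitary.conjStarAlgAut_apply _ _
      rw [show ⇑(Unitary.conjStarAlgAut ℝ (Matrix k k ℂ) ⟨U, hU⟩) = _ from funext h]
      fun_prop) hA.isSelfAdjoint (by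
      rw [Unitary.conjStarAlgAut_apply]
      exact (isHermitian_mul_mul_conjTranspose U hA).isSelfAdjoint)
  simpa [Unitary.conjStarAlgAut_apply, star_eq_conjTranspose] using h.symm

/-- Interpolate at the finite spectrum. The extra nodes `s` allow the polynomial to be evaluated at
prescribed points without first identifying the spectrum, as needed for diagonal matrices. -/
theorem exists_cfc_eq_aeval (f : ℝ → ℝ) {A : Matrix k k ℂ} (hA : A.IsHermitian) (s : Finset ℝ) :
    ∃ q : Polynomial ℝ, (∀ x ∈ s, q.eval x = f x) ∧ cfc f A = Polynomial.aeval A q := by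
  let t := s ∪ A.finite_real_spectrum.toFinset
  refine ⟨Lagrange.interpolate t id f, fun x hx => ?_, ?_⟩
  · exact Lagrange.eval_interpolate_at_node (v := id) f Function.injective_id.injOn
      (Finset.mem_union_left _ hx)
  · rw [← cfc_polynomial _ A hA.isSelfAdjoint]
    refine cfc_congr fun x hx => ?_
    exact (Lagrange.eval_interpolate_at_node (v := id) f Function.injective_id.injOn
      (Finset.mem_union_right _ (by simpa using hx))).symm

omit [Fintype k] in
theorem isHermitian_diagonal_ofReal (p : k → ℝ) :
    (diagonal fun i => (p i : ℂ)).IsHermitian := by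
  rw [IsHermitian, diagonal_conjTranspose]
  congr 1
  ext i
  simp

theorem cfc_diagonal_ofReal (f : ℝ → ℝ) (p : k → ℝ) :
    cfc f (diagonal fun i => (p i : ℂ)) = diagonal fun i => (f (p i) : ℂ) := by
  obtain ⟨q, hq, h⟩ := exists_cfc_eq_aeval f (isHermitian_diagonal_ofReal p) (Finset.univ.image p)
  rw [h]
  have h2 : (diagonal fun i => (p i : ℂ)) = diagonalAlgHom ℝ (fun i => (p i : ℂ)) := rfl
  rw [h2, Polynomial.aeval_algHom_apply]
  change diagonal _ = diagonal _
  congr 1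
  ext i
  have : Polynomial.aeval (fun i => (p i : ℂ)) q i = Polynomial.aeval (p i : ℂ) q := by
    simpa using (Polynomial.aeval_algHom_apply (Pi.evalAlgHom ℝ (fun _ : k => ℂ) i)
      (fun i => (p i : ℂ)) q).symm
  rw [this, ← hq (p i) (by simp)]
  simpa using Polynomial.aeval_algebraMap_apply ℂ (p i) q

theorem mul_cfc_log {ρ : Matrix k k ℂ} (hρ : ρ.IsHermitian) :
    ρ * cfc Real.log ρ = cfc (fun x => x * Real.log x) ρ := by
  rw [cfc_mul (fun x => x) Real.log ρ (continuousOn_spectrum _ _) (continuousOn_spectrum _ _),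
    cfc_id' ℝ ρ hρ.isSelfAdjoint]

theorem trace_cfc (f : ℝ → ℝ) {ρ : Matrix k k ℂ} (hρ : ρ.IsHermitian) :
    trace (cfc f ρ) = ∑ i, (f (hρ.eigenvalues i) : ℂ) := by
  rw [hρ.cfc_eq, IsHermitian.cfc, Unitary.conjStarAlgAut_apply, trace_mul_comm, ← mul_assoc]
  simp [trace_diagonal]

theorem entropy_eq_sum {ρ : Matrix k k ℂ} (hρ : ρ.IsHermitian) :
    entropy ρ = ∑ i, Real.negMulLog (hρ.eigenvalues i) := by
  rw [entropy, mul_cfc_log hρ, trace_cfc _ hρ, ← Complex.ofReal_sum, Complex.ofReal_re,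
    ← Finset.sum_neg_distrib]
  simp [Real.negMulLog]

theorem entropy_unitary_conj {ρ U : Matrix k k ℂ} (hρ : ρ.IsHermitian)
    (hU : U ∈ unitaryGroup k ℂ) : entropy (U * ρ * Uᴴ) = entropy ρ := by
  have h1 : Uᴴ * U = 1 := mem_unitaryGroup_iff'.mp hU
  rw [entropy, entropy, cfc_unitary_conj _ hρ hU]
  have : U * ρ * Uᴴ * (U * cfc Real.log ρ * Uᴴ) = U * (ρ * cfc Real.log ρ) * Uᴴ := by
    calc _ = U * ρ * (Uᴴ * U) * cfc Real.log ρ * Uᴴ := by simp only [mul_assoc]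
      _ = _ := by rw [h1]; simp only [mul_assoc, mul_one]
  rw [this, trace_mul_comm, ← mul_assoc, h1, one_mul]

end FunctionalCalculus

/-! ### Relative entropy as a quadratic form in the deviation -/

section Klein

/-- `q ln (q / p) - q + p`. -/
noncomputable def kleinFun (p q : ℝ) : ℝ := q * Real.log q - q * Real.log p - q + p

/-- `kleinFun p q / (q - p) ^ 2`, continued to `q = p`. -/
noncomputable def kleinSlope (p q : ℝ) : ℝ :=
  if q = p then 1 / (2 * p) else kleinFun p q / (q - p) ^ 2

theorem kleinSlope_mul (p q : ℝ) : (q - p) * kleinSlope p q * (q - p) = kleinFun p q := by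
  unfold kleinSlope
  split_ifs with h
  · subst h; simp [kleinFun]
  · have : q - p ≠ 0 := sub_ne_zero.mpr h
    field_simp

theorem hasDerivAt_kleinFun (p : ℝ) {q : ℝ} (hq : q ≠ 0) :
    HasDerivAt (kleinFun p) (Real.log q - Real.log p) q := by
  have h := (((Real.hasDerivAt_mul_log hq).sub ((hasDerivAt_id q).mul_const (Real.log p))).sub
    (hasDerivAt_id q)).add_const p
  refine h.congr_deriv ?_
  ring

/-- At q = p, l'Hôpital reduces the quotient to half the slope of the logarithm. Continuity on all
of ℝ, including q ≤ 0, is what `continuousOn_cfc_hermitian` requires, so no positivity of the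
perturbed states has to be tracked. -/
theorem continuous_kleinSlope {p : ℝ} (hp : 0 < p) : Continuous (kleinSlope p) := by
  have hc : Continuous (kleinFun p) := by
    unfold kleinFun
    have := Real.continuous_mul_log
    fun_prop
  rw [continuous_iff_continuousAt]
  intro q
  by_cases hq : q = p
  · subst hq
    rw [continuousAt_iff_punctured_nhds]
    have h1 : Tendsto (fun x => kleinFun q x / (x - q) ^ 2) (𝓝[≠] q) (𝓝 (1 / (2 * q))) := by
      refine HasDerivAt.lhopital_zero_nhdsNE (f' := fun x => Real.log x - Real.log q)
        (g' := fun x => 2 * (x - q)) ?_ ?_ ?_ ?_ ?_ ?_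
      · have : ∀ᶠ x in 𝓝 q, x ≠ 0 := eventually_ne_nhds hp.ne'
        filter_upwards [nhdsWithin_le_nhds this] with x hx using hasDerivAt_kleinFun q hx
      · refine Eventually.of_forall fun x => ?_
        have h := ((hasDerivAt_id x).sub_const q).pow 2
        refine h.congr_deriv ?_
        simp
      · filter_upwards [self_mem_nhdsWithin] with x hx
        have : x - q ≠ 0 := sub_ne_zero.mpr hx
        simpa using this
      · have := hc.tendsto q
        have h0 : kleinFun q q = 0 := by simp [kleinFun]
        rw [h0] at this
        exact this.mono_left nhdsWithin_le_nhds
      · have : Continuous fun x : ℝ => (x - q) ^ 2 := by fun_prop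
        have := this.tendsto q
        simp only [sub_self, ne_eq, OfNat.ofNat_ne_zero, not_false_eq_true, zero_pow] at this
        exact this.mono_left nhdsWithin_le_nhds
      · have h := (hasDerivAt_iff_tendsto_slope.mp (Real.hasDerivAt_log hp.ne')).const_mul (1 / 2)
        convert h using 2
        · rename_i x
          rw [slope_def_field, mul_comm 2, ← div_div]
          ring
        · ring
    have h2 : kleinSlope q q = 1 / (2 * q) := by simp [kleinSlope]
    rw [h2]
    refine h1.congr' ?_
    filter_upwards [self_mem_nhdsWithin] with x hx
    have : x ≠ q := hx
    simp [kleinSlope, this]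
  · have h1 : ContinuousAt (fun x => kleinFun p x / (x - p) ^ 2) q :=
      hc.continuousAt.div (by fun_prop) (pow_ne_zero 2 (sub_ne_zero.mpr hq))
    refine h1.congr ?_
    filter_upwards [eventually_ne_nhds hq] with x hx
    simp [kleinSlope, hx]

/-- The two numerators add up to (q − p)(ln q − ln p). Symmetrizing a sum of `kleinSlope` over pairs
of eigenvalues thus produces the logarithmic slopes of `f₂`. -/
theorem kleinSlope_add_swap {p q : ℝ} (hp : 0 < p) (hq : 0 < q) :
    kleinSlope p q + kleinSlope q p = logSlope p q := by
  unfold kleinSlope logSlope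
  by_cases h : p = q
  · subst h
    simp only [if_true]
    field_simp
    norm_num
  · have h1 : q - p ≠ 0 := sub_ne_zero.mpr (Ne.symm h)
    have h2 : p - q ≠ 0 := sub_ne_zero.mpr h
    rw [if_neg h, if_neg (Ne.symm h), if_neg h]
    have h3 : (q - p) ^ 2 = (p - q) ^ 2 := by ring
    rw [h3, ← add_div, div_eq_div_iff (pow_ne_zero 2 h2) h2]
    unfold kleinFun
    ring

variable {k : Type} [Fintype k] [DecidableEq k]

/-- The relative entropy of `ρ` and `diagonal p`, as a form that is quadratic in their
difference. -/
noncomputable def kleinDiv (p : k → ℝ) (ρ : Matrix k k ℂ) : ℝ :=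
  (∑ j, ((ρ - diagonal fun i => (p i : ℂ)) * cfc (kleinSlope (p j)) ρ *
    (ρ - diagonal fun i => (p i : ℂ))) j j).re

theorem cfc_kleinFun (p : ℝ) {ρ : Matrix k k ℂ} (hρ : ρ.IsHermitian) :
    (ρ - (p : ℂ) • 1) * cfc (kleinSlope p) ρ * (ρ - (p : ℂ) • 1) =
      ρ * cfc Real.log ρ - (Real.log p : ℂ) • ρ - ρ + (p : ℂ) • 1 := by
  have hc := fun f => continuousOn_spectrum f ρ
  have h1 : ρ - (p : ℂ) • (1 : Matrix k k ℂ) = cfc (fun q => q - p) ρ := by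
    rw [cfc_sub (fun q => q) (fun _ => p) ρ (hc _) (hc _), cfc_id' ℝ ρ hρ.isSelfAdjoint,
      cfc_const p ρ hρ.isSelfAdjoint, Algebra.algebraMap_eq_smul_one]
    congr 1
  have h2 : (Real.log p : ℂ) • ρ = cfc (fun q => q * Real.log p) ρ := by
    rw [cfc_mul (fun q => q) (fun _ => Real.log p) ρ (hc _) (hc _), cfc_id' ℝ ρ hρ.isSelfAdjoint,
      cfc_const _ ρ hρ.isSelfAdjoint, ← Algebra.commutes, ← Algebra.smul_def]
    rfl
  rw [h1, ← cfc_mul _ _ ρ (hc _) (hc _), ← cfc_mul _ _ ρ (hc _) (hc _)]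
  have h3 : (fun x => (x - p) * kleinSlope p x * (x - p)) =
      fun x => x * Real.log x - x * Real.log p - x + p := by
    funext x
    rw [kleinSlope_mul, kleinFun]
  rw [h3, cfc_add ρ (fun x => x * Real.log x - x * Real.log p - x) (fun _ => p) (hc _) (hc _),
    cfc_sub (fun x => x * Real.log x - x * Real.log p) (fun x => x) ρ (hc _) (hc _),
    cfc_sub (fun x => x * Real.log x) (fun x => x * Real.log p) ρ (hc _) (hc _),
    mul_cfc_log hρ, h2, cfc_id' ℝ ρ hρ.isSelfAdjoint, cfc_const p ρ hρ.isSelfAdjoint,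
    Algebra.algebraMap_eq_smul_one]
  congr 1

/-- Row j and column j of ρ − diag p agree with those of ρ − p_j · 1. The (j, j) entry of the
quadratic form is therefore that of a function of ρ alone, and the scalar identity behind `kleinFun`
applies although ρ and diag p need not commute. -/
theorem neg_entropy_eq_kleinDiv (p : k → ℝ) {ρ : Matrix k k ℂ} (hρ : ρ.IsHermitian) :
    -entropy ρ = kleinDiv p ρ + (trace (ρ * diagonal fun i => (Real.log (p i) : ℂ))).re
      + (trace ρ).re - ∑ i, p i := by
  have key : ∀ j, ((ρ - diagonal fun i => (p i : ℂ)) * cfc (kleinSlope (p j)) ρ *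
      (ρ - diagonal fun i => (p i : ℂ))) j j =
      (ρ * cfc Real.log ρ) j j - (Real.log (p j) : ℂ) * ρ j j - ρ j j + (p j : ℂ) := by
    intro j
    have h := congrFun₂ (cfc_kleinFun (p j) hρ) j j
    simp only [Matrix.add_apply, Matrix.sub_apply, Matrix.smul_apply, one_apply_eq, smul_eq_mul, mul_one] at h
    rw [← h]
    have hl : ∀ x, (ρ - diagonal fun i => (p i : ℂ)) j x = (ρ - (p j : ℂ) • 1) j x := by
      intro x
      simp [diagonal_apply, one_apply]
    have hr : ∀ x, (ρ - diagonal fun i => (p i : ℂ)) x j = (ρ - (p j : ℂ) • 1) x j := by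
      intro x
      by_cases hx : x = j
      · subst hx; simp
      · simp [hx]
    simp only [mul_apply, hl, hr]
  rw [kleinDiv, Finset.sum_congr rfl fun j _ => key j, entropy, neg_neg]
  simp only [Finset.sum_add_distrib, Finset.sum_sub_distrib, Complex.add_re, Complex.sub_re, trace,
    diag, mul_diagonal, ← Complex.ofReal_sum, Complex.ofReal_re]
  have : ∑ i, (Real.log (p i) : ℂ) * ρ i i = ∑ i, ρ i i * (Real.log (p i) : ℂ) :=
    Finset.sum_congr rfl fun _ _ => mul_comm _ _
  rw [this]
  ring

theorem continuousOn_kleinDiv {p : k → ℝ} (hp : ∀ i, 0 < p i) {X : Type*} [TopologicalSpace X]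
    {a : X → Matrix k k ℂ} {s : Set X} (ha : ContinuousOn a s) (h : ∀ x ∈ s, (a x).IsHermitian) :
    ContinuousOn (fun x => kleinDiv p (a x)) s := by
  unfold kleinDiv
  have h1 : ∀ j, ContinuousOn (fun x => cfc (kleinSlope (p j)) (a x)) s := fun j =>
    continuousOn_cfc_hermitian (continuous_kleinSlope (hp j)) ha h
  refine Complex.continuous_re.comp_continuousOn (continuousOn_finsetSum _ fun j _ => ?_)
  have h2 : ContinuousOn (fun x => (a x - diagonal fun i => (p i : ℂ)) *
      cfc (kleinSlope (p j)) (a x) * (a x - diagonal fun i => (p i : ℂ))) s :=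
    ((ha.sub continuousOn_const).mul (h1 j)).mul (ha.sub continuousOn_const)
  exact (continuous_apply_apply j j).comp_continuousOn h2

end Klein

end SkewedCode

namespace SkewedCode

/-! ### Second moments of the entries of Uᴴ K U over the Haar measure -/

section HaarMoments

variable {k : Type} [Fintype k] [DecidableEq k]

instance isProbabilityMeasure_haar :
    IsProbabilityMeasure (haar : Measure (unitaryGroup k ℂ)) :=
  ⟨by simpa [haar] using Measure.haarMeasure_self (K₀ := (⊤ : TopologicalSpace.PositiveCompacts
    (unitaryGroup k ℂ)))⟩

instance isHaarMeasure_haar : (haar : Measure (unitaryGroup k ℂ)).IsHaarMeasure := by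
  unfold haar
  infer_instance

/-- A right translate is again a Haar probability measure, and there is only one. -/
theorem map_mul_right_haar (V : unitaryGroup k ℂ) :
    Measure.map (· * V) (haar : Measure (unitaryGroup k ℂ)) = haar := by
  have : IsProbabilityMeasure (Measure.map (· * V) (haar : Measure (unitaryGroup k ℂ))) :=
    Measure.isProbabilityMeasure_map (by fun_prop)
  exact Measure.isHaarMeasure_eq_of_isProbabilityMeasure _ _

theorem integral_haar_mul_right (f : unitaryGroup k ℂ → ℝ) (V : unitaryGroup k ℂ) :
    ∫ U, f (U * V) ∂haar = ∫ U, f U ∂haar := by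
  conv_rhs => rw [← map_mul_right_haar V]
  exact ((MeasurableEquiv.mulRight V).measurableEmbedding.integral_map f).symm

theorem integrable_haar {f : unitaryGroup k ℂ → ℝ} (hf : Continuous f) : Integrable f haar :=
  hf.integrable_of_hasCompactSupport (HasCompactSupport.of_compactSpace f)

theorem continuous_conj_unitary (K : Matrix k k ℂ) :
    Continuous fun U : unitaryGroup k ℂ => (U : Matrix k k ℂ)ᴴ * K * (U : Matrix k k ℂ) := by
  have h : Continuous fun U : unitaryGroup k ℂ => (U : Matrix k k ℂ) := continuous_subtype_val
  fun_prop

theorem continuous_conj_unitary_apply (K : Matrix k k ℂ) (i j : k) :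
    Continuous fun U : unitaryGroup k ℂ =>
      ((U : Matrix k k ℂ)ᴴ * K * (U : Matrix k k ℂ)) i j :=
  (continuous_apply_apply i j).comp (continuous_conj_unitary K)

theorem conj_unitary_mul (K : Matrix k k ℂ) (U V : unitaryGroup k ℂ) :
    ((U * V : unitaryGroup k ℂ) : Matrix k k ℂ)ᴴ * K * ((U * V : unitaryGroup k ℂ) :
      Matrix k k ℂ) = (V : Matrix k k ℂ)ᴴ * ((U : Matrix k k ℂ)ᴴ * K * U) * V := by
  simp only [Submonoid.coe_mul, conjTranspose_mul, mul_assoc]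

/-- Right invariance under permutation matrices: the moments can only depend on whether the two
indices are equal. -/
theorem integral_conj_unitary_perm (K : Matrix k k ℂ) (g : Matrix k k ℂ → ℝ) (π : Equiv.Perm k) :
    ∫ U : unitaryGroup k ℂ, g (((U : Matrix k k ℂ)ᴴ * K * U).submatrix π π) ∂haar =
      ∫ U : unitaryGroup k ℂ, g ((U : Matrix k k ℂ)ᴴ * K * U) ∂haar := by
  let P : Matrix k k ℂ := (1 : Matrix k k ℂ).submatrix id π
  have hP : ∀ M : Matrix k k ℂ, Pᴴ * M * P = M.submatrix π π := by
    intro M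
    ext i j
    simp [P, mul_apply, one_apply, apply_ite]
  have hU : P ∈ unitaryGroup k ℂ := by
    rw [mem_unitaryGroup_iff', star_eq_conjTranspose]
    have := hP 1
    rw [mul_one] at this
    rw [this]
    simp
  rw [← integral_haar_mul_right (fun U : unitaryGroup k ℂ => g ((U : Matrix k k ℂ)ᴴ * K * U))
    ⟨P, hU⟩]
  congr 1
  funext U
  rw [conj_unitary_mul, hP]

/-- Second moment of the entries of `Uᴴ K U`. -/
noncomputable def conjMoment (K : Matrix k k ℂ) (i j : k) : ℝ :=
  ∫ U : unitaryGroup k ℂ, Complex.normSq (((U : Matrix k k ℂ)ᴴ * K * U) i j) ∂haar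

/-- Correlation of the diagonal entries of `Uᴴ K U`. -/
noncomputable def conjCorr (K : Matrix k k ℂ) (i j : k) : ℝ :=
  ∫ U : unitaryGroup k ℂ, (((U : Matrix k k ℂ)ᴴ * K * U) i i *
    star (((U : Matrix k k ℂ)ᴴ * K * U) j j)).re ∂haar

omit [Fintype k] in
theorem exists_perm_pair {i j i' j' : k} (h : i ≠ j) (h' : i' ≠ j') :
    ∃ π : Equiv.Perm k, π i = i' ∧ π j = j' := by
  refine ⟨Equiv.swap (Equiv.swap i i' j) j' * Equiv.swap i i', ?_, ?_⟩
  · rw [Equiv.Perm.mul_apply, Equiv.swap_apply_left]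
    refine Equiv.swap_apply_of_ne_of_ne ?_ h'
    intro h2
    apply h
    apply (Equiv.swap i i').injective
    rw [Equiv.swap_apply_left]
    exact h2
  · rw [Equiv.Perm.mul_apply, Equiv.swap_apply_left]

theorem conjMoment_diag (K : Matrix k k ℂ) (i i' : k) : conjMoment K i i = conjMoment K i' i' := by
  have := integral_conj_unitary_perm K (fun M => Complex.normSq (M i i)) (Equiv.swap i i')
  simpa [conjMoment] using this.symm

theorem conjMoment_offdiag (K : Matrix k k ℂ) {i j i' j' : k} (h : i ≠ j) (h' : i' ≠ j') :
    conjMoment K i j = conjMoment K i' j' := by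
  obtain ⟨π, h1, h2⟩ := exists_perm_pair h h'
  have := integral_conj_unitary_perm K (fun M => Complex.normSq (M i j)) π
  simpa [conjMoment, h1, h2] using this.symm

theorem sum_conjMoment (K : Matrix k k ℂ) :
    ∑ i, ∑ j, conjMoment K i j = ∑ i, ∑ j, Complex.normSq (K i j) := by
  have hc : ∀ i j, Continuous fun U : unitaryGroup k ℂ =>
      Complex.normSq (((U : Matrix k k ℂ)ᴴ * K * U) i j) := fun i j =>
    Complex.continuous_normSq.comp (continuous_conj_unitary_apply K i j)
  have htr : ∀ M : Matrix k k ℂ, (∑ i, ∑ j, (Complex.normSq (M i j) : ℂ)) = trace (M * Mᴴ) := by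
    intro M
    simp [trace, mul_apply, Complex.mul_conj]
  have key : ∀ U : unitaryGroup k ℂ,
      ∑ i, ∑ j, Complex.normSq (((U : Matrix k k ℂ)ᴴ * K * U) i j) =
        ∑ i, ∑ j, Complex.normSq (K i j) := by
    intro U
    have hU : (U : Matrix k k ℂ) * (U : Matrix k k ℂ)ᴴ = 1 := mem_unitaryGroup_iff.mp U.2
    generalize (U : Matrix k k ℂ) = V at hU ⊢
    have : trace ((Vᴴ * K * V) * (Vᴴ * K * V)ᴴ) = trace (K * Kᴴ) := by
      calc _ = trace (Vᴴ * (K * (V * Vᴴ) * Kᴴ * V)) := by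
            simp only [conjTranspose_mul, conjTranspose_conjTranspose, mul_assoc]
        _ = trace (K * Kᴴ * (V * Vᴴ)) := by
            rw [hU, mul_one, trace_mul_comm, mul_assoc, hU]
        _ = _ := by rw [hU, mul_one]
    rw [← htr, ← htr] at this
    exact_mod_cast this
  unfold conjMoment
  simp_rw [← integral_finsetSum _ fun j _ => integrable_haar (hc _ j)]
  rw [← integral_finsetSum _ fun i _ => integrable_haar (continuous_finsetSum _ fun j _ => hc i j)]
  simp [key]

theorem sum_conjCorr (K : Matrix k k ℂ) :
    ∑ i, ∑ j, conjCorr K i j = Complex.normSq (trace K) := by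
  have hc : ∀ i j, Continuous fun U : unitaryGroup k ℂ =>
      (((U : Matrix k k ℂ)ᴴ * K * U) i i * star (((U : Matrix k k ℂ)ᴴ * K * U) j j)).re :=
    fun i j => Complex.continuous_re.comp ((continuous_conj_unitary_apply K i i).mul
      (continuous_conj_unitary_apply K j j).star)
  have key : ∀ U : unitaryGroup k ℂ,
      ∑ i, ∑ j, (((U : Matrix k k ℂ)ᴴ * K * U) i i *
        star (((U : Matrix k k ℂ)ᴴ * K * U) j j)).re = Complex.normSq (trace K) := by
    intro U
    have hU : (U : Matrix k k ℂ) * (U : Matrix k k ℂ)ᴴ = 1 := mem_unitaryGroup_iff.mp U.2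
    have : trace ((U : Matrix k k ℂ)ᴴ * K * (U : Matrix k k ℂ)) = trace K := by
      rw [trace_mul_comm, ← mul_assoc, hU, one_mul]
    simp_rw [← Complex.re_sum]
    rw [← this, trace, ← Finset.sum_mul_sum, ← star_sum]
    simp only [diag]
    rw [Complex.star_def, Complex.mul_conj, Complex.ofReal_re]
  unfold conjCorr
  simp_rw [← integral_finsetSum _ fun j _ => integrable_haar (hc _ j)]
  rw [← integral_finsetSum _ fun i _ => integrable_haar (continuous_finsetSum _ fun j _ => hc i j)]
  rw [integral_congr_ae (ae_of_all _ key)]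
  simp

theorem integral_add_four {f₁ f₂ f₃ f₄ : unitaryGroup k ℂ → ℝ} (h₁ : Integrable f₁ haar)
    (h₂ : Integrable f₂ haar) (h₃ : Integrable f₃ haar) (h₄ : Integrable f₄ haar) :
    ∫ U, (f₁ U + f₂ U + f₃ U + f₄ U) ∂haar =
      ∫ U, f₁ U ∂haar + ∫ U, f₂ U ∂haar + ∫ U, f₃ U ∂haar + ∫ U, f₄ U ∂haar := by
  have h₁₂ : Integrable (fun U => f₁ U + f₂ U) haar := h₁.add h₂
  have h₁₂₃ : Integrable (fun U => f₁ U + f₂ U + f₃ U) haar := h₁₂.add h₃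
  rw [integral_add h₁₂₃ h₄, integral_add h₁₂ h₃, integral_add h₁ h₂]

/-- Right invariance under a unitary that mixes the basis vectors i and j with cosine c = 24/25,
sine s = 7/25 and a phase w. Averaging over w in {1, −1, i, −i} removes the phase-dependent cross
terms and leaves a = (c⁴ + s⁴) a + 2c²s² (corr + off), where c⁴ + s⁴ = 1 − 2c²s². A Pythagorean pair
keeps the computation free of square roots. -/
theorem conjMoment_diag_eq_add (K : Matrix k k ℂ) {i j : k} (h : i ≠ j) :
    conjMoment K i i = conjMoment K i j + conjCorr K i j := by
  have rot : ∀ w : ℂ, w * star w = 1 → conjMoment K i i = ∫ U : unitaryGroup k ℂ,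
      Complex.normSq ((24 / 25) ^ 2 * ((U : Matrix k k ℂ)ᴴ * K * U) i i +
        (7 / 25) ^ 2 * ((U : Matrix k k ℂ)ᴴ * K * U) j j +
        24 * 7 / 25 ^ 2 * (w * ((U : Matrix k k ℂ)ᴴ * K * U) i j +
          star w * ((U : Matrix k k ℂ)ᴴ * K * U) j i)) ∂haar := by
    intro w hw
    -- The vector has squared norm 2, so 1 − u u* is a unitary reflection; its column i has the
    -- entries 24/25 at i and (7/25) w at j.
    let u : k → ℂ := fun a => (if a = i then 1 / 5 else 0) + (if a = j then -(7 / 5) * w else 0)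
    let V : Matrix k k ℂ := 1 - vecMulVec u (star u)
    have hu : star u ⬝ᵥ u = 2 := by
      have : ∀ a, star u a * u a = (if a = i then 1 / 25 else 0) +
          (if a = j then 49 / 25 else 0) := by
        intro a
        simp only [u, Pi.star_apply]
        by_cases h1 : a = i
        · subst h1
          simp [h]
          norm_num
        · by_cases h2 : a = j
          · subst h2
            simp only [h1, if_false, if_true, zero_add, star_mul', star_neg]
            have : star (7 / 5 : ℂ) = 7 / 5 := by simp
            rw [this]
            linear_combination 49 / 25 * hw
          · simp [h1, h2]
      rw [dotProduct, Finset.sum_congr rfl fun a _ => this a, Finset.sum_add_distrib]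
      simp
      norm_num
    have hVh : Vᴴ = V := by
      simp [V, conjTranspose_sub, conjTranspose_vecMulVec]
    have hV : V ∈ unitaryGroup k ℂ := by
      rw [mem_unitaryGroup_iff, star_eq_conjTranspose, hVh]
      simp only [V, sub_mul, mul_sub, one_mul, mul_one, vecMulVec_mul_vecMulVec, hu]
      rw [show (2 : ℂ) • star u = star u + star u from two_smul _ _, vecMulVec_add]
      abel
    have hVi : ∀ a, V a i = (if a = i then 24 / 25 else 0) +
        (if a = j then 7 / 25 * w else 0) := by
      intro a
      have h' : ¬ i = j := h
      simp only [V, u, Matrix.sub_apply, one_apply, vecMulVec_apply, Pi.star_apply]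
      by_cases h1 : a = i
      · subst h1
        simp [h]
        norm_num
      · by_cases h2 : a = j
        · subst h2
          simp [h1, h']
          ring
        · simp [h1, h2]
    have hVM : ∀ M : Matrix k k ℂ, (Vᴴ * M * V) i i = (24 / 25) ^ 2 * M i i +
        (7 / 25) ^ 2 * M j j + 24 * 7 / 25 ^ 2 * (w * M i j + star w * M j i) := by
      intro M
      have hs : ∀ a, Vᴴ i a = (if a = i then 24 / 25 else 0) +
          (if a = j then 7 / 25 * star w else 0) := by
        intro a
        rw [conjTranspose_apply, hVi, star_add, apply_ite star, apply_ite star]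
        simp
      simp only [mul_apply, hVi, hs, add_mul, mul_add, Finset.sum_add_distrib,
        ite_mul, mul_ite, zero_mul, mul_zero, Finset.sum_ite_eq', Finset.mem_univ, if_true]
      linear_combination (7 / 25) ^ 2 * M j j * hw
    have := integral_haar_mul_right (fun U : unitaryGroup k ℂ =>
      Complex.normSq (((U : Matrix k k ℂ)ᴴ * K * U) i i)) ⟨V, hV⟩
    rw [conjMoment, ← this]
    congr 1
    funext U
    rw [conj_unitary_mul, hVM]
  have pt : ∀ a b p q : ℂ,
      Complex.normSq ((24 / 25) ^ 2 * a + (7 / 25) ^ 2 * b + 24 * 7 / 25 ^ 2 *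
        (1 * p + star 1 * q)) +
      Complex.normSq ((24 / 25) ^ 2 * a + (7 / 25) ^ 2 * b + 24 * 7 / 25 ^ 2 *
        (-1 * p + star (-1) * q)) +
      Complex.normSq ((24 / 25) ^ 2 * a + (7 / 25) ^ 2 * b + 24 * 7 / 25 ^ 2 *
        (Complex.I * p + star Complex.I * q)) +
      Complex.normSq ((24 / 25) ^ 2 * a + (7 / 25) ^ 2 * b + 24 * 7 / 25 ^ 2 *
        (-Complex.I * p + star (-Complex.I) * q)) =
      4 * ((24 / 25) ^ 4 * Complex.normSq a + (7 / 25) ^ 4 * Complex.normSq b +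
        2 * (24 * 7 / 25 ^ 2) ^ 2 * (a * star b).re +
        (24 * 7 / 25 ^ 2) ^ 2 * (Complex.normSq p + Complex.normSq q)) := by
    intro a b p q
    have e1 : (24 / 25 : ℂ) ^ 2 = ((24 / 25) ^ 2 : ℝ) := by norm_num
    have e2 : (7 / 25 : ℂ) ^ 2 = ((7 / 25) ^ 2 : ℝ) := by norm_num
    have e3 : (24 * 7 / 25 ^ 2 : ℂ) = (24 * 7 / 25 ^ 2 : ℝ) := by norm_num
    rw [e1, e2, e3]
    simp only [Complex.normSq_apply, Complex.add_re, Complex.add_im, Complex.mul_re,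
      Complex.ofReal_re, Complex.ofReal_im, Complex.mul_im, Complex.one_re, Complex.one_im,
      Complex.neg_re, Complex.neg_im, Complex.I_re, Complex.I_im, Complex.star_def,
      Complex.conj_re, Complex.conj_im]
    norm_num
    ring
  have hcn : ∀ i' j', Continuous fun U : unitaryGroup k ℂ =>
      Complex.normSq (((U : Matrix k k ℂ)ᴴ * K * U) i' j') := fun i' j' =>
    Complex.continuous_normSq.comp (continuous_conj_unitary_apply K i' j')
  have hcc : Continuous fun U : unitaryGroup k ℂ =>
      (((U : Matrix k k ℂ)ᴴ * K * U) i i * star (((U : Matrix k k ℂ)ᴴ * K * U) j j)).re :=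
    Complex.continuous_re.comp ((continuous_conj_unitary_apply K i i).mul
      (continuous_conj_unitary_apply K j j).star)
  have hcw : ∀ w : ℂ, Continuous fun U : unitaryGroup k ℂ =>
      Complex.normSq ((24 / 25) ^ 2 * ((U : Matrix k k ℂ)ᴴ * K * U) i i +
        (7 / 25) ^ 2 * ((U : Matrix k k ℂ)ᴴ * K * U) j j +
        24 * 7 / 25 ^ 2 * (w * ((U : Matrix k k ℂ)ᴴ * K * U) i j +
          star w * ((U : Matrix k k ℂ)ᴴ * K * U) j i)) := by
    intro w
    have h1 := continuous_conj_unitary_apply K i i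
    have h2 := continuous_conj_unitary_apply K j j
    have h3 := continuous_conj_unitary_apply K i j
    have h4 := continuous_conj_unitary_apply K j i
    exact Complex.continuous_normSq.comp (by fun_prop)
  have total : 4 * conjMoment K i i = 4 * ((24 / 25) ^ 4 * conjMoment K i i +
      (7 / 25) ^ 4 * conjMoment K j j + 2 * (24 * 7 / 25 ^ 2) ^ 2 * conjCorr K i j +
      (24 * 7 / 25 ^ 2) ^ 2 * (conjMoment K i j + conjMoment K j i)) := by
    have hw := fun w => integrable_haar (hcw w)
    calc 4 * conjMoment K i i = conjMoment K i i + conjMoment K i i + conjMoment K i i +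
          conjMoment K i i := by ring
      _ = _ := by
        conv_lhs =>
          enter [2]
          rw [rot (-Complex.I) (by simp)]
        conv_lhs =>
          enter [1, 2]
          rw [rot Complex.I (by simp)]
        conv_lhs =>
          enter [1, 1, 2]
          rw [rot (-1) (by simp)]
        conv_lhs =>
          enter [1, 1, 1]
          rw [rot 1 (by simp)]
        rw [← integral_add_four (hw 1) (hw (-1)) (hw Complex.I) (hw (-Complex.I))]
        have i1 := fun i' j' => integrable_haar (hcn i' j')
        have i2 := integrable_haar hcc
        have i3 : Integrable (fun U : unitaryGroup k ℂ =>
            Complex.normSq (((U : Matrix k k ℂ)ᴴ * K * U) i j) +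
            Complex.normSq (((U : Matrix k k ℂ)ᴴ * K * U) j i)) haar := (i1 i j).add (i1 j i)
        rw [integral_congr_ae (ae_of_all _ fun U => pt _ _ _ _), integral_const_mul,
          integral_add_four ((i1 i i).const_mul _) ((i1 j j).const_mul _) (i2.const_mul _)
          (i3.const_mul _), integral_const_mul, integral_const_mul,
          integral_const_mul, integral_const_mul, integral_add (i1 i j) (i1 j i)]
        rfl
  rw [conjMoment_diag K j i, conjMoment_offdiag K h.symm h] at total
  linarith

/-- The diagonal and the off-diagonal moment are two unknowns, fixed by two invariants of
conjugation: the Hilbert-Schmidt norm and the modulus of the trace. The correlations of the diagonal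
entries are eliminated with `conjMoment_diag_eq_add`. In dimension one there is no off-diagonal
pair. -/
theorem conjMoment_eq (K : Matrix k k ℂ) (i j : k) :
    conjMoment K i j = if i = j then
      ((∑ i, ∑ j, Complex.normSq (K i j)) + Complex.normSq (trace K)) /
        (Fintype.card k * (Fintype.card k + 1))
    else ((∑ i, ∑ j, Complex.normSq (K i j)) - Complex.normSq (trace K) / Fintype.card k) /
        ((Fintype.card k : ℝ) ^ 2 - 1) := by
  set d : ℝ := (Fintype.card k : ℝ) with hd
  have hd1 : (1 : ℝ) ≤ d := by
    rw [hd]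
    exact_mod_cast Fintype.card_pos_iff.mpr ⟨i⟩
  set T1 := ∑ i, ∑ j, Complex.normSq (K i j) with hT1
  set T2 := Complex.normSq (trace K) with hT2
  have hsplit : ∀ (f : k → k → ℝ) (x y : ℝ), (∀ a, f a a = x) → (∀ a b, a ≠ b → f a b = y) →
      ∑ a, ∑ b, f a b = d * x + d * (d - 1) * y := by
    intro f x y hx hy
    have : ∀ a b, f a b = y + if a = b then x - y else 0 := by
      intro a b
      split_ifs with hab
      · rw [← hab, hx]; ring
      · rw [hy a b hab, add_zero]
    simp only [this, Finset.sum_add_distrib, Finset.sum_const, Finset.card_univ, nsmul_eq_mul,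
      Finset.sum_ite_eq, Finset.mem_univ, if_true, ← hd]
    ring
  have hs1 := hsplit (conjMoment K) (conjMoment K i i)
  have hcorr : ∀ a, conjCorr K a a = conjMoment K i i := by
    intro a
    rw [conjMoment_diag K i a, conjMoment, conjCorr]
    congr 1
    funext U
    rw [Complex.star_def, Complex.mul_conj, Complex.ofReal_re]
  by_cases hcard : ∃ a b : k, a ≠ b
  · obtain ⟨a, b, hab⟩ := hcard
    have e1 := hs1 (conjMoment K a b) (fun c => conjMoment_diag K c i)
      (fun c c' hc => conjMoment_offdiag K hc hab)
    have e2 := hsplit (conjCorr K) (conjMoment K i i) (conjMoment K i i - conjMoment K a b) hcorr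
      (fun c c' hc => by
        rw [conjMoment_diag K i c, conjMoment_diag_eq_add K hc, conjMoment_offdiag K hab hc]; ring)
    rw [sum_conjMoment, ← hT1] at e1
    rw [sum_conjCorr, ← hT2] at e2
    have hd2 : (2 : ℝ) ≤ d := by
      rw [hd]
      exact_mod_cast Fintype.one_lt_card_iff.mpr ⟨a, b, hab⟩
    have hd3 : d ^ 2 - 1 ≠ 0 := by nlinarith
    have hd4 : d * (d + 1) ≠ 0 := by positivity
    have hx : conjMoment K i i = (T1 + T2) / (d * (d + 1)) := by
      rw [eq_div_iff hd4]; linarith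
    split_ifs with hij
    · rw [← hij, hx]
    · rw [conjMoment_offdiag K hij hab, eq_div_iff hd3]
      have : T2 / d = conjMoment K i i + (d - 1) * (conjMoment K i i - conjMoment K a b) := by
        rw [div_eq_iff (by positivity)]; linarith
      rw [this, e1]
      ring
  · push Not at hcard
    have hij : i = j := hcard i j
    have e1 := hs1 0 (fun c => conjMoment_diag K c i) (fun c c' hc => absurd (hcard c c') hc)
    have e2 := hsplit (conjCorr K) (conjMoment K i i) 0 hcorr
      (fun c c' hc => absurd (hcard c c') hc)
    rw [sum_conjMoment, ← hT1] at e1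
    rw [sum_conjCorr, ← hT2] at e2
    have hcard1 : d = 1 := by
      rw [hd]
      exact_mod_cast Fintype.card_eq_one_iff.mpr ⟨i, fun y => hcard y i⟩
    rw [if_pos hij, ← hij, hcard1]
    rw [hcard1] at e1 e2
    linarith

end HaarMoments

end SkewedCode

namespace SkewedCode

/-! ### Completeness of the Pauli strings -/

section PauliStrings

variable {N : Type} [Fintype N] [DecidableEq N]

theorem sum_pauli (x y z w : Fin 2) :
    ∑ q, star (pauli q z w) * pauli q x y = if x = z ∧ y = w then 2 else 0 := by
  fin_cases x <;> fin_cases y <;> fin_cases z <;> fin_cases w <;>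
    simp [Fin.sum_univ_four, pauli] <;> norm_num

theorem pauli_isHermitian (q : Fin 4) (x y : Fin 2) : star (pauli q y x) = pauli q x y := by
  fin_cases q <;> fin_cases x <;> fin_cases y <;> simp [pauli]

theorem pauli_mul_self (q : Fin 4) (x z : Fin 2) :
    ∑ y, pauli q x y * pauli q y z = if x = z then 1 else 0 := by
  fin_cases q <;> fin_cases x <;> fin_cases z <;> simp [pauli]

omit [DecidableEq N] in
theorem pauliString_isHermitian (p : N → Fin 4) : (pauliString p).IsHermitian := by
  ext x y
  simp only [conjTranspose_apply, pauliString, of_apply, star_prod, pauli_isHermitian]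

theorem pauliString_mul_self (p : N → Fin 4) : pauliString p * pauliString p = 1 := by
  ext x z
  simp only [mul_apply, pauliString, of_apply, ← Finset.prod_mul_distrib]
  have := Finset.prod_univ_sum (fun _ : N => (Finset.univ : Finset (Fin 2)))
    (fun k y => pauli (p k) (x k) y * pauli (p k) y (z k))
  simp only [Fintype.piFinset_univ] at this
  rw [← this]
  simp only [pauli_mul_self, one_apply]
  by_cases h : x = z
  · simp [h]
  · rw [if_neg h]
    obtain ⟨k, hk⟩ := Function.ne_iff.mp h
    exact Finset.prod_eq_zero (Finset.mem_univ k) (if_neg hk)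

theorem sum_pauliString (x y z w : N → Fin 2) :
    ∑ p : N → Fin 4, star (pauliString p z w) * pauliString p x y =
      if x = z ∧ y = w then (2 : ℂ) ^ Fintype.card N else 0 := by
  simp only [pauliString, of_apply, star_prod, ← Finset.prod_mul_distrib]
  have := Finset.prod_univ_sum (fun _ : N => (Finset.univ : Finset (Fin 4)))
    (fun k q => star (pauli q (z k) (w k)) * pauli q (x k) (y k))
  simp only [Fintype.piFinset_univ] at this
  rw [← this]
  simp only [sum_pauli]
  by_cases h : x = z ∧ y = w
  · simp [h.1, h.2]
  · rw [if_neg h]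
    have : ∃ k, ¬ (x k = z k ∧ y k = w k) := by
      by_contra hc
      push Not at hc
      exact h ⟨funext fun k => (hc k).1, funext fun k => (hc k).2⟩
    obtain ⟨k, hk⟩ := this
    exact Finset.prod_eq_zero (Finset.mem_univ k) (if_neg hk)

/-- Pauli strings are an orthogonal operator basis, so this is Parseval for the projectors onto `a`
and `b`. With `a = b` it is the purity identity; with `a` the unperturbed state and `b` the velocity
it turns a sum over Pauli strings into an overlap. -/
theorem sum_pauliString_expect (a b : (N → Fin 2) → ℂ) :
    ∑ p : N → Fin 4, star (star a ⬝ᵥ pauliString p *ᵥ a) * (star b ⬝ᵥ pauliString p *ᵥ b) =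
      2 ^ Fintype.card N * (star (star a ⬝ᵥ b) * (star a ⬝ᵥ b)) := by
  have e : ∀ (c : (N → Fin 2) → ℂ) (p : N → Fin 4), star c ⬝ᵥ pauliString p *ᵥ c =
      ∑ x, ∑ y, star (c x) * c y * pauliString p x y := by
    intro c p
    simp only [dotProduct, mulVec, Finset.mul_sum, Pi.star_apply]
    refine Finset.sum_congr rfl fun x _ => Finset.sum_congr rfl fun y _ => ?_
    ring
  have h1 : ∀ p : N → Fin 4,
      star (star a ⬝ᵥ pauliString p *ᵥ a) * (star b ⬝ᵥ pauliString p *ᵥ b) =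
      ∑ x, ∑ y, ∑ z, ∑ w, a z * star (a w) * (star (b x) * b y) *
        (star (pauliString p z w) * pauliString p x y) := by
    intro p
    rw [e, e]
    simp only [star_sum, Finset.sum_mul, Finset.mul_sum, star_mul', star_star]
    refine Finset.sum_congr rfl fun x _ => Finset.sum_congr rfl fun y _ =>
      Finset.sum_congr rfl fun z _ => Finset.sum_congr rfl fun w _ => ?_
    ring
  have h2 : ∑ p : N → Fin 4,
      star (star a ⬝ᵥ pauliString p *ᵥ a) * (star b ⬝ᵥ pauliString p *ᵥ b) =
      ∑ x, ∑ y, ∑ z, ∑ w, a z * star (a w) * (star (b x) * b y) *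
        (if x = z ∧ y = w then (2 : ℂ) ^ Fintype.card N else 0) := by
    simp only [h1, ← sum_pauliString, Finset.mul_sum]
    rw [Finset.sum_comm]
    refine Finset.sum_congr rfl fun z _ => ?_
    rw [Finset.sum_comm]
    refine Finset.sum_congr rfl fun w _ => ?_
    rw [Finset.sum_comm]
    refine Finset.sum_congr rfl fun x _ => ?_
    rw [Finset.sum_comm]
  rw [h2]
  simp only [ite_and, mul_ite, mul_zero, Finset.sum_ite_eq, Finset.mem_univ, if_true,
    Finset.sum_ite_irrel, Finset.sum_const_zero, dotProduct, star_sum, Finset.sum_mul,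
    Finset.mul_sum, Pi.star_apply, star_mul', star_star]
  rw [Finset.sum_comm]
  refine Finset.sum_congr rfl fun z _ => Finset.sum_congr rfl fun w _ => ?_
  ring

/-- All Pauli expectation values of the vector are `0`, `1` or `-1`. -/
def HasIntegralPauliSpectrum (S : (N → Fin 2) → ℂ) : Prop :=
  ∀ p : N → Fin 4, ∃ s : ℝ, (s = 0 ∨ s = 1 ∨ s = -1) ∧ star S ⬝ᵥ pauliString p *ᵥ S = s

end PauliStrings

/-! ### Second-order expansion of the stabilizer Rényi entropy -/

section StabilizerRenyi

/-- Chain rule for difference quotients at a given scale. Using `dslope` avoids a case distinction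
where `f t = x`. -/
theorem tendsto_comp_slope {X : Type*} {l : Filter X} {h : ℝ → ℝ} {x h' c : ℝ}
    (hd : HasDerivAt h h' x) {f r : X → ℝ} (hr : Tendsto r l (𝓝 0)) (hr0 : ∀ᶠ t in l, r t ≠ 0)
    (hf : Tendsto (fun t => (f t - x) / r t) l (𝓝 c)) :
    Tendsto (fun t => (h (f t) - h x) / r t) l (𝓝 (h' * c)) := by
  have hfx : Tendsto f l (𝓝 x) := by
    have h1 := (hf.mul hr).add_const x
    rw [mul_zero, zero_add] at h1
    refine h1.congr' ?_
    filter_upwards [hr0] with t ht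
    rw [div_mul_cancel₀ _ ht, sub_add_cancel]
  have h2 : Tendsto (fun t => dslope h x (f t)) l (𝓝 h') := by
    have := (continuousAt_dslope_same.mpr hd.differentiableAt).tendsto
    rw [dslope_same, hd.deriv] at this
    exact this.comp hfx
  refine (h2.mul hf).congr fun t => ?_
  have := sub_smul_dslope h x (f t)
  rw [smul_eq_mul] at this
  rw [← this]
  ring

variable {N : Type} [Fintype N] [DecidableEq N]

omit [Fintype N] [DecidableEq N] in
theorem dotProduct_star_conj {k : Type} [Fintype k] {P : Matrix k k ℂ} (hP : P.IsHermitian)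
    (a b : k → ℂ) : star (star a ⬝ᵥ P *ᵥ b) = star b ⬝ᵥ P *ᵥ a := by
  rw [star_dotProduct, star_star, star_mulVec, hP.eq, ← dotProduct_mulVec]

/-- Equality case of Cauchy-Schwarz: the norm of P S − s S vanishes. -/
theorem pauliString_mulVec_eq {S : (N → Fin 2) → ℂ} (hS1 : star S ⬝ᵥ S = 1) {p : N → Fin 4} {s : ℝ}
    (hs : s * s = 1) (h : star S ⬝ᵥ pauliString p *ᵥ S = s) : pauliString p *ᵥ S = (s : ℂ) • S := by
  have hP := pauliString_isHermitian p
  have hs' : (s : ℂ) * s = 1 := by exact_mod_cast hs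
  rw [← sub_eq_zero, ← dotProduct_star_self_eq_zero (R := ℂ)]
  have h1 : star (pauliString p *ᵥ S) ⬝ᵥ pauliString p *ᵥ S = 1 := by
    rw [star_mulVec, hP.eq, ← dotProduct_mulVec, mulVec_mulVec, pauliString_mul_self, one_mulVec,
      hS1]
  have h2 : star (pauliString p *ᵥ S) ⬝ᵥ S = s := by
    rw [star_mulVec, hP.eq, ← dotProduct_mulVec, h]
  rw [star_sub, star_smul, sub_dotProduct, dotProduct_sub, dotProduct_sub,
    smul_dotProduct, smul_dotProduct, dotProduct_smul, dotProduct_smul, h1, h2, h, hS1]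
  simp
  linear_combination (-1 : ℂ) * hs'

/-- A Pauli string with zero expectation at `S` contributes O(|ε|^(2α)), which is o(ε²) since α > 1.
One with expectation s = ±1 stabilizes `S` up to sign and loses ε²(‖φ‖² − s⟨φ|P|φ⟩) before the power
is taken. Completeness sums these losses to the variance. The second-order term of ψ is not needed:
normalization eliminates it. -/
theorem tendsto_stabilizerRenyi {α : ℝ} (hα : 1 < α) {S φ : (N → Fin 2) → ℂ}
    (hS1 : star S ⬝ᵥ S = 1) (hS : HasIntegralPauliSpectrum S) {ψ : ℝ → (N → Fin 2) → ℂ}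
    (hψ : ∀ ε, star (ψ ε) ⬝ᵥ ψ ε = 1)
    (hφ : Tendsto (fun ε : ℝ => ε⁻¹ • (ψ ε - S)) (𝓝[≠] 0) (𝓝 φ)) :
    Tendsto (fun ε => stabilizerRenyi α (ψ ε) / ε ^ 2) (𝓝[≠] 0)
      (𝓝 (2 * α / (α - 1) * ((star φ ⬝ᵥ φ).re - Complex.normSq (star S ⬝ᵥ φ)))) := by
  choose s hs hsS using hS
  set f : ℝ → (N → Fin 2) → ℂ := fun ε => ε⁻¹ • (ψ ε - S) with hf
  have hψf : ∀ ε : ℝ, ε ≠ 0 → ψ ε = S + (ε : ℂ) • f ε := by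
    intro ε hε
    ext x
    simp only [hf, Pi.add_apply, Pi.smul_apply, Pi.sub_apply, smul_eq_mul, Complex.real_smul]
    have : (ε : ℂ) ≠ 0 := by exact_mod_cast hε
    push_cast
    field_simp
    ring
  have hne : ∀ᶠ ε : ℝ in 𝓝[≠] 0, ε ≠ 0 := self_mem_nhdsWithin
  have h0 : Tendsto (fun ε : ℝ => ε) (𝓝[≠] 0) (𝓝 0) := nhdsWithin_le_nhds
  have hsq : Tendsto (fun ε : ℝ => ε ^ 2) (𝓝[≠] 0) (𝓝 0) := by simpa using h0.pow 2
  have hsq0 : ∀ᶠ ε : ℝ in 𝓝[≠] 0, ε ^ 2 ≠ 0 := by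
    filter_upwards [hne] with ε hε using pow_ne_zero 2 hε
  have hexp : ∀ (p : N → Fin 4), Tendsto (fun ε => star (f ε) ⬝ᵥ pauliString p *ᵥ f ε) (𝓝[≠] 0)
      (𝓝 (star φ ⬝ᵥ pauliString p *ᵥ φ)) := by
    intro p
    have hc : Continuous fun v : (N → Fin 2) → ℂ => star v ⬝ᵥ pauliString p *ᵥ v := by fun_prop
    exact (hc.tendsto φ).comp hφ
  have hself : Tendsto (fun ε => star (f ε) ⬝ᵥ f ε) (𝓝[≠] 0) (𝓝 (star φ ⬝ᵥ φ)) := by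
    have hc : Continuous fun v : (N → Fin 2) → ℂ => star v ⬝ᵥ v := by fun_prop
    exact (hc.tendsto φ).comp hφ
  have him : ∀ (p : N → Fin 4) (v : (N → Fin 2) → ℂ), (star v ⬝ᵥ pauliString p *ᵥ v).im = 0 := by
    intro p v
    have := dotProduct_star_conj (pauliString_isHermitian p) v v
    exact Complex.conj_eq_iff_im.mp this
  have hterm : ∀ p : N → Fin 4, Tendsto
      (fun ε => (‖star (ψ ε) ⬝ᵥ pauliString p *ᵥ ψ ε‖ ^ (2 * α) - s p * s p) / ε ^ 2) (𝓝[≠] 0)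
      (𝓝 (-(2 * α) * (s p * s p * (star φ ⬝ᵥ φ).re -
        s p * (star φ ⬝ᵥ pauliString p *ᵥ φ).re))) := by
    intro p
    have hP := pauliString_isHermitian p
    by_cases hsp : s p = 0
    · rw [hsp]
      simp only [mul_zero, zero_mul, sub_zero]
      have hk : Tendsto (fun ε : ℝ => star (f ε) ⬝ᵥ pauliString p *ᵥ S +
          star S ⬝ᵥ pauliString p *ᵥ f ε + (ε : ℂ) * (star (f ε) ⬝ᵥ pauliString p *ᵥ f ε))
          (𝓝[≠] 0) (𝓝 (star φ ⬝ᵥ pauliString p *ᵥ S + star S ⬝ᵥ pauliString p *ᵥ φ +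
            ((0 : ℝ) : ℂ) * (star φ ⬝ᵥ pauliString p *ᵥ φ))) := by
        have hc1 : Continuous fun v : (N → Fin 2) → ℂ => star v ⬝ᵥ pauliString p *ᵥ S +
            star S ⬝ᵥ pauliString p *ᵥ v := by fun_prop
        exact ((hc1.tendsto φ).comp hφ).add
          (((Complex.continuous_ofReal.tendsto 0).comp h0).mul (hexp p))
      have hk2 := (hk.norm.rpow_const (p := 2 * α) (Or.inr (by linarith)))
      -- After the factor ε² is split off, a positive power of |ε| remains.
      have hpow : Tendsto (fun ε : ℝ => |ε| ^ (2 * α - 2)) (𝓝[≠] 0) (𝓝 0) := by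
        have := (h0.abs).rpow_const (p := 2 * α - 2) (Or.inr (by linarith))
        rwa [abs_zero, Real.zero_rpow (by linarith)] at this
      have := hpow.mul hk2
      rw [zero_mul] at this
      refine this.congr' ?_
      filter_upwards [hne] with ε hε
      have habs : 0 < |ε| := abs_pos.mpr hε
      have e1 : star (ψ ε) ⬝ᵥ pauliString p *ᵥ ψ ε = (ε : ℂ) *
          (star (f ε) ⬝ᵥ pauliString p *ᵥ S + star S ⬝ᵥ pauliString p *ᵥ f ε +
            (ε : ℂ) * (star (f ε) ⬝ᵥ pauliString p *ᵥ f ε)) := by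
        rw [hψf ε hε, star_add, star_smul, mulVec_add, mulVec_smul, add_dotProduct, dotProduct_add,
          dotProduct_add, smul_dotProduct, smul_dotProduct, dotProduct_smul, dotProduct_smul, hsS,
          hsp]
        simp
        ring
      rw [e1, norm_mul, Complex.norm_real, Real.norm_eq_abs, Real.mul_rpow habs.le (norm_nonneg _),
        Real.rpow_sub habs]
      have : |ε| ^ (2 : ℝ) = ε ^ 2 := by
        rw [Real.rpow_two, sq_abs]
      rw [this]
      ring
    · have hs2 : s p * s p = 1 := by
        rcases hs p with h | h | h
        · exact absurd h hsp
        · rw [h]; norm_num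
        · rw [h]; norm_num
      have hs2' : (s p : ℂ) * s p = 1 := by exact_mod_cast hs2
      have hPS := pauliString_mulVec_eq hS1 hs2 (hsS p)
      have hSP : ∀ v, star S ⬝ᵥ pauliString p *ᵥ v = s p * (star S ⬝ᵥ v) := by
        intro v
        rw [dotProduct_mulVec, ← hP.eq, ← star_mulVec, hPS, star_smul, smul_dotProduct]
        simp
      -- An exact identity, not an expansion: the terms linear in the increment cancel against the
      -- normalization of `ψ ε`.
      have hval : ∀ ε : ℝ, ε ≠ 0 → (s p * (star (ψ ε) ⬝ᵥ pauliString p *ᵥ ψ ε).re - 1) / ε ^ 2 =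
          -((star (f ε) ⬝ᵥ f ε).re - s p * (star (f ε) ⬝ᵥ pauliString p *ᵥ f ε).re) := by
        intro ε hε
        have e1 : star (ψ ε) ⬝ᵥ pauliString p *ᵥ ψ ε = s p * (1 + ε * (star S ⬝ᵥ f ε) +
            ε * (star (f ε) ⬝ᵥ S)) + ε ^ 2 * (star (f ε) ⬝ᵥ pauliString p *ᵥ f ε) := by
          rw [hψf ε hε, star_add, star_smul, mulVec_add, mulVec_smul, add_dotProduct,
            dotProduct_add, dotProduct_add, smul_dotProduct, smul_dotProduct, dotProduct_smul,
            dotProduct_smul, hsS, hSP, hPS, dotProduct_smul]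
          simp
          ring
        have e2 : 1 = 1 + ε * (star S ⬝ᵥ f ε) +
            ε * (star (f ε) ⬝ᵥ S) + ε ^ 2 * (star (f ε) ⬝ᵥ f ε) := by
          rw [← hψ ε]
          conv_lhs => rw [hψf ε hε]
          rw [star_add, star_smul, add_dotProduct,
            dotProduct_add, dotProduct_add, smul_dotProduct, smul_dotProduct, dotProduct_smul,
            dotProduct_smul, hS1, hψ]
          simp
          ring
        have e3 : (s p : ℂ) * (star (ψ ε) ⬝ᵥ pauliString p *ᵥ ψ ε) - 1 = (ε ^ 2 : ℝ) *
            -((star (f ε) ⬝ᵥ f ε) - s p * (star (f ε) ⬝ᵥ pauliString p *ᵥ f ε)) := by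
          rw [e1]
          push_cast
          linear_combination (1 + ε * (star S ⬝ᵥ f ε) + ε * (star (f ε) ⬝ᵥ S)) * hs2' - e2
        have e4 := congrArg Complex.re e3
        rw [Complex.sub_re, Complex.re_ofReal_mul, Complex.one_re, Complex.re_ofReal_mul,
          Complex.neg_re, Complex.sub_re, Complex.re_ofReal_mul] at e4
        rw [e4, mul_comm, mul_div_assoc, div_self (pow_ne_zero 2 hε), mul_one]
      have hlim : Tendsto (fun ε => (s p * (star (ψ ε) ⬝ᵥ pauliString p *ᵥ ψ ε).re - 1) / ε ^ 2)
          (𝓝[≠] 0) (𝓝 (-((star φ ⬝ᵥ φ).re - s p * (star φ ⬝ᵥ pauliString p *ᵥ φ).re))) := by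
        have h1 := (Complex.continuous_re.tendsto _).comp hself
        have h2 := (Complex.continuous_re.tendsto _).comp (hexp p)
        refine (h1.sub (h2.const_mul (s p))).neg.congr' ?_
        filter_upwards [hne] with ε hε
        rw [hval ε hε]
        rfl
      have hder : HasDerivAt (fun x : ℝ => |x| ^ (2 * α)) (2 * α) 1 := by
        have h1 := Real.hasDerivAt_rpow_const (x := 1) (p := 2 * α) (Or.inl one_ne_zero)
        rw [Real.one_rpow, mul_one] at h1
        refine h1.congr_of_eventuallyEq ?_
        filter_upwards [lt_mem_nhds (show (0 : ℝ) < 1 by norm_num)] with x hx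
        rw [abs_of_pos hx]
      have := tendsto_comp_slope hder hsq hsq0 hlim
      rw [hs2, one_mul]
      convert this using 2
      · rename_i ε
        have e5 : ‖star (ψ ε) ⬝ᵥ pauliString p *ᵥ ψ ε‖ =
            |s p * (star (ψ ε) ⬝ᵥ pauliString p *ᵥ ψ ε).re| := by
          have h1 : |s p| = 1 := by
            rcases hs p with h | h | h
            · exact absurd h hsp
            · rw [h, abs_one]
            · rw [h, abs_neg, abs_one]
          rw [abs_mul, h1, one_mul, Complex.abs_re_eq_norm.mpr (him _ _)]
        rw [e5, abs_one, Real.one_rpow]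
      · ring
  have hone : (∑ p : N → Fin 4, s p * s p) = 2 ^ Fintype.card N := by
    have := sum_pauliString_expect S S
    simp only [hsS, hS1, Complex.star_def, Complex.conj_ofReal, map_one, mul_one] at this
    exact_mod_cast this
  have hphi : ∑ p : N → Fin 4, s p * (star φ ⬝ᵥ pauliString p *ᵥ φ).re =
      2 ^ Fintype.card N * Complex.normSq (star S ⬝ᵥ φ) := by
    have := sum_pauliString_expect S φ
    simp only [hsS] at this
    have h2 := congrArg Complex.re this
    rw [Complex.re_sum] at h2
    simp only [Complex.star_def, Complex.conj_ofReal, Complex.re_ofReal_mul] at h2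
    rw [h2, mul_comm (starRingEnd ℂ _), Complex.mul_conj]
    exact_mod_cast Complex.ofReal_re _
  have hsum : Tendsto (fun ε => (((2 : ℝ) ^ Fintype.card N)⁻¹ *
      (∑ p : N → Fin 4, ‖star (ψ ε) ⬝ᵥ pauliString p *ᵥ ψ ε‖ ^ (2 * α)) - 1) / ε ^ 2) (𝓝[≠] 0)
      (𝓝 (-(2 * α) * ((star φ ⬝ᵥ φ).re - Complex.normSq (star S ⬝ᵥ φ)))) := by
    have h1 := (tendsto_finsetSum Finset.univ fun p _ => hterm p).const_mul
      (((2 : ℝ) ^ Fintype.card N)⁻¹)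
    have h2 : (2 : ℝ) ^ Fintype.card N ≠ 0 := by positivity
    have h3 : (((2 : ℝ) ^ Fintype.card N)⁻¹) * ∑ p : N → Fin 4, (-(2 * α) *
        (s p * s p * (star φ ⬝ᵥ φ).re - s p * (star φ ⬝ᵥ pauliString p *ᵥ φ).re)) =
        -(2 * α) * ((star φ ⬝ᵥ φ).re - Complex.normSq (star S ⬝ᵥ φ)) := by
      rw [← Finset.mul_sum, Finset.sum_sub_distrib, hphi, ← Finset.sum_mul, hone]
      field_simp
    rw [h3] at h1
    refine h1.congr fun ε => ?_
    rw [← Finset.sum_div, Finset.sum_sub_distrib, hone]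
    field_simp
  have hlog := tendsto_comp_slope (Real.hasDerivAt_log one_ne_zero) hsq hsq0 hsum
  have := hlog.const_mul (1 / (1 - α))
  convert this using 2
  · rw [stabilizerRenyi, Real.log_one, sub_zero, mul_div_assoc]
  · have h1 : α - 1 ≠ 0 := by linarith
    have h2 : 1 - α ≠ 0 := by linarith
    field_simp
    ring

end StabilizerRenyi

end SkewedCode

namespace SkewedCode

/-! ### Hilbert-Schmidt inequalities -/

section HilbertSchmidt

variable {k l : Type} [Fintype k] [Fintype l]

/-- The squared Hilbert-Schmidt norm. -/
noncomputable def hsSq (A : Matrix k l ℂ) : ℝ := ∑ i, ∑ j, Complex.normSq (A i j)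

theorem hsSq_nonneg (A : Matrix k l ℂ) : 0 ≤ hsSq A :=
  Finset.sum_nonneg fun _ _ => Finset.sum_nonneg fun _ _ => Complex.normSq_nonneg _

theorem continuous_hsSq : Continuous (hsSq : Matrix k l ℂ → ℝ) := by
  unfold hsSq
  have := Complex.continuous_normSq
  fun_prop

theorem ofReal_hsSq (A : Matrix k l ℂ) : (hsSq A : ℂ) = trace (Aᴴ * A) := by
  simp only [hsSq, trace, diag, mul_apply, conjTranspose_apply, Complex.ofReal_sum]
  rw [Finset.sum_comm]
  refine Finset.sum_congr rfl fun i _ => Finset.sum_congr rfl fun j _ => ?_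
  rw [Complex.star_def, mul_comm, Complex.mul_conj]

theorem hsSq_eq_re (A : Matrix k l ℂ) : hsSq A = (trace (Aᴴ * A)).re := by
  rw [← ofReal_hsSq, Complex.ofReal_re]

theorem hsSq_unitary_mul [DecidableEq k] {U : Matrix k k ℂ} (hU : Uᴴ * U = 1) (A : Matrix k l ℂ) :
    hsSq (U * A) = hsSq A := by
  rw [hsSq_eq_re, hsSq_eq_re, conjTranspose_mul, Matrix.mul_assoc, ← Matrix.mul_assoc Uᴴ, hU,
    Matrix.one_mul]

theorem hsSq_smul (c : ℂ) (A : Matrix k l ℂ) : hsSq (c • A) = Complex.normSq c * hsSq A := by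
  simp only [hsSq, Matrix.smul_apply, smul_eq_mul, map_mul, Finset.mul_sum]

/-- Young's inequality, entry by entry. The weight `t` stays free because the infidelity bound takes
it proportional to |ε|. -/
theorem two_mul_abs_re_trace_le (A B : Matrix k l ℂ) {t : ℝ} (ht : 0 < t) :
    2 * |(trace (Aᴴ * B)).re| ≤ t * hsSq A + t⁻¹ * hsSq B := by
  have h1 : ∀ x y : ℂ, 2 * |(star x * y).re| ≤
      t * Complex.normSq x + t⁻¹ * Complex.normSq y := by
    intro x y
    have h2 : |(star x * y).re| ≤ ‖x‖ * ‖y‖ := by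
      refine (Complex.abs_re_le_norm _).trans ?_
      rw [norm_mul, norm_star]
    rw [Complex.normSq_eq_norm_sq, Complex.normSq_eq_norm_sq]
    have h3 : 0 ≤ t⁻¹ * (t * ‖x‖ - ‖y‖) ^ 2 := by positivity
    have h4 : t⁻¹ * (t * ‖x‖ - ‖y‖) ^ 2 = t * ‖x‖ ^ 2 - 2 * (‖x‖ * ‖y‖) + t⁻¹ * ‖y‖ ^ 2 := by
      field_simp
      ring
    linarith
  have h5 : trace (Aᴴ * B) = ∑ j, ∑ i, star (A i j) * B i j := by
    simp [trace, mul_apply]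
  rw [h5, Complex.re_sum]
  simp only [Complex.re_sum]
  calc 2 * |∑ j, ∑ i, (star (A i j) * B i j).re|
      ≤ 2 * ∑ j, ∑ i, |(star (A i j) * B i j).re| := by
        gcongr
        refine (Finset.abs_sum_le_sum_abs _ _).trans ?_
        exact Finset.sum_le_sum fun j _ => Finset.abs_sum_le_sum_abs _ _
    _ ≤ ∑ j, ∑ i, (t * Complex.normSq (A i j) + t⁻¹ * Complex.normSq (B i j)) := by
        rw [Finset.mul_sum]
        refine Finset.sum_le_sum fun j _ => ?_
        rw [Finset.mul_sum]
        exact Finset.sum_le_sum fun i _ => h1 _ _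
    _ = _ := by
        rw [Finset.sum_comm]
        simp only [hsSq, Finset.mul_sum, Finset.sum_add_distrib]

theorem sq_re_trace_le (A B : Matrix k l ℂ) : (trace (Aᴴ * B)).re ^ 2 ≤ hsSq A * hsSq B := by
  rcases (hsSq_nonneg A).eq_or_lt with h0 | h0
  · have h1 : A = 0 := by
      ext i j
      have h2 := (Finset.sum_eq_zero_iff_of_nonneg (f := fun i => ∑ j, Complex.normSq (A i j))
        fun _ _ => Finset.sum_nonneg fun _ _ => Complex.normSq_nonneg _).mp h0.symm i
          (Finset.mem_univ i)
      have h3 := (Finset.sum_eq_zero_iff_of_nonneg (f := fun j => Complex.normSq (A i j))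
        fun _ _ => Complex.normSq_nonneg _).mp h2 j (Finset.mem_univ j)
      simpa using h3
    simp [h1, hsSq]
  · by_cases hr : (trace (Aᴴ * B)).re = 0
    · rw [hr, zero_pow two_ne_zero]
      exact mul_nonneg (hsSq_nonneg A) (hsSq_nonneg B)
    · have hr' : 0 < |(trace (Aᴴ * B)).re| := abs_pos.mpr hr
      have := two_mul_abs_re_trace_le A B (div_pos hr' h0)
      rw [div_mul_cancel₀ _ h0.ne', inv_div] at this
      have h2 : |(trace (Aᴴ * B)).re| ≤ hsSq A / |(trace (Aᴴ * B)).re| * hsSq B := by linarith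
      rw [div_mul_eq_mul_div, le_div_iff₀ hr'] at h2
      rwa [← sq_abs, sq]

end HilbertSchmidt

/-! ### Encodings as operators on A₁A₂ acting on the exact code -/

section Choi

variable {n m : ℕ}

/-- The operator `M` on `A₁ A₂` with `Y = (M ⊗ 1) (attach χ)`, for `χ` maximally entangled. -/
noncomputable def opOf (χ : Bits m × Bits m → ℂ) :
    Matrix (Phys n m) (Bits n) ℂ →ₗ[ℂ] Matrix (Bits n × Bits m) (Bits n × Bits m) ℂ where
  toFun Y := Matrix.of fun p q => (2 : ℂ) ^ m * ∑ y, Y (p, y) q.1 * star (χ (q.2, y))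
  map_add' Y Z := by
    ext p q
    simp [add_mul, Finset.sum_add_distrib, mul_add]
  map_smul' c Y := by
    ext p q
    simp only [Matrix.smul_apply, smul_eq_mul, of_apply, RingHom.id_apply, mul_assoc,
      ← Finset.mul_sum]
    ring

theorem opOf_apply (χ : Bits m × Bits m → ℂ) (Y : Matrix (Phys n m) (Bits n) ℂ)
    (p q : Bits n × Bits m) :
    opOf χ Y p q = (2 : ℂ) ^ m * ∑ y, Y (p, y) q.1 * star (χ (q.2, y)) := rfl

theorem opOf_kronecker_one_mul (χ : Bits m × Bits m → ℂ)
    (A : Matrix (Bits n × Bits m) (Bits n × Bits m) ℂ) (Y : Matrix (Phys n m) (Bits n) ℂ) :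
    opOf χ ((A ⊗ₖ (1 : Matrix (Bits m) (Bits m) ℂ)) * Y) = A * opOf χ Y := by
  ext p q
  simp only [opOf_apply, mul_apply, kroneckerMap_apply, Fintype.sum_prod_type (α₂ := Bits m),
    one_apply, mul_ite, mul_one, mul_zero, ite_mul, zero_mul, Finset.sum_ite_eq, Finset.mem_univ,
    if_true, Finset.mul_sum, Finset.sum_mul]
  rw [Finset.sum_comm]
  refine Finset.sum_congr rfl fun i _ => ?_
  rw [Finset.sum_comm]
  refine Finset.sum_congr rfl fun x _ => Finset.sum_congr rfl fun y _ => ?_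
  ring

theorem opOf_attach_eq (χ x : Bits m × Bits m → ℂ) :
    opOf χ (attach (n := n) x) = (1 : Matrix (Bits n) (Bits n) ℂ) ⊗ₖ
      (Matrix.of fun a a' => (2 : ℂ) ^ m * ∑ y, x (a, y) * star (χ (a', y))) := by
  ext p q
  simp only [opOf_apply, attach, of_apply, kroneckerMap_apply, one_apply]
  by_cases h : p.1 = q.1 <;> simp [h]

variable {χ : Bits m × Bits m → ℂ}

theorem flat_fst (hχ : traceSnd (vecMulVec χ (star χ)) = ((2 : ℂ) ^ m)⁻¹ • 1) (x x' : Bits m) :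
    ∑ y, χ (x, y) * star (χ (x', y)) = if x = x' then ((2 : ℂ) ^ m)⁻¹ else 0 := by
  have := congrFun₂ hχ x x'
  simpa [traceSnd, vecMulVec_apply, one_apply] using this

/-- Flatness on A₂ says that 2^m Xᴴ is a right inverse of the coefficient matrix X of χ. As A₂ and Ā
have equal dimension, X is square and the inverse is two-sided, so χ is flat on Ā as well. -/
theorem flat_snd (hχ : traceSnd (vecMulVec χ (star χ)) = ((2 : ℂ) ^ m)⁻¹ • 1) (y y' : Bits m) :
    ∑ x, star (χ (x, y)) * χ (x, y') = if y = y' then ((2 : ℂ) ^ m)⁻¹ else 0 := by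
  let X : Matrix (Bits m) (Bits m) ℂ := Matrix.of fun x y => χ (x, y)
  have h2 : (2 : ℂ) ^ m ≠ 0 := by positivity
  have h1 : X * ((2 : ℂ) ^ m • Xᴴ) = 1 := by
    ext x x'
    simp only [X, mul_apply, Matrix.smul_apply, conjTranspose_apply, of_apply, smul_eq_mul]
    have := flat_fst hχ x x'
    simp only [mul_left_comm _ ((2 : ℂ) ^ m), ← Finset.mul_sum, this, one_apply]
    split_ifs
    · exact mul_inv_cancel₀ h2
    · simp
  have h1' : ((2 : ℂ) ^ m • Xᴴ) * X = 1 := mul_eq_one_comm.mp h1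
  have h3 := congrFun₂ h1' y y'
  simp only [X, mul_apply, Matrix.smul_apply, conjTranspose_apply, of_apply, smul_eq_mul,
    mul_assoc, ← Finset.mul_sum, one_apply] at h3
  rw [← mul_right_inj' h2, h3]
  split_ifs
  · exact (mul_inv_cancel₀ h2).symm
  · simp

section Flat

variable (hχ : traceSnd (vecMulVec χ (star χ)) = ((2 : ℂ) ^ m)⁻¹ • 1)

include hχ

theorem opOf_attach : opOf χ (attach (n := n) χ) = 1 := by
  have h2 : (2 : ℂ) ^ m ≠ 0 := by positivity
  rw [opOf_attach_eq, ← one_kronecker_one]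
  congr 1
  ext a a'
  simp only [of_apply, flat_fst hχ, one_apply]
  split_ifs
  · exact mul_inv_cancel₀ h2
  · simp

/-- Flatness on Ā makes `opOf` invertible: this is its inverse. -/
theorem eq_sum_opOf (Y : Matrix (Phys n m) (Bits n) ℂ) (p : Bits n × Bits m) (y : Bits m)
    (j : Bits n) : Y (p, y) j = ∑ x, opOf χ Y p (j, x) * χ (x, y) := by
  have h2 : (2 : ℂ) ^ m ≠ 0 := by positivity
  simp only [opOf_apply, mul_assoc, ← Finset.mul_sum, Finset.sum_mul]
  rw [Finset.sum_comm]
  simp only [← Finset.mul_sum, flat_snd hχ, mul_ite, mul_zero, Finset.sum_ite_eq', Finset.mem_univ,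
    if_true]
  field_simp

/-- Once both encodings are expanded through `opOf`, Ā only enters through the overlap of two rows
of χ, which is a Kronecker delta over 2^m. Tracing out Ā thus leaves σ ⊗ 1 between the two
operators. -/
theorem traceSnd_mul_conjTranspose (Y Z : Matrix (Phys n m) (Bits n) ℂ)
    (σ : Matrix (Bits n) (Bits n) ℂ) :
    traceSnd (Y * σ * Zᴴ) = ((2 : ℂ) ^ m)⁻¹ •
      (opOf χ Y * (σ ⊗ₖ (1 : Matrix (Bits m) (Bits m) ℂ)) * (opOf χ Z)ᴴ) := by
  ext p q
  have h1 : traceSnd (Y * σ * Zᴴ) p q =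
      ∑ j, ∑ i, ∑ x, ∑ x', opOf χ Y p (i, x) * σ i j * star (opOf χ Z q (j, x')) *
        ∑ y, χ (x, y) * star (χ (x', y)) := by
    simp only [traceSnd, of_apply, mul_apply, conjTranspose_apply]
    simp only [eq_sum_opOf hχ Y, eq_sum_opOf hχ Z, star_sum, Finset.sum_mul, Finset.mul_sum]
    rw [Finset.sum_comm]
    refine Finset.sum_congr rfl fun j _ => ?_
    have h : ∀ (f : Bits m → Bits n → Bits m → Bits m → ℂ),
        ∑ y, ∑ x', ∑ i, ∑ x, f y i x x' = ∑ i, ∑ x, ∑ x', ∑ y, f y i x x' := by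
      intro f
      calc _ = ∑ y, ∑ i, ∑ x', ∑ x, f y i x x' :=
            Finset.sum_congr rfl fun y _ => Finset.sum_comm
        _ = ∑ i, ∑ y, ∑ x', ∑ x, f y i x x' := Finset.sum_comm
        _ = ∑ i, ∑ y, ∑ x, ∑ x', f y i x x' :=
            Finset.sum_congr rfl fun i _ => Finset.sum_congr rfl fun y _ => Finset.sum_comm
        _ = ∑ i, ∑ x, ∑ y, ∑ x', f y i x x' :=
            Finset.sum_congr rfl fun i _ => Finset.sum_comm
        _ = _ := Finset.sum_congr rfl fun i _ => Finset.sum_congr rfl fun x _ => Finset.sum_comm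
    refine Eq.trans ?_ ((h fun y i x x' => opOf χ Y p (i, x) * χ (x, y) * σ i j *
      star (opOf χ Z q (j, x') * χ (x', y))).trans ?_)
    · rfl
    · refine Finset.sum_congr rfl fun i _ => Finset.sum_congr rfl fun x _ =>
        Finset.sum_congr rfl fun x' _ => Finset.sum_congr rfl fun y _ => ?_
      rw [star_mul']
      ring
  rw [h1]
  simp only [flat_fst hχ, mul_ite, mul_zero, Finset.sum_ite_eq, Finset.mem_univ, if_true,
    Matrix.smul_apply, mul_apply, kroneckerMap_apply, one_apply, mul_one, conjTranspose_apply,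
    Fintype.sum_prod_type (α₂ := Bits m), Finset.sum_ite_eq', smul_eq_mul, Finset.mul_sum,
    Finset.sum_mul]
  refine Finset.sum_congr rfl fun j _ => ?_
  rw [Finset.sum_comm]
  refine Finset.sum_congr rfl fun x _ => Finset.sum_congr rfl fun i _ => ?_
  ring

theorem conjTranspose_mul_eq (Y Z : Matrix (Phys n m) (Bits n) ℂ) :
    Yᴴ * Z = ((2 : ℂ) ^ m)⁻¹ • traceSnd ((opOf χ Y)ᴴ * opOf χ Z) := by
  ext i j
  have h1 : (Yᴴ * Z) i j = ∑ p, ∑ x', ∑ x, star (opOf χ Y p (i, x)) * opOf χ Z p (j, x') *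
      ∑ y, χ (x', y) * star (χ (x, y)) := by
    simp only [mul_apply, conjTranspose_apply]
    rw [Fintype.sum_prod_type (α₂ := Bits m)]
    simp only [eq_sum_opOf hχ Y, eq_sum_opOf hχ Z, star_sum, Finset.sum_mul, Finset.mul_sum]
    refine Finset.sum_congr rfl fun p _ => ?_
    rw [Finset.sum_comm]
    rw [Finset.sum_comm' (t' := Finset.univ) (s' := fun _ => Finset.univ) (by simp)]
    rw [Finset.sum_comm]
    refine Finset.sum_congr rfl fun x _ => ?_
    rw [Finset.sum_comm]
    refine Finset.sum_congr rfl fun x' _ => Finset.sum_congr rfl fun y _ => ?_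
    rw [star_mul']
    ring
  rw [h1]
  simp only [flat_fst hχ, mul_ite, mul_zero, Finset.sum_ite_eq, Finset.mem_univ, if_true,
    Matrix.smul_apply, traceSnd, of_apply, mul_apply, conjTranspose_apply, smul_eq_mul,
    Finset.mul_sum]
  rw [Finset.sum_comm]
  refine Finset.sum_congr rfl fun p _ => Finset.sum_congr rfl fun x _ => ?_
  ring

end Flat

theorem trace_traceSnd {a b : Type} [Fintype a] [Fintype b] (M : Matrix (a × b) (a × b) ℂ) :
    trace (traceSnd M) = trace M := by
  simp [trace, traceSnd, Fintype.sum_prod_type]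

theorem trace_traceFst {a b : Type} [Fintype a] [Fintype b] (M : Matrix (a × b) (a × b) ℂ) :
    trace (traceFst M) = trace M := by
  simp only [trace, traceFst, Fintype.sum_prod_type, diag, of_apply]
  rw [Finset.sum_comm]

theorem hsSq_opOf (hχ : traceSnd (vecMulVec χ (star χ)) = ((2 : ℂ) ^ m)⁻¹ • 1)
    (Y : Matrix (Phys n m) (Bits n) ℂ) : hsSq Y = ((2 : ℝ) ^ m)⁻¹ * hsSq (opOf χ Y) := by
  have h : (hsSq Y : ℂ) = ((2 : ℂ) ^ m)⁻¹ * (hsSq (opOf χ Y) : ℂ) := by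
    rw [ofReal_hsSq, conjTranspose_mul_eq hχ, trace_smul, trace_traceSnd, ofReal_hsSq, smul_eq_mul]
  apply Complex.ofReal_injective
  push_cast
  exact h

end Choi

end SkewedCode

namespace SkewedCode

/-! ### Choi vectors and their operators -/

section ChoiVectors

variable {n m : ℕ}

/-- The qubits of the Choi state. -/
abbrev Qubits (n m : ℕ) : Type := Fin n ⊕ Fin n ⊕ Fin m ⊕ Fin m

/-- The basis state of the Choi system with the given parts on `r`, `A₁`, `A₂`, `Ā`. -/
def joinBits (r i : Bits n) (a b : Bits m) : Qubits n m → Fin 2 :=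
  Sum.elim r (Sum.elim i (Sum.elim a b))

theorem sum_joinBits {M : Type*} [AddCommMonoid M] (f : (Qubits n m → Fin 2) → M) :
    ∑ x, f x = ∑ r, ∑ i, ∑ a, ∑ b, f (joinBits r i a b) := by
  rw [← (Equiv.sumArrowEquivProdArrow (Fin n) (Fin n ⊕ Fin m ⊕ Fin m) (Fin 2)).symm.sum_comp,
    Fintype.sum_prod_type]
  refine Finset.sum_congr rfl fun r _ => ?_
  rw [← (Equiv.sumArrowEquivProdArrow (Fin n) (Fin m ⊕ Fin m) (Fin 2)).symm.sum_comp,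
    Fintype.sum_prod_type]
  refine Finset.sum_congr rfl fun i _ => ?_
  rw [← (Equiv.sumArrowEquivProdArrow (Fin m) (Fin m) (Fin 2)).symm.sum_comp,
    Fintype.sum_prod_type]
  rfl

theorem eq_joinBits (x : Qubits n m → Fin 2) : x = joinBits (fun k => x (.inl k))
    (fun k => x (.inr (.inl k))) (fun k => x (.inr (.inr (.inl k))))
    (fun k => x (.inr (.inr (.inr k)))) := by
  ext (q | q | q | q) <;> rfl

theorem choi_joinBits (V : Matrix (Phys n m) (Bits n) ℂ) (r i : Bits n) (a b : Bits m) :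
    choi V (joinBits r i a b) = ((Real.sqrt ((2 : ℝ) ^ n) : ℝ) : ℂ)⁻¹ * V ((i, a), b) r := rfl

theorem sqrt_two_pow_mul_self (n : ℕ) :
    ((Real.sqrt ((2 : ℝ) ^ n) : ℝ) : ℂ) * ((Real.sqrt ((2 : ℝ) ^ n) : ℝ) : ℂ) = 2 ^ n := by
  rw [← Complex.ofReal_mul, Real.mul_self_sqrt (by positivity)]
  push_cast
  rfl

theorem sqrt_two_pow_ne_zero (n : ℕ) : ((Real.sqrt ((2 : ℝ) ^ n) : ℝ) : ℂ) ≠ 0 := by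
  intro h
  have h1 := sqrt_two_pow_mul_self n
  rw [h, zero_mul] at h1
  exact pow_ne_zero n two_ne_zero h1.symm

/-- The inverse of `choi`. -/
noncomputable def unchoi : ((Qubits n m → Fin 2) → ℂ) →ₗ[ℂ] Matrix (Phys n m) (Bits n) ℂ where
  toFun v := Matrix.of fun p j =>
    ((Real.sqrt ((2 : ℝ) ^ n) : ℝ) : ℂ) * v (joinBits j p.1.1 p.1.2 p.2)
  map_add' v w := by
    ext p j
    simp [mul_add]
  map_smul' c v := by
    ext p j
    simp only [Pi.smul_apply, smul_eq_mul, of_apply, Matrix.smul_apply, RingHom.id_apply]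
    ring

theorem unchoi_choi (V : Matrix (Phys n m) (Bits n) ℂ) : unchoi (choi V) = V := by
  ext p j
  change ((Real.sqrt ((2 : ℝ) ^ n) : ℝ) : ℂ) * choi V (joinBits j p.1.1 p.1.2 p.2) = _
  rw [choi_joinBits, mul_inv_cancel_left₀ (sqrt_two_pow_ne_zero n)]

theorem choi_unchoi (v : (Qubits n m → Fin 2) → ℂ) : choi (unchoi v) = v := by
  ext x
  rw [eq_joinBits x, choi_joinBits]
  exact inv_mul_cancel_left₀ (sqrt_two_pow_ne_zero n) _

/-- `choi` as a linear map. -/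
noncomputable def choiₗ : Matrix (Phys n m) (Bits n) ℂ →ₗ[ℂ] ((Qubits n m → Fin 2) → ℂ) where
  toFun := choi
  map_add' v w := by
    ext x
    simp [choi, mul_add]
  map_smul' c v := by
    ext x
    simp only [choi, Matrix.smul_apply, smul_eq_mul, RingHom.id_apply, Pi.smul_apply]
    ring

theorem choi_dotProduct (V V' : Matrix (Phys n m) (Bits n) ℂ) :
    star (choi V) ⬝ᵥ choi V' = ((2 : ℂ) ^ n)⁻¹ * trace (Vᴴ * V') := by
  have h : ((Real.sqrt ((2 : ℝ) ^ n) : ℝ) : ℂ)⁻¹ * ((Real.sqrt ((2 : ℝ) ^ n) : ℝ) : ℂ)⁻¹ =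
      ((2 : ℂ) ^ n)⁻¹ := by
    rw [← mul_inv, sqrt_two_pow_mul_self]
  simp only [dotProduct, sum_joinBits, Pi.star_apply, choi_joinBits, star_mul', trace, diag,
    mul_apply, conjTranspose_apply, Fintype.sum_prod_type, Finset.mul_sum, ← h]
  refine Finset.sum_congr rfl fun r _ => Finset.sum_congr rfl fun i _ =>
    Finset.sum_congr rfl fun a _ => Finset.sum_congr rfl fun b _ => ?_
  rw [star_inv₀, Complex.star_def, Complex.conj_ofReal]
  ring

/-- The operator on `A₁ A₂` that maps the Choi state of the exact code to the given vector. -/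
noncomputable def vecOp (χ : Bits m × Bits m → ℂ) :
    ((Qubits n m → Fin 2) → ℂ) →ₗ[ℂ] Matrix (Bits n × Bits m) (Bits n × Bits m) ℂ :=
  opOf χ ∘ₗ unchoi

theorem vecOp_choi (χ : Bits m × Bits m → ℂ) (V : Matrix (Phys n m) (Bits n) ℂ) :
    vecOp χ (choi V) = opOf χ V := by
  rw [vecOp, LinearMap.comp_apply, unchoi_choi]

/-- Up to the factor d d_χ, `vecOp` is an isometry, so variances of Choi vectors become
Hilbert-Schmidt distances. -/
theorem dotProduct_eq_vecOp {χ : Bits m × Bits m → ℂ}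
    (hχ : traceSnd (vecMulVec χ (star χ)) = ((2 : ℂ) ^ m)⁻¹ • 1) (v w : (Qubits n m → Fin 2) → ℂ) :
    star v ⬝ᵥ w = ((2 : ℂ) ^ n * 2 ^ m)⁻¹ * trace ((vecOp χ v)ᴴ * vecOp χ w) := by
  rw [← choi_unchoi v, ← choi_unchoi w, choi_dotProduct, vecOp_choi, vecOp_choi,
    conjTranspose_mul_eq hχ, trace_smul, trace_traceSnd, smul_eq_mul, mul_inv, mul_assoc]

theorem vecOp_mulVec_choi_attach (χ : Bits m × Bits m → ℂ)
    (T : Matrix (Qubits n m → Fin 2) (Qubits n m → Fin 2) ℂ) (i j : Bits n) (a a' : Bits m) :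
    vecOp χ (T *ᵥ choi (attach χ)) (i, a) (j, a') = (2 : ℂ) ^ m * ∑ b, ∑ k, ∑ c, ∑ c',
      T (joinBits j i a b) (joinBits k k c c') * χ (c, c') * star (χ (a', b)) := by
  have h : ∀ x, (T *ᵥ choi (attach χ)) x = ((Real.sqrt ((2 : ℝ) ^ n) : ℝ) : ℂ)⁻¹ *
      ∑ k, ∑ c, ∑ c', T x (joinBits k k c c') * χ (c, c') := by
    intro x
    simp only [mulVec, dotProduct, sum_joinBits, choi_joinBits, attach, of_apply, mul_ite, mul_zero,
      Finset.sum_ite_irrel, Finset.sum_const_zero, Finset.sum_ite_eq', Finset.mem_univ, if_true,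
      Finset.mul_sum]
    refine Finset.sum_congr rfl fun k _ => Finset.sum_congr rfl fun c _ =>
      Finset.sum_congr rfl fun c' _ => ?_
    ring
  rw [vecOp, LinearMap.comp_apply, opOf_apply]
  change (2 : ℂ) ^ m * ∑ y, ((Real.sqrt ((2 : ℝ) ^ n) : ℝ) : ℂ) *
    (T *ᵥ choi (attach χ)) (joinBits j i a y) * star (χ (a', y)) = _
  congr 1
  refine Finset.sum_congr rfl fun y _ => ?_
  rw [h, mul_inv_cancel_left₀ (sqrt_two_pow_ne_zero n)]
  simp only [Finset.sum_mul]

end ChoiVectors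

/-! ### Pauli expectations of stabilizer states and of the exact Choi state -/

section IntegralSpectrum

variable {N : Type} [Fintype N] [DecidableEq N]

/-- The squared expectations add up to 2^N by purity, and the 2^N stabilizing strings already
exhaust this sum; every other expectation must vanish. -/
theorem IsStabilizerState.hasIntegralPauliSpectrum {S : (N → Fin 2) → ℂ}
    (hS : IsStabilizerState S) : HasIntegralPauliSpectrum S := by
  classical
  obtain ⟨h1, h2⟩ := hS
  set G : Finset (N → Fin 4) :=
    Finset.univ.filter fun p => pauliString p *ᵥ S = S ∨ pauliString p *ᵥ S = -S with hG
  have hcard : G.card = 2 ^ Fintype.card N := by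
    rw [← h2, Nat.card_eq_fintype_card, Fintype.card_subtype]
  have hval : ∀ p ∈ G, ∃ s : ℝ, (s = 1 ∨ s = -1) ∧ star S ⬝ᵥ pauliString p *ᵥ S = s := by
    intro p hp
    rcases (Finset.mem_filter.mp hp).2 with h | h
    · exact ⟨1, Or.inl rfl, by rw [h, h1]; simp⟩
    · exact ⟨-1, Or.inr rfl, by rw [h, dotProduct_neg, h1]; simp⟩
  have hsum : ∑ p : N → Fin 4, Complex.normSq (star S ⬝ᵥ pauliString p *ᵥ S) =
      2 ^ Fintype.card N := by
    have := sum_pauliString_expect S S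
    simp only [h1, star_one, mul_one, Complex.star_def] at this
    have h3 : ∀ z : ℂ, (starRingEnd ℂ) z * z = (Complex.normSq z : ℂ) := fun z => by
      rw [mul_comm, Complex.mul_conj]
    simp only [h3] at this
    exact_mod_cast this
  have hG1 : ∑ p ∈ G, Complex.normSq (star S ⬝ᵥ pauliString p *ᵥ S) = 2 ^ Fintype.card N := by
    have : ∀ p ∈ G, Complex.normSq (star S ⬝ᵥ pauliString p *ᵥ S) = 1 := by
      intro p hp
      obtain ⟨s, hs, hp⟩ := hval p hp
      rw [hp, Complex.normSq_ofReal]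
      rcases hs with rfl | rfl <;> norm_num
    rw [Finset.sum_congr rfl this, Finset.sum_const, hcard]
    simp
  have hrest : ∑ p ∈ Gᶜ, Complex.normSq (star S ⬝ᵥ pauliString p *ᵥ S) = 0 := by
    have := Finset.sum_add_sum_compl G fun p => Complex.normSq (star S ⬝ᵥ pauliString p *ᵥ S)
    rw [hsum, hG1] at this
    linarith
  intro p
  by_cases hp : p ∈ G
  · obtain ⟨s, hs, h⟩ := hval p hp
    exact ⟨s, Or.inr hs, h⟩
  · refine ⟨0, Or.inl rfl, ?_⟩
    have := (Finset.sum_eq_zero_iff_of_nonneg fun _ _ => Complex.normSq_nonneg _).mp hrest p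
      (Finset.mem_compl.mpr hp)
    rw [Complex.normSq_eq_zero.mp this, Complex.ofReal_zero]

theorem exists_sign_mul {x y : ℂ} (hx : ∃ s : ℝ, (s = 0 ∨ s = 1 ∨ s = -1) ∧ x = s)
    (hy : ∃ s : ℝ, (s = 0 ∨ s = 1 ∨ s = -1) ∧ y = s) :
    ∃ s : ℝ, (s = 0 ∨ s = 1 ∨ s = -1) ∧ x * y = s := by
  obtain ⟨s, hs, rfl⟩ := hx
  obtain ⟨t, ht, rfl⟩ := hy
  refine ⟨s * t, ?_, by push_cast; rfl⟩
  rcases hs with rfl | rfl | rfl <;> rcases ht with rfl | rfl | rfl <;> norm_num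

theorem bell_pauli (q q' : Fin 4) : ∃ s : ℝ, (s = 0 ∨ s = 1 ∨ s = -1) ∧
    (2 : ℂ)⁻¹ * ∑ x, ∑ y, pauli q x y * pauli q' x y = s := by
  by_cases h : q = q'
  · by_cases h2 : q = 2
    · refine ⟨-1, by norm_num, ?_⟩
      subst h
      subst h2
      simp [pauli]
      norm_num
    · refine ⟨1, by norm_num, ?_⟩
      subst h
      fin_cases q <;> first | (exact absurd rfl h2) | (simp [pauli]; try norm_num)
  · refine ⟨0, by norm_num, ?_⟩
    fin_cases q <;> fin_cases q' <;> first | (exact absurd rfl h) | (simp [pauli])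

theorem bell_pauliString {n : ℕ} (p p' : Fin n → Fin 4) : ∃ s : ℝ, (s = 0 ∨ s = 1 ∨ s = -1) ∧
    ((2 : ℂ) ^ n)⁻¹ * ∑ x, ∑ y, pauliString p x y * pauliString p' x y = s := by
  have h1 : ((2 : ℂ) ^ n)⁻¹ * ∑ x, ∑ y, pauliString p x y * pauliString p' x y =
      ∏ k, ((2 : ℂ)⁻¹ * ∑ x, ∑ y, pauli (p k) x y * pauli (p' k) x y) := by
    rw [Finset.prod_mul_distrib, Finset.prod_const, Finset.card_univ, Fintype.card_fin, inv_pow]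
    congr 1
    have e1 := Finset.prod_univ_sum (fun _ : Fin n => (Finset.univ : Finset (Fin 2)))
      (fun k x => ∑ y, pauli (p k) x y * pauli (p' k) x y)
    rw [Fintype.piFinset_univ] at e1
    rw [e1]
    refine Finset.sum_congr rfl fun x _ => ?_
    have e2 := Finset.prod_univ_sum (fun _ : Fin n => (Finset.univ : Finset (Fin 2)))
      (fun k y => pauli (p k) (x k) y * pauli (p' k) (x k) y)
    rw [Fintype.piFinset_univ] at e2
    rw [e2]
    simp only [pauliString, of_apply, Finset.prod_mul_distrib]
  rw [h1]
  refine Finset.prod_induction _ (fun z : ℂ => ∃ s : ℝ, (s = 0 ∨ s = 1 ∨ s = -1) ∧ z = s)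
    (fun _ _ => exists_sign_mul) ⟨1, by norm_num, by simp⟩ fun k _ => bell_pauli _ _

/-- The Choi state of the exact code is a product of Bell pairs on r A₁ with χ on A₂Ā, so each Pauli
expectation factors. -/
theorem hasIntegralPauliSpectrum_choi_attach {n m : ℕ} {χ : Bits m × Bits m → ℂ}
    (hχ : IsStabilizerState (χ ∘ Equiv.sumArrowEquivProdArrow (Fin m) (Fin m) (Fin 2))) :
    HasIntegralPauliSpectrum (choi (attach (n := n) χ)) := by
  intro p
  let pr : Fin n → Fin 4 := fun k => p (.inl k)
  let p1 : Fin n → Fin 4 := fun k => p (.inr (.inl k))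
  let p2 : Fin m ⊕ Fin m → Fin 4 := fun k => p (.inr (.inr k))
  have hP : ∀ r i a b r' i' a' b', pauliString p (joinBits r i a b) (joinBits r' i' a' b') =
      pauliString pr r r' * pauliString p1 i i' *
        pauliString p2 (Sum.elim a b) (Sum.elim a' b') := by
    intro r i a b r' i' a' b'
    simp only [pauliString, of_apply, Fintype.prod_sum_type, joinBits, Sum.elim_inl, Sum.elim_inr,
      pr, p1, p2]
    ring
  have hsq : star ((Real.sqrt ((2 : ℝ) ^ n) : ℝ) : ℂ)⁻¹ * ((Real.sqrt ((2 : ℝ) ^ n) : ℝ) : ℂ)⁻¹ =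
      ((2 : ℂ) ^ n)⁻¹ := by
    rw [star_inv₀, Complex.star_def, Complex.conj_ofReal, ← mul_inv, sqrt_two_pow_mul_self]
  have hsum2 : ∀ f : (Fin m ⊕ Fin m → Fin 2) → ℂ, ∑ x, f x = ∑ a, ∑ b, f (Sum.elim a b) := by
    intro f
    rw [← (Equiv.sumArrowEquivProdArrow (Fin m) (Fin m) (Fin 2)).symm.sum_comp,
      Fintype.sum_prod_type]
    rfl
  have key : star (choi (attach (n := n) χ)) ⬝ᵥ pauliString p *ᵥ choi (attach χ) =
      (((2 : ℂ) ^ n)⁻¹ * ∑ x, ∑ y, pauliString pr x y * pauliString p1 x y) *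
      (star (χ ∘ Equiv.sumArrowEquivProdArrow (Fin m) (Fin m) (Fin 2)) ⬝ᵥ pauliString p2 *ᵥ
        (χ ∘ Equiv.sumArrowEquivProdArrow (Fin m) (Fin m) (Fin 2))) := by
    have e1 : ∀ a b : Bits m, (χ ∘ Equiv.sumArrowEquivProdArrow (Fin m) (Fin m) (Fin 2))
        (Sum.elim a b) = χ (a, b) := fun a b => rfl
    simp only [dotProduct, mulVec, sum_joinBits, hsum2, Pi.star_apply, choi_joinBits, attach,
      of_apply, hP, e1, mul_ite, mul_zero, Finset.sum_ite_irrel, Finset.sum_const_zero,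
      Finset.sum_ite_eq', Finset.mem_univ, if_true, Finset.mul_sum, apply_ite star, star_zero,
      ite_mul, zero_mul, Finset.sum_mul, star_mul', ← hsq]
    have hswap : ∀ f : Bits n → Bits m → Bits m → Bits n → Bits m → Bits m → ℂ,
        ∑ r, ∑ a, ∑ b, ∑ r', ∑ a', ∑ b', f r a b r' a' b' =
        ∑ a, ∑ b, ∑ a', ∑ b', ∑ r, ∑ r', f r a b r' a' b' := by
      intro f
      rw [Finset.sum_comm]
      refine Finset.sum_congr rfl fun a _ => ?_
      rw [Finset.sum_comm]
      refine Finset.sum_congr rfl fun b _ => ?_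
      have h1 : ∀ r, ∑ r', ∑ a', ∑ b', f r a b r' a' b' = ∑ a', ∑ b', ∑ r', f r a b r' a' b' := by
        intro r
        rw [Finset.sum_comm]
        refine Finset.sum_congr rfl fun a' _ => ?_
        exact Finset.sum_comm
      simp only [h1]
      rw [Finset.sum_comm]
      refine Finset.sum_congr rfl fun a' _ => ?_
      exact Finset.sum_comm
    rw [hswap]
    refine Finset.sum_congr rfl fun a _ => Finset.sum_congr rfl fun b _ =>
      Finset.sum_congr rfl fun a' _ => Finset.sum_congr rfl fun b' _ =>
      Finset.sum_congr rfl fun r _ => Finset.sum_congr rfl fun r' _ => ?_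
    ring
  rw [key]
  exact exists_sign_mul (bell_pauliString _ _) (hχ.hasIntegralPauliSpectrum p2)

end IntegralSpectrum

end SkewedCode

namespace SkewedCode

/-! ### Two-local generators in the operator picture -/

section TwoLocal

variable {n m : ℕ}

theorem SupportedOn.apply_eq {N : Type} {S : Set N} {M : Matrix (N → Fin 2) (N → Fin 2) ℂ}
    (h : SupportedOn S M) {x y x' y' : N → Fin 2} (hx : ∀ q ∈ S, x q = x' q)
    (hy : ∀ q ∈ S, y q = y' q) (hxy : ∀ q, q ∉ S → x q = y q)
    (hxy' : ∀ q, q ∉ S → x' q = y' q) : M x y = M x' y' := by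
  obtain ⟨t, ht⟩ := h
  rw [(ht x y).1 hxy, (ht x' y').1 hxy']
  congr 1 <;> funext q
  · exact hx q q.2
  · exact hy q q.2

theorem SupportedOn.apply_eq_zero {N : Type} {S : Set N} {M : Matrix (N → Fin 2) (N → Fin 2) ℂ}
    (h : SupportedOn S M) {x y : N → Fin 2} {q : N} (hq : q ∉ S) (hxy : x q ≠ y q) : M x y = 0 := by
  obtain ⟨t, ht⟩ := h
  exact (ht x y).2 fun hc => hxy (hc q hq)

theorem im_trace_mul_hermitian {k : Type} [Fintype k] {N Z : Matrix k k ℂ} (hN : N.IsHermitian)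
    (hZ : Z.IsHermitian) : (trace (N * Z)).im = 0 := by
  have : star (trace (N * Z)) = trace (N * Z) := by
    rw [← trace_conjTranspose, conjTranspose_mul, hN.eq, hZ.eq, trace_mul_comm]
  exact Complex.conj_eq_iff_im.mp this

theorem trace_mul_one_kronecker {a b : Type} [Fintype a] [Fintype b] [DecidableEq a]
    (N : Matrix (a × b) (a × b) ℂ) (g : Matrix b b ℂ) :
    trace (N * ((1 : Matrix a a ℂ) ⊗ₖ g)) = trace (traceFst N * g) := by
  simp only [trace, diag, mul_apply, Fintype.sum_prod_type, kroneckerMap_apply, one_apply, ite_mul,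
    one_mul, zero_mul, mul_ite, mul_zero, Finset.sum_ite_irrel, Finset.sum_const_zero,
    Finset.sum_ite_eq', Finset.mem_univ, if_true, traceFst, of_apply, Finset.sum_mul]
  rw [Finset.sum_comm]
  refine Finset.sum_congr rfl fun y _ => ?_
  rw [Finset.sum_comm]

theorem trace_mul_kronecker_one {a b : Type} [Fintype a] [Fintype b] [DecidableEq b]
    (N : Matrix (a × b) (a × b) ℂ) (h : Matrix a a ℂ) :
    trace (N * (h ⊗ₖ (1 : Matrix b b ℂ))) = trace (traceSnd N * h) := by
  simp only [trace, diag, mul_apply, Fintype.sum_prod_type, kroneckerMap_apply, one_apply,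
    mul_one, mul_ite, mul_zero,
    Finset.sum_ite_eq', Finset.mem_univ, if_true, traceSnd, of_apply, Finset.sum_mul]
  refine Finset.sum_congr rfl fun y _ => ?_
  rw [Finset.sum_comm]

variable {χ : Bits m × Bits m → ℂ}
  (hχ : traceSnd (vecMulVec χ (star χ)) = ((2 : ℂ) ^ m)⁻¹ • 1)
  {T : Matrix (Qubits n m → Fin 2) (Qubits n m → Fin 2) ℂ}
  {N : Matrix (Bits n × Bits m) (Bits n × Bits m) ℂ}

include hχ in
-- Here the generator itself is the operator. In the three analogous lemmas, an action on r is moved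
-- to A₁ by transposing that index, and an action on Ā is moved to A₂ through χ. Both moves preserve
-- hermiticity when the pair is mapped to distinct factors A₁ and A₂.
theorem vecOp_isHermitian_A₁A₂ (hT : T.IsHermitian)
    (hS : SupportedOn {q | party n m q = .A₁ ∨ party n m q = .A₂} T) :
    (vecOp χ (T *ᵥ choi (attach χ))).IsHermitian := by
  obtain ⟨t, hT', ht⟩ : ∃ t : Bits n → Bits m → Bits n → Bits m → ℂ, (∀ r i a b r' i' a' b',
      T (joinBits r i a b) (joinBits r' i' a' b') = if r = r' ∧ b = b' then t i a i' a' else 0) ∧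
      ∀ i a i' a', star (t i' a' i a) = t i a i' a' := by
    refine ⟨fun i a i' a' => T (joinBits 0 i a 0) (joinBits 0 i' a' 0), ?_, fun _ _ _ _ => hT.apply _ _⟩
    intro r i a b r' i' a' b'
    split_ifs with h
    · refine hS.apply_eq ?_ ?_ ?_ ?_ <;> rintro (q | q | q | q) hq <;>
        simp_all [party, joinBits]
    · rcases not_and_or.mp h with h | h <;> obtain ⟨k, hk⟩ := Function.ne_iff.mp h
      · exact hS.apply_eq_zero (q := .inl k) (by simp [party]) hk
      · exact hS.apply_eq_zero (q := .inr (.inr (.inr k))) (by simp [party]) hk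
  have h2 : (2 : ℂ) ^ m ≠ 0 := by positivity
  have hZ : ∀ i a j a', vecOp χ (T *ᵥ choi (attach χ)) (i, a) (j, a') =
      t i a j a' := by
    intro i a j a'
    rw [vecOp_mulVec_choi_attach]
    simp only [hT', ite_and, ite_mul, zero_mul, Finset.sum_ite_irrel, Finset.sum_const_zero,
      Finset.sum_ite_eq, Finset.mem_univ, if_true]
    rw [Finset.sum_comm]
    simp only [mul_assoc, ← Finset.mul_sum, flat_fst hχ, mul_ite, mul_zero, Finset.sum_ite_eq',
      Finset.mem_univ, if_true]
    field_simp
  ext ⟨i, a⟩ ⟨j, a'⟩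
  rw [conjTranspose_apply, hZ, hZ, ht]

include hχ in
theorem vecOp_isHermitian_rA₂ (hT : T.IsHermitian)
    (hS : SupportedOn {q | party n m q = .r ∨ party n m q = .A₂} T) :
    (vecOp χ (T *ᵥ choi (attach χ))).IsHermitian := by
  obtain ⟨t, hT', ht⟩ : ∃ t : Bits n → Bits m → Bits n → Bits m → ℂ, (∀ r i a b r' i' a' b',
      T (joinBits r i a b) (joinBits r' i' a' b') = if i = i' ∧ b = b' then t r a r' a' else 0) ∧
      ∀ r a r' a', star (t r' a' r a) = t r a r' a' := by
    refine ⟨fun r a r' a' => T (joinBits r 0 a 0) (joinBits r' 0 a' 0), ?_, fun _ _ _ _ => hT.apply _ _⟩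
    intro r i a b r' i' a' b'
    split_ifs with h
    · refine hS.apply_eq ?_ ?_ ?_ ?_ <;> rintro (q | q | q | q) hq <;>
        simp_all [party, joinBits]
    · rcases not_and_or.mp h with h | h <;> obtain ⟨k, hk⟩ := Function.ne_iff.mp h
      · exact hS.apply_eq_zero (q := .inr (.inl k)) (by simp [party]) hk
      · exact hS.apply_eq_zero (q := .inr (.inr (.inr k))) (by simp [party]) hk
  have h2 : (2 : ℂ) ^ m ≠ 0 := by positivity
  have hZ : ∀ i a j a', vecOp χ (T *ᵥ choi (attach χ)) (i, a) (j, a') =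
      t j a i a' := by
    intro i a j a'
    rw [vecOp_mulVec_choi_attach]
    simp only [hT', ite_and, ite_mul, zero_mul, Finset.sum_ite_irrel, Finset.sum_const_zero,
      Finset.sum_ite_eq, Finset.mem_univ, if_true]
    rw [Finset.sum_comm]
    simp only [mul_assoc, ← Finset.mul_sum, flat_fst hχ, mul_ite, mul_zero, Finset.sum_ite_eq',
      Finset.mem_univ, if_true]
    field_simp
  ext ⟨i, a⟩ ⟨j, a'⟩
  rw [conjTranspose_apply, hZ, hZ, ht]

theorem vecOp_isHermitian_A₁Abar (hT : T.IsHermitian)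
    (hS : SupportedOn {q | party n m q = .A₁ ∨ party n m q = .Abar} T) :
    (vecOp χ (T *ᵥ choi (attach χ))).IsHermitian := by
  obtain ⟨t, hT', ht⟩ : ∃ t : Bits n → Bits m → Bits n → Bits m → ℂ, (∀ r i a b r' i' a' b',
      T (joinBits r i a b) (joinBits r' i' a' b') = if r = r' ∧ a = a' then t i b i' b' else 0) ∧
      ∀ i b i' b', star (t i' b' i b) = t i b i' b' := by
    refine ⟨fun i b i' b' => T (joinBits 0 i 0 b) (joinBits 0 i' 0 b'), ?_, fun _ _ _ _ => hT.apply _ _⟩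
    intro r i a b r' i' a' b'
    split_ifs with h
    · refine hS.apply_eq ?_ ?_ ?_ ?_ <;> rintro (q | q | q | q) hq <;>
        simp_all [party, joinBits]
    · rcases not_and_or.mp h with h | h <;> obtain ⟨k, hk⟩ := Function.ne_iff.mp h
      · exact hS.apply_eq_zero (q := .inl k) (by simp [party]) hk
      · exact hS.apply_eq_zero (q := .inr (.inr (.inl k))) (by simp [party]) hk
  have hZ : ∀ i a j a', vecOp χ (T *ᵥ choi (attach χ)) (i, a) (j, a') = (2 : ℂ) ^ m *
      ∑ b, ∑ b', t i b j b' * χ (a, b') * star (χ (a', b)) := by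
    intro i a j a'
    rw [vecOp_mulVec_choi_attach]
    simp only [hT', ite_and, ite_mul, zero_mul, Finset.sum_ite_irrel, Finset.sum_const_zero,
      Finset.sum_ite_eq, Finset.mem_univ, if_true]
  ext ⟨i, a⟩ ⟨j, a'⟩
  rw [conjTranspose_apply, hZ, hZ, star_mul', star_sum, star_pow, star_ofNat, Finset.sum_comm]
  congr 1
  refine Finset.sum_congr rfl fun b _ => ?_
  rw [star_sum]
  refine Finset.sum_congr rfl fun b' _ => ?_
  rw [star_mul', star_mul', star_star, ht]
  ring

theorem vecOp_isHermitian_rAbar (hT : T.IsHermitian)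
    (hS : SupportedOn {q | party n m q = .r ∨ party n m q = .Abar} T) :
    (vecOp χ (T *ᵥ choi (attach χ))).IsHermitian := by
  obtain ⟨t, hT', ht⟩ : ∃ t : Bits n → Bits m → Bits n → Bits m → ℂ, (∀ r i a b r' i' a' b',
      T (joinBits r i a b) (joinBits r' i' a' b') = if i = i' ∧ a = a' then t r b r' b' else 0) ∧
      ∀ r b r' b', star (t r' b' r b) = t r b r' b' := by
    refine ⟨fun r b r' b' => T (joinBits r 0 0 b) (joinBits r' 0 0 b'), ?_, fun _ _ _ _ => hT.apply _ _⟩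
    intro r i a b r' i' a' b'
    split_ifs with h
    · refine hS.apply_eq ?_ ?_ ?_ ?_ <;> rintro (q | q | q | q) hq <;>
        simp_all [party, joinBits]
    · rcases not_and_or.mp h with h | h <;> obtain ⟨k, hk⟩ := Function.ne_iff.mp h
      · exact hS.apply_eq_zero (q := .inr (.inl k)) (by simp [party]) hk
      · exact hS.apply_eq_zero (q := .inr (.inr (.inl k))) (by simp [party]) hk
  have hZ : ∀ i a j a', vecOp χ (T *ᵥ choi (attach χ)) (i, a) (j, a') = (2 : ℂ) ^ m *
      ∑ b, ∑ b', t j b i b' * χ (a, b') * star (χ (a', b)) := by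
    intro i a j a'
    rw [vecOp_mulVec_choi_attach]
    simp only [hT', ite_and, ite_mul, zero_mul, Finset.sum_ite_irrel, Finset.sum_const_zero,
      Finset.sum_ite_eq, Finset.mem_univ, if_true]
  ext ⟨i, a⟩ ⟨j, a'⟩
  rw [conjTranspose_apply, hZ, hZ, star_mul', star_sum, star_pow, star_ofNat, Finset.sum_comm]
  congr 1
  refine Finset.sum_congr rfl fun b _ => ?_
  rw [star_sum]
  refine Finset.sum_congr rfl fun b' _ => ?_
  rw [star_mul', star_mul', star_star, ht]
  ring

/-- A₂ and Ā purify each other, so both actions land on A₂. The operator `g` need not be Hermitian: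
this is the extra freedom that removes the mean of D. -/
theorem exists_vecOp_eq_A₂Abar
    (hS : SupportedOn {q | party n m q = .A₂ ∨ party n m q = .Abar} T) :
    ∃ g, vecOp χ (T *ᵥ choi (attach χ)) = (1 : Matrix (Bits n) (Bits n) ℂ) ⊗ₖ g := by
  obtain ⟨t, hT'⟩ : ∃ t : Bits m → Bits m → Bits m → Bits m → ℂ, (∀ r i a b r' i' a' b',
      T (joinBits r i a b) (joinBits r' i' a' b') = if r = r' ∧ i = i' then t a b a' b' else 0) := by
    refine ⟨fun a b a' b' => T (joinBits 0 0 a b) (joinBits 0 0 a' b'), ?_⟩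
    intro r i a b r' i' a' b'
    split_ifs with h
    · refine hS.apply_eq ?_ ?_ ?_ ?_ <;> rintro (q | q | q | q) hq <;>
        simp_all [party, joinBits]
    · rcases not_and_or.mp h with h | h <;> obtain ⟨k, hk⟩ := Function.ne_iff.mp h
      · exact hS.apply_eq_zero (q := .inl k) (by simp [party]) hk
      · exact hS.apply_eq_zero (q := .inr (.inl k)) (by simp [party]) hk
  refine ⟨Matrix.of fun a a' => (2 : ℂ) ^ m * ∑ b, ∑ c, ∑ c',
    t a b c c' * χ (c, c') * star (χ (a', b)), ?_⟩
  ext ⟨i, a⟩ ⟨j, a'⟩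
  rw [vecOp_mulVec_choi_attach]
  simp only [hT', ite_and, ite_mul, zero_mul, Finset.sum_ite_irrel, Finset.sum_const_zero,
    Finset.sum_ite_eq, Finset.mem_univ, if_true, kroneckerMap_apply, one_apply, of_apply]
  by_cases h : i = j <;> simp [h]

/-- The same for the Bell pairs on r A₁: both actions land on A₁, and `h` need not be Hermitian. -/
theorem exists_vecOp_eq_rA₁ (hχ : traceSnd (vecMulVec χ (star χ)) = ((2 : ℂ) ^ m)⁻¹ • 1)
    (hS : SupportedOn {q | party n m q = .r ∨ party n m q = .A₁} T) :
    ∃ h, vecOp χ (T *ᵥ choi (attach χ)) = h ⊗ₖ (1 : Matrix (Bits m) (Bits m) ℂ) := by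
  obtain ⟨t, hT'⟩ : ∃ t : Bits n → Bits n → Bits n → Bits n → ℂ, (∀ r i a b r' i' a' b',
      T (joinBits r i a b) (joinBits r' i' a' b') = if a = a' ∧ b = b' then t r i r' i' else 0) := by
    refine ⟨fun r i r' i' => T (joinBits r i 0 0) (joinBits r' i' 0 0), ?_⟩
    intro r i a b r' i' a' b'
    split_ifs with h
    · refine hS.apply_eq ?_ ?_ ?_ ?_ <;> rintro (q | q | q | q) hq <;>
        simp_all [party, joinBits]
    · rcases not_and_or.mp h with h | h <;> obtain ⟨k, hk⟩ := Function.ne_iff.mp h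
      · exact hS.apply_eq_zero (q := .inr (.inr (.inl k))) (by simp [party]) hk
      · exact hS.apply_eq_zero (q := .inr (.inr (.inr k))) (by simp [party]) hk
  have h2 : (2 : ℂ) ^ m ≠ 0 := by positivity
  refine ⟨Matrix.of fun i j => ∑ k, t j i k k, ?_⟩
  ext ⟨i, a⟩ ⟨j, a'⟩
  rw [vecOp_mulVec_choi_attach]
  simp only [hT', ite_and, ite_mul, zero_mul, Finset.sum_ite_irrel, Finset.sum_const_zero,
    Finset.sum_ite_eq, Finset.mem_univ, if_true, kroneckerMap_apply, one_apply, of_apply]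
  rw [Finset.sum_comm]
  simp only [mul_assoc, ← Finset.mul_sum, flat_fst hχ, ← Finset.sum_mul]
  split_ifs
  · field_simp
  · simp

include hχ in
-- Orthogonality of `N` to every two-local velocity i T: a trace of two Hermitian operators is real,
-- and the vanishing partial traces of `N` annihilate 1 ⊗ g and h ⊗ 1. The pairs containing r cost
-- nothing, so the same bound serves with or without r.
theorem im_trace_mul_vecOp (hN : N.IsHermitian) (hN1 : traceFst N = 0) (hN2 : traceSnd N = 0)
    (hT : T.IsHermitian) {P Q : Party} (hPQ : P ≠ Q)
    (hS : SupportedOn {q | party n m q = P ∨ party n m q = Q} T) :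
    (trace (N * vecOp χ (T *ᵥ choi (attach χ)))).im = 0 := by
  have h1 : ∀ P Q : Party, {q | party n m q = P ∨ party n m q = Q} =
      {q | party n m q = Q ∨ party n m q = P} := fun P Q => by
    ext q
    exact or_comm
  have hA₂Abar : SupportedOn {q | party n m q = .A₂ ∨ party n m q = .Abar} T →
      (trace (N * vecOp χ (T *ᵥ choi (attach χ)))).im = 0 := by
    intro hS
    obtain ⟨g, hg⟩ := exists_vecOp_eq_A₂Abar (χ := χ) hS
    rw [hg, trace_mul_one_kronecker, hN1]
    simp
  have hrA₁ : SupportedOn {q | party n m q = .r ∨ party n m q = .A₁} T →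
      (trace (N * vecOp χ (T *ᵥ choi (attach χ)))).im = 0 := by
    intro hS
    obtain ⟨g, hg⟩ := exists_vecOp_eq_rA₁ hχ hS
    rw [hg, trace_mul_kronecker_one, hN2]
    simp
  cases P <;> cases Q
  · exact absurd rfl hPQ
  · exact hrA₁ hS
  · exact im_trace_mul_hermitian hN (vecOp_isHermitian_rA₂ hχ hT hS)
  · exact im_trace_mul_hermitian hN (vecOp_isHermitian_rAbar hT hS)
  · exact hrA₁ (h1 _ _ ▸ hS)
  · exact absurd rfl hPQ
  · exact im_trace_mul_hermitian hN (vecOp_isHermitian_A₁A₂ hχ hT hS)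
  · exact im_trace_mul_hermitian hN (vecOp_isHermitian_A₁Abar hT hS)
  · exact im_trace_mul_hermitian hN (vecOp_isHermitian_rA₂ hχ hT (h1 _ _ ▸ hS))
  · exact im_trace_mul_hermitian hN (vecOp_isHermitian_A₁A₂ hχ hT (h1 _ _ ▸ hS))
  · exact absurd rfl hPQ
  · exact hA₂Abar hS
  · exact im_trace_mul_hermitian hN (vecOp_isHermitian_rAbar hT (h1 _ _ ▸ hS))
  · exact im_trace_mul_hermitian hN (vecOp_isHermitian_A₁Abar hT (h1 _ _ ▸ hS))
  · exact hA₂Abar (h1 _ _ ▸ hS)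
  · exact absurd rfl hPQ

end TwoLocal

/-! ### First-order expansions of matrix families -/

section Exponentials

variable {k : Type} [Fintype k] [DecidableEq k]

open scoped Matrix.Norms.L2Operator in
theorem tendsto_exp_slope (T : Matrix k k ℂ) :
    Tendsto (fun ε : ℝ => ε⁻¹ • (NormedSpace.exp ((Complex.I * (ε : ℂ)) • T) - 1)) (𝓝[≠] 0)
      (𝓝 (Complex.I • T)) := by
  have h := hasDerivAt_exp_smul_const (𝕂 := ℝ) (Complex.I • T) (0 : ℝ)
  rw [hasDerivAt_iff_tendsto_slope_zero] at h
  simp only [zero_smul, NormedSpace.exp_zero, one_mul, zero_add] at h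
  refine h.congr fun ε => ?_
  congr 3
  rw [mul_comm, mul_smul]
  rfl

open scoped Matrix.Norms.L2Operator in
theorem exp_mem_unitaryGroup {T : Matrix k k ℂ} (hT : T.IsHermitian) (ε : ℝ) :
    NormedSpace.exp ((Complex.I * (ε : ℂ)) • T) ∈ unitaryGroup k ℂ := by
  let +nondep : NormedAlgebra ℚ (Matrix k k ℂ) := .restrictScalars ℚ ℂ _
  refine NormedSpace.exp_mem_unitary_of_mem_skewAdjoint ?_
  rw [skewAdjoint.mem_iff, star_smul, star_eq_conjTranspose, hT.eq]
  simp

/-- If `f = x + ε f' + o(ε)` then `f → x`. -/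
theorem tendsto_of_slope {E : Type*} [AddCommGroup E] [Module ℝ E] [TopologicalSpace E]
    [ContinuousSMul ℝ E] [ContinuousAdd E] {f : ℝ → E} {x f' : E}
    (h : Tendsto (fun ε : ℝ => ε⁻¹ • (f ε - x)) (𝓝[≠] 0) (𝓝 f')) :
    Tendsto f (𝓝[≠] 0) (𝓝 x) := by
  have h0 : Tendsto (fun ε : ℝ => ε) (𝓝[≠] 0) (𝓝 0) := nhdsWithin_le_nhds
  have := (h0.smul h).add_const x
  rw [zero_smul, zero_add] at this
  refine this.congr' ?_
  filter_upwards [self_mem_nhdsWithin] with ε hε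
  rw [smul_smul, mul_inv_cancel₀ hε, one_smul, sub_add_cancel]

theorem tendsto_matrix_mul {k l o : Type} [Fintype l] {X : Type*}
    {F : Filter X} {f : X → Matrix k l ℂ} {g : X → Matrix l o ℂ} {x : Matrix k l ℂ}
    {y : Matrix l o ℂ} (hf : Tendsto f F (𝓝 x)) (hg : Tendsto g F (𝓝 y)) :
    Tendsto (fun t => f t * g t) F (𝓝 (x * y)) := by
  refine tendsto_pi_nhds.mpr fun i => tendsto_pi_nhds.mpr fun j => ?_
  simp only [mul_apply]
  refine tendsto_finsetSum _ fun a _ => ?_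
  exact (((continuous_apply_apply i a).tendsto x).comp hf).mul
    (((continuous_apply_apply a j).tendsto y).comp hg)

theorem tendsto_mul_slope {k l o : Type} [Fintype l]
    {f : ℝ → Matrix k l ℂ} {g : ℝ → Matrix l o ℂ} {x f' : Matrix k l ℂ} {y g' : Matrix l o ℂ}
    (hf : Tendsto (fun ε : ℝ => ε⁻¹ • (f ε - x)) (𝓝[≠] 0) (𝓝 f'))
    (hg : Tendsto (fun ε : ℝ => ε⁻¹ • (g ε - y)) (𝓝[≠] 0) (𝓝 g')) :
    Tendsto (fun ε : ℝ => ε⁻¹ • (f ε * g ε - x * y)) (𝓝[≠] 0) (𝓝 (f' * y + x * g')) := by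
  have hg0 : Tendsto g (𝓝[≠] 0) (𝓝 y) := tendsto_of_slope hg
  have h1 := tendsto_matrix_mul hf hg0
  have h2 := tendsto_matrix_mul (tendsto_const_nhds (x := x)) hg
  refine (h1.add h2).congr fun ε => ?_
  rw [Matrix.smul_mul, Matrix.mul_smul, ← smul_add, Matrix.sub_mul, Matrix.mul_sub]
  congr 1
  abel

/-- To first order the generators simply add up, so the ordering of the subsystems does not
influence the leading coefficient of the magic. -/
theorem tendsto_list_prod_slope {ι : Type} (s : List ι) (T : ι → Matrix k k ℂ) :
    Tendsto (fun ε : ℝ => ε⁻¹ •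
      ((s.map fun p => NormedSpace.exp ((Complex.I * (ε : ℂ)) • T p)).prod - 1)) (𝓝[≠] 0)
      (𝓝 (Complex.I • (s.map T).sum)) := by
  induction s with
  | nil => simp
  | cons p s ih =>
    have := tendsto_mul_slope (tendsto_exp_slope (T p)) ih
    simpa only [List.map_cons, List.prod_cons, List.sum_cons, smul_add, mul_one, one_mul]
      using this

theorem tendsto_linear_slope {E F : Type*} [AddCommGroup E] [Module ℂ E] [TopologicalSpace E]
    [AddCommGroup F] [Module ℂ F] [TopologicalSpace F] (L : E →ₗ[ℂ] F) (hL : Continuous L)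
    {f : ℝ → E} {x f' : E} (hf : Tendsto (fun ε : ℝ => ε⁻¹ • (f ε - x)) (𝓝[≠] 0) (𝓝 f')) :
    Tendsto (fun ε : ℝ => ε⁻¹ • (L (f ε) - L x)) (𝓝[≠] 0) (𝓝 (L f')) := by
  refine ((hL.tendsto f').comp hf).congr fun ε => ?_
  simp only [Function.comp_apply]
  rw [← map_sub]
  exact (L.restrictScalars ℝ).map_smul ε⁻¹ (f ε - x)

theorem twoLocalUnitary_mem {N ι : Type} [Fintype N] [DecidableEq N] {part : N → ι}
    {T : ι → ι → Matrix (N → Fin 2) (N → Fin 2) ℂ} (hT : IsTwoLocal part T) {s : List ι}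
    (hs : ∀ p ∈ pairs s, p.1 ≠ p.2) (ε : ℝ) :
    twoLocalUnitary s T ε ∈ unitaryGroup (N → Fin 2) ℂ := by
  refine Submonoid.list_prod_mem _ fun M hM => ?_
  obtain ⟨p, hp, rfl⟩ := List.mem_map.mp hM
  exact exp_mem_unitaryGroup (hT _ _ (hs p hp)).1 ε

theorem ne_of_mem_pairs {ι : Type} {s : List ι} (h : s.Nodup) : ∀ p ∈ pairs s, p.1 ≠ p.2 := by
  induction s with
  | nil => simp [pairs]
  | cons i s ih =>
    intro p hp
    rw [pairs, List.mem_append, List.mem_map] at hp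
    rw [List.nodup_cons] at h
    rcases hp with ⟨j, hj, rfl⟩ | hp
    · exact fun hc => h.1 ((show i = j from hc) ▸ hj)
    · exact ih h.2 p hp

end Exponentials

end SkewedCode

namespace SkewedCode

/-! ### Partial traces and unitarity of recoveries -/

section PartialTraces

variable {a b : Type} [Fintype a] [Fintype b]

omit [Fintype a] in
theorem traceSnd_conjTranspose (M : Matrix (a × b) (a × b) ℂ) : traceSnd Mᴴ = (traceSnd M)ᴴ := by
  ext i j
  simp [traceSnd]

omit [Fintype b] in
theorem traceFst_conjTranspose (M : Matrix (a × b) (a × b) ℂ) : traceFst Mᴴ = (traceFst M)ᴴ := by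
  ext i j
  simp [traceFst]

omit [Fintype a] in
theorem traceSnd_sub (M M' : Matrix (a × b) (a × b) ℂ) :
    traceSnd (M - M') = traceSnd M - traceSnd M' := by
  ext i j
  simp [traceSnd]

omit [Fintype b] in
theorem traceFst_sub (M M' : Matrix (a × b) (a × b) ℂ) :
    traceFst (M - M') = traceFst M - traceFst M' := by
  ext i j
  simp [traceFst]

omit [Fintype a] in
theorem traceSnd_smul (c : ℂ) (M : Matrix (a × b) (a × b) ℂ) :
    traceSnd (c • M) = c • traceSnd M := by
  ext i j
  simp [traceSnd, Finset.mul_sum]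

omit [Fintype a] in
theorem traceSnd_kronecker (h : Matrix a a ℂ) (g : Matrix b b ℂ) :
    traceSnd (h ⊗ₖ g) = trace g • h := by
  ext i j
  simp only [traceSnd, of_apply, kroneckerMap_apply, ← Finset.mul_sum, Matrix.smul_apply, trace,
    diag, smul_eq_mul]
  ring

omit [Fintype b] in
theorem traceFst_kronecker (h : Matrix a a ℂ) (g : Matrix b b ℂ) :
    traceFst (h ⊗ₖ g) = trace h • g := by
  ext i j
  simp only [traceFst, of_apply, kroneckerMap_apply, ← Finset.sum_mul, Matrix.smul_apply, trace,
    diag, smul_eq_mul]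

theorem card_bits (n : ℕ) : (Fintype.card (Bits n) : ℂ) = 2 ^ n := by
  simp

end PartialTraces

section Recovery

variable {n m : ℕ}

theorem Recovery.op_mul_conjTranspose (R : Recovery n m) : R.op * R.opᴴ = 1 := by
  have h1 : (R.1 : Matrix (Bits n × Bits m) (Bits n × Bits m) ℂ) * (R.1 : Matrix _ _ ℂ)ᴴ = 1 :=
    mem_unitaryGroup_iff.mp R.1.2
  have h2 : (R.2 : Matrix (Bits m) (Bits m) ℂ) * (R.2 : Matrix _ _ ℂ)ᴴ = 1 :=
    mem_unitaryGroup_iff.mp R.2.2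
  rw [Recovery.op, conjTranspose_kronecker, ← mul_kronecker_mul, h1, h2, one_kronecker_one]

theorem Recovery.conjTranspose_mul_op (R : Recovery n m) : R.opᴴ * R.op = 1 :=
  mul_eq_one_comm.mp R.op_mul_conjTranspose

end Recovery

/-! ### The gap operator and the lower bound on the magic -/

namespace SkewedStabilizerCode

variable {n m : ℕ} (C : SkewedStabilizerCode n m)

/-- The operator on `A₁ A₂` through which `W_R` acts on the exact code. -/
noncomputable def skewOp : Matrix (Bits n × Bits m) (Bits n × Bits m) ℂ :=
  opOf C.χ (C.WR * attach (n := n) C.χ)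

theorem WR_isHermitian : C.WR.IsHermitian := isHermitian_mul_mul_conjTranspose _ C.isHermitian_W

theorem attach_isometry : (attach (n := n) C.χ)ᴴ * attach (n := n) C.χ = 1 := by
  rw [conjTranspose_mul_eq C.flat_χ, opOf_attach C.flat_χ, conjTranspose_one, mul_one,
    ← one_kronecker_one, traceSnd_kronecker, trace_one, card_bits, smul_smul,
    inv_mul_cancel₀ (by positivity), one_smul]

theorem D_def : C.D = (Complex.I * (2 : ℂ) ^ m) •
    traceSnd (C.WR * (attach (n := n) C.χ * (attach (n := n) C.χ)ᴴ) -
      (attach (n := n) C.χ * (attach (n := n) C.χ)ᴴ) * C.WR) := rfl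

/-- The two orderings in the commutator give `skewOp` and, because `WR` is Hermitian, its adjoint.
-/
theorem D_eq : C.D = Complex.I • (C.skewOp - C.skewOpᴴ) := by
  have h1 := traceSnd_mul_conjTranspose C.flat_χ (C.WR * attach (n := n) C.χ) (attach (n := n) C.χ) 1
  have h2 := traceSnd_mul_conjTranspose C.flat_χ (attach (n := n) C.χ) (C.WR * attach (n := n) C.χ) 1
  rw [Matrix.mul_one, opOf_attach C.flat_χ, one_kronecker_one, conjTranspose_one, mul_one,
    mul_one] at h1
  rw [Matrix.mul_one, opOf_attach C.flat_χ, one_kronecker_one, one_mul, one_mul,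
    conjTranspose_mul, C.WR_isHermitian.eq, ← Matrix.mul_assoc] at h2
  rw [Matrix.mul_assoc] at h1
  rw [D_def, traceSnd_sub, h1, h2, ← smul_sub, smul_smul, mul_assoc,
    mul_inv_cancel₀ (by positivity), mul_one]
  rfl

theorem D_isHermitian : C.D.IsHermitian := by
  rw [IsHermitian, D_eq, conjTranspose_smul, conjTranspose_sub, conjTranspose_conjTranspose,
    Complex.star_def, Complex.conj_I, neg_smul, ← smul_neg, neg_sub]

/-- Up to 2^m, the partial trace of `skewOp` is the compression of `WR` to the exact code. That
compression is Hermitian, so nothing survives in the anti-Hermitian part. -/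
theorem traceSnd_D : traceSnd C.D = 0 := by
  have h := conjTranspose_mul_eq C.flat_χ (attach (n := n) C.χ) (C.WR * attach (n := n) C.χ)
  rw [opOf_attach C.flat_χ, conjTranspose_one, one_mul] at h
  change _ = _ • traceSnd C.skewOp at h
  have h2 : traceSnd C.skewOp = (2 : ℂ) ^ m • ((attach (n := n) C.χ)ᴴ * (C.WR * attach (n := n) C.χ)) := by
    rw [h, smul_smul, mul_inv_cancel₀ (by positivity), one_smul]
  have h3 : (traceSnd C.skewOp)ᴴ = traceSnd C.skewOp := by
    rw [h2, conjTranspose_smul, conjTranspose_mul, conjTranspose_mul, conjTranspose_conjTranspose,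
      C.WR_isHermitian.eq, Matrix.mul_assoc]
    simp
  rw [D_eq, traceSnd_smul, traceSnd_sub, traceSnd_conjTranspose, h3, sub_self, smul_zero]

theorem trace_D : trace C.D = 0 := by
  rw [← trace_traceSnd, traceSnd_D, trace_zero]

/-- The average of `D` over `A₁`. -/
noncomputable def meanD : Matrix (Bits m) (Bits m) ℂ := ((2 : ℂ) ^ n)⁻¹ • traceFst C.D

/-- The part of `D` that cannot be compensated by two-local generators. -/
noncomputable def gapOp : Matrix (Bits n × Bits m) (Bits n × Bits m) ℂ :=
  C.D - (1 : Matrix (Bits n) (Bits n) ℂ) ⊗ₖ C.meanD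

theorem meanD_isHermitian : C.meanD.IsHermitian := by
  rw [IsHermitian, meanD, conjTranspose_smul, ← traceFst_conjTranspose, C.D_isHermitian.eq]
  simp

theorem trace_meanD : trace C.meanD = 0 := by
  rw [meanD, trace_smul, trace_traceFst, trace_D, smul_zero]

theorem gapOp_isHermitian : C.gapOp.IsHermitian := by
  rw [IsHermitian, gapOp, conjTranspose_sub, conjTranspose_kronecker, conjTranspose_one,
    C.D_isHermitian.eq, C.meanD_isHermitian.eq]

theorem traceFst_gapOp : traceFst C.gapOp = 0 := by
  rw [gapOp, traceFst_sub, traceFst_kronecker, trace_one, card_bits, meanD, smul_smul,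
    mul_inv_cancel₀ (by positivity), one_smul, sub_self]

theorem traceSnd_gapOp : traceSnd C.gapOp = 0 := by
  rw [gapOp, traceSnd_sub, traceSnd_kronecker, trace_meanD, zero_smul, traceSnd_D, sub_self]

theorem trace_gapOp : trace C.gapOp = 0 := by
  rw [← trace_traceSnd, traceSnd_gapOp, trace_zero]

/-- `gapOp` is the orthogonal projection of `D` away from the operators 1 ⊗ g. -/
theorem trace_gapOp_mul_D : trace (C.gapOp * C.D) = hsSq C.gapOp := by
  rw [ofReal_hsSq, C.gapOp_isHermitian.eq]
  conv_rhs => enter [1, 2]; rw [gapOp]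
  rw [mul_sub, trace_sub, trace_mul_one_kronecker, traceFst_gapOp]
  simp

theorem hsSq_gapOp : hsSq C.gapOp = (trace (C.D * C.D)).re -
    1 / (2 : ℝ) ^ n * (trace (traceFst C.D * traceFst C.D)).re := by
  have h : (hsSq C.gapOp : ℂ) = trace (C.D * C.D) -
      ((1 / (2 : ℝ) ^ n : ℝ) : ℂ) * trace (traceFst C.D * traceFst C.D) := by
    rw [← trace_gapOp_mul_D, gapOp, sub_mul, trace_sub, trace_mul_comm (_ ⊗ₖ _),
      trace_mul_one_kronecker, meanD, Matrix.mul_smul, trace_smul]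
    push_cast
    rw [one_div, smul_eq_mul]
  have := congrArg Complex.re h
  rwa [Complex.ofReal_re, Complex.sub_re, Complex.re_ofReal_mul] at this

/-- The squared distance of the skewing from the two-local generators. -/
noncomputable def gap : ℝ := hsSq C.gapOp / (4 * (2 ^ n * 2 ^ m))

theorem gap_nonneg : 0 ≤ C.gap := div_nonneg (hsSq_nonneg _) (by positivity)

theorem one_lt_two_pow_sq (hn : 1 ≤ n) : (1 : ℝ) < ((2 : ℝ) ^ n) ^ 2 := by
  have : (1 : ℝ) < 2 ^ n := one_lt_pow₀ (by norm_num) (by omega)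
  nlinarith

theorem c₂_eq (hn : 1 ≤ n) : C.c₂ = 2 * C.gap * (1 - 1 / ((2 : ℝ) ^ n) ^ 2)⁻¹ := by
  have h1 := one_lt_two_pow_sq hn
  have h2 : ((2 : ℝ) ^ n) ^ 2 - 1 ≠ 0 := by linarith
  have h3 : (2 : ℝ) ^ n ≠ 0 := by positivity
  have h4 : (2 : ℝ) ^ m ≠ 0 := by positivity
  rw [c₂, ← hsSq_gapOp, gap]
  have h5 : 1 - 1 / ((2 : ℝ) ^ n) ^ 2 = (((2 : ℝ) ^ n) ^ 2 - 1) / ((2 : ℝ) ^ n) ^ 2 := by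
    field_simp
  rw [h5]
  field_simp
  ring

/-- The skewed encoding, followed by the recovery of the exact code. -/
noncomputable def recEnc (ε : ℝ) : Matrix (Phys n m) (Bits n) ℂ := C.rec₀.op * C.enc ε

theorem enc₀_eq : C.enc₀ = C.rec₀.opᴴ * attach (n := n) C.χ := by
  rw [← C.exact_recovery, ← Matrix.mul_assoc, C.rec₀.conjTranspose_mul_op, Matrix.one_mul]

theorem exp_W_isometry (ε : ℝ) :
    (NormedSpace.exp ((Complex.I * (ε : ℂ)) • C.W))ᴴ *
      NormedSpace.exp ((Complex.I * (ε : ℂ)) • C.W) = 1 :=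
  mem_unitaryGroup_iff'.mp (exp_mem_unitaryGroup C.isHermitian_W ε)

theorem enc_isometry (ε : ℝ) : (C.enc ε)ᴴ * C.enc ε = 1 := by
  rw [enc, conjTranspose_mul, Matrix.mul_assoc, ← Matrix.mul_assoc _ _ C.enc₀, exp_W_isometry,
    Matrix.one_mul, enc₀_eq, conjTranspose_mul, conjTranspose_conjTranspose, Matrix.mul_assoc,
    ← Matrix.mul_assoc C.rec₀.op, C.rec₀.op_mul_conjTranspose, Matrix.one_mul, attach_isometry]

theorem op_mul_enc_isometry (R : Recovery n m) (ε : ℝ) :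
    (R.op * C.enc ε)ᴴ * (R.op * C.enc ε) = 1 := by
  rw [conjTranspose_mul, Matrix.mul_assoc, ← Matrix.mul_assoc _ _ (C.enc ε),
    R.conjTranspose_mul_op, Matrix.one_mul, enc_isometry]

theorem tendsto_recEnc_slope :
    Tendsto (fun ε : ℝ => ε⁻¹ • (C.recEnc ε - attach (n := n) C.χ)) (𝓝[≠] 0)
      (𝓝 (Complex.I • (C.WR * attach (n := n) C.χ))) := by
  have h1 : Tendsto (fun _ : ℝ => C.enc₀) (𝓝[≠] 0) (𝓝 C.enc₀) := tendsto_const_nhds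
  have h2 : Tendsto (fun _ : ℝ => C.rec₀.op) (𝓝[≠] 0) (𝓝 C.rec₀.op) := tendsto_const_nhds
  have h3 := tendsto_matrix_mul h2 (tendsto_matrix_mul (tendsto_exp_slope C.W) h1)
  have h4 : C.rec₀.op * (Complex.I • C.W * C.enc₀) = Complex.I • (C.WR * attach (n := n) C.χ) := by
    rw [Matrix.smul_mul, Matrix.mul_smul, WR, enc₀_eq]
    simp only [Matrix.mul_assoc]
  rw [h4] at h3
  refine h3.congr fun ε => ?_
  rw [Matrix.smul_mul, Matrix.mul_smul, Matrix.sub_mul, Matrix.mul_sub, Matrix.one_mul,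
    C.exact_recovery]
  rfl

theorem choiState_eq (ε : ℝ) : C.choiState ε = choi (C.recEnc ε) := rfl

theorem choi_dotProduct_self {V : Matrix (Phys n m) (Bits n) ℂ} (hV : Vᴴ * V = 1) :
    star (choi V) ⬝ᵥ choi V = 1 := by
  rw [choi_dotProduct, hV, trace_one, card_bits, inv_mul_cancel₀ (by positivity)]

/-- The first-order change of the Choi state under the skewing and two-local generators `T`. -/
noncomputable def choiVelocity (s : List Party)
    (T : Party → Party → Matrix (Qubits n m → Fin 2) (Qubits n m → Fin 2) ℂ) :
    (Qubits n m → Fin 2) → ℂ :=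
  Complex.I • (((pairs s).map fun p => T p.1 p.2).sum *ᵥ choi (attach (n := n) C.χ) +
    choi (C.WR * attach (n := n) C.χ))

theorem tendsto_mulVec {k : Type} [Fintype k] {X : Type*} {F : Filter X} {f : X → Matrix k k ℂ}
    {g : X → k → ℂ} {x : Matrix k k ℂ} {y : k → ℂ} (hf : Tendsto f F (𝓝 x))
    (hg : Tendsto g F (𝓝 y)) : Tendsto (fun t => f t *ᵥ g t) F (𝓝 (x *ᵥ y)) := by
  refine tendsto_pi_nhds.mpr fun i => ?_
  simp only [mulVec, dotProduct]
  refine tendsto_finsetSum _ fun a _ => ?_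
  exact (((continuous_apply_apply i a).tendsto x).comp hf).mul
    (((continuous_apply a).tendsto y).comp hg)

theorem tendsto_choi_slope (s : List Party)
    (T : Party → Party → Matrix (Qubits n m → Fin 2) (Qubits n m → Fin 2) ℂ) :
    Tendsto (fun ε : ℝ => ε⁻¹ • (twoLocalUnitary s T ε *ᵥ C.choiState ε - choi (attach (n := n) C.χ)))
      (𝓝[≠] 0) (𝓝 (C.choiVelocity s T)) := by
  have hc : Continuous (choiₗ (n := n) (m := m)) := LinearMap.continuous_of_finiteDimensional _
  have h1 : Tendsto (fun ε : ℝ => ε⁻¹ • (C.choiState ε - choi (attach (n := n) C.χ))) (𝓝[≠] 0)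
      (𝓝 (Complex.I • choi (C.WR * attach (n := n) C.χ))) := by
    have := tendsto_linear_slope choiₗ hc C.tendsto_recEnc_slope
    rw [map_smul] at this
    exact this
  have h2 := tendsto_list_prod_slope (pairs s) (fun p => T p.1 p.2)
  have h3 := (tendsto_mulVec h2 (tendsto_of_slope h1)).add h1
  have h4 : (Complex.I • ((pairs s).map fun p => T p.1 p.2).sum) *ᵥ choi (attach (n := n) C.χ) +
      Complex.I • choi (C.WR * attach (n := n) C.χ) = C.choiVelocity s T := by
    rw [choiVelocity, smul_add, smul_mulVec]
  rw [h4] at h3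
  refine h3.congr fun ε => ?_
  rw [smul_mulVec, ← smul_add, sub_mulVec, one_mulVec, sub_add_sub_cancel]
  rfl

theorem nodup_of_perm {L s : List Party} (hL : L = [.A₁, .A₂, .Abar] ∨ L = [.r, .A₁, .A₂, .Abar])
    (hs : s.Perm L) : s.Nodup := by
  rw [hs.nodup_iff]
  rcases hL with rfl | rfl <;> simp

/-- The leading coefficient of the magic for given two-local generators. -/
noncomputable def velocityVariance (s : List Party)
    (T : Party → Party → Matrix (Qubits n m → Fin 2) (Qubits n m → Fin 2) ℂ) : ℝ :=
  (star (C.choiVelocity s T) ⬝ᵥ C.choiVelocity s T).re -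
    Complex.normSq (star (choi (attach (n := n) C.χ)) ⬝ᵥ C.choiVelocity s T)

theorem tendsto_scaledMagic {α : ℝ} (hα : 1 < α) {s : List Party} (hs : s.Nodup)
    {T : Party → Party → Matrix (Qubits n m → Fin 2) (Qubits n m → Fin 2) ℂ}
    (hT : IsTwoLocal (party n m) T) :
    Tendsto (scaledMagic α s T C.choiState) (𝓝[≠] 0)
      (𝓝 (2 * α / (α - 1) * C.velocityVariance s T)) := by
  refine tendsto_stabilizerRenyi hα (choi_dotProduct_self C.attach_isometry)
    (hasIntegralPauliSpectrum_choi_attach C.isStabilizer_χ) (fun ε => ?_) (C.tendsto_choi_slope s T)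
  have hU : (twoLocalUnitary s T ε)ᴴ * twoLocalUnitary s T ε = 1 :=
    mem_unitaryGroup_iff'.mp (twoLocalUnitary_mem hT (ne_of_mem_pairs hs) ε)
  rw [star_mulVec, ← dotProduct_mulVec, mulVec_mulVec, hU, one_mulVec, choiState_eq]
  exact choi_dotProduct_self (C.op_mul_enc_isometry C.rec₀ ε)

/-- The component of the velocity along the Choi state of the exact code is a multiple of the
identity in the operator picture; removing it leaves the variance. -/
theorem velocityVariance_eq (s : List Party)
    (T : Party → Party → Matrix (Qubits n m → Fin 2) (Qubits n m → Fin 2) ℂ) :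
    C.velocityVariance s T = hsSq (vecOp C.χ (C.choiVelocity s T) -
      (star (choi (attach (n := n) C.χ)) ⬝ᵥ C.choiVelocity s T) • 1) / (2 ^ n * 2 ^ m) := by
  set φ := C.choiVelocity s T
  set S := choi (attach (n := n) C.χ) with hS
  set c := star S ⬝ᵥ φ with hc
  have hS1 : vecOp C.χ S = 1 := by rw [hS, vecOp_choi, opOf_attach C.flat_χ]
  have h1 : star (φ - c • S) ⬝ᵥ (φ - c • S) = ((2 : ℂ) ^ n * 2 ^ m)⁻¹ *
      (hsSq (vecOp C.χ φ - c • 1) : ℂ) := by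
    rw [dotProduct_eq_vecOp C.flat_χ, map_sub, map_smul, hS1, ofReal_hsSq]
  have h2 : star (φ - c • S) ⬝ᵥ (φ - c • S) = star φ ⬝ᵥ φ - (Complex.normSq c : ℂ) := by
    have h3 : star φ ⬝ᵥ S = star c := by
      rw [hc, star_dotProduct]
    have h4 : star S ⬝ᵥ S = 1 := choi_dotProduct_self C.attach_isometry
    rw [star_sub, star_smul, sub_dotProduct, dotProduct_sub, dotProduct_sub, smul_dotProduct,
      smul_dotProduct, dotProduct_smul, dotProduct_smul, h3, h4, ← hc, ← Complex.mul_conj]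
    simp only [smul_eq_mul, Complex.star_def]
    ring
  have h5 := congrArg Complex.re (h2.symm.trans h1)
  rw [Complex.sub_re, Complex.ofReal_re] at h5
  have h6 : ((2 : ℂ) ^ n * 2 ^ m)⁻¹ = ((((2 : ℝ) ^ n * 2 ^ m)⁻¹ : ℝ) : ℂ) := by push_cast; rfl
  rw [h6, Complex.re_ofReal_mul, Complex.ofReal_re] at h5
  rw [velocityVariance, h5]
  ring

theorem im_trace_gapOp_mul_sum {s : List Party} (hs : s.Nodup)
    {T : Party → Party → Matrix (Qubits n m → Fin 2) (Qubits n m → Fin 2) ℂ}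
    (hT : IsTwoLocal (party n m) T) :
    (trace (C.gapOp * vecOp C.χ (((pairs s).map fun p => T p.1 p.2).sum *ᵥ
      choi (attach (n := n) C.χ)))).im = 0 := by
  have hne := ne_of_mem_pairs hs
  generalize pairs s = l at hne ⊢
  induction l with
  | nil => simp
  | cons p t ih =>
    rw [List.map_cons, List.sum_cons, add_mulVec, map_add, mul_add, trace_add, Complex.add_im,
      ih fun q hq => hne q (List.mem_cons_of_mem _ hq), add_zero]
    have hp := hne p List.mem_cons_self
    exact im_trace_mul_vecOp C.flat_χ C.gapOp_isHermitian C.traceFst_gapOp C.traceSnd_gapOp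
      (hT _ _ hp).1 hp (hT _ _ hp).2

/-- Pair the velocity with `gapOp`. The two-local generators drop out and only the anti-Hermitian
part of `skewOp` contributes, so the real part is ‖N‖²/2 whatever the generators; Cauchy-Schwarz
then gives ‖Z‖² ≥ ‖N‖²/4. -/
theorem gap_le_velocityVariance {s : List Party} (hs : s.Nodup)
    {T : Party → Party → Matrix (Qubits n m → Fin 2) (Qubits n m → Fin 2) ℂ}
    (hT : IsTwoLocal (party n m) T) : C.gap ≤ C.velocityVariance s T := by
  rw [velocityVariance_eq, gap, div_le_div_iff₀ (by positivity) (by positivity)]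
  set c := star (choi (attach (n := n) C.χ)) ⬝ᵥ C.choiVelocity s T
  set Z := vecOp C.χ (C.choiVelocity s T) - c • 1 with hZ
  have h1 : (trace (C.gapOpᴴ * Z)).re = hsSq C.gapOp / 2 := by
    have hD : trace (C.gapOp * C.D) = Complex.I * (trace (C.gapOp * C.skewOp) -
        star (trace (C.gapOp * C.skewOp))) := by
      rw [D_eq, Matrix.mul_smul, trace_smul, mul_sub, trace_sub, ← trace_conjTranspose,
        conjTranspose_mul, C.gapOp_isHermitian.eq, trace_mul_comm C.skewOpᴴ, smul_eq_mul]
    have hD2 := congrArg Complex.re (C.trace_gapOp_mul_D.symm.trans hD)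
    rw [Complex.ofReal_re] at hD2
    simp at hD2
    rw [C.gapOp_isHermitian.eq, hZ, choiVelocity, mul_sub, trace_sub, Matrix.mul_smul, trace_smul, mul_one,
      C.trace_gapOp, smul_zero, sub_zero, map_smul, Matrix.mul_smul, trace_smul, map_add, mul_add,
      trace_add, vecOp_choi]
    change (Complex.I • (_ + trace (C.gapOp * C.skewOp))).re = _
    simp only [smul_eq_mul, Complex.mul_re, Complex.I_re, Complex.I_im, zero_mul, one_mul,
      Complex.add_im, C.im_trace_gapOp_mul_sum hs hT]
    rw [hD2]
    ring
  have h2 := sq_re_trace_le C.gapOp Z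
  rw [h1] at h2
  rcases (hsSq_nonneg C.gapOp).eq_or_lt with h0 | h0
  · rw [← h0, zero_mul]
    have := hsSq_nonneg Z
    positivity
  · have h3 : hsSq C.gapOp / 4 ≤ hsSq Z := by
      by_contra hc
      push Not at hc
      nlinarith
    have h4 : (0 : ℝ) < 2 ^ n * 2 ^ m := by positivity
    nlinarith

end SkewedStabilizerCode

end SkewedCode

namespace SkewedCode

/-! ### Lifting generators to the Choi system -/

section Lifts

variable {n m : ℕ}

/-- The part of a basis state of the Choi system on the physical space. -/
def physBits (x : Qubits n m → Fin 2) : Phys n m :=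
  ((fun k => x (.inr (.inl k)), fun k => x (.inr (.inr (.inl k)))),
    fun k => x (.inr (.inr (.inr k))))

/-- An operator on the physical space, acting on the Choi system. -/
def liftPhys (Q : Matrix (Phys n m) (Phys n m) ℂ) :
    Matrix (Qubits n m → Fin 2) (Qubits n m → Fin 2) ℂ :=
  Matrix.of fun x y => if (fun k => x (.inl k)) = (fun k => y (.inl k)) then
    Q (physBits x) (physBits y) else 0

theorem liftPhys_mulVec_choi (Q : Matrix (Phys n m) (Phys n m) ℂ)
    (V : Matrix (Phys n m) (Bits n) ℂ) : liftPhys Q *ᵥ choi V = choi (Q * V) := by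
  ext x
  rw [eq_joinBits x]
  generalize (fun k => x (.inl k)) = r
  generalize (fun k => x (.inr (.inl k))) = i
  generalize (fun k => x (.inr (.inr (.inl k)))) = a
  generalize (fun k => x (.inr (.inr (.inr k)))) = b
  rw [choi_joinBits, mulVec, dotProduct, sum_joinBits]
  simp only [choi_joinBits]
  have h : ∀ r' i' a' b', liftPhys Q (joinBits r i a b) (joinBits r' i' a' b') =
      if r = r' then Q ((i, a), b) ((i', a'), b') else 0 := fun _ _ _ _ => rfl
  simp only [h, ite_mul, zero_mul, Finset.sum_ite_irrel, Finset.sum_const_zero,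
    Finset.sum_ite_eq, Finset.mem_univ, if_true, mul_apply, Fintype.sum_prod_type, Finset.mul_sum]
  refine Finset.sum_congr rfl fun _ _ => Finset.sum_congr rfl fun _ _ =>
    Finset.sum_congr rfl fun _ _ => ?_
  ring

theorem liftPhys_isHermitian {Q : Matrix (Phys n m) (Phys n m) ℂ} (hQ : Q.IsHermitian) :
    (liftPhys Q).IsHermitian := by
  ext x y
  simp only [conjTranspose_apply, liftPhys, of_apply]
  rw [apply_ite star, hQ.apply, star_zero]
  simp only [eq_comm]

theorem supportedOn_liftPhys_A₁A₂ (H : Matrix (Bits n × Bits m) (Bits n × Bits m) ℂ) :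
    SupportedOn {q | party n m q = .A₁ ∨ party n m q = .A₂}
      (liftPhys (H ⊗ₖ (1 : Matrix (Bits m) (Bits m) ℂ))) := by
  refine ⟨fun u v => H (fun k => u ⟨.inr (.inl k), .inl rfl⟩,
      fun k => u ⟨.inr (.inr (.inl k)), .inr rfl⟩) (fun k => v ⟨.inr (.inl k), .inl rfl⟩,
      fun k => v ⟨.inr (.inr (.inl k)), .inr rfl⟩), fun x y => ⟨fun h => ?_, fun h => ?_⟩⟩
  · have h1 : (fun k => x (.inl k)) = fun k => y (.inl k) :=
      funext fun k => h (.inl k) (by simp [party])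
    have h2 : (physBits x).2 = (physBits y).2 :=
      funext fun k => h (.inr (.inr (.inr k))) (by simp [party])
    rw [liftPhys, of_apply, if_pos h1, kroneckerMap_apply, h2, one_apply_eq, mul_one]
    rfl
  · rw [liftPhys, of_apply]
    split_ifs with h1
    · rw [kroneckerMap_apply, one_apply_ne, mul_zero]
      intro h2
      refine h ?_
      rintro (q | q | q | q) hq
      · exact congrFun h1 q
      · simp [party] at hq
      · simp [party] at hq
      · exact congrFun h2 q
    · rfl

/-- An operator on `A₂ Ā`, acting on the physical space. -/
def liftBath (G : Matrix (Bits m × Bits m) (Bits m × Bits m) ℂ) :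
    Matrix (Phys n m) (Phys n m) ℂ :=
  Matrix.of fun p q => if p.1.1 = q.1.1 then G (p.1.2, p.2) (q.1.2, q.2) else 0

theorem liftBath_isHermitian {G : Matrix (Bits m × Bits m) (Bits m × Bits m) ℂ}
    (hG : G.IsHermitian) : (liftBath (n := n) G).IsHermitian := by
  ext x y
  simp only [conjTranspose_apply, liftBath, of_apply]
  rw [apply_ite star, hG.apply, star_zero]
  simp only [eq_comm]

theorem liftBath_mul_attach (G : Matrix (Bits m × Bits m) (Bits m × Bits m) ℂ)
    (χ : Bits m × Bits m → ℂ) : liftBath (n := n) G * attach (n := n) χ = attach (n := n) (G *ᵥ χ) := by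
  ext p i
  simp only [mul_apply, liftBath, attach, of_apply, Fintype.sum_prod_type, ite_mul, zero_mul,
    mul_ite, mul_zero, Finset.sum_ite_irrel, Finset.sum_const_zero,
    Finset.sum_ite_eq', Finset.mem_univ, if_true, mulVec, dotProduct]

theorem supportedOn_liftPhys_A₂Abar (G : Matrix (Bits m × Bits m) (Bits m × Bits m) ℂ) :
    SupportedOn {q | party n m q = .A₂ ∨ party n m q = .Abar}
      (liftPhys (liftBath (n := n) G)) := by
  refine ⟨fun u v => G (fun k => u ⟨.inr (.inr (.inl k)), .inl rfl⟩,
      fun k => u ⟨.inr (.inr (.inr k)), .inr rfl⟩) (fun k => v ⟨.inr (.inr (.inl k)), .inl rfl⟩,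
      fun k => v ⟨.inr (.inr (.inr k)), .inr rfl⟩), fun x y => ⟨fun h => ?_, fun h => ?_⟩⟩
  · have h1 : (fun k => x (.inl k)) = fun k => y (.inl k) :=
      funext fun k => h (.inl k) (by simp [party])
    have h2 : (physBits x).1.1 = (physBits y).1.1 :=
      funext fun k => h (.inr (.inl k)) (by simp [party])
    rw [liftPhys, of_apply, if_pos h1, liftBath, of_apply, if_pos h2]
    rfl
  · rw [liftPhys, of_apply]
    split_ifs with h1
    · rw [liftBath, of_apply, if_neg]
      intro h2
      refine h ?_
      rintro (q | q | q | q) hq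
      · exact congrFun h1 q
      · exact congrFun h2 q
      · simp [party] at hq
      · simp [party] at hq
    · rfl

end Lifts

/-! ### Optimal two-local generators -/

namespace SkewedStabilizerCode

variable {n m : ℕ} (C : SkewedStabilizerCode n m)

/-- The Hermitian part of the skewing, as seen on `A₁ A₂`. -/
noncomputable def hermSkew : Matrix (Bits n × Bits m) (Bits n × Bits m) ℂ :=
  (2 : ℂ)⁻¹ • (C.skewOp + C.skewOpᴴ)

theorem hermSkew_isHermitian : C.hermSkew.IsHermitian := by
  rw [IsHermitian, hermSkew, conjTranspose_smul, conjTranspose_add, conjTranspose_conjTranspose,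
    add_comm]
  simp

theorem skewOp_sub_hermSkew : Complex.I • (C.skewOp - C.hermSkew) = (2 : ℂ)⁻¹ • C.D := by
  rw [hermSkew, D_eq]
  module

/-- The vector `(i / 2) (meanD ⊗ 1) χ`. -/
noncomputable def bathVec : Bits m × Bits m → ℂ := fun p =>
  (Complex.I / 2) * ∑ a', C.meanD p.1 a' * C.χ (a', p.2)

theorem opOf_attach_bathVec : opOf C.χ (attach (n := n) C.bathVec) =
    (Complex.I / 2) • ((1 : Matrix (Bits n) (Bits n) ℂ) ⊗ₖ C.meanD) := by
  rw [opOf_attach_eq, ← kronecker_smul]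
  congr 1
  ext a a'
  simp only [bathVec, of_apply, mul_assoc, ← Finset.mul_sum, Finset.sum_mul, Matrix.smul_apply]
  rw [Finset.sum_comm]
  simp only [← Finset.mul_sum, flat_fst C.flat_χ, mul_ite, mul_zero, Finset.sum_ite_eq',
    Finset.mem_univ, if_true, smul_eq_mul]
  have h2 : (2 : ℂ) ^ m ≠ 0 := by positivity
  field_simp

theorem star_χ_dotProduct_χ : star C.χ ⬝ᵥ C.χ = 1 := by
  have h := congrArg trace C.flat_χ
  rw [trace_traceSnd, trace_vecMulVec, trace_smul, trace_one, card_bits, smul_eq_mul,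
    inv_mul_cancel₀ (by positivity)] at h
  rw [dotProduct_comm]
  exact h

/-- This is tracelessness of `meanD`. Orthogonality makes it possible for a Hermitian generator to
send χ to `bathVec`. -/
theorem star_bathVec_dotProduct_χ : star C.bathVec ⬝ᵥ C.χ = 0 := by
  have h : star C.χ ⬝ᵥ C.bathVec = 0 := by
    simp only [dotProduct, bathVec, Fintype.sum_prod_type, Pi.star_apply, Finset.mul_sum]
    have h1 : ∀ a, ∑ y, ∑ a', star (C.χ (a, y)) * (Complex.I / 2 * (C.meanD a a' * C.χ (a', y))) =
        Complex.I / 2 * ((2 : ℂ) ^ m)⁻¹ * C.meanD a a := by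
      intro a
      rw [Finset.sum_comm]
      have h2 : ∀ a', ∑ y, star (C.χ (a, y)) * (Complex.I / 2 * (C.meanD a a' * C.χ (a', y))) =
          Complex.I / 2 * C.meanD a a' * if a' = a then ((2 : ℂ) ^ m)⁻¹ else 0 := by
        intro a'
        rw [← flat_fst C.flat_χ, Finset.mul_sum]
        exact Finset.sum_congr rfl fun y _ => by ring
      simp only [h2, mul_ite, mul_zero, Finset.sum_ite_eq', Finset.mem_univ, if_true]
      ring
    simp only [h1]
    rw [← Finset.mul_sum]
    have := C.trace_meanD
    rw [trace] at this
    simp only [diag] at this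
    rw [this, mul_zero]
  rw [star_dotProduct, h, star_zero]

/-- The generator on `A₂ Ā` of the optimal two-local unitary. -/
noncomputable def bathGen : Matrix (Bits m × Bits m) (Bits m × Bits m) ℂ :=
  vecMulVec C.bathVec (star C.χ) + vecMulVec C.χ (star C.bathVec)

theorem bathGen_isHermitian : C.bathGen.IsHermitian := by
  rw [IsHermitian, bathGen, conjTranspose_add, conjTranspose_vecMulVec, conjTranspose_vecMulVec,
    star_star, star_star, add_comm]

theorem bathGen_mulVec_χ : C.bathGen *ᵥ C.χ = C.bathVec := by
  rw [bathGen, add_mulVec, vecMulVec_mulVec, vecMulVec_mulVec, star_χ_dotProduct_χ,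
    star_bathVec_dotProduct_χ]
  ext p
  simp

/-- The generators of the optimal two-local unitary. -/
noncomputable def optGen :
    Party → Party → Matrix (Qubits n m → Fin 2) (Qubits n m → Fin 2) ℂ
  | .A₁, .A₂ => liftPhys ((-C.hermSkew) ⊗ₖ (1 : Matrix (Bits m) (Bits m) ℂ))
  | .A₂, .Abar => liftPhys (liftBath C.bathGen)
  | _, _ => 0

theorem supportedOn_zero {N : Type} (S : Set N) :
    SupportedOn S (0 : Matrix (N → Fin 2) (N → Fin 2) ℂ) :=
  ⟨0, fun _ _ => ⟨fun _ => rfl, fun _ => rfl⟩⟩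

theorem isTwoLocal_optGen : IsTwoLocal (party n m) C.optGen := by
  have h12 : (C.optGen .A₁ .A₂).IsHermitian ∧
      SupportedOn {q | party n m q = .A₁ ∨ party n m q = .A₂} (C.optGen .A₁ .A₂) := by
    refine ⟨liftPhys_isHermitian ?_, supportedOn_liftPhys_A₁A₂ _⟩
    rw [IsHermitian, conjTranspose_kronecker, conjTranspose_one, conjTranspose_neg,
      C.hermSkew_isHermitian.eq]
  have h23 : (C.optGen .A₂ .Abar).IsHermitian ∧
      SupportedOn {q | party n m q = .A₂ ∨ party n m q = .Abar} (C.optGen .A₂ .Abar) :=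
    ⟨liftPhys_isHermitian (liftBath_isHermitian C.bathGen_isHermitian),
      supportedOn_liftPhys_A₂Abar _⟩
  intro i j hij
  cases i <;> cases j <;> first
    | exact h12
    | exact h23
    | exact ⟨isHermitian_zero, supportedOn_zero _⟩

/-- Cancelling the Hermitian part of `skewOp` leaves D/2, and the generator on A₂Ā adds i · (i/2) (1
⊗ `meanD`), which subtracts the mean. Both lists contain the two pairs used, in the order in which
`optGen` is nonzero. -/
theorem vecOp_choiVelocity_optGen {L : List Party}
    (hL : L = [.A₁, .A₂, .Abar] ∨ L = [.r, .A₁, .A₂, .Abar]) :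
    vecOp C.χ (C.choiVelocity L C.optGen) = (2 : ℂ)⁻¹ • C.gapOp := by
  have h1 : ((pairs L).map fun p => C.optGen p.1 p.2).sum =
      liftPhys ((-C.hermSkew) ⊗ₖ (1 : Matrix (Bits m) (Bits m) ℂ)) +
        liftPhys (liftBath C.bathGen) := by
    rcases hL with rfl | rfl <;> simp [pairs, optGen]
  rw [choiVelocity, h1, add_mulVec, liftPhys_mulVec_choi, liftPhys_mulVec_choi,
    liftBath_mul_attach, bathGen_mulVec_χ, map_smul, map_add, map_add, vecOp_choi, vecOp_choi,
    vecOp_choi, opOf_kronecker_one_mul, opOf_attach C.flat_χ, mul_one, opOf_attach_bathVec]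
  change Complex.I • (_ + C.skewOp) = _
  have h2 := C.skewOp_sub_hermSkew
  have h3 : Complex.I • (-C.hermSkew + (Complex.I / 2) • (1 : Matrix (Bits n) (Bits n) ℂ) ⊗ₖ C.meanD
      + C.skewOp) = Complex.I • (C.skewOp - C.hermSkew) +
      (Complex.I * (Complex.I / 2)) • (1 : Matrix (Bits n) (Bits n) ℂ) ⊗ₖ C.meanD := by module
  have h4 : Complex.I * (Complex.I / 2) = -(2 : ℂ)⁻¹ := by
    rw [← mul_div_assoc, Complex.I_mul_I, neg_div, one_div]
  rw [h3, h2, h4, gapOp]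
  module

theorem velocityVariance_optGen {L : List Party}
    (hL : L = [.A₁, .A₂, .Abar] ∨ L = [.r, .A₁, .A₂, .Abar]) :
    C.velocityVariance L C.optGen = C.gap := by
  have h0 : star (choi (attach (n := n) C.χ)) ⬝ᵥ C.choiVelocity L C.optGen = 0 := by
    rw [dotProduct_eq_vecOp C.flat_χ, vecOp_choi, opOf_attach C.flat_χ, conjTranspose_one, one_mul,
      vecOp_choiVelocity_optGen C hL, trace_smul, trace_gapOp, smul_zero, mul_zero]
  rw [velocityVariance_eq, h0, zero_smul, sub_zero, vecOp_choiVelocity_optGen C hL, hsSq_smul, gap]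
  have : Complex.normSq (2 : ℂ)⁻¹ = 1 / 4 := by
    rw [map_inv₀, Complex.normSq_ofNat]
    norm_num
  rw [this]
  field_simp

theorem isLeast_magicCoeffs {α : ℝ} (hα : 1 < α) {L : List Party}
    (hL : L = [.A₁, .A₂, .Abar] ∨ L = [.r, .A₁, .A₂, .Abar]) :
    IsLeast (magicCoeffs α (party n m) L C.choiState) (2 * α / (α - 1) * C.gap) := by
  constructor
  · refine ⟨L, C.optGen, List.Perm.refl _, C.isTwoLocal_optGen, ?_⟩
    rw [← C.velocityVariance_optGen hL]
    exact C.tendsto_scaledMagic hα (nodup_of_perm hL (List.Perm.refl _)) C.isTwoLocal_optGen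
  · rintro c ⟨s, T, hs, hT, hc⟩
    have hs' := nodup_of_perm hL hs
    rw [tendsto_nhds_unique hc (C.tendsto_scaledMagic hα hs' hT)]
    have : 0 < α - 1 := by linarith
    exact mul_le_mul_of_nonneg_left (C.gap_le_velocityVariance hs' hT) (by positivity)

theorem nonlocalMagicCoeff_eq {α : ℝ} (hα : 1 < α) {L : List Party}
    (hL : L = [.A₁, .A₂, .Abar] ∨ L = [.r, .A₁, .A₂, .Abar]) :
    nonlocalMagicCoeff α (party n m) L C.choiState = 2 * α / (α - 1) * C.gap :=
  (C.isLeast_magicCoeffs hα hL).csInf_eq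

end SkewedStabilizerCode

end SkewedCode

namespace SkewedCode

/-! ### Entanglement infidelity as a distance to product vectors -/

section HilbertSchmidt

variable {k l o : Type} [Fintype k] [Fintype l] [Fintype o]

theorem hsSq_conjTranspose (A : Matrix k l ℂ) : hsSq Aᴴ = hsSq A := by
  rw [hsSq, hsSq, Finset.sum_comm]
  simp [conjTranspose_apply, Complex.normSq_conj]

theorem hsSq_mul_le (A : Matrix k l ℂ) (B : Matrix l o ℂ) : hsSq (A * B) ≤ hsSq A * hsSq B := by
  have h : ∀ i j, Complex.normSq ((A * B) i j) ≤
      (∑ a, Complex.normSq (A i a)) * ∑ a, Complex.normSq (B a j) := by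
    intro i j
    simp only [Complex.normSq_eq_norm_sq, mul_apply]
    calc ‖∑ a, A i a * B a j‖ ^ 2 ≤ (∑ a, ‖A i a‖ * ‖B a j‖) ^ 2 := by
          gcongr
          refine (norm_sum_le _ _).trans (Finset.sum_le_sum fun a _ => ?_)
          rw [norm_mul]
      _ ≤ _ := Finset.sum_mul_sq_le_sq_mul_sq _ _ _
  calc hsSq (A * B) ≤ ∑ i, ∑ j, (∑ a, Complex.normSq (A i a)) * ∑ a, Complex.normSq (B a j) :=
        Finset.sum_le_sum fun i _ => Finset.sum_le_sum fun j _ => h i j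
    _ = hsSq A * hsSq B := by
        simp only [hsSq]
        rw [Finset.sum_comm (γ := l) (f := fun a j => Complex.normSq (B a j)), Finset.sum_mul_sum]

theorem hsSq_sub_smul_one [DecidableEq k] (A : Matrix k k ℂ) (z : ℂ) :
    hsSq (A - z • 1) = hsSq A - 2 * (star z * trace A).re + Fintype.card k * Complex.normSq z := by
  have h : (hsSq (A - z • 1) : ℂ) = hsSq A - (star z * trace A + star (star z * trace A)) +
      Fintype.card k * (Complex.normSq z : ℂ) := by
    rw [ofReal_hsSq, ofReal_hsSq, conjTranspose_sub, conjTranspose_smul, conjTranspose_one, sub_mul,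
      mul_sub, mul_sub, Matrix.mul_smul, Matrix.mul_smul, Matrix.smul_mul, Matrix.smul_mul,
      Matrix.mul_one, Matrix.one_mul, Matrix.mul_one, trace_sub, trace_sub, trace_sub, trace_smul,
      trace_smul, trace_smul, trace_smul, trace_conjTranspose, trace_one, ← Complex.mul_conj]
    simp only [smul_eq_mul, star_mul', Complex.star_def, Complex.conj_conj]
    ring
  have h2 := congrArg Complex.re h
  simp only [Complex.ofReal_re, Complex.add_re, Complex.sub_re, Complex.star_def,
    Complex.conj_re] at h2
  rw [h2]
  have : ((Fintype.card k : ℂ) * (Complex.normSq z : ℂ)).re = Fintype.card k * Complex.normSq z := by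
    rw [← Complex.ofReal_natCast, Complex.re_ofReal_mul, Complex.ofReal_re]
  rw [this, Complex.star_def]
  ring

end HilbertSchmidt

section Fidelity

variable {n m : ℕ}

/-- The Kraus operator of the channel to `A₁` that belongs to the basis state `q` of `A₂ Ā`. -/
def block (Y : Matrix (Phys n m) (Bits n) ℂ) (q : Bits m × Bits m) : Matrix (Bits n) (Bits n) ℂ :=
  Matrix.of fun i j => Y ((i, q.1), q.2) j

/-- The normalized traces of the Kraus operators of the channel to `A₁`. -/
noncomputable def meanBlock (Y : Matrix (Phys n m) (Bits n) ℂ) : Bits m × Bits m → ℂ :=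
  fun q => ((2 : ℂ) ^ n)⁻¹ * trace (block Y q)

/-- The entanglement fidelity of the channel to `A₁`. -/
noncomputable def fid (Y : Matrix (Phys n m) (Bits n) ℂ) : ℝ :=
  ∑ q, Complex.normSq (meanBlock Y q)

theorem hsSq_eq_sum_block (Y : Matrix (Phys n m) (Bits n) ℂ) : hsSq Y = ∑ q, hsSq (block Y q) := by
  simp only [hsSq, Fintype.sum_prod_type, block, of_apply]
  rw [Finset.sum_comm]
  refine Finset.sum_congr rfl fun a _ => ?_
  rw [Finset.sum_comm]

theorem block_attach (z : Bits m × Bits m → ℂ) (q : Bits m × Bits m) :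
    block (attach (n := n) z) q = z q • 1 := by
  ext i j
  simp [block, attach, one_apply]

/-- Pythagoras in each block: `meanBlock` gives the orthogonal projection of Y onto the encodings
`attach z`. For an isometry, 1 − `fid` is therefore the normalized squared distance to this
subspace. -/
theorem hsSq_sub_attach (Y : Matrix (Phys n m) (Bits n) ℂ) (z : Bits m × Bits m → ℂ) :
    hsSq (Y - attach (n := n) z) = hsSq Y - 2 ^ n * fid Y +
      2 ^ n * ∑ q, Complex.normSq (meanBlock Y q - z q) := by
  rw [hsSq_eq_sum_block, hsSq_eq_sum_block Y, fid, Finset.mul_sum, Finset.mul_sum,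
    ← Finset.sum_sub_distrib, ← Finset.sum_add_distrib]
  refine Finset.sum_congr rfl fun q _ => ?_
  have h1 : block (Y - attach (n := n) z) q = block Y q - z q • 1 := by
    rw [← block_attach]
    rfl
  have h2 : trace (block Y q) = (2 : ℂ) ^ n * meanBlock Y q := by
    rw [meanBlock, mul_inv_cancel_left₀ (by positivity)]
  have h3 : ((Fintype.card (Bits n) : ℕ) : ℝ) = 2 ^ n := by simp
  rw [h1, hsSq_sub_smul_one, h2, h3, Complex.normSq_sub]
  have h4 : (star (z q) * ((2 : ℂ) ^ n * meanBlock Y q)).re =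
      2 ^ n * (meanBlock Y q * (starRingEnd ℂ) (z q)).re := by
    have : (star (z q) * ((2 : ℂ) ^ n * meanBlock Y q)) =
        ((2 ^ n : ℝ) : ℂ) * (meanBlock Y q * (starRingEnd ℂ) (z q)) := by
      push_cast
      rw [Complex.star_def]
      ring
    rw [this, Complex.re_ofReal_mul]
  rw [h4]
  ring

theorem hsSq_of_isometry {Y : Matrix (Phys n m) (Bits n) ℂ} (hY : Yᴴ * Y = 1) :
    hsSq Y = 2 ^ n := by
  rw [hsSq_eq_re, hY, trace_one, Complex.natCast_re]
  simp

theorem hsSq_sub_attach_meanBlock {Y : Matrix (Phys n m) (Bits n) ℂ} (hY : Yᴴ * Y = 1) :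
    hsSq (Y - attach (n := n) (meanBlock Y)) = 2 ^ n * (1 - fid Y) := by
  rw [hsSq_sub_attach, hsSq_of_isometry hY]
  simp
  ring

theorem one_sub_fid_le {Y : Matrix (Phys n m) (Bits n) ℂ} (hY : Yᴴ * Y = 1)
    (z : Bits m × Bits m → ℂ) : 2 ^ n * (1 - fid Y) ≤ hsSq (Y - attach (n := n) z) := by
  rw [hsSq_sub_attach, hsSq_of_isometry hY]
  have : 0 ≤ (2 : ℝ) ^ n * ∑ q, Complex.normSq (meanBlock Y q - z q) :=
    mul_nonneg (by positivity) (Finset.sum_nonneg fun _ _ => Complex.normSq_nonneg _)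
  linarith

theorem one_kronecker_mul_attach (B : Matrix (Bits m) (Bits m) ℂ) (z : Bits m × Bits m → ℂ) :
    ((1 : Matrix (Bits n × Bits m) (Bits n × Bits m) ℂ) ⊗ₖ B) * attach (n := n) z =
      attach (n := n) (fun q => ∑ y, B q.2 y * z (q.1, y)) := by
  ext p i
  simp only [mul_apply, attach, of_apply, kroneckerMap_apply,
    Fintype.sum_prod_type (α₂ := Bits m) (α₁ := Bits n × Bits m), one_apply, ite_mul, one_mul,
    zero_mul, mul_ite, mul_zero]
  rw [Finset.sum_eq_single p.1]
  · by_cases h : p.1.1 = i <;> simp [h]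
  · intro q _ hq
    simp [Ne.symm hq]
  · simp

/-- Up to a unitary, `R_A ⊗ R_Ā` moves product states to operators `A (1 ⊗ w)`. -/
theorem exists_opOf_conjTranspose_mul_attach (χ z : Bits m × Bits m → ℂ)
    {A : Matrix (Bits n × Bits m) (Bits n × Bits m) ℂ} (hA : A * Aᴴ = 1)
    (B : Matrix (Bits m) (Bits m) ℂ) : ∃ g : Matrix (Bits m) (Bits m) ℂ,
      (opOf χ ((A ⊗ₖ B)ᴴ * attach (n := n) z))ᴴ * opOf χ ((A ⊗ₖ B)ᴴ * attach (n := n) z) =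
        (1 : Matrix (Bits n) (Bits n) ℂ) ⊗ₖ g := by
  -- The part on Ā maps product vectors to product vectors, and the unitary part on A cancels in the
  -- Gram operator.
  have h1 : (A ⊗ₖ B)ᴴ = (Aᴴ ⊗ₖ (1 : Matrix (Bits m) (Bits m) ℂ)) *
      ((1 : Matrix (Bits n × Bits m) (Bits n × Bits m) ℂ) ⊗ₖ Bᴴ) := by
    rw [conjTranspose_kronecker, ← mul_kronecker_mul, Matrix.mul_one, Matrix.one_mul]
  rw [h1, Matrix.mul_assoc, one_kronecker_mul_attach, opOf_kronecker_one_mul, opOf_attach_eq]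
  generalize (Matrix.of fun a a' => _ : Matrix (Bits m) (Bits m) ℂ) = w
  refine ⟨wᴴ * w, ?_⟩
  rw [conjTranspose_mul, conjTranspose_conjTranspose, Matrix.mul_assoc, ← Matrix.mul_assoc A, hA,
    Matrix.one_mul, conjTranspose_kronecker, conjTranspose_one, ← mul_kronecker_mul,
    Matrix.one_mul]

end Fidelity

/-! ### A lower bound on the infidelity of every recovery -/

namespace SkewedStabilizerCode

variable {n m : ℕ} (C : SkewedStabilizerCode n m)

/-- The operator on `A₁ A₂` through which the skewed code is obtained from the exact one. -/
noncomputable def recOp (ε : ℝ) : Matrix (Bits n × Bits m) (Bits n × Bits m) ℂ :=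
  opOf C.χ (C.recEnc ε)

theorem tendsto_recOp_slope :
    Tendsto (fun ε : ℝ => ε⁻¹ • (C.recOp ε - 1)) (𝓝[≠] 0) (𝓝 (Complex.I • C.skewOp)) := by
  have h := tendsto_linear_slope (opOf C.χ) (LinearMap.continuous_of_finiteDimensional _)
    C.tendsto_recEnc_slope
  rw [map_smul, opOf_attach C.flat_χ] at h
  exact h

theorem tendsto_conjTranspose_slope {k l : Type} {f : ℝ → Matrix k l ℂ} {x f' : Matrix k l ℂ}
    (h : Tendsto (fun ε : ℝ => ε⁻¹ • (f ε - x)) (𝓝[≠] 0) (𝓝 f')) :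
    Tendsto (fun ε : ℝ => ε⁻¹ • ((f ε)ᴴ - xᴴ)) (𝓝[≠] 0) (𝓝 f'ᴴ) := by
  have hc : Continuous fun A : Matrix k l ℂ => Aᴴ := continuous_id.matrix_conjTranspose
  refine ((hc.tendsto f').comp h).congr fun ε => ?_
  simp [conjTranspose_smul]

theorem tendsto_gram_slope : Tendsto (fun ε : ℝ => ε⁻¹ • ((C.recOp ε)ᴴ * C.recOp ε - 1)) (𝓝[≠] 0)
    (𝓝 C.D) := by
  have h := tendsto_mul_slope (tendsto_conjTranspose_slope C.tendsto_recOp_slope)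
    C.tendsto_recOp_slope
  rw [conjTranspose_one, Matrix.mul_one, Matrix.mul_one, Matrix.one_mul] at h
  have h2 : (Complex.I • C.skewOp)ᴴ + Complex.I • C.skewOp = C.D := by
    rw [D_eq, conjTranspose_smul, Complex.star_def, Complex.conj_I]
    module
  rwa [h2] at h

/-- Rotate the product vector nearest to the recovered code back by the recovery. Its Gram operator
has the form 1 ⊗ g, so `gapOp` does not see it, and its distance to `recOp` is the infidelity. The
recovery enters the later estimates only through these two facts, which makes them uniform in it. -/
theorem hsSq_recOp_sub (R : Recovery n m) (ε : ℝ) : ∃ P : Matrix (Bits n × Bits m) _ ℂ,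
    trace (C.gapOp * (Pᴴ * P)) = 0 ∧
      hsSq (C.recOp ε - P) = 2 ^ m * (2 ^ n * (1 - fid (R.op * C.enc ε))) := by
  obtain ⟨A, hA', hA⟩ : ∃ A : Matrix (Bits n × Bits m) (Bits n × Bits m) ℂ,
      A = (R.1 : Matrix _ _ ℂ) * (C.rec₀.1 : Matrix _ _ ℂ)ᴴ ∧ A * Aᴴ = 1 :=
    ⟨_, rfl, mem_unitaryGroup_iff.mp (R.1 * C.rec₀.1⁻¹).2⟩
  obtain ⟨B, hB'⟩ : ∃ B : Matrix (Bits m) (Bits m) ℂ,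
      B = (R.2 : Matrix _ _ ℂ) * (C.rec₀.2 : Matrix _ _ ℂ)ᴴ := ⟨_, rfl⟩
  have hQ : A ⊗ₖ B = R.op * C.rec₀.opᴴ := by
    rw [Recovery.op, Recovery.op, conjTranspose_kronecker, ← mul_kronecker_mul, hA', hB']
  have hQ1 : (A ⊗ₖ B)ᴴ * (A ⊗ₖ B) = 1 := by
    rw [hQ, conjTranspose_mul, conjTranspose_conjTranspose, Matrix.mul_assoc,
      ← Matrix.mul_assoc R.opᴴ, R.conjTranspose_mul_op, Matrix.one_mul,
      C.rec₀.op_mul_conjTranspose]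
  set z := meanBlock (R.op * C.enc ε)
  obtain ⟨g, hg⟩ := exists_opOf_conjTranspose_mul_attach C.χ z hA B
  refine ⟨opOf C.χ ((A ⊗ₖ B)ᴴ * attach (n := n) z), ?_, ?_⟩
  · rw [hg, trace_mul_one_kronecker, traceFst_gapOp]
    simp
  · have h1 : C.recEnc ε = (A ⊗ₖ B)ᴴ * (R.op * C.enc ε) := by
      rw [hQ, conjTranspose_mul, conjTranspose_conjTranspose, Matrix.mul_assoc,
        ← Matrix.mul_assoc R.opᴴ, R.conjTranspose_mul_op, Matrix.one_mul, recEnc]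
    have h2 : (A ⊗ₖ B)ᴴᴴ * (A ⊗ₖ B)ᴴ = 1 := by
      rw [conjTranspose_conjTranspose]
      exact mul_eq_one_comm.mp hQ1
    have h3 := hsSq_opOf C.flat_χ (C.recEnc ε - (A ⊗ₖ B)ᴴ * attach (n := n) z)
    rw [map_sub] at h3
    rw [← hsSq_sub_attach_meanBlock (C.op_mul_enc_isometry R ε), ← hsSq_unitary_mul h2,
      Matrix.mul_sub, ← h1, h3, mul_inv_cancel_left₀ (by positivity)]
    rfl

/-- Substituting P = M − Δ in the hypothesis expresses tr(N MᴴM) through cross terms and a term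
quadratic in Δ. Young's inequality with weight t bounds the former, Cauchy-Schwarz the latter. -/
theorem trace_gram_le (N M P : Matrix (Bits n × Bits m) (Bits n × Bits m) ℂ) (hN : N.IsHermitian)
    (hP : trace (N * (Pᴴ * P)) = 0) {t : ℝ} (ht : 0 < t) :
    |(trace (N * (Mᴴ * M))).re| ≤ t * hsSq (M * N) + (t⁻¹ + (1 + hsSq N)) * hsSq (M - P) := by
  set Δ := M - P with hΔ
  have h0 : P = M - Δ := by rw [hΔ, sub_sub_cancel]
  have h1 : trace (N * (Mᴴ * M)) = trace ((M * N)ᴴ * Δ) + star (trace ((M * N)ᴴ * Δ)) -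
      trace ((Δ * N)ᴴ * Δ) := by
    rw [← trace_conjTranspose, conjTranspose_mul _ Δ, conjTranspose_conjTranspose,
      conjTranspose_mul, conjTranspose_mul, hN.eq]
    have h4 : Pᴴ * P = Mᴴ * M - Mᴴ * Δ - Δᴴ * M + Δᴴ * Δ := by
      rw [h0, conjTranspose_sub]
      noncomm_ring
    rw [h4, mul_add, mul_sub, mul_sub, trace_add, trace_sub, trace_sub] at hP
    have h3 : trace (Δᴴ * (M * N)) = trace (N * (Δᴴ * M)) := by
      rw [← Matrix.mul_assoc, trace_mul_comm]
    rw [h3]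
    simp only [Matrix.mul_assoc] at hP ⊢
    linear_combination hP
  have h2 := congrArg Complex.re h1
  rw [Complex.sub_re, Complex.add_re, Complex.star_def, Complex.conj_re] at h2
  have h3 := two_mul_abs_re_trace_le (M * N) Δ ht
  have h4 := sq_re_trace_le (Δ * N) Δ
  have h5 := mul_le_mul_of_nonneg_right (hsSq_mul_le Δ N) (hsSq_nonneg Δ)
  have h6 : |(trace ((Δ * N)ᴴ * Δ)).re| ≤ (1 + hsSq N) * hsSq Δ := by
    refine abs_le_of_sq_le_sq ?_ (mul_nonneg (by linarith [hsSq_nonneg N]) (hsSq_nonneg Δ))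
    have : 0 ≤ (1 + hsSq N + hsSq N ^ 2) * hsSq Δ ^ 2 := by
      have := hsSq_nonneg N
      positivity
    nlinarith
  rw [h2]
  calc _ ≤ |(trace ((M * N)ᴴ * Δ)).re + (trace ((M * N)ᴴ * Δ)).re| +
        |(trace ((Δ * N)ᴴ * Δ)).re| := abs_sub _ _
    _ ≤ _ := by
      rw [← two_mul, abs_mul, abs_two, add_mul]
      linarith

/-- No recovery brings the entanglement infidelity of the skewed code below `gap * ε ^ 2`. -/
theorem eventually_le_one_sub_fid {c : ℝ} (hc : 0 < c) :
    ∀ᶠ ε in 𝓝[≠] (0 : ℝ), ∀ R : Recovery n m,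
      ε ^ 2 * (C.gap - c) ≤ 1 - fid (R.op * C.enc ε) := by
  set X := hsSq C.gapOp with hX
  let a : ℝ → ℝ := fun ε => ε⁻¹ * (trace (C.gapOp * ((C.recOp ε)ᴴ * C.recOp ε))).re
  let b : ℝ → ℝ := fun ε => hsSq (C.recOp ε * C.gapOp)
  -- The Gram operator changes by ε D, and pairing D with `gapOp` gives the squared norm X.
  have ha : Tendsto a (𝓝[≠] 0) (𝓝 X) := by
    have h1 : Continuous fun Z : Matrix (Bits n × Bits m) (Bits n × Bits m) ℂ =>
        (trace (C.gapOp * Z)).re := by fun_prop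
    have h2 := (h1.tendsto _).comp C.tendsto_gram_slope
    rw [trace_gapOp_mul_D, Complex.ofReal_re] at h2
    refine h2.congr fun ε => ?_
    simp only [Function.comp_apply, a]
    rw [Matrix.mul_smul, trace_smul, Complex.real_smul, Complex.re_ofReal_mul, mul_sub, trace_sub,
      Matrix.mul_one, trace_gapOp, sub_zero]
  have hb : Tendsto b (𝓝[≠] 0) (𝓝 X) := by
    have h1 : Continuous fun Z : Matrix (Bits n × Bits m) (Bits n × Bits m) ℂ =>
        hsSq (Z * C.gapOp) := continuous_hsSq.comp (continuous_id.mul continuous_const)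
    have h2 := (h1.tendsto _).comp (tendsto_of_slope C.tendsto_recOp_slope)
    rw [one_mul] at h2
    exact h2
  have h0 : Tendsto (fun ε : ℝ => |ε|) (𝓝[≠] 0) (𝓝 0) := by
    have := (continuous_abs (G := ℝ)).tendsto 0
    rw [abs_zero] at this
    exact this.mono_left nhdsWithin_le_nhds
  have hg : Tendsto (fun ε => (|a ε| - b ε / 2) / 2 / (1 + (1 + X) * |ε| / 2)) (𝓝[≠] 0)
      (𝓝 (X / 4)) := by
    have h1 := ((ha.abs.sub (hb.div_const 2)).div_const 2).div
      (((h0.const_mul (1 + X)).div_const 2).const_add 1) (by norm_num)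
    have h2 : (|X| - X / 2) / 2 / (1 + (1 + X) * 0 / 2) = X / 4 := by
      rw [abs_of_nonneg (hsSq_nonneg _)]
      ring
    rw [h2] at h1
    exact h1
  have hc' : X / 4 - 2 ^ m * (2 ^ n * c) < X / 4 := sub_lt_self _ (by positivity)
  filter_upwards [hg.eventually (lt_mem_nhds hc'), self_mem_nhdsWithin] with ε hε hε0 R
  have he : 0 < |ε| := abs_pos.mpr hε0
  obtain ⟨P, hP1, hP2⟩ := C.hsSq_recOp_sub R ε
  -- With weight |ε|/2 the inequality reads |ε| X ≤ |ε| X/2 + (2/|ε|) ‖Δ‖² to leading order, that is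
  -- ‖Δ‖² ≥ ε² X/4; this weight gives the sharp constant.
  have h1 := trace_gram_le C.gapOp (C.recOp ε) P C.gapOp_isHermitian hP1 (half_pos he)
  have h2 : |(trace (C.gapOp * ((C.recOp ε)ᴴ * C.recOp ε))).re| = |ε| * |a ε| := by
    rw [← abs_mul, mul_inv_cancel_left₀ hε0]
  rw [h2, hP2, ← hX] at h1
  set F := (2 : ℝ) ^ m * (2 ^ n * (1 - fid (R.op * C.enc ε))) with hF
  have hX0 : 0 ≤ X := hsSq_nonneg _
  have h3 : 0 < 1 + (1 + X) * |ε| / 2 := by positivity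
  rw [lt_div_iff₀ h3] at hε
  have h4 : |ε| ^ 2 * ((|a ε| - b ε / 2) / 2) ≤ (1 + (1 + X) * |ε| / 2) * F := by
    have h5 := mul_le_mul_of_nonneg_left h1 (half_pos he).le
    have h6 : |ε| / 2 * (|ε| / 2 * hsSq (C.recOp ε * C.gapOp) + ((|ε| / 2)⁻¹ + (1 + X)) * F) =
        |ε| ^ 2 * (b ε / 4) + (1 + (1 + X) * |ε| / 2) * F := by
      simp only [b]
      field_simp
      ring
    rw [h6] at h5
    nlinarith
  have h7 : |ε| ^ 2 * (X / 4 - 2 ^ m * (2 ^ n * c)) * (1 + (1 + X) * |ε| / 2) ≤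
      F * (1 + (1 + X) * |ε| / 2) := by
    have := mul_le_mul_of_nonneg_left hε.le (sq_nonneg |ε|)
    linarith
  have h8 := le_of_mul_le_mul_right h7 h3
  rw [sq_abs] at h8
  have h9 : X / 4 = 2 ^ m * (2 ^ n * C.gap) := by
    rw [gap, hX]
    field_simp
  rw [h9, hF] at h8
  have h10 : (0 : ℝ) < 2 ^ m * 2 ^ n := by positivity
  refine le_of_mul_le_mul_left ?_ h10
  linarith

end SkewedStabilizerCode

end SkewedCode

/-! ### A reference recovery that attains the infidelity bound -/

namespace SkewedCode

namespace SkewedStabilizerCode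

variable {n m : ℕ} (C : SkewedStabilizerCode n m)

/-- The recovery of the exact code, corrected on `A` for the Hermitian part of the skewing. -/
noncomputable def skewRec (ε : ℝ) : Recovery n m :=
  (⟨NormedSpace.exp ((Complex.I * (ε : ℂ)) • -C.hermSkew),
    exp_mem_unitaryGroup C.hermSkew_isHermitian.neg ε⟩ * C.rec₀.1, C.rec₀.2)

/-- The skewed encoding followed by `skewRec`. -/
noncomputable def skewEnc (ε : ℝ) : Matrix (Phys n m) (Bits n) ℂ := (C.skewRec ε).op * C.enc ε

/-- The operator on `A₁ A₂` through which `skewEnc` is obtained from the exact code. -/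
noncomputable def skewEncOp (ε : ℝ) : Matrix (Bits n × Bits m) (Bits n × Bits m) ℂ :=
  opOf C.χ (C.skewEnc ε)

theorem skewEnc_isometry (ε : ℝ) : (C.skewEnc ε)ᴴ * C.skewEnc ε = 1 := C.op_mul_enc_isometry _ ε

theorem skewEncOp_eq (ε : ℝ) : C.skewEncOp ε =
    NormedSpace.exp ((Complex.I * (ε : ℂ)) • -C.hermSkew) * C.recOp ε := by
  have h : (C.skewRec ε).op = (NormedSpace.exp ((Complex.I * (ε : ℂ)) • -C.hermSkew) ⊗ₖ
      (1 : Matrix (Bits m) (Bits m) ℂ)) * C.rec₀.op := by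
    rw [Recovery.op, Recovery.op, ← mul_kronecker_mul, Matrix.one_mul]
    rfl
  rw [skewEncOp, skewEnc, h, Matrix.mul_assoc, opOf_kronecker_one_mul]
  rfl

/-- The correction on A removes exactly the Hermitian part of `skewOp`. -/
theorem tendsto_skewEncOp_slope :
    Tendsto (fun ε : ℝ => ε⁻¹ • (C.skewEncOp ε - 1)) (𝓝[≠] 0) (𝓝 ((2 : ℂ)⁻¹ • C.D)) := by
  have h := tendsto_mul_slope (tendsto_exp_slope (-C.hermSkew)) C.tendsto_recOp_slope
  rw [Matrix.mul_one, Matrix.mul_one, Matrix.one_mul, ← smul_add, neg_add_eq_sub,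
    skewOp_sub_hermSkew] at h
  refine h.congr fun ε => ?_
  rw [skewEncOp_eq]

theorem attach_add_smul (x y : Bits m × Bits m → ℂ) (c : ℂ) :
    attach (n := n) (x + c • y) = attach (n := n) x + c • attach (n := n) y := by
  ext p i
  simp only [attach, of_apply, Matrix.add_apply, Matrix.smul_apply, Pi.add_apply, Pi.smul_apply]
  split_ifs <;> simp

theorem eventually_one_sub_fid_skewEnc_le {c : ℝ} (hc : 0 < c) :
    ∀ᶠ ε in 𝓝[≠] (0 : ℝ), 1 - fid (C.skewEnc ε) ≤ ε ^ 2 * (C.gap + c) := by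
  have h1 : Tendsto (fun ε : ℝ => hsSq (ε⁻¹ • (C.skewEncOp ε - 1) -
      (2 : ℂ)⁻¹ • ((1 : Matrix (Bits n) (Bits n) ℂ) ⊗ₖ C.meanD))) (𝓝[≠] 0)
      (𝓝 (hsSq C.gapOp / 4)) := by
    have h2 := (continuous_hsSq.tendsto _).comp (C.tendsto_skewEncOp_slope.sub_const
      ((2 : ℂ)⁻¹ • ((1 : Matrix (Bits n) (Bits n) ℂ) ⊗ₖ C.meanD)))
    rw [← smul_sub, ← gapOp, hsSq_smul] at h2
    have h3 : Complex.normSq (2 : ℂ)⁻¹ * hsSq C.gapOp = hsSq C.gapOp / 4 := by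
      rw [map_inv₀, Complex.normSq_ofNat]
      ring
    rw [h3] at h2
    exact h2
  have hc' : hsSq C.gapOp / 4 < hsSq C.gapOp / 4 + 2 ^ m * (2 ^ n * c) :=
    lt_add_of_pos_right _ (by positivity)
  filter_upwards [h1.eventually (gt_mem_nhds hc'), self_mem_nhdsWithin] with ε hε hε0
  have hε0' : ε ≠ 0 := hε0
  -- The trial product vector corresponds to the operator 1 + (ε/2)(1 ⊗ `meanD`), which absorbs the
  -- mean of D/2 and leaves `gapOp`/2.
  have h4 := one_sub_fid_le (C.skewEnc_isometry ε) (C.χ + (-Complex.I * ε) • C.bathVec)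
  have h5 : opOf C.χ (C.skewEnc ε - attach (n := n) (C.χ + (-Complex.I * ε) • C.bathVec)) =
      (ε : ℂ) • (ε⁻¹ • (C.skewEncOp ε - 1) -
        (2 : ℂ)⁻¹ • ((1 : Matrix (Bits n) (Bits n) ℂ) ⊗ₖ C.meanD)) := by
    have h6 : (ε : ℂ) • (ε⁻¹ • (C.skewEncOp ε - 1)) = C.skewEncOp ε - 1 := by
      rw [Complex.coe_smul, smul_smul, mul_inv_cancel₀ hε0', one_smul]
    have h7 : -Complex.I * ε * (Complex.I / 2) = (ε : ℂ) * (2 : ℂ)⁻¹ := by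
      linear_combination (-(ε : ℂ) / 2) * Complex.I_mul_I
    rw [map_sub, attach_add_smul, map_add, map_smul, opOf_attach C.flat_χ, opOf_attach_bathVec,
      smul_sub, h6, smul_smul, smul_smul, h7, skewEncOp]
    abel
  rw [hsSq_opOf C.flat_χ, h5, hsSq_smul, Complex.normSq_ofReal] at h4
  have h8 : hsSq C.gapOp / 4 = 2 ^ m * (2 ^ n * C.gap) := by
    rw [gap]
    field_simp
  rw [h8] at hε
  have h9 : (2 : ℝ) ^ m * (2 ^ n * (1 - fid (C.skewEnc ε))) ≤ ε * ε * hsSq (ε⁻¹ •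
      (C.skewEncOp ε - 1) - (2 : ℂ)⁻¹ • ((1 : Matrix (Bits n) (Bits n) ℂ) ⊗ₖ C.meanD)) := by
    have := mul_le_mul_of_nonneg_left h4 (by positivity : (0 : ℝ) ≤ 2 ^ m)
    rwa [mul_inv_cancel_left₀ (by positivity)] at this
  have h10 := mul_le_mul_of_nonneg_left hε.le (mul_self_nonneg ε)
  have h11 : (0 : ℝ) < 2 ^ m * 2 ^ n := by positivity
  refine le_of_mul_le_mul_left ?_ h11
  linarith

theorem tendsto_of_eventually_between {f : ℝ → ℝ} {g : ℝ}
    (h1 : ∀ c > 0, ∀ᶠ ε in 𝓝[≠] (0 : ℝ), ε ^ 2 * (g - c) ≤ f ε)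
    (h2 : ∀ c > 0, ∀ᶠ ε in 𝓝[≠] (0 : ℝ), f ε ≤ ε ^ 2 * (g + c)) :
    Tendsto (fun ε => (ε ^ 2)⁻¹ * f ε) (𝓝[≠] 0) (𝓝 g) := by
  rw [tendsto_order]
  constructor
  · intro a ha
    filter_upwards [h1 ((g - a) / 2) (by linarith), self_mem_nhdsWithin] with ε hε hε0
    have : (0 : ℝ) < ε ^ 2 := by
      have : ε ≠ 0 := hε0
      positivity
    rw [lt_inv_mul_iff₀ this]
    nlinarith
  · intro a ha
    filter_upwards [h2 ((a - g) / 2) (by linarith), self_mem_nhdsWithin] with ε hε hε0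
    have : (0 : ℝ) < ε ^ 2 := by
      have : ε ≠ 0 := hε0
      positivity
    rw [inv_mul_lt_iff₀ this]
    nlinarith

theorem tendsto_one_sub_fid_skewEnc :
    Tendsto (fun ε => (ε ^ 2)⁻¹ * (1 - fid (C.skewEnc ε))) (𝓝[≠] 0) (𝓝 C.gap) :=
  tendsto_of_eventually_between
    (fun _ hc => (C.eventually_le_one_sub_fid hc).mono fun ε hε => hε (C.skewRec ε))
    fun _ hc => C.eventually_one_sub_fid_skewEnc_le hc

end SkewedStabilizerCode

end SkewedCode

namespace SkewedCode

/-! ### Entropy estimates from the spectrum -/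

section Spectra

variable {k : Type} [Fintype k] [DecidableEq k]

open scoped MatrixOrder Matrix.Norms.L2Operator in
theorem posSemidef_smul_one_sub_iff {ρ : Matrix k k ℂ} (hρ : ρ.IsHermitian) (p : ℝ) :
    ((p : ℂ) • (1 : Matrix k k ℂ) - ρ).PosSemidef ↔ ∀ i, hρ.eigenvalues i ≤ p := by
  have h := le_algebraMap_iff_spectrum_le (R := ℝ) (r := p) (a := ρ) hρ.isSelfAdjoint
  rw [hρ.spectrum_real_eq_range_eigenvalues, Set.forall_mem_range, Matrix.le_iff,
    Algebra.algebraMap_eq_smul_one] at h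
  exact h

theorem hsSq_cfc (f : ℝ → ℝ) {ρ : Matrix k k ℂ} (hρ : ρ.IsHermitian) :
    hsSq (cfc f ρ) = ∑ i, f (hρ.eigenvalues i) ^ 2 := by
  have h1 : (cfc f ρ)ᴴ = cfc f ρ := (cfc_predicate (R := ℝ) f ρ : IsSelfAdjoint (cfc f ρ))
  rw [hsSq_eq_re, h1, ← cfc_mul f f ρ (continuousOn_spectrum _ _) (continuousOn_spectrum _ _),
    trace_cfc _ hρ, ← Complex.ofReal_sum, Complex.ofReal_re]
  simp [sq]

theorem hsSq_sub_smul_one_eq_sum {ρ : Matrix k k ℂ} (hρ : ρ.IsHermitian) (c : ℝ) :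
    hsSq (ρ - (c : ℂ) • 1) = ∑ i, (hρ.eigenvalues i - c) ^ 2 := by
  have h1 : ρ - (c : ℂ) • (1 : Matrix k k ℂ) = cfc (fun q => q - c) ρ := by
    rw [cfc_sub (fun q => q) (fun _ => c) ρ (continuousOn_spectrum _ _) (continuousOn_spectrum _ _),
      cfc_id' ℝ ρ hρ.isSelfAdjoint, cfc_const c ρ hρ.isSelfAdjoint, Algebra.algebraMap_eq_smul_one]
    rfl
  rw [h1, hsSq_cfc _ hρ]

theorem sum_eigenvalues_eq_one {ρ : Matrix k k ℂ} (hρ : ρ.IsHermitian) (h1 : trace ρ = 1) :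
    ∑ i, hρ.eigenvalues i = 1 := by
  have h := hρ.trace_eq_sum_eigenvalues
  rw [h1] at h
  have h2 := congrArg Complex.re h
  simpa using h2.symm

theorem entropy_le_log_card {ρ : Matrix k k ℂ} (hρ : ρ.PosSemidef) (h1 : trace ρ = 1) :
    entropy ρ ≤ Real.log (Fintype.card k) := by
  have hs := sum_eigenvalues_eq_one hρ.isHermitian h1
  have hk : (0 : ℝ) < Fintype.card k := by
    rcases isEmpty_or_nonempty k with h | h
    · simp at hs
    · exact_mod_cast Fintype.card_pos
  rw [entropy_eq_sum hρ.isHermitian]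
  have h2 : ∀ i, Real.negMulLog (hρ.isHermitian.eigenvalues i) ≤
      hρ.isHermitian.eigenvalues i * Real.log (Fintype.card k) +
        (1 / Fintype.card k - hρ.isHermitian.eigenvalues i) := by
    intro i
    set x := hρ.isHermitian.eigenvalues i
    rcases (hρ.eigenvalues_nonneg i).eq_or_lt with h | h
    · change 0 = x at h
      rw [← h]
      simp
    · change 0 < x at h
      have h3 := Real.log_le_sub_one_of_pos (x := (x * Fintype.card k)⁻¹) (by positivity)
      rw [Real.log_inv, Real.log_mul h.ne' hk.ne'] at h3
      have h4 := mul_le_mul_of_nonneg_left h3 h.le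
      have h5 : x * ((x * Fintype.card k)⁻¹ - 1) = 1 / Fintype.card k - x := by
        field_simp
      rw [h5] at h4
      rw [Real.negMulLog]
      linarith
  refine (Finset.sum_le_sum fun i _ => h2 i).trans ?_
  rw [Finset.sum_add_distrib, ← Finset.sum_mul, hs, Finset.sum_sub_distrib, hs]
  simp [hk.ne']

/-- Near the maximally mixed state the entropy deficit is quadratic in the deviation: apply ln y ≤ y
− 1 at y = x · card. -/
theorem log_card_sub_le_entropy {ρ : Matrix k k ℂ} (hρ : ρ.PosSemidef) (h1 : trace ρ = 1) :
    Real.log (Fintype.card k) -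
      Fintype.card k * hsSq (ρ - (((Fintype.card k : ℝ)⁻¹ : ℝ) : ℂ) • 1) ≤ entropy ρ := by
  have hs := sum_eigenvalues_eq_one hρ.isHermitian h1
  have hk : (0 : ℝ) < Fintype.card k := by
    rcases isEmpty_or_nonempty k with h | h
    · simp at hs
    · exact_mod_cast Fintype.card_pos
  rw [entropy_eq_sum hρ.isHermitian, hsSq_sub_smul_one_eq_sum hρ.isHermitian]
  have h2 : ∀ i, hρ.isHermitian.eigenvalues i * Real.log (Fintype.card k) -
      (Fintype.card k * (hρ.isHermitian.eigenvalues i - (Fintype.card k : ℝ)⁻¹) ^ 2 +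
        (hρ.isHermitian.eigenvalues i - (Fintype.card k : ℝ)⁻¹)) ≤
      Real.negMulLog (hρ.isHermitian.eigenvalues i) := by
    intro i
    set x := hρ.isHermitian.eigenvalues i
    have h6 : (Fintype.card k : ℝ) * (x - (Fintype.card k : ℝ)⁻¹) ^ 2 +
        (x - (Fintype.card k : ℝ)⁻¹) = x * (x * Fintype.card k - 1) := by
      field_simp
      ring
    rw [h6]
    rcases (hρ.eigenvalues_nonneg i).eq_or_lt with h | h
    · change 0 = x at h
      rw [← h]
      simp
    · change 0 < x at h
      have h3 := Real.log_le_sub_one_of_pos (x := x * Fintype.card k) (by positivity)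
      rw [Real.log_mul h.ne' hk.ne'] at h3
      have h4 := mul_le_mul_of_nonneg_left h3 h.le
      rw [Real.negMulLog]
      linarith
  refine le_trans (le_of_eq ?_) (Finset.sum_le_sum fun i _ => h2 i)
  rw [Finset.sum_sub_distrib, ← Finset.sum_mul, hs, Finset.sum_add_distrib, Finset.sum_sub_distrib,
    hs, Finset.mul_sum]
  simp [hk.ne']

theorem eigenvalues_le_one {ρ : Matrix k k ℂ} (hρ : ρ.PosSemidef) (h1 : trace ρ = 1) (i : k) :
    hρ.isHermitian.eigenvalues i ≤ 1 := by
  rw [← sum_eigenvalues_eq_one hρ.isHermitian h1]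
  exact Finset.single_le_sum (fun j _ => hρ.eigenvalues_nonneg j) (Finset.mem_univ i)

theorem sum_erase_eigenvalues {ρ : Matrix k k ℂ} (hρ : ρ.IsHermitian) (h1 : trace ρ = 1)
    (i : k) : ∑ j ∈ Finset.univ.erase i, hρ.eigenvalues j = 1 - hρ.eigenvalues i := by
  rw [← sum_eigenvalues_eq_one hρ h1, ← Finset.add_sum_erase _ _ (Finset.mem_univ i)]
  ring

/-- The other eigenvalues sum to θ = 1 − λ_i, so each is at most θ and carries a factor −ln of at
least −ln θ. -/
theorem negMulLog_le_entropy {ρ : Matrix k k ℂ} (hρ : ρ.PosSemidef) (h1 : trace ρ = 1) (i : k) :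
    Real.negMulLog (1 - hρ.isHermitian.eigenvalues i) ≤ entropy ρ := by
  have hs := sum_erase_eigenvalues hρ.isHermitian h1 i
  rw [entropy_eq_sum hρ.isHermitian, ← Finset.add_sum_erase _ _ (Finset.mem_univ i)]
  have h2 : 0 ≤ Real.negMulLog (hρ.isHermitian.eigenvalues i) :=
    Real.negMulLog_nonneg (hρ.eigenvalues_nonneg i) (eigenvalues_le_one hρ h1 i)
  have h3 : ∀ j ∈ Finset.univ.erase i, hρ.isHermitian.eigenvalues j *
      -Real.log (1 - hρ.isHermitian.eigenvalues i) ≤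
        Real.negMulLog (hρ.isHermitian.eigenvalues j) := by
    intro j hj
    rw [Real.negMulLog, neg_mul, ← mul_neg]
    rcases (hρ.eigenvalues_nonneg j).eq_or_lt with h | h
    · rw [← h]
      simp
    · refine mul_le_mul_of_nonneg_left (neg_le_neg (Real.log_le_log h ?_)) h.le
      rw [← hs]
      exact Finset.single_le_sum (fun j _ => hρ.eigenvalues_nonneg j) hj
  have h4 := Finset.sum_le_sum h3
  rw [← Finset.sum_mul, hs] at h4
  rw [Real.negMulLog]
  linarith

/-- A crude bound from −ln λ_j ≥ −ln λ_max ≥ 1 − λ_max. It is needed to know that the eigenvalue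
deficit is small, since x ↦ −x ln x is not monotone and `negMulLog_le_entropy` alone would not
exclude large deficits. -/
theorem one_sub_le_entropy {ρ : Matrix k k ℂ} (hρ : ρ.PosSemidef) (h1 : trace ρ = 1) {i : k}
    (hi : ∀ j, hρ.isHermitian.eigenvalues j ≤ hρ.isHermitian.eigenvalues i) :
    1 - hρ.isHermitian.eigenvalues i ≤ entropy ρ := by
  have hs := sum_eigenvalues_eq_one hρ.isHermitian h1
  have h0 : 0 < hρ.isHermitian.eigenvalues i := by
    refine (hρ.eigenvalues_nonneg i).lt_of_ne fun h => ?_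
    rw [← h] at hi
    have : ∑ j, hρ.isHermitian.eigenvalues j ≤ 0 := Finset.sum_nonpos fun j _ => hi j
    linarith
  rw [entropy_eq_sum hρ.isHermitian]
  have h3 : ∀ j, hρ.isHermitian.eigenvalues j * (1 - hρ.isHermitian.eigenvalues i) ≤
      Real.negMulLog (hρ.isHermitian.eigenvalues j) := by
    intro j
    rw [Real.negMulLog, neg_mul, ← mul_neg]
    rcases (hρ.eigenvalues_nonneg j).eq_or_lt with h | h
    · rw [← h]
      simp
    · refine mul_le_mul_of_nonneg_left ?_ h.le
      have h4 := Real.log_le_log h (hi j)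
      have h5 := Real.log_le_sub_one_of_pos h0
      linarith
  have h4 := Finset.sum_le_sum fun j (_ : j ∈ Finset.univ) => h3 j
  rwa [← Finset.sum_mul, hs, one_mul] at h4

/-- The tangent bound −x ln x ≤ −x ln q + q − x is used with q = 1 at the index i and with q = θ
elsewhere. The leading term −θ ln θ matches the lower bound `negMulLog_le_entropy`. -/
theorem entropy_le_of_one_sub_le {ρ : Matrix k k ℂ} (hρ : ρ.PosSemidef) (h1 : trace ρ = 1) {i : k}
    {θ : ℝ} (hθ : 0 < θ) (hθ1 : θ ≤ 1) (hi : 1 - hρ.isHermitian.eigenvalues i ≤ θ) :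
    entropy ρ ≤ Real.negMulLog θ + (Fintype.card k + 1) * θ := by
  have hs := sum_erase_eigenvalues hρ.isHermitian h1 i
  rw [entropy_eq_sum hρ.isHermitian, ← Finset.add_sum_erase _ _ (Finset.mem_univ i)]
  have hg : ∀ x : ℝ, 0 ≤ x → ∀ q : ℝ, 0 < q → Real.negMulLog x ≤ x * -Real.log q + (q - x) := by
    intro x hx q hq
    rcases hx.eq_or_lt with rfl | hx
    · simp [hq.le]
    · have h3 := Real.log_le_sub_one_of_pos (x := q / x) (by positivity)
      rw [Real.log_div hq.ne' hx.ne'] at h3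
      have h4 := mul_le_mul_of_nonneg_left h3 hx.le
      have h5 : x * (q / x - 1) = q - x := by field_simp
      rw [Real.negMulLog]
      linarith
  have h2 := hg _ (hρ.eigenvalues_nonneg i) 1 one_pos
  rw [Real.log_one, neg_zero, mul_zero, zero_add] at h2
  have h3 : ∀ j ∈ Finset.univ.erase i, Real.negMulLog (hρ.isHermitian.eigenvalues j) ≤
      hρ.isHermitian.eigenvalues j * -Real.log θ + θ := fun j _ =>
    (hg _ (hρ.eigenvalues_nonneg j) θ hθ).trans (by linarith [hρ.eigenvalues_nonneg j])
  have h4 := Finset.sum_le_sum h3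
  rw [Finset.sum_add_distrib, ← Finset.sum_mul, hs, Finset.sum_const, nsmul_eq_mul] at h4
  have h5 : ((Finset.univ.erase i).card : ℝ) * θ ≤ Fintype.card k * θ := by
    gcongr
    exact Finset.card_le_univ _
  have h6 : (1 - hρ.isHermitian.eigenvalues i) * -Real.log θ ≤ θ * -Real.log θ :=
    mul_le_mul_of_nonneg_right hi (neg_nonneg.mpr (Real.log_nonpos hθ.le hθ1))
  have h7 : Real.negMulLog θ = θ * -Real.log θ := by rw [Real.negMulLog, neg_mul, mul_neg]
  linarith

end Spectra

/-! ### The Choi state of the channel to A₁ -/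

section ChannelState

variable {n m : ℕ}

theorem recoveredA₁_eq (V : Matrix (Phys n m) (Bits n) ℂ) (R : Recovery n m)
    (σ : Matrix (Bits n) (Bits n) ℂ) :
    recoveredA₁ V R σ = ∑ q, block (R.op * V) q * σ * (block (R.op * V) q)ᴴ := by
  have h : R.op * (V * σ * Vᴴ) * R.opᴴ = (R.op * V) * σ * (R.op * V)ᴴ := by
    rw [conjTranspose_mul]
    simp only [Matrix.mul_assoc]
  rw [recoveredA₁, recoveredA, h]
  ext i i'
  rw [Matrix.sum_apply]
  simp only [traceSnd, of_apply, Fintype.sum_prod_type]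
  rfl

/-- The Choi operator of the channel to `A₁`. -/
noncomputable def chState (Y : Matrix (Phys n m) (Bits n) ℂ) :
    Matrix (Bits n × Bits n) (Bits n × Bits n) ℂ :=
  ((2 : ℂ) ^ n)⁻¹ • ∑ q, vecMulVec (fun x => block Y q x.1 x.2) (star fun x => block Y q x.1 x.2)

theorem chState_apply (Y : Matrix (Phys n m) (Bits n) ℂ) (x y : Bits n × Bits n) :
    chState Y x y = ((2 : ℂ) ^ n)⁻¹ * ∑ q, block Y q x.1 x.2 * star (block Y q y.1 y.2) := by
  rw [chState, Matrix.smul_apply, Matrix.sum_apply]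
  simp [vecMulVec_apply]

theorem channelState_eq (V : Matrix (Phys n m) (Bits n) ℂ) (R : Recovery n m) :
    channelState V R = chState (R.op * V) := by
  ext x y
  rw [chState_apply, channelState, of_apply, recoveredA₁_eq, Matrix.sum_apply]
  congr 1
  refine Finset.sum_congr rfl fun q _ => ?_
  simp [mul_apply, Matrix.single_apply, ite_and]

theorem chState_posSemidef (Y : Matrix (Phys n m) (Bits n) ℂ) : (chState Y).PosSemidef := by
  refine PosSemidef.smul (posSemidef_sum _ fun q _ => posSemidef_vecMulVec_self_star _) ?_
  exact inv_nonneg.mpr (by positivity)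

theorem traceSnd_chState (Y : Matrix (Phys n m) (Bits n) ℂ) :
    traceSnd (chState Y) = ((2 : ℂ) ^ n)⁻¹ • ∑ q, block Y q * (block Y q)ᴴ := by
  ext i i'
  rw [Matrix.smul_apply, Matrix.sum_apply]
  simp only [traceSnd, of_apply, chState_apply, mul_apply, conjTranspose_apply, smul_eq_mul,
    ← Finset.mul_sum]
  rw [Finset.sum_comm]

theorem traceFst_chState {Y : Matrix (Phys n m) (Bits n) ℂ} (hY : Yᴴ * Y = 1) :
    traceFst (chState Y) = ((2 : ℂ) ^ n)⁻¹ • 1 := by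
  have h : ∑ q, (block Y q)ᴴ * block Y q = 1 := by
    rw [← hY]
    ext j j'
    rw [Matrix.sum_apply]
    simp only [mul_apply, conjTranspose_apply, Fintype.sum_prod_type, block, of_apply]
    symm
    rw [Finset.sum_comm]
    refine Finset.sum_congr rfl fun a _ => ?_
    rw [Finset.sum_comm]
  ext j j'
  have h2 := congrFun₂ h j' j
  rw [Matrix.sum_apply] at h2
  simp only [traceFst, of_apply, chState_apply, Matrix.smul_apply, smul_eq_mul, ← Finset.mul_sum]
  rw [Finset.sum_comm]
  congr 1
  simp only [mul_apply, conjTranspose_apply] at h2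
  simp only [mul_comm (block Y _ _ _), h2, one_apply, eq_comm]

theorem trace_chState {Y : Matrix (Phys n m) (Bits n) ℂ} (hY : Yᴴ * Y = 1) :
    trace (chState Y) = 1 := by
  rw [← trace_traceFst, traceFst_chState hY, trace_smul, trace_one, card_bits, smul_eq_mul,
    inv_mul_cancel₀ (by positivity)]

theorem traceSnd_posSemidef {a b : Type} [Fintype a] [Fintype b]
    {M : Matrix (a × b) (a × b) ℂ} (hM : M.PosSemidef) : (traceSnd M).PosSemidef := by
  have : traceSnd M = ∑ k, M.submatrix (fun i => (i, k)) (fun i => (i, k)) := by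
    ext i j
    rw [Matrix.sum_apply]
    rfl
  rw [this]
  exact posSemidef_sum _ fun k _ => hM.submatrix _

theorem traceFst_posSemidef {a b : Type} [Fintype a] [Fintype b]
    {M : Matrix (a × b) (a × b) ℂ} (hM : M.PosSemidef) : (traceFst M).PosSemidef := by
  have : traceFst M = ∑ k, M.submatrix (fun i => (k, i)) (fun i => (k, i)) := by
    ext i j
    rw [Matrix.sum_apply]
    rfl
  rw [this]
  exact posSemidef_sum _ fun k _ => hM.submatrix _

/-- The unnormalized maximally entangled vector twisted by `K`. -/
theorem dotProduct_chState_mulVec (Y : Matrix (Phys n m) (Bits n) ℂ)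
    (K : Matrix (Bits n) (Bits n) ℂ) :
    star (fun x : Bits n × Bits n => K x.1 x.2) ⬝ᵥ (chState Y *ᵥ fun x => K x.1 x.2) =
      ((2 : ℂ) ^ n)⁻¹ * ∑ q, (Complex.normSq (trace (Kᴴ * block Y q)) : ℂ) := by
  have h1 : ∀ q, trace (Kᴴ * block Y q) =
      star (fun x : Bits n × Bits n => K x.1 x.2) ⬝ᵥ (fun x => block Y q x.1 x.2) := by
    intro q
    simp only [trace, diag, mul_apply, conjTranspose_apply, dotProduct, Pi.star_apply,
      Fintype.sum_prod_type]
    rw [Finset.sum_comm]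
  rw [chState, smul_mulVec, dotProduct_smul, smul_eq_mul, Matrix.sum_mulVec, dotProduct_sum]
  congr 1
  refine Finset.sum_congr rfl fun q _ => ?_
  rw [h1, vecMulVec_mulVec, ← Complex.mul_conj, dotProduct_smul, star_dotProduct]
  simp

/-- The entanglement fidelity is the expectation of the Choi state in the maximally entangled
vector, hence at most its largest eigenvalue. -/
theorem fid_le_of_eigenvalues_le {Y : Matrix (Phys n m) (Bits n) ℂ} {p : ℝ}
    (hp : ∀ i, (chState_posSemidef Y).isHermitian.eigenvalues i ≤ p) : fid Y ≤ p := by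
  have h1 := ((posSemidef_smul_one_sub_iff (chState_posSemidef Y).isHermitian p).mpr
    hp).dotProduct_mulVec_nonneg fun x => (1 : Matrix (Bits n) (Bits n) ℂ) x.1 x.2
  rw [sub_mulVec, dotProduct_sub, dotProduct_chState_mulVec, smul_mulVec, one_mulVec,
    dotProduct_smul] at h1
  have h2 : star (fun x : Bits n × Bits n => (1 : Matrix (Bits n) (Bits n) ℂ) x.1 x.2) ⬝ᵥ
      (fun x => (1 : Matrix (Bits n) (Bits n) ℂ) x.1 x.2) = 2 ^ n := by
    simp [dotProduct, Fintype.sum_prod_type, one_apply]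
  have h3 : ∀ q, (Complex.normSq (trace ((1 : Matrix (Bits n) (Bits n) ℂ)ᴴ * block Y q)) : ℂ) =
      (((2 : ℝ) ^ n) ^ 2 * Complex.normSq (meanBlock Y q) : ℝ) := by
    intro q
    rw [conjTranspose_one, Matrix.one_mul, meanBlock, map_mul, map_inv₀]
    congr 1
    have : Complex.normSq ((2 : ℂ) ^ n) = ((2 : ℝ) ^ n) ^ 2 := by
      rw [map_pow, Complex.normSq_ofNat, ← pow_mul, mul_comm n, pow_mul]
      norm_num
    rw [this, mul_inv_cancel_left₀ (by positivity)]
  rw [h2] at h1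
  simp only [h3] at h1
  rw [← Complex.ofReal_sum, ← Finset.mul_sum] at h1
  have h4 : (p : ℂ) • (2 : ℂ) ^ n - ((2 : ℂ) ^ n)⁻¹ *
      ((((2 : ℝ) ^ n) ^ 2 * fid Y : ℝ) : ℂ) = ((2 ^ n * (p - fid Y) : ℝ) : ℂ) := by
    push_cast
    rw [smul_eq_mul]
    field_simp
  rw [← fid, h4, Complex.zero_le_real] at h1
  have := nonneg_of_mul_nonneg_right h1 (by positivity)
  linarith

end ChannelState

end SkewedCode

/-! ### Optimal coherent information forces a large top eigenvalue -/

namespace SkewedCode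

theorem negMulLog_le_negMulLog {a b : ℝ} (ha : 0 < a) (hab : a ≤ b) (hb : b ≤ Real.exp (-1)) :
    Real.negMulLog a ≤ Real.negMulLog b := by
  have hb0 : 0 < b := ha.trans_le hab
  have h1 := Real.log_le_sub_one_of_pos (x := b / a) (by positivity)
  rw [Real.log_div hb0.ne' ha.ne'] at h1
  have h2 : Real.log b ≤ -1 := by
    rw [← Real.log_exp (-1)]
    exact Real.log_le_log hb0 hb
  have h3 := mul_le_mul_of_nonneg_left h1 ha.le
  have h4 : a * (b / a - 1) = b - a := by field_simp
  rw [h4] at h3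
  rw [Real.negMulLog, Real.negMulLog]
  nlinarith [mul_nonneg (sub_nonneg.mpr hab) (by linarith : 0 ≤ -1 - Real.log b)]

/-- Inverts the leading entropy. A deficit above (1 + κ)θ would have an entropy term at least κ θ
|ln θ| larger up to O(θ), and this outweighs D θ as θ tends to 0. The first hypothesis on `h` keeps
it in (0, 1/e], where −x ln x is monotone. Errors of order θ thus do not affect the leading
constant. -/
theorem eventually_le_of_negMulLog_le {κ : ℝ} (hκ : 0 < κ) (D : ℝ) :
    ∀ᶠ θ in 𝓝[>] (0 : ℝ), ∀ h : ℝ, h ≤ Real.negMulLog θ + D * θ →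
      Real.negMulLog h ≤ Real.negMulLog θ + D * θ → h ≤ (1 + κ) * θ := by
  have h1 : Tendsto (fun θ : ℝ => Real.negMulLog θ + D * θ) (𝓝[>] 0) (𝓝 0) := by
    have hc : Continuous fun θ : ℝ => Real.negMulLog θ + D * θ :=
      Real.continuous_negMulLog.add (continuous_const.mul continuous_id)
    have := hc.tendsto 0
    simp only [Real.negMulLog_zero, mul_zero, add_zero] at this
    exact this.mono_left nhdsWithin_le_nhds
  have h2 := Real.tendsto_log_nhdsGT_zero.eventually
    (eventually_lt_atBot (-((D + (1 + κ) * Real.log (1 + κ)) / κ)))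
  filter_upwards [h1.eventually (gt_mem_nhds (Real.exp_pos (-1))), h2, self_mem_nhdsWithin]
    with θ hθ1 hθ2 hθ0 h hh1 hh2
  have hθ : 0 < θ := hθ0
  by_contra! hc
  have h3 := (negMulLog_le_negMulLog (by positivity) hc.le (hh1.trans hθ1.le)).trans hh2
  rw [Real.negMulLog, Real.negMulLog, Real.log_mul (by positivity) hθ.ne'] at h3
  have h4 : θ * (κ * -Real.log θ) ≤ θ * (D + (1 + κ) * Real.log (1 + κ)) := by linarith
  have h5 := le_of_mul_le_mul_left h4 hθ
  rw [lt_neg, div_lt_iff₀ hκ] at hθ2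
  linarith

section Recovered

variable {n m : ℕ}

theorem recoveredA_eq {χ : Bits m × Bits m → ℂ}
    (hχ : traceSnd (vecMulVec χ (star χ)) = ((2 : ℂ) ^ m)⁻¹ • 1) (V : Matrix (Phys n m) (Bits n) ℂ)
    (R : Recovery n m) (σ : Matrix (Bits n) (Bits n) ℂ) :
    recoveredA V R σ = ((2 : ℂ) ^ m)⁻¹ • (opOf χ (R.op * V) *
      (σ ⊗ₖ (1 : Matrix (Bits m) (Bits m) ℂ)) * (opOf χ (R.op * V))ᴴ) := by
  rw [← traceSnd_mul_conjTranspose hχ, recoveredA, conjTranspose_mul]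
  simp only [Matrix.mul_assoc]

end Recovered

namespace SkewedStabilizerCode

variable {n m : ℕ} (C : SkewedStabilizerCode n m)

theorem tendsto_recoveredA_skewRec_slope (σ : Matrix (Bits n) (Bits n) ℂ) :
    Tendsto (fun ε : ℝ => ε⁻¹ • (recoveredA (C.enc ε) (C.skewRec ε) σ -
      ((2 : ℂ) ^ m)⁻¹ • (σ ⊗ₖ (1 : Matrix (Bits m) (Bits m) ℂ)))) (𝓝[≠] 0)
      (𝓝 (((2 : ℂ) ^ m)⁻¹ • ((2 : ℂ)⁻¹ • (C.D * (σ ⊗ₖ (1 : Matrix (Bits m) (Bits m) ℂ)) +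
        (σ ⊗ₖ (1 : Matrix (Bits m) (Bits m) ℂ)) * C.D)))) := by
  set Z := σ ⊗ₖ (1 : Matrix (Bits m) (Bits m) ℂ)
  have h0 : Tendsto (fun ε : ℝ => ε⁻¹ • (Z - Z)) (𝓝[≠] 0) (𝓝 0) := by simp
  have h1 := tendsto_mul_slope (tendsto_mul_slope C.tendsto_skewEncOp_slope h0)
    (tendsto_conjTranspose_slope C.tendsto_skewEncOp_slope)
  rw [conjTranspose_one, Matrix.mul_one, Matrix.one_mul, Matrix.mul_zero, add_zero,
    Matrix.mul_one, conjTranspose_smul, C.D_isHermitian.eq, Matrix.smul_mul, Matrix.mul_smul] at h1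
  have h2 : star (2 : ℂ)⁻¹ = (2 : ℂ)⁻¹ := by simp
  rw [h2, ← smul_add] at h1
  refine (h1.const_smul ((2 : ℂ) ^ m)⁻¹).congr fun ε => ?_
  rw [recoveredA_eq C.flat_χ, ← smul_sub, smul_comm]
  rfl

/-- The difference of the channel to `A₁` from the identity is of higher order on the maximally
mixed state. -/
theorem eventually_hsSq_traceSnd_chState_le :
    ∀ᶠ ε in 𝓝[≠] (0 : ℝ), hsSq (traceSnd (chState (C.skewEnc ε)) -
      (((Fintype.card (Bits n) : ℝ)⁻¹ : ℝ) : ℂ) • 1) ≤ ε ^ 2 := by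
  let L : Matrix (Bits n × Bits m) (Bits n × Bits m) ℂ →ₗ[ℂ] Matrix (Bits n) (Bits n) ℂ :=
    { toFun := traceSnd
      map_add' := fun A B => by
        ext i j
        simp [traceSnd, Finset.sum_add_distrib]
      map_smul' := fun c A => traceSnd_smul c A }
  have h1 := tendsto_linear_slope L (LinearMap.continuous_of_finiteDimensional _)
    (C.tendsto_recoveredA_skewRec_slope 1)
  -- The first-order change on the maximally mixed input is proportional to the partial trace of D,
  -- which vanishes; the constant 1 in the bound is then available for small ε.
  have h2 : L (((2 : ℂ) ^ m)⁻¹ • ((2 : ℂ)⁻¹ • (C.D * ((1 : Matrix (Bits n) (Bits n) ℂ) ⊗ₖ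
      (1 : Matrix (Bits m) (Bits m) ℂ)) + ((1 : Matrix (Bits n) (Bits n) ℂ) ⊗ₖ
      (1 : Matrix (Bits m) (Bits m) ℂ)) * C.D))) = 0 := by
    rw [one_kronecker_one, Matrix.mul_one, Matrix.one_mul, map_smul, map_smul, map_add]
    change _ • _ • (traceSnd C.D + traceSnd C.D) = _
    rw [traceSnd_D]
    simp
  rw [h2] at h1
  have h3 := ((continuous_hsSq.tendsto _).comp (h1.const_smul ((2 : ℂ) ^ n)⁻¹))
  have h4 : hsSq (((2 : ℂ) ^ n)⁻¹ • (0 : Matrix (Bits n) (Bits n) ℂ)) = 0 := by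
    simp [hsSq]
  rw [h4] at h3
  filter_upwards [h3.eventually (gt_mem_nhds one_pos), self_mem_nhdsWithin] with ε hε hε0
  have hε0' : ε ≠ 0 := hε0
  have h5 : traceSnd (chState (C.skewEnc ε)) - (((Fintype.card (Bits n) : ℝ)⁻¹ : ℝ) : ℂ) • 1 =
      (ε : ℂ) • (((2 : ℂ) ^ n)⁻¹ • (ε⁻¹ • (L (recoveredA (C.enc ε) (C.skewRec ε) 1) -
        L (((2 : ℂ) ^ m)⁻¹ • ((1 : Matrix (Bits n) (Bits n) ℂ) ⊗ₖ
          (1 : Matrix (Bits m) (Bits m) ℂ)))))) := by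
    have h6 : L (((2 : ℂ) ^ m)⁻¹ • ((1 : Matrix (Bits n) (Bits n) ℂ) ⊗ₖ
          (1 : Matrix (Bits m) (Bits m) ℂ))) = 1 := by
      rw [map_smul]
      change _ • traceSnd _ = _
      rw [traceSnd_kronecker, trace_one, card_bits, smul_smul, inv_mul_cancel₀ (by positivity),
        one_smul]
    have h7 : L (recoveredA (C.enc ε) (C.skewRec ε) 1) =
        ∑ q, block (C.skewEnc ε) q * (block (C.skewEnc ε) q)ᴴ := by
      change recoveredA₁ _ _ _ = _
      rw [recoveredA₁_eq]
      simp only [Matrix.mul_one]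
      rfl
    have h8 : ∀ Z : Matrix (Bits n) (Bits n) ℂ, (ε : ℂ) • (ε⁻¹ • Z) = Z := fun Z => by
      rw [Complex.coe_smul, smul_smul, mul_inv_cancel₀ hε0', one_smul]
    rw [h6, h7, traceSnd_chState, smul_comm (ε : ℂ), h8, smul_sub]
    simp
  rw [h5, hsSq_smul, Complex.normSq_ofReal]
  have h8 : hsSq (((2 : ℂ) ^ n)⁻¹ • (ε⁻¹ • (L (recoveredA (C.enc ε) (C.skewRec ε) 1) -
        L (((2 : ℂ) ^ m)⁻¹ • ((1 : Matrix (Bits n) (Bits n) ℂ) ⊗ₖ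
          (1 : Matrix (Bits m) (Bits m) ℂ)))))) < 1 := hε
  nlinarith [mul_self_nonneg ε]

/-- The largest eigenvalue of the Choi operator of an optimal recovery. -/
theorem eventually_one_sub_eigenvalue_le {c : ℝ} (hc : 0 < c) :
    ∀ᶠ ε in 𝓝[≠] (0 : ℝ), ∀ R : Recovery n m, IsOptimalRecovery (C.enc ε) R → ∀ i,
      (∀ j, (chState_posSemidef (R.op * C.enc ε)).isHermitian.eigenvalues j ≤
        (chState_posSemidef (R.op * C.enc ε)).isHermitian.eigenvalues i) →
      1 - (chState_posSemidef (R.op * C.enc ε)).isHermitian.eigenvalues i ≤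
        ε ^ 2 * (C.gap + c) := by
  have hg := C.gap_nonneg
  -- Half of the slack keeps the comparison scale positive even when the gap vanishes; the other
  -- half is spent on the factor 1 + κ.
  set g := C.gap + c / 2 with hg'
  have hg0 : 0 < g := by positivity
  have hθ : Tendsto (fun ε : ℝ => ε ^ 2 * g) (𝓝[≠] 0) (𝓝[>] 0) := by
    refine tendsto_nhdsWithin_iff.mpr ⟨?_, ?_⟩
    · have h : Continuous fun ε : ℝ => ε ^ 2 * g := by fun_prop
      have := h.tendsto 0
      rw [zero_pow two_ne_zero, zero_mul] at this
      exact this.mono_left nhdsWithin_le_nhds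
    · filter_upwards [self_mem_nhdsWithin] with ε hε
      have : ε ≠ 0 := hε
      exact Set.mem_Ioi.mpr (by positivity)
  have hκ : 0 < c / 2 / g := by positivity
  -- Collects all O(θ) errors at θ = ε² g: the remainder in the entropy upper bound, and the entropy
  -- deficit of the output on A₁, which is at most d ε².
  set D : ℝ := Fintype.card (Bits n × Bits n) + 1 + Fintype.card (Bits n) / g with hD
  have hθ1 : ∀ᶠ θ in 𝓝[>] (0 : ℝ), θ ≤ 1 :=
    nhdsWithin_le_nhds (Iic_mem_nhds one_pos)
  filter_upwards [hθ.eventually (eventually_le_of_negMulLog_le hκ D), hθ.eventually hθ1,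
    C.eventually_hsSq_traceSnd_chState_le, C.eventually_one_sub_fid_skewEnc_le (half_pos hc),
    self_mem_nhdsWithin] with ε h1 h2 h3 h4 hε0 R hR i hi
  have hε0' : ε ≠ 0 := hε0
  rw [← hg'] at h4
  have hθ0 : 0 < ε ^ 2 * g := by positivity
  have hY := C.op_mul_enc_isometry R ε
  have hω := chState_posSemidef (R.op * C.enc ε)
  have hω' := chState_posSemidef (C.skewEnc ε)
  -- Optimality is used only against the reference recovery. Together with S(A₁) ≤ ln d it bounds
  -- the entropy of the optimal Choi state by that of the reference, up to O(ε²).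
  have hopt := hR (C.skewRec ε)
  rw [coherentInfo, coherentInfo, channelState_eq, channelState_eq] at hopt
  change entropy (traceSnd (chState (C.skewEnc ε))) - entropy (chState (C.skewEnc ε)) ≤ _ at hopt
  have h5 := entropy_le_log_card (traceSnd_posSemidef hω)
    (by rw [trace_traceSnd, trace_chState hY])
  have h6 := log_card_sub_le_entropy (traceSnd_posSemidef hω')
    (by rw [trace_traceSnd, trace_chState (C.skewEnc_isometry ε)])
  obtain ⟨j, hj⟩ := Finite.exists_max hω'.isHermitian.eigenvalues
  have h7 := entropy_le_of_one_sub_le hω' (trace_chState (C.skewEnc_isometry ε)) hθ0 h2 (i := j)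
    (by linarith [fid_le_of_eigenvalues_le hj])
  have h8 : (Fintype.card (Bits n) : ℝ) * hsSq (traceSnd (chState (C.skewEnc ε)) -
      (((Fintype.card (Bits n) : ℝ)⁻¹ : ℝ) : ℂ) • 1) ≤
      Fintype.card (Bits n) / g * (ε ^ 2 * g) := by
    have : (Fintype.card (Bits n) : ℝ) / g * (ε ^ 2 * g) = Fintype.card (Bits n) * ε ^ 2 := by
      field_simp
    rw [this]
    gcongr
  have h9 : entropy (chState (R.op * C.enc ε)) ≤
      Real.negMulLog (ε ^ 2 * g) + D * (ε ^ 2 * g) := by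
    rw [hD]
    linarith
  have h10 := h1 _ ((one_sub_le_entropy hω (trace_chState hY) hi).trans h9)
    ((negMulLog_le_entropy hω (trace_chState hY) i).trans h9)
  refine h10.trans (le_of_eq ?_)
  have : (1 + c / 2 / g) * (ε ^ 2 * g) = ε ^ 2 * (g + c / 2) := by
    field_simp
  rw [this, hg']
  ring

end SkewedStabilizerCode

end SkewedCode

namespace SkewedCode

/-! ### Rank-one perturbations and polar decomposition -/

section Polar

variable {k : Type} [Fintype k]

theorem hsSq_add_le {l : Type} [Fintype l] (A B : Matrix k l ℂ) :
    hsSq (A + B) ≤ 2 * hsSq A + 2 * hsSq B := by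
  simp only [hsSq, Finset.mul_sum, ← Finset.sum_add_distrib]
  refine Finset.sum_le_sum fun i _ => Finset.sum_le_sum fun j _ => ?_
  rw [Matrix.add_apply, Complex.normSq_apply, Complex.normSq_apply, Complex.normSq_apply,
    Complex.add_re, Complex.add_im]
  nlinarith [sq_nonneg ((A i j).re - (B i j).re), sq_nonneg ((A i j).im - (B i j).im)]

variable [DecidableEq k]

/-- Removing an eigenvector is compression by the complementary projection. -/
theorem posSemidef_sub_vecMulVec {ρ : Matrix k k ℂ} (hρ : ρ.PosSemidef) {v : k → ℂ}
    (hv : star v ⬝ᵥ v = 1) {p : ℝ} (h : ρ *ᵥ v = (p : ℂ) • v) :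
    (ρ - (p : ℂ) • vecMulVec v (star v)).PosSemidef := by
  set P := vecMulVec v (star v) with hP
  have h1 : ρ * P = (p : ℂ) • P := by
    rw [hP, mul_vecMulVec, h, smul_vecMulVec]
  have hPh : Pᴴ = P := by rw [hP, conjTranspose_vecMulVec, star_star]
  have h2 : P * ρ = (p : ℂ) • P := by
    have := congrArg Matrix.conjTranspose h1
    rw [conjTranspose_mul, hPh, hρ.isHermitian.eq, conjTranspose_smul, hPh] at this
    rw [this]
    simp
  have h3 : P * P = P := by
    rw [hP, vecMulVec_mul_vecMulVec, hv, one_smul]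
  have h4 := hρ.mul_mul_conjTranspose_same (1 - P)
  have h5 : (1 - P) * ρ * (1 - P)ᴴ = ρ - (p : ℂ) • P := by
    rw [conjTranspose_sub, conjTranspose_one, hPh, sub_mul, one_mul, h2, mul_sub, mul_one, sub_mul,
      h1, Matrix.smul_mul, h3]
    abel
  rwa [h5] at h4

theorem hsSq_le_sq_of_trace_eq {ρ : Matrix k k ℂ} (hρ : ρ.PosSemidef) {t : ℝ}
    (ht : trace ρ = (t : ℂ)) : hsSq ρ ≤ t ^ 2 := by
  have h1 : ∑ i, hρ.isHermitian.eigenvalues i = t := by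
    have h := hρ.isHermitian.trace_eq_sum_eigenvalues
    rw [ht] at h
    have h2 := congrArg Complex.re h
    simpa using h2.symm
  have h2 := hsSq_sub_smul_one_eq_sum hρ.isHermitian 0
  simp only [Complex.ofReal_zero, zero_smul, sub_zero] at h2
  rw [h2, ← h1]
  exact Finset.sum_sq_le_sq_sum_of_nonneg fun i _ => hρ.eigenvalues_nonneg i

/-- Polar decomposition, with the distance of the positive part from the identity. -/
theorem exists_polar (K : Matrix k k ℂ)
    (hK : ∀ i, 0 < (isHermitian_conjTranspose_mul_self K).eigenvalues i)
    (hG : trace (Kᴴ * K) = Fintype.card k) :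
    ∃ u S : Matrix k k ℂ, uᴴ * u = 1 ∧ uᴴ * K = S ∧ Kᴴ * u = S ∧
      hsSq (S - 1) ≤ hsSq (Kᴴ * K - 1) ∧ hsSq S = Fintype.card k ∧
      Fintype.card k - hsSq (Kᴴ * K - 1) / 2 ≤ (trace S).re := by
  set G := Kᴴ * K with hGdef
  have hGh : G.IsHermitian := isHermitian_conjTranspose_mul_self K
  have hc := fun f => continuousOn_spectrum f G
  -- This is (KᴴK)^(−1/2); the unitary is K J and the positive part is the square root of KᴴK.
  set J := cfc (fun x => (Real.sqrt x)⁻¹) G with hJ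
  have hJh : Jᴴ = J := (cfc_predicate (R := ℝ) (fun x => (Real.sqrt x)⁻¹) G : IsSelfAdjoint J)
  have hJG : J * G = cfc Real.sqrt G := by
    have h1 : J * G = J * cfc (fun x : ℝ => x) G := by rw [cfc_id' ℝ G hGh.isSelfAdjoint]
    rw [h1, hJ, ← cfc_mul _ _ G (hc _) (hc _)]
    congr 1
    funext x
    rcases le_or_gt 0 x with hx | hx
    · rcases hx.eq_or_lt with rfl | hx'
      · simp
      · have : Real.sqrt x ≠ 0 := (Real.sqrt_pos.mpr hx').ne'
        field_simp
        rw [Real.sq_sqrt hx]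
    · simp [Real.sqrt_eq_zero_of_nonpos hx.le]
  have hSh : (cfc Real.sqrt G)ᴴ = cfc Real.sqrt G :=
    (cfc_predicate (R := ℝ) Real.sqrt G : IsSelfAdjoint (cfc Real.sqrt G))
  have hsp : ∀ x ∈ spectrum ℝ G, 0 < x := by
    rw [hGh.spectrum_real_eq_range_eigenvalues, Set.forall_mem_range]
    exact hK
  have htr : ∑ i, hGh.eigenvalues i = Fintype.card k := by
    have h := hGh.trace_eq_sum_eigenvalues
    rw [hG] at h
    have h2 := congrArg Complex.re h
    simpa using h2.symm
  have hd : hsSq (G - 1) = ∑ i, (hGh.eigenvalues i - 1) ^ 2 := by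
    have := hsSq_sub_smul_one_eq_sum hGh 1
    rwa [Complex.ofReal_one, one_smul] at this
  refine ⟨K * J, cfc Real.sqrt G, ?_, ?_, ?_, ?_, ?_, ?_⟩
  · rw [conjTranspose_mul, hJh, Matrix.mul_assoc, ← Matrix.mul_assoc Kᴴ, ← hGdef,
      ← Matrix.mul_assoc, hJG, hJ, ← cfc_mul _ _ G (hc _) (hc _)]
    rw [cfc_congr (g := fun _ => (1 : ℝ)), cfc_const_one ℝ G hGh.isSelfAdjoint]
    intro x hx
    exact mul_inv_cancel₀ (Real.sqrt_pos.mpr (hsp x hx)).ne'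
  · rw [conjTranspose_mul, hJh, Matrix.mul_assoc, ← hGdef, hJG]
  · rw [← Matrix.mul_assoc, ← hGdef, ← hSh, ← hJG, conjTranspose_mul, hJh, hGh.eq]
  · have h1 : cfc Real.sqrt G - 1 = cfc (fun x => Real.sqrt x - 1) G := by
      rw [cfc_sub Real.sqrt (fun _ => 1) G (hc _) (hc _), cfc_const_one ℝ G hGh.isSelfAdjoint]
    rw [h1, hsSq_cfc _ hGh, hd]
    refine Finset.sum_le_sum fun i _ => ?_
    set x := hGh.eigenvalues i
    have hx : 0 < x := hK i
    have h2 := Real.sq_sqrt hx.le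
    have h3 := Real.sqrt_nonneg x
    have h4 : (x - 1) ^ 2 = (Real.sqrt x - 1) ^ 2 * (Real.sqrt x + 1) ^ 2 := by
      rw [← mul_pow]
      congr 1
      linear_combination -h2
    rw [h4]
    exact le_mul_of_one_le_right (sq_nonneg _) (by nlinarith)
  · rw [hsSq_cfc _ hGh, ← htr]
    exact Finset.sum_congr rfl fun i _ => Real.sq_sqrt (hK i).le
  · rw [trace_cfc _ hGh, ← Complex.ofReal_sum, Complex.ofReal_re, hd, Finset.sum_div]
    -- The identity √x = (x + 1)/2 − (√x − 1)²/2 shows that the trace of the positive part falls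
    -- short of the dimension only at second order.
    have h1 : ∀ i, (hGh.eigenvalues i + 1) / 2 - (hGh.eigenvalues i - 1) ^ 2 / 2 ≤
        Real.sqrt (hGh.eigenvalues i) := by
      intro i
      set x := hGh.eigenvalues i
      have hx : 0 < x := hK i
      have h2 := Real.sq_sqrt hx.le
      have h3 := Real.sqrt_nonneg x
      have h4 : (x - 1) ^ 2 = (Real.sqrt x - 1) ^ 2 * (Real.sqrt x + 1) ^ 2 := by
        rw [← mul_pow]
        congr 1
        linear_combination -h2
      have h5 : (Real.sqrt x - 1) ^ 2 ≤ (x - 1) ^ 2 := by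
        rw [h4]
        exact le_mul_of_one_le_right (sq_nonneg _) (by nlinarith)
      nlinarith
    have h2 := Finset.sum_le_sum fun i (_ : i ∈ Finset.univ) => h1 i
    rw [Finset.sum_sub_distrib, ← Finset.sum_div, Finset.sum_add_distrib, htr] at h2
    simp at h2
    linarith

/-- The operator inequality bounds the eigenvalues above by 1/(1 − h) ≤ 1 + 2h. As the trace is
fixed, an eigenvalue below 1 is compensated by the excess of the others, which yields the lower
bound. -/
theorem abs_eigenvalues_sub_one_le {G : Matrix k k ℂ} (hG : G.IsHermitian)
    (htr : trace G = Fintype.card k) {h : ℝ} (hh : h ≤ 1 / 2)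
    (hp : (1 - ((1 - h : ℝ) : ℂ) • G).PosSemidef) (i : k) :
    |hG.eigenvalues i - 1| ≤ 2 * Fintype.card k * h := by
  have hsum : ∑ i, hG.eigenvalues i = Fintype.card k := by
    have h := hG.trace_eq_sum_eigenvalues
    rw [htr] at h
    have h2 := congrArg Complex.re h
    simpa using h2.symm
  have hp0 : 0 < 1 - h := by linarith
  have h1 : (((1 - h)⁻¹ : ℝ) : ℂ) • (1 : Matrix k k ℂ) - G =
      ((1 - h)⁻¹ : ℝ) • (1 - ((1 - h : ℝ) : ℂ) • G) := by
    rw [smul_sub, ← Complex.coe_smul, ← Complex.coe_smul, smul_smul, ← Complex.ofReal_mul,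
      inv_mul_cancel₀ hp0.ne', Complex.ofReal_one, one_smul]
  have h2 := hp.smul (inv_nonneg.mpr hp0.le)
  rw [← h1, posSemidef_smul_one_sub_iff hG] at h2
  have h3 : (1 - h)⁻¹ - 1 = h * (1 - h)⁻¹ := by
    field_simp
    ring
  have hk : (1 : ℝ) ≤ Fintype.card k := by
    have : Nonempty k := ⟨i⟩
    exact_mod_cast Fintype.card_pos
  have hh0 : 0 ≤ h := by
    by_contra hn
    have h4 : (1 - h)⁻¹ < 1 := inv_lt_one_of_one_lt₀ (by linarith)
    have h5 : ∑ i, hG.eigenvalues i < ∑ _i : k, (1 : ℝ) :=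
      Finset.sum_lt_sum_of_nonempty ⟨i, Finset.mem_univ i⟩ fun j _ => (h2 j).trans_lt h4
    rw [hsum] at h5
    simp at h5
  have h4 : h * (1 - h)⁻¹ ≤ h * 2 := by
    refine mul_le_mul_of_nonneg_left ?_ hh0
    rw [inv_le_comm₀ hp0 two_pos]
    linarith
  have h5 : ∀ j, hG.eigenvalues j - 1 ≤ 2 * h := fun j => by linarith [h2 j]
  rw [abs_le]
  constructor
  · have h6 : ∑ j ∈ Finset.univ.erase i, (hG.eigenvalues j - 1) ≤
        ∑ _j ∈ Finset.univ.erase i, 2 * h := Finset.sum_le_sum fun j _ => h5 j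
    have h7 : ∑ j, (hG.eigenvalues j - 1) = 0 := by
      rw [Finset.sum_sub_distrib, hsum]
      simp
    rw [← Finset.add_sum_erase _ _ (Finset.mem_univ i)] at h7
    have h8 : ∑ _j ∈ Finset.univ.erase i, 2 * h ≤ Fintype.card k * (2 * h) := by
      rw [Finset.sum_const, nsmul_eq_mul]
      have : ((Finset.univ.erase i).card : ℝ) ≤ Fintype.card k := by
        exact_mod_cast Finset.card_le_univ _
      gcongr
    linarith
  · nlinarith [h5 i]

end Polar

/-! ### Channels from Choi operators -/

section ChoiMap

variable {k : Type} [Fintype k]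

/-- The linear map with Choi operator `Ω`. -/
def choiMap (Ω : Matrix (k × k) (k × k) ℂ) (σ : Matrix k k ℂ) : Matrix k k ℂ :=
  Matrix.of fun i i' => ∑ j, ∑ j', σ j j' * Ω (i, j) (i', j')

theorem hsSq_choiMap_le (Ω : Matrix (k × k) (k × k) ℂ) (σ : Matrix k k ℂ) :
    hsSq (choiMap Ω σ) ≤ hsSq σ * hsSq Ω := by
  have h : ∀ i i', Complex.normSq (choiMap Ω σ i i') ≤
      hsSq σ * ∑ j, ∑ j', Complex.normSq (Ω (i, j) (i', j')) := by
    intro i i'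
    simp only [hsSq, Complex.normSq_eq_norm_sq, choiMap, of_apply, ← Fintype.sum_prod_type']
    calc _ ≤ (∑ x : k × k, ‖σ x.1 x.2‖ * ‖Ω (i, x.1) (i', x.2)‖) ^ 2 := by
          gcongr
          refine (norm_sum_le _ _).trans (Finset.sum_le_sum fun a _ => ?_)
          rw [norm_mul]
      _ ≤ _ := Finset.sum_mul_sq_le_sq_mul_sq _ _ _
  refine (Finset.sum_le_sum fun i _ => Finset.sum_le_sum fun i' _ => h i i').trans (le_of_eq ?_)
  simp only [← Finset.mul_sum]
  congr 1
  simp only [hsSq, Fintype.sum_prod_type]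
  refine Finset.sum_congr rfl fun i _ => ?_
  rw [Finset.sum_comm]

theorem choiMap_vecMulVec (V σ : Matrix k k ℂ) :
    choiMap (vecMulVec (fun x => V x.1 x.2) (star fun x : k × k => V x.1 x.2)) σ = V * σ * Vᴴ := by
  ext i i'
  simp only [choiMap, of_apply, vecMulVec_apply, Pi.star_apply, mul_apply, conjTranspose_apply,
    Finset.sum_mul]
  rw [Finset.sum_comm]
  refine Finset.sum_congr rfl fun j _ => Finset.sum_congr rfl fun j' _ => ?_
  ring

theorem choiMap_add (Ω Ω' : Matrix (k × k) (k × k) ℂ) (σ : Matrix k k ℂ) :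
    choiMap (Ω + Ω') σ = choiMap Ω σ + choiMap Ω' σ := by
  ext i i'
  simp only [choiMap, of_apply, Matrix.add_apply, mul_add, Finset.sum_add_distrib]

theorem choiMap_smul (c : ℂ) (Ω : Matrix (k × k) (k × k) ℂ) (σ : Matrix k k ℂ) :
    choiMap (c • Ω) σ = c • choiMap Ω σ := by
  ext i i'
  simp only [choiMap, of_apply, Matrix.smul_apply, smul_eq_mul, Finset.mul_sum]
  refine Finset.sum_congr rfl fun j _ => Finset.sum_congr rfl fun j' _ => ?_
  ring

theorem choiMap_sum {ι : Type} (s : Finset ι) (Ω : ι → Matrix (k × k) (k × k) ℂ)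
    (σ : Matrix k k ℂ) : choiMap (∑ q ∈ s, Ω q) σ = ∑ q ∈ s, choiMap (Ω q) σ := by
  classical
  induction s using Finset.induction_on with
  | empty =>
    ext i i'
    simp [choiMap]
  | insert a s ha ih => rw [Finset.sum_insert ha, Finset.sum_insert ha, choiMap_add, ih]

end ChoiMap

/-! ### From a large top eigenvalue to a nearby unitary channel -/

section Correction

variable {n m : ℕ}

/-- The channel to `A₁` of the encoding `Y`. -/
noncomputable def channel (Y : Matrix (Phys n m) (Bits n) ℂ) (σ : Matrix (Bits n) (Bits n) ℂ) :
    Matrix (Bits n) (Bits n) ℂ :=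
  ∑ q, block Y q * σ * (block Y q)ᴴ

theorem channel_eq_choiMap (Y : Matrix (Phys n m) (Bits n) ℂ) (σ : Matrix (Bits n) (Bits n) ℂ) :
    channel Y σ = (2 : ℂ) ^ n • choiMap (chState Y) σ := by
  rw [chState, choiMap_smul, choiMap_sum, smul_smul, mul_inv_cancel₀ (by positivity), one_smul,
    channel]
  exact Finset.sum_congr rfl fun q _ => (choiMap_vecMulVec _ _).symm

/-- Positivity of the remainder, tested on the maximally entangled vector twisted by `u`. -/
theorem le_sum_normSq_trace (Y : Matrix (Phys n m) (Bits n) ℂ) {V u : Matrix (Bits n) (Bits n) ℂ}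
    {p : ℝ} (hΩ : (chState Y - (p : ℂ) • vecMulVec (fun x : Bits n × Bits n => V x.1 x.2)
      (star fun x : Bits n × Bits n => V x.1 x.2)).PosSemidef) :
    2 ^ n * (p * Complex.normSq (trace (Vᴴ * u))) ≤
      ∑ q, Complex.normSq (trace (uᴴ * block Y q)) := by
  have h1 := hΩ.dotProduct_mulVec_nonneg fun x : Bits n × Bits n => u x.1 x.2
  have h2 : (star fun x : Bits n × Bits n => V x.1 x.2) ⬝ᵥ (fun x => u x.1 x.2) =
      trace (Vᴴ * u) := by
    simp only [trace, diag, mul_apply, conjTranspose_apply, dotProduct, Pi.star_apply,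
      Fintype.sum_prod_type]
    rw [Finset.sum_comm]
  have h3 : star (fun x : Bits n × Bits n => u x.1 x.2) ⬝ᵥ (fun x => V x.1 x.2) =
      star (trace (Vᴴ * u)) := by
    rw [← h2, star_dotProduct]
  rw [sub_mulVec, dotProduct_sub, dotProduct_chState_mulVec, smul_mulVec, vecMulVec_mulVec,
    dotProduct_smul, dotProduct_smul, h2, h3] at h1
  have h4 : ((2 : ℂ) ^ n)⁻¹ * ∑ q, (Complex.normSq (trace (uᴴ * block Y q)) : ℂ) -
      (p : ℂ) • MulOpposite.op (trace (Vᴴ * u)) • star (trace (Vᴴ * u)) =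
      (((2 : ℝ) ^ n)⁻¹ * ∑ q, Complex.normSq (trace (uᴴ * block Y q)) -
        p * Complex.normSq (trace (Vᴴ * u)) : ℝ) := by
    push_cast
    rw [← Complex.mul_conj]
    simp only [MulOpposite.smul_eq_mul_unop, MulOpposite.unop_op, smul_eq_mul, Complex.star_def]
    ring
  rw [h4, Complex.zero_le_real, sub_nonneg, le_inv_mul_iff₀ (by positivity)] at h1
  exact h1

/-- If the Choi operator is close to a rank-one operator, the channel is close to a unitary one. -/
theorem exists_unitary_of_top {Y : Matrix (Phys n m) (Bits n) ℂ} (hY : Yᴴ * Y = 1)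
    {V : Matrix (Bits n) (Bits n) ℂ} (hVtr : trace (Vᴴ * V) = 1) {h : ℝ} (hh0 : 0 ≤ h)
    (hsmall : 2 * 2 ^ n * h ≤ 1 / 2)
    (hΩ : (chState Y - ((1 - h : ℝ) : ℂ) • vecMulVec (fun x : Bits n × Bits n => V x.1 x.2)
      (star fun x : Bits n × Bits n => V x.1 x.2)).PosSemidef) :
    ∃ u : Matrix (Bits n) (Bits n) ℂ, uᴴ * u = 1 ∧
      1 - ((2 : ℝ) ^ n)⁻¹ ^ 2 * ∑ q, Complex.normSq (trace (uᴴ * block Y q)) ≤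
        h + 70 * (2 ^ n) ^ 4 * h ^ 2 ∧
      ∀ σ : Matrix (Bits n) (Bits n) ℂ, hsSq σ ≤ 1 →
        hsSq (uᴴ * channel Y σ * u - σ) ≤ 70 * (2 ^ n) ^ 4 * h ^ 2 := by
  set d : ℝ := 2 ^ n with hd
  have hd1 : 1 ≤ d := one_le_pow₀ one_le_two
  have hcard : (Fintype.card (Bits n) : ℝ) = d := by simp [hd]
  have hdc : (d : ℂ) = 2 ^ n := by simp [hd]
  have hh1 : h ≤ 1 / 4 := by nlinarith
  have hle := fun u => le_sum_normSq_trace Y (u := u) hΩ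
  have hv1 : star (fun x : Bits n × Bits n => V x.1 x.2) ⬝ᵥ (fun x => V x.1 x.2) = 1 := by
    rw [← hVtr]
    simp only [trace, diag, mul_apply, conjTranspose_apply, dotProduct, Pi.star_apply,
      Fintype.sum_prod_type]
    rw [Finset.sum_comm]
  have h3 : traceFst (vecMulVec (fun x : Bits n × Bits n => V x.1 x.2)
      (star fun x : Bits n × Bits n => V x.1 x.2)) = (Vᴴ * V)ᵀ := by
    ext j j'
    simp only [traceFst, of_apply, vecMulVec_apply, Pi.star_apply, transpose_apply, mul_apply,
      conjTranspose_apply]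
    exact Finset.sum_congr rfl fun _ _ => mul_comm _ _
  have hchoi := fun σ => choiMap_vecMulVec V σ
  generalize (fun x : Bits n × Bits n => V x.1 x.2) = v at *
  set Ω := chState Y - ((1 - h : ℝ) : ℂ) • vecMulVec v (star v) with hΩd
  -- The remainder is positive with trace h, so its Hilbert-Schmidt norm is at most h.
  have hΩtr : trace Ω = (h : ℂ) := by
    rw [hΩd, trace_sub, trace_chState hY, trace_smul, trace_vecMulVec, dotProduct_comm, hv1]
    push_cast
    simp
  have hΩs := hsSq_le_sq_of_trace_eq hΩ hΩtr
  have hs : (Real.sqrt d : ℂ) * Real.sqrt d = d := by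
    rw [← Complex.ofReal_mul, Real.mul_self_sqrt (by positivity)]
  -- Normalized so that K is unitary when the top eigenvector is maximally entangled; in general its
  -- polar unitary serves as the correction.
  set K : Matrix (Bits n) (Bits n) ℂ := (Real.sqrt d : ℂ) • V with hK
  have hKh : Kᴴ = (Real.sqrt d : ℂ) • Vᴴ := by
    rw [hK, conjTranspose_smul, Complex.star_def, Complex.conj_ofReal]
  have hG : Kᴴ * K = (d : ℂ) • (Vᴴ * V) := by
    rw [hKh, hK, Matrix.smul_mul, Matrix.mul_smul, smul_smul, hs]
  have hGtr : trace (Kᴴ * K) = Fintype.card (Bits n) := by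
    rw [hG, trace_smul, hVtr, card_bits, hdc, smul_eq_mul, mul_one]
  -- Trace preservation fixes the marginal of the Choi state on r to be 1/d. Positivity of the
  -- marginal of the remainder then gives (1 − h) KᴴK ≤ 1.
  have hGp : (1 - ((1 - h : ℝ) : ℂ) • (Kᴴ * K)).PosSemidef := by
    have h1 := (traceFst_posSemidef hΩ).transpose.smul (by positivity : (0 : ℝ) ≤ d)
    have h2 : d • (traceFst Ω)ᵀ = 1 - ((1 - h : ℝ) : ℂ) • (Kᴴ * K) := by
      have h4 : traceFst Ω = ((2 : ℂ) ^ n)⁻¹ • 1 - ((1 - h : ℝ) : ℂ) • (Vᴴ * V)ᵀ := by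
        rw [hΩd, traceFst_sub, traceFst_chState hY, ← h3]
        congr 1
        ext j j'
        simp [traceFst, Finset.mul_sum]
      rw [h4, hG, transpose_sub, transpose_smul, transpose_smul, transpose_one, transpose_transpose,
        ← Complex.coe_smul, smul_sub, smul_smul, hdc, mul_inv_cancel₀ (by positivity), one_smul,
        smul_comm]
    rwa [h2] at h1
  have hGe := abs_eigenvalues_sub_one_le (isHermitian_conjTranspose_mul_self K) hGtr
    (by linarith) hGp
  rw [hcard] at hGe
  have hGs : hsSq (Kᴴ * K - 1) ≤ 4 * d ^ 3 * h ^ 2 := by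
    have h1 := hsSq_sub_smul_one_eq_sum (isHermitian_conjTranspose_mul_self K) 1
    rw [Complex.ofReal_one, one_smul] at h1
    rw [h1]
    refine (Finset.sum_le_sum fun j _ => sq_le_sq' (neg_le_of_abs_le (hGe j))
      (le_of_abs_le (hGe j))).trans (le_of_eq ?_)
    rw [Finset.sum_const, Finset.card_univ, nsmul_eq_mul, hcard]
    ring
  obtain ⟨u, S, hu, huK, hKu, hS1, hSs, hStr⟩ := exists_polar K
    (fun j => by linarith [neg_le_of_abs_le (hGe j)]) hGtr
  rw [hcard] at hSs hStr
  refine ⟨u, hu, ?_, fun σ hσ => ?_⟩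
  · have h1 := hle u
    have h2 : d * Complex.normSq (trace (Vᴴ * u)) = Complex.normSq (trace S) := by
      rw [← hKu, hKh, Matrix.smul_mul, trace_smul, smul_eq_mul, Complex.normSq_mul,
        Complex.normSq_ofReal, Real.mul_self_sqrt (by positivity)]
    have h3 : (trace S).re * (trace S).re ≤ Complex.normSq (trace S) := by
      rw [Complex.normSq_apply]
      linarith [mul_self_nonneg (trace S).im]
    -- The non-unitarity of K enters the fidelity only at order h², so the infidelity after
    -- correction is h to first order.
    have h4 : d - 2 * d ^ 3 * h ^ 2 ≤ (trace S).re := by linarith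
    have h5 : d ^ 2 - 4 * d ^ 4 * h ^ 2 ≤ Complex.normSq (trace S) := by
      nlinarith [sq_nonneg ((trace S).re - d)]
    have h6 : (1 - h) * (d ^ 2 - 4 * d ^ 4 * h ^ 2) ≤
        ∑ q, Complex.normSq (trace (uᴴ * block Y q)) := by
      refine le_trans ?_ h1
      have h7 := mul_le_mul_of_nonneg_left h5 (by linarith : 0 ≤ 1 - h)
      rw [← h2] at h7
      linarith
    have h8 := mul_le_mul_of_nonneg_left h6 (by positivity : 0 ≤ d⁻¹ ^ 2)
    have h9 : d⁻¹ ^ 2 * ((1 - h) * (d ^ 2 - 4 * d ^ 4 * h ^ 2)) =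
        (1 - h) * (1 - 4 * d ^ 2 * h ^ 2) := by
      field_simp
    rw [h9] at h8
    have h10 : 4 * d ^ 2 * h ^ 2 ≤ 70 * d ^ 4 * h ^ 2 := by
      have : d ^ 2 ≤ d ^ 4 := pow_le_pow_right₀ hd1 (by norm_num)
      gcongr
      linarith [sq_nonneg d]
    have h11 : 0 ≤ h * (4 * d ^ 2 * h ^ 2) := by positivity
    linarith
  · have hN : uᴴ * channel Y σ * u - σ = ((S - 1) * σ * S + σ * (S - 1) +
        ((-h : ℝ) : ℂ) • (S * σ * S)) + uᴴ * ((d : ℂ) • choiMap Ω σ) * u := by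
      have h1 : chState Y = ((1 - h : ℝ) : ℂ) • vecMulVec v (star v) + Ω := by
        rw [hΩd]
        abel
      have h2 : (d : ℂ) • (V * σ * Vᴴ) = K * σ * Kᴴ := by
        rw [hKh, hK, Matrix.smul_mul, Matrix.smul_mul, Matrix.mul_smul, smul_smul, hs]
      have h3 : uᴴ * (K * σ * Kᴴ) * u = S * σ * S := by
        calc _ = (uᴴ * K) * σ * (Kᴴ * u) := by simp only [Matrix.mul_assoc]
          _ = _ := by rw [huK, hKu]
      rw [channel_eq_choiMap, ← hdc, h1, choiMap_add, choiMap_smul, hchoi, smul_add,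
        smul_comm, h2, mul_add, add_mul, Matrix.mul_smul, Matrix.smul_mul, h3]
      have h4 : ((1 - h : ℝ) : ℂ) = 1 - (h : ℂ) := by push_cast; rfl
      have h5 : (S - 1) * σ * S + σ * (S - 1) = S * σ * S - σ := by noncomm_ring
      rw [h4, h5]
      push_cast
      module
    have huu : uᴴᴴ * uᴴ = 1 := by
      rw [conjTranspose_conjTranspose]
      exact mul_eq_one_comm.mp hu
    have hE : hsSq (uᴴ * ((d : ℂ) • choiMap Ω σ) * u) ≤ d ^ 2 * h ^ 2 := by
      rw [Matrix.mul_assoc, hsSq_unitary_mul huu, ← hsSq_conjTranspose, conjTranspose_mul,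
        hsSq_unitary_mul huu, hsSq_conjTranspose, hsSq_smul, Complex.normSq_ofReal, ← sq]
      refine mul_le_mul_of_nonneg_left ?_ (sq_nonneg d)
      refine (hsSq_choiMap_le Ω σ).trans ?_
      calc hsSq σ * hsSq Ω ≤ 1 * hsSq Ω := mul_le_mul_of_nonneg_right hσ (hsSq_nonneg _)
        _ ≤ h ^ 2 := by rw [one_mul]; exact hΩs
    have hδ : hsSq (S - 1) ≤ 4 * d ^ 3 * h ^ 2 := hS1.trans hGs
    have hδ0 := hsSq_nonneg (S - 1)
    have e1 : hsSq ((S - 1) * σ * S) ≤ 4 * d ^ 4 * h ^ 2 := by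
      calc hsSq ((S - 1) * σ * S) ≤ hsSq ((S - 1) * σ) * hsSq S := hsSq_mul_le _ _
        _ ≤ (hsSq (S - 1) * hsSq σ) * hsSq S :=
            mul_le_mul_of_nonneg_right (hsSq_mul_le _ _) (hsSq_nonneg _)
        _ ≤ (4 * d ^ 3 * h ^ 2 * 1) * d := by
            rw [hSs]
            have := hsSq_nonneg σ
            gcongr
        _ = _ := by ring
    have e2 : hsSq (σ * (S - 1)) ≤ 4 * d ^ 4 * h ^ 2 := by
      calc hsSq (σ * (S - 1)) ≤ hsSq σ * hsSq (S - 1) := hsSq_mul_le _ _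
        _ ≤ 1 * (4 * d ^ 3 * h ^ 2) := by
            have := hsSq_nonneg σ
            gcongr
        _ ≤ _ := by
            have : d ^ 3 ≤ d ^ 4 := pow_le_pow_right₀ hd1 (by norm_num)
            rw [one_mul]
            gcongr
    have e3 : hsSq (((-h : ℝ) : ℂ) • (S * σ * S)) ≤ d ^ 4 * h ^ 2 := by
      rw [hsSq_smul, Complex.normSq_ofReal]
      have h1 : hsSq (S * σ * S) ≤ d ^ 4 := by
        calc hsSq (S * σ * S) ≤ hsSq (S * σ) * hsSq S := hsSq_mul_le _ _
          _ ≤ (hsSq S * hsSq σ) * hsSq S :=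
              mul_le_mul_of_nonneg_right (hsSq_mul_le _ _) (hsSq_nonneg _)
          _ ≤ (d * 1) * d := by
              rw [hSs]
              gcongr
          _ = d ^ 2 := by ring
          _ ≤ d ^ 4 := pow_le_pow_right₀ hd1 (by norm_num)
      have h2 : -h * -h = h ^ 2 := by ring
      rw [h2, mul_comm (d ^ 4)]
      gcongr
    have e4 : d ^ 2 * h ^ 2 ≤ d ^ 4 * h ^ 2 := by
      have : d ^ 2 ≤ d ^ 4 := pow_le_pow_right₀ hd1 (by norm_num)
      gcongr
    rw [hN]
    have f1 := hsSq_add_le ((S - 1) * σ * S + σ * (S - 1) + ((-h : ℝ) : ℂ) • (S * σ * S))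
      (uᴴ * ((d : ℂ) • choiMap Ω σ) * u)
    have f2 := hsSq_add_le ((S - 1) * σ * S + σ * (S - 1)) (((-h : ℝ) : ℂ) • (S * σ * S))
    have f3 := hsSq_add_le ((S - 1) * σ * S) (σ * (S - 1))
    linarith

/-- Apply the preceding construction to an eigenvector of the Choi state, read as a matrix. -/
theorem exists_unitary_correction {Y : Matrix (Phys n m) (Bits n) ℂ} (hY : Yᴴ * Y = 1)
    (i : Bits n × Bits n) {h : ℝ} (hh : h = 1 - (chState_posSemidef Y).isHermitian.eigenvalues i)
    (hsmall : 2 * 2 ^ n * h ≤ 1 / 2) :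
    ∃ u : Matrix (Bits n) (Bits n) ℂ, uᴴ * u = 1 ∧
      1 - ((2 : ℝ) ^ n)⁻¹ ^ 2 * ∑ q, Complex.normSq (trace (uᴴ * block Y q)) ≤
        h + 70 * (2 ^ n) ^ 4 * h ^ 2 ∧
      ∀ σ : Matrix (Bits n) (Bits n) ℂ, hsSq σ ≤ 1 →
        hsSq (uᴴ * channel Y σ * u - σ) ≤ 70 * (2 ^ n) ^ 4 * h ^ 2 := by
  have hω := chState_posSemidef Y
  have hh0 : 0 ≤ h := by
    rw [hh]
    linarith [eigenvalues_le_one hω (trace_chState hY) i]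
  have hp : hω.isHermitian.eigenvalues i = 1 - h := by rw [hh]; ring
  obtain ⟨v, hv⟩ : ∃ v : Bits n × Bits n → ℂ, v = (hω.isHermitian.eigenvectorBasis i).ofLp :=
    ⟨_, rfl⟩
  have hv1 : star v ⬝ᵥ v = 1 := by
    have h1 := (hω.isHermitian.eigenvectorBasis).orthonormal.1 i
    have h2 := inner_self_eq_norm_sq_to_K (𝕜 := ℂ) (hω.isHermitian.eigenvectorBasis i)
    rw [h1, EuclideanSpace.inner_eq_star_dotProduct, dotProduct_comm, ← hv] at h2
    simpa using h2
  have hv2 : chState Y *ᵥ v = ((1 - h : ℝ) : ℂ) • v := by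
    have := hω.isHermitian.mulVec_eigenvectorBasis i
    rw [hp, ← hv] at this
    rw [Complex.coe_smul]
    exact this
  have hΩ := posSemidef_sub_vecMulVec hω hv1 hv2
  refine exists_unitary_of_top hY (V := Matrix.of fun i j => v (i, j)) ?_ hh0 hsmall hΩ
  rw [← hv1]
  simp only [trace, diag, mul_apply, conjTranspose_apply, dotProduct, Pi.star_apply,
    Fintype.sum_prod_type, of_apply]
  rw [Finset.sum_comm]

end Correction

end SkewedCode

namespace SkewedCode

/-! ### Uniform bounds and limits of the quadratic form -/

section Klein

variable {k : Type} [Fintype k] [DecidableEq k]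

/-- Homogeneity of degree −1; it transfers the quadratic weights from the bulk spectrum λ/d_χ to λ.
-/
theorem kleinSlope_div {p q e : ℝ} (hp : 0 < p) (hq : 0 < q) (he : 0 < e) :
    kleinSlope (p / e) (q / e) = e * kleinSlope p q := by
  unfold kleinSlope
  by_cases h : q = p
  · subst h
    rw [if_pos rfl, if_pos rfl]
    field_simp
  · have h' : q / e ≠ p / e := fun hc => h ((div_left_inj' he.ne').mp hc)
    have h2 : q - p ≠ 0 := sub_ne_zero.mpr h
    rw [if_neg h, if_neg h', kleinFun, kleinFun, Real.log_div hq.ne' he.ne',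
      Real.log_div hp.ne' he.ne']
    field_simp
    ring

/-- A Hilbert-Schmidt bound confines the spectrum to a compact interval, on which the continuous
slopes are bounded. The constant is uniform over states, as domination in the Haar integral
requires. -/
theorem exists_abs_kleinDiv_le {p : k → ℝ} (hp : ∀ i, 0 < p i) (B : ℝ) : ∃ C : ℝ, 0 ≤ C ∧
    ∀ ρ : Matrix k k ℂ, ρ.IsHermitian → hsSq ρ ≤ B →
      |kleinDiv p ρ| ≤ C * hsSq (ρ - diagonal fun i => (p i : ℂ)) := by
  have h1 : ∀ j, ∃ M : ℝ, ∀ q ∈ Set.Icc (-Real.sqrt B) (Real.sqrt B), |kleinSlope (p j) q| ≤ M :=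
    fun j => by
      obtain ⟨M, hM⟩ := isCompact_Icc.exists_bound_of_continuousOn
        (continuous_kleinSlope (hp j)).continuousOn (s := Set.Icc (-Real.sqrt B) (Real.sqrt B))
      exact ⟨M, hM⟩
  choose M hM using h1
  refine ⟨∑ j, Real.sqrt (Fintype.card k * M j ^ 2),
    Finset.sum_nonneg fun _ _ => Real.sqrt_nonneg _, fun ρ hρ hB => ?_⟩
  have h2 : ∀ i, hρ.eigenvalues i ∈ Set.Icc (-Real.sqrt B) (Real.sqrt B) := by
    intro i
    have h3 := hsSq_sub_smul_one_eq_sum hρ 0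
    simp only [Complex.ofReal_zero, zero_smul, sub_zero] at h3
    have h4 : hρ.eigenvalues i ^ 2 ≤ B := by
      refine le_trans ?_ hB
      rw [h3]
      exact Finset.single_le_sum (fun j _ => sq_nonneg (hρ.eigenvalues j)) (Finset.mem_univ i)
    exact abs_le.mp (Real.abs_le_sqrt h4)
  set Δ := ρ - diagonal fun i => (p i : ℂ)
  have h5 : ∀ j, |((Δ * cfc (kleinSlope (p j)) ρ * Δ) j j).re| ≤
      Real.sqrt (Fintype.card k * M j ^ 2) * hsSq Δ := by
    intro j
    have h6 : hsSq (cfc (kleinSlope (p j)) ρ) ≤ Fintype.card k * M j ^ 2 := by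
      rw [hsSq_cfc _ hρ]
      refine (Finset.sum_le_sum fun i _ => sq_le_sq' (neg_le_of_abs_le (hM j _ (h2 i)))
        (le_of_abs_le (hM j _ (h2 i)))).trans (le_of_eq ?_)
      rw [Finset.sum_const, Finset.card_univ, nsmul_eq_mul]
    have h7 : hsSq (Δ * cfc (kleinSlope (p j)) ρ * Δ) ≤
        (Fintype.card k * M j ^ 2) * hsSq Δ ^ 2 := by
      have h0 := hsSq_nonneg Δ
      calc _ ≤ hsSq (Δ * cfc (kleinSlope (p j)) ρ) * hsSq Δ := hsSq_mul_le _ _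
        _ ≤ (hsSq Δ * hsSq (cfc (kleinSlope (p j)) ρ)) * hsSq Δ :=
            mul_le_mul_of_nonneg_right (hsSq_mul_le _ _) h0
        _ ≤ (hsSq Δ * (Fintype.card k * M j ^ 2)) * hsSq Δ := by gcongr
        _ = _ := by ring
    have h8 : ((Δ * cfc (kleinSlope (p j)) ρ * Δ) j j).re ^ 2 ≤
        hsSq (Δ * cfc (kleinSlope (p j)) ρ * Δ) := by
      calc _ ≤ Complex.normSq ((Δ * cfc (kleinSlope (p j)) ρ * Δ) j j) := by
            rw [Complex.normSq_apply]
            nlinarith [mul_self_nonneg ((Δ * cfc (kleinSlope (p j)) ρ * Δ) j j).im]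
        _ ≤ ∑ b, Complex.normSq ((Δ * cfc (kleinSlope (p j)) ρ * Δ) j b) :=
            Finset.single_le_sum (f := fun b => Complex.normSq
              ((Δ * cfc (kleinSlope (p j)) ρ * Δ) j b)) (fun _ _ => Complex.normSq_nonneg _)
              (Finset.mem_univ j)
        _ ≤ _ := Finset.single_le_sum (f := fun a => ∑ b, Complex.normSq
              ((Δ * cfc (kleinSlope (p j)) ρ * Δ) a b))
              (fun _ _ => Finset.sum_nonneg fun _ _ => Complex.normSq_nonneg _) (Finset.mem_univ j)
    have h9 := Real.abs_le_sqrt (h8.trans h7)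
    rwa [Real.sqrt_mul (by positivity), Real.sqrt_sq (hsSq_nonneg _)] at h9
  rw [kleinDiv, Complex.re_sum, Finset.sum_mul]
  exact (Finset.abs_sum_le_sum_abs _ _).trans (Finset.sum_le_sum fun j _ => h5 j)

/-- The two outer factors supply ε² and the derivative δ, while the functional calculus in the
middle converges to its value at diag p by continuity. No differentiation of matrix logarithms is
needed. -/
theorem tendsto_kleinDiv {p : k → ℝ} (hp : ∀ i, 0 < p i) {ρ : ℝ → Matrix k k ℂ}
    (hρ : ∀ ε, (ρ ε).IsHermitian) {δ : Matrix k k ℂ}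
    (h : Tendsto (fun ε : ℝ => ε⁻¹ • (ρ ε - diagonal fun i => (p i : ℂ))) (𝓝[≠] 0) (𝓝 δ)) :
    Tendsto (fun ε : ℝ => (ε ^ 2)⁻¹ * kleinDiv p (ρ ε)) (𝓝[≠] 0)
      (𝓝 (∑ x, ∑ y, Complex.normSq (δ x y) * kleinSlope (p x) (p y))) := by
  have hδ : δᴴ = δ := by
    have h1 : Continuous fun A : Matrix k k ℂ => Aᴴ := continuous_id.matrix_conjTranspose
    have h2 := (h1.tendsto δ).comp h
    refine tendsto_nhds_unique h2 (h.congr fun ε => ?_)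
    simp only [Function.comp_apply]
    rw [conjTranspose_smul, conjTranspose_sub, (hρ ε).eq, (isHermitian_diagonal_ofReal p).eq]
    simp
  have hlim := tendsto_of_slope h
  have hcfc : ∀ j, Tendsto (fun ε => cfc (kleinSlope (p j)) (ρ ε)) (𝓝[≠] 0)
      (𝓝 (diagonal fun i => (kleinSlope (p j) (p i) : ℂ))) := by
    intro j
    have h1 := continuousOn_cfc_hermitian (continuous_kleinSlope (hp j))
      (a := fun A : Matrix k k ℂ => A) (s := {A | A.IsHermitian}) continuousOn_id fun A hA => hA
    have h2 := h1 _ (isHermitian_diagonal_ofReal p)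
    rw [ContinuousWithinAt, cfc_diagonal_ofReal] at h2
    exact h2.comp (tendsto_nhdsWithin_iff.mpr ⟨hlim, Eventually.of_forall hρ⟩)
  have h3 : Tendsto (fun ε : ℝ => (∑ j, ((ε⁻¹ • (ρ ε - diagonal fun i => (p i : ℂ))) *
      cfc (kleinSlope (p j)) (ρ ε) * (ε⁻¹ • (ρ ε - diagonal fun i => (p i : ℂ)))) j j).re)
      (𝓝[≠] 0) (𝓝 (∑ j, (δ * (diagonal fun i => (kleinSlope (p j) (p i) : ℂ)) * δ) j j).re) := by
    refine (Complex.continuous_re.tendsto _).comp (tendsto_finsetSum _ fun j _ => ?_)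
    exact ((continuous_apply_apply j j).tendsto _).comp
      (tendsto_matrix_mul (tendsto_matrix_mul h (hcfc j)) h)
  have h4 : (∑ j, (δ * (diagonal fun i => (kleinSlope (p j) (p i) : ℂ)) * δ) j j).re =
      ∑ x, ∑ y, Complex.normSq (δ x y) * kleinSlope (p x) (p y) := by
    rw [Complex.re_sum]
    refine Finset.sum_congr rfl fun x _ => ?_
    rw [mul_apply, Complex.re_sum]
    refine Finset.sum_congr rfl fun y _ => ?_
    rw [mul_diagonal]
    have h5 : δ y x = star (δ x y) := by
      conv_lhs => rw [← hδ]
      rfl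
    have h6 : δ x y * (kleinSlope (p x) (p y) : ℂ) * star (δ x y) =
        ((Complex.normSq (δ x y) * kleinSlope (p x) (p y) : ℝ) : ℂ) := by
      push_cast
      rw [← Complex.mul_conj, Complex.star_def]
      ring
    rw [h5, h6, Complex.ofReal_re]
  rw [h4] at h3
  refine h3.congr fun ε => ?_
  rw [kleinDiv]
  have h7 : ∀ j, ((ε⁻¹ • (ρ ε - diagonal fun i => (p i : ℂ))) *
      cfc (kleinSlope (p j)) (ρ ε) * (ε⁻¹ • (ρ ε - diagonal fun i => (p i : ℂ)))) j j =
      (((ε ^ 2)⁻¹ : ℝ) : ℂ) * ((ρ ε - diagonal fun i => (p i : ℂ)) *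
      cfc (kleinSlope (p j)) (ρ ε) * (ρ ε - diagonal fun i => (p i : ℂ))) j j := by
    intro j
    rw [Matrix.smul_mul, Matrix.smul_mul, Matrix.mul_smul, smul_smul, Matrix.smul_apply,
      Complex.real_smul]
    congr 2
    rw [sq, mul_inv]
  simp only [h7]
  rw [← Finset.mul_sum, Complex.re_ofReal_mul]

end Klein

/-! ### Local conjugations and averaged quadratic expressions -/

section PartialTraceConj

variable {a b : Type} [Fintype a] [Fintype b] [DecidableEq a] [DecidableEq b]

omit [DecidableEq a] in
-- By duality: pair with h ⊗ 1 and move the unitary around the trace.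
theorem traceSnd_kronecker_conj (A : Matrix a a ℂ) {B : Matrix b b ℂ} (hB : Bᴴ * B = 1)
    (Z : Matrix (a × b) (a × b) ℂ) :
    traceSnd ((A ⊗ₖ B) * Z * (A ⊗ₖ B)ᴴ) = A * traceSnd Z * Aᴴ := by
  rw [ext_iff_trace_mul_right]
  intro h
  rw [← trace_mul_kronecker_one, Matrix.mul_assoc (A * traceSnd Z), Matrix.mul_assoc A,
    trace_mul_comm A, Matrix.mul_assoc (traceSnd Z), ← trace_mul_kronecker_one,
    Matrix.mul_assoc ((A ⊗ₖ B) * Z), Matrix.mul_assoc (A ⊗ₖ B), trace_mul_comm (A ⊗ₖ B),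
    Matrix.mul_assoc Z, conjTranspose_kronecker, ← mul_kronecker_mul, ← mul_kronecker_mul,
    Matrix.mul_one, hB]

end PartialTraceConj

section Haar

variable {k : Type} [Fintype k] [DecidableEq k]

theorem integral_sum_normSq_conj {Q : Type} [Fintype Q] (B : Q → Matrix k k ℂ) (w : k → k → ℝ) :
    ∫ U : unitaryGroup k ℂ, ∑ q, ∑ i, ∑ j, w i j *
      Complex.normSq (((U : Matrix k k ℂ)ᴴ * B q * U) i j) ∂haar =
    ∑ i, ∑ j, w i j * if i = j then
      ((∑ q, hsSq (B q)) + ∑ q, Complex.normSq (trace (B q))) /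
        (Fintype.card k * (Fintype.card k + 1))
    else ((∑ q, hsSq (B q)) - (∑ q, Complex.normSq (trace (B q))) / Fintype.card k) /
        ((Fintype.card k : ℝ) ^ 2 - 1) := by
  have hc : ∀ q i j, Continuous fun U : unitaryGroup k ℂ =>
      w i j * Complex.normSq (((U : Matrix k k ℂ)ᴴ * B q * U) i j) := fun q i j =>
    continuous_const.mul (Complex.continuous_normSq.comp (continuous_conj_unitary_apply (B q) i j))
  rw [integral_finsetSum _ fun q _ => integrable_haar (continuous_finsetSum _ fun i _ =>
    continuous_finsetSum _ fun j _ => hc q i j)]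
  have h1 : ∀ q, ∫ U : unitaryGroup k ℂ, ∑ i, ∑ j, w i j *
      Complex.normSq (((U : Matrix k k ℂ)ᴴ * B q * U) i j) ∂haar =
      ∑ i, ∑ j, w i j * conjMoment (B q) i j := by
    intro q
    rw [integral_finsetSum _ fun i _ => integrable_haar (continuous_finsetSum _ fun j _ => hc q i j)]
    refine Finset.sum_congr rfl fun i _ => ?_
    rw [integral_finsetSum _ fun j _ => integrable_haar (hc q i j)]
    refine Finset.sum_congr rfl fun j _ => ?_
    rw [integral_const_mul, conjMoment]
  simp only [h1]
  rw [Finset.sum_comm]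
  refine Finset.sum_congr rfl fun i _ => ?_
  rw [Finset.sum_comm]
  refine Finset.sum_congr rfl fun j _ => ?_
  rw [← Finset.mul_sum]
  congr 1
  simp only [conjMoment_eq]
  split_ifs
  · rw [← Finset.sum_div, Finset.sum_add_distrib]
    rfl
  · rw [← Finset.sum_div, Finset.sum_sub_distrib, ← Finset.sum_div]
    rfl

end Haar

end SkewedCode

namespace SkewedCode

/-! ### States of fixed spectrum and the entropy form of the correction -/

section RotatedStates

variable {k : Type} [Fintype k] [DecidableEq k]

/-- The state with spectrum `lam` in the basis given by `U`. -/
def rotState (lam : k → ℝ) (U : Matrix k k ℂ) : Matrix k k ℂ :=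
  U * (diagonal fun i => (lam i : ℂ)) * Uᴴ

theorem rotState_isHermitian (lam : k → ℝ) (U : Matrix k k ℂ) : (rotState lam U).IsHermitian :=
  isHermitian_mul_mul_conjTranspose _ (isHermitian_diagonal_ofReal lam)

theorem conj_rotState (lam : k → ℝ) {U : Matrix k k ℂ} (hU : U ∈ unitaryGroup k ℂ) :
    Uᴴ * rotState lam U * U = diagonal fun i => (lam i : ℂ) := by
  have h : Uᴴ * U = 1 := mem_unitaryGroup_iff'.mp hU
  calc Uᴴ * (U * (diagonal fun i => (lam i : ℂ)) * Uᴴ) * U =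
      (Uᴴ * U) * (diagonal fun i => (lam i : ℂ)) * (Uᴴ * U) := by simp only [Matrix.mul_assoc]
    _ = _ := by rw [h, Matrix.one_mul, Matrix.mul_one]

theorem trace_rotState (lam : k → ℝ) {U : Matrix k k ℂ} (hU : U ∈ unitaryGroup k ℂ)
    (h1 : ∑ i, lam i = 1) : trace (rotState lam U) = 1 := by
  have h : Uᴴ * U = 1 := mem_unitaryGroup_iff'.mp hU
  rw [rotState, trace_mul_comm, ← Matrix.mul_assoc, h, Matrix.one_mul, trace_diagonal,
    ← Complex.ofReal_sum, h1, Complex.ofReal_one]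

theorem hsSq_conj_unitary {U : Matrix k k ℂ} (hU : U ∈ unitaryGroup k ℂ) (A : Matrix k k ℂ) :
    hsSq (Uᴴ * A * U) = hsSq A := by
  have h : Uᴴᴴ * Uᴴ = 1 := by
    rw [conjTranspose_conjTranspose]
    exact mem_unitaryGroup_iff.mp hU
  rw [Matrix.mul_assoc, hsSq_unitary_mul h, ← hsSq_conjTranspose, conjTranspose_mul,
    hsSq_unitary_mul h, hsSq_conjTranspose]

theorem hsSq_rotState (lam : k → ℝ) {U : Matrix k k ℂ} (hU : U ∈ unitaryGroup k ℂ) :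
    hsSq (rotState lam U) = ∑ i, lam i ^ 2 := by
  rw [← hsSq_conj_unitary hU, conj_rotState lam hU, hsSq]
  refine Finset.sum_congr rfl fun i _ => ?_
  rw [Finset.sum_eq_single i]
  · rw [diagonal_apply_eq, Complex.normSq_ofReal, sq]
  · intro j _ hj
    rw [diagonal_apply_ne' _ hj, map_zero]
  · simp

theorem conjTranspose_mem_unitaryGroup {U : Matrix k k ℂ} (hU : U ∈ unitaryGroup k ℂ) :
    Uᴴ ∈ unitaryGroup k ℂ := by
  rw [mem_unitaryGroup_iff, star_eq_conjTranspose, conjTranspose_conjTranspose]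
  exact mem_unitaryGroup_iff'.mp hU

theorem entropy_conj_unitary {ρ U : Matrix k k ℂ} (hρ : ρ.IsHermitian)
    (hU : U ∈ unitaryGroup k ℂ) : entropy (Uᴴ * ρ * U) = entropy ρ := by
  have := entropy_unitary_conj hρ (conjTranspose_mem_unitaryGroup hU)
  rwa [conjTranspose_conjTranspose] at this

end RotatedStates

section ChannelProperties

variable {n m : ℕ}

theorem channel_isHermitian (Y : Matrix (Phys n m) (Bits n) ℂ) {σ : Matrix (Bits n) (Bits n) ℂ}
    (hσ : σ.IsHermitian) : (channel Y σ).IsHermitian := by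
  rw [IsHermitian, channel, conjTranspose_sum]
  exact Finset.sum_congr rfl fun q _ => (isHermitian_mul_mul_conjTranspose _ hσ).eq

theorem recoveredA_eq_conj (V : Matrix (Phys n m) (Bits n) ℂ) (R : Recovery n m)
    (σ : Matrix (Bits n) (Bits n) ℂ) : recoveredA V R σ =
      (R.1 : Matrix (Bits n × Bits m) (Bits n × Bits m) ℂ) * traceSnd (V * σ * Vᴴ) *
        (R.1 : Matrix (Bits n × Bits m) (Bits n × Bits m) ℂ)ᴴ := by
  have h : (R.2 : Matrix (Bits m) (Bits m) ℂ)ᴴ * (R.2 : Matrix (Bits m) (Bits m) ℂ) = 1 :=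
    mem_unitaryGroup_iff'.mp R.2.2
  rw [recoveredA, Recovery.op, traceSnd_kronecker_conj _ h]

theorem traceSnd_conj_isHermitian (V : Matrix (Phys n m) (Bits n) ℂ)
    {σ : Matrix (Bits n) (Bits n) ℂ} (hσ : σ.IsHermitian) :
    (traceSnd (V * σ * Vᴴ)).IsHermitian := by
  rw [IsHermitian, ← traceSnd_conjTranspose, (isHermitian_mul_mul_conjTranspose V hσ).eq]

theorem recoveredA_isHermitian (V : Matrix (Phys n m) (Bits n) ℂ) (R : Recovery n m)
    {σ : Matrix (Bits n) (Bits n) ℂ} (hσ : σ.IsHermitian) : (recoveredA V R σ).IsHermitian := by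
  rw [recoveredA_eq_conj]
  exact isHermitian_mul_mul_conjTranspose _ (traceSnd_conj_isHermitian V hσ)

theorem entropy_recoveredA (V : Matrix (Phys n m) (Bits n) ℂ) (R R' : Recovery n m)
    {σ : Matrix (Bits n) (Bits n) ℂ} (hσ : σ.IsHermitian) :
    entropy (recoveredA V R σ) = entropy (recoveredA V R' σ) := by
  have h := traceSnd_conj_isHermitian V hσ
  rw [recoveredA_eq_conj, recoveredA_eq_conj, entropy_unitary_conj h R.1.2,
    entropy_unitary_conj h R'.1.2]

theorem trace_recoveredA {V : Matrix (Phys n m) (Bits n) ℂ} (hV : Vᴴ * V = 1) (R : Recovery n m)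
    (σ : Matrix (Bits n) (Bits n) ℂ) : trace (recoveredA V R σ) = trace σ := by
  have h : (R.1 : Matrix (Bits n × Bits m) (Bits n × Bits m) ℂ)ᴴ *
    (R.1 : Matrix (Bits n × Bits m) (Bits n × Bits m) ℂ) = 1 := mem_unitaryGroup_iff'.mp R.1.2
  rw [recoveredA_eq_conj, trace_mul_comm, ← Matrix.mul_assoc, h, Matrix.one_mul, trace_traceSnd,
    trace_mul_comm, ← Matrix.mul_assoc, hV, Matrix.one_mul]

theorem traceSnd_recoveredA (V : Matrix (Phys n m) (Bits n) ℂ) (R : Recovery n m)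
    (σ : Matrix (Bits n) (Bits n) ℂ) : traceSnd (recoveredA V R σ) = channel (R.op * V) σ :=
  recoveredA₁_eq V R σ

theorem trace_channel {V : Matrix (Phys n m) (Bits n) ℂ} (hV : Vᴴ * V = 1) (R : Recovery n m)
    (σ : Matrix (Bits n) (Bits n) ℂ) : trace (channel (R.op * V) σ) = trace σ := by
  rw [← traceSnd_recoveredA, trace_traceSnd, trace_recoveredA hV]

end ChannelProperties

namespace SkewedStabilizerCode

variable {n m : ℕ} (C : SkewedStabilizerCode n m)

theorem recoveredA_exact (σ : Matrix (Bits n) (Bits n) ℂ) :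
    recoveredA C.enc₀ C.rec₀ σ = ((2 : ℂ) ^ m)⁻¹ • (σ ⊗ₖ (1 : Matrix (Bits m) (Bits m) ℂ)) := by
  have h : C.rec₀.op * C.enc₀ = attach (n := n) C.χ := C.exact_recovery
  rw [recoveredA_eq C.flat_χ, h, opOf_attach C.flat_χ, conjTranspose_one, Matrix.one_mul,
    Matrix.mul_one]

theorem recoveredA₁_exact (σ : Matrix (Bits n) (Bits n) ℂ) :
    recoveredA₁ C.enc₀ C.rec₀ σ = σ := by
  rw [recoveredA₁, recoveredA_exact, traceSnd_smul, traceSnd_kronecker, trace_one, card_bits,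
    smul_smul, inv_mul_cancel₀ (by positivity), one_smul]

/-- The spectrum of the exact recovered state on `A₁ A₂`. -/
noncomputable def bulkSpec (m : ℕ) (lam : Bits n → ℝ) : Bits n × Bits m → ℝ :=
  fun x => lam x.1 / 2 ^ m

theorem kronecker_one_mem {U : Matrix (Bits n) (Bits n) ℂ} (hU : U ∈ unitaryGroup (Bits n) ℂ) :
    U ⊗ₖ (1 : Matrix (Bits m) (Bits m) ℂ) ∈ unitaryGroup (Bits n × Bits m) ℂ := by
  rw [mem_unitaryGroup_iff, star_eq_conjTranspose, conjTranspose_kronecker, conjTranspose_one,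
    ← mul_kronecker_mul, Matrix.mul_one]
  have h : U * Uᴴ = 1 := mem_unitaryGroup_iff.mp hU
  rw [h, one_kronecker_one]

theorem smul_rotState_kronecker (lam : Bits n → ℝ) (U : Matrix (Bits n) (Bits n) ℂ) :
    ((2 : ℂ) ^ m)⁻¹ • (rotState lam U ⊗ₖ (1 : Matrix (Bits m) (Bits m) ℂ)) =
      (U ⊗ₖ (1 : Matrix (Bits m) (Bits m) ℂ)) * (diagonal fun x => (bulkSpec m lam x : ℂ)) *
        (U ⊗ₖ (1 : Matrix (Bits m) (Bits m) ℂ))ᴴ := by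
  have h : (diagonal fun x => (bulkSpec m lam x : ℂ)) = ((2 : ℂ) ^ m)⁻¹ •
      ((diagonal fun i => (lam i : ℂ)) ⊗ₖ (1 : Matrix (Bits m) (Bits m) ℂ)) := by
    rw [← diagonal_one, diagonal_kronecker_diagonal, ← diagonal_smul]
    congr 1
    ext x
    simp only [bulkSpec, Pi.smul_apply, smul_eq_mul, mul_one]
    push_cast
    rw [div_eq_mul_inv, mul_comm]
  rw [h, Matrix.mul_smul, Matrix.smul_mul, conjTranspose_kronecker, conjTranspose_one,
    ← mul_kronecker_mul, ← mul_kronecker_mul, Matrix.mul_one, Matrix.mul_one, rotState]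

theorem cfc_log_rotState (lam : Bits n → ℝ) {U : Matrix (Bits n) (Bits n) ℂ}
    (hU : U ∈ unitaryGroup (Bits n) ℂ) : cfc Real.log (rotState lam U) =
      U * (diagonal fun i => (Real.log (lam i) : ℂ)) * Uᴴ := by
  rw [rotState, cfc_unitary_conj _ (isHermitian_diagonal_ofReal lam) hU, cfc_diagonal_ofReal]

theorem cfc_log_bulk {lam : Bits n → ℝ} (hlam : ∀ i, 0 < lam i) {U : Matrix (Bits n) (Bits n) ℂ}
    (hU : U ∈ unitaryGroup (Bits n) ℂ) :
    cfc Real.log (((2 : ℂ) ^ m)⁻¹ • (rotState lam U ⊗ₖ (1 : Matrix (Bits m) (Bits m) ℂ))) =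
      cfc Real.log (rotState lam U) ⊗ₖ (1 : Matrix (Bits m) (Bits m) ℂ) -
        ((Real.log (2 ^ m) : ℝ) : ℂ) • 1 := by
  rw [smul_rotState_kronecker, cfc_unitary_conj _ (isHermitian_diagonal_ofReal _)
    (kronecker_one_mem hU), cfc_diagonal_ofReal, cfc_log_rotState lam hU]
  have h : (diagonal fun x => (Real.log (bulkSpec m lam x) : ℂ)) =
      ((diagonal fun i => (Real.log (lam i) : ℂ)) ⊗ₖ (1 : Matrix (Bits m) (Bits m) ℂ)) -
        ((Real.log (2 ^ m) : ℝ) : ℂ) • 1 := by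
    rw [← diagonal_one, diagonal_kronecker_diagonal, ← diagonal_one, ← diagonal_smul, diagonal_sub]
    congr 1
    ext x
    rw [bulkSpec, Real.log_div (hlam x.1).ne' (by positivity)]
    simp
  have h2 : (U ⊗ₖ (1 : Matrix (Bits m) (Bits m) ℂ)) * (U ⊗ₖ (1 : Matrix (Bits m) (Bits m) ℂ))ᴴ =
      1 := mem_unitaryGroup_iff.mp (kronecker_one_mem hU)
  rw [h, mul_sub, sub_mul, Matrix.mul_smul, Matrix.smul_mul, Matrix.mul_one, h2,
    conjTranspose_kronecker, conjTranspose_one, ← mul_kronecker_mul, ← mul_kronecker_mul,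
    Matrix.mul_one, Matrix.mul_one]

/-- The logarithm of the exact state on A₁A₂ is ln σ ⊗ 1 minus a constant. Its pairing with the
recovered state only sees the marginal on A₁ and cancels the pairing in the second relative entropy.
-/
theorem sCorr_eq_entropy {lam : Bits n → ℝ} (hlam : ∀ i, 0 < lam i) (hlam1 : ∑ i, lam i = 1)
    (ε : ℝ) (R : Recovery n m) {U : Matrix (Bits n) (Bits n) ℂ}
    (hU : U ∈ unitaryGroup (Bits n) ℂ) : C.sCorr ε R (rotState lam U) =
      entropy (channel (R.op * C.enc ε) (rotState lam U)) -
        entropy (recoveredA (C.enc ε) R (rotState lam U)) + Real.log (2 ^ m) := by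
  have h1 : recoveredA₁ (C.enc ε) R (rotState lam U) =
      channel (R.op * C.enc ε) (rotState lam U) := recoveredA₁_eq _ _ _
  have h2 := trace_recoveredA (C.enc_isometry ε) R (rotState lam U)
  rw [trace_rotState lam hU hlam1] at h2
  rw [sCorr, recoveredA₁_exact, recoveredA_exact, relEntropy, relEntropy, h1, cfc_log_bulk hlam hU,
    mul_sub, mul_sub, trace_sub, trace_sub, mul_sub, trace_sub, trace_mul_kronecker_one,
    traceSnd_recoveredA, Matrix.mul_smul, Matrix.mul_one, trace_smul, h2, entropy, entropy]
  simp only [Complex.sub_re, smul_eq_mul, mul_one, Complex.ofReal_re]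
  ring

/-- The part of the relative entropy on `A₁` that is linear in the channel. -/
noncomputable def linPart (lam : Bits n → ℝ) (Y : Matrix (Phys n m) (Bits n) ℂ)
    (U : Matrix (Bits n) (Bits n) ℂ) : ℝ :=
  (trace (Uᴴ * channel Y (rotState lam U) * U * diagonal fun i => (Real.log (lam i) : ℂ))).re

theorem neg_entropy_channel {lam : Bits n → ℝ} (hlam1 : ∑ i, lam i = 1) (ε : ℝ)
    (R : Recovery n m) {U : Matrix (Bits n) (Bits n) ℂ} (hU : U ∈ unitaryGroup (Bits n) ℂ) :
    -entropy (channel (R.op * C.enc ε) (rotState lam U)) =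
      kleinDiv lam (Uᴴ * channel (R.op * C.enc ε) (rotState lam U) * U) +
        linPart lam (R.op * C.enc ε) U := by
  have h0 := channel_isHermitian (R.op * C.enc ε) (rotState_isHermitian lam U)
  have h1 := neg_entropy_eq_kleinDiv lam (isHermitian_conjTranspose_mul_mul U h0)
  have h2 : U * Uᴴ = 1 := mem_unitaryGroup_iff.mp hU
  rw [entropy_conj_unitary h0 hU, trace_mul_comm (Uᴴ * _) U, ← Matrix.mul_assoc, h2, Matrix.one_mul,
    trace_channel (C.enc_isometry ε), trace_rotState lam hU hlam1, hlam1] at h1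
  rw [h1, linPart]
  simp

/-- The recovered state on `A₁ A₂`, in the eigenbasis of the logical state. -/
noncomputable def bulkState (lam : Bits n → ℝ) (ε : ℝ) (U : Matrix (Bits n) (Bits n) ℂ) :
    Matrix (Bits n × Bits m) (Bits n × Bits m) ℂ :=
  (U ⊗ₖ (1 : Matrix (Bits m) (Bits m) ℂ))ᴴ *
    recoveredA (C.enc ε) (C.skewRec ε) (rotState lam U) * (U ⊗ₖ (1 : Matrix (Bits m) (Bits m) ℂ))

theorem bulkState_isHermitian (lam : Bits n → ℝ) (ε : ℝ) (U : Matrix (Bits n) (Bits n) ℂ) :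
    (C.bulkState lam ε U).IsHermitian :=
  isHermitian_conjTranspose_mul_mul _ (recoveredA_isHermitian _ _ (rotState_isHermitian lam U))

theorem neg_entropy_recoveredA {lam : Bits n → ℝ} (hlam : ∀ i, 0 < lam i)
    (hlam1 : ∑ i, lam i = 1) (ε : ℝ) {U : Matrix (Bits n) (Bits n) ℂ}
    (hU : U ∈ unitaryGroup (Bits n) ℂ) :
    -entropy (recoveredA (C.enc ε) (C.skewRec ε) (rotState lam U)) =
      kleinDiv (bulkSpec m lam) (C.bulkState lam ε U) + linPart lam (C.skewEnc ε) U -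
        Real.log (2 ^ m) := by
  have h0 := recoveredA_isHermitian (C.enc ε) (C.skewRec ε) (rotState_isHermitian lam U)
  have h1 := neg_entropy_eq_kleinDiv (bulkSpec m lam) (C.bulkState_isHermitian lam ε U)
  have hUU := kronecker_one_mem (m := m) hU
  have h3 : (U ⊗ₖ (1 : Matrix (Bits m) (Bits m) ℂ)) * (U ⊗ₖ (1 : Matrix (Bits m) (Bits m) ℂ))ᴴ =
      1 := mem_unitaryGroup_iff.mp hUU
  have htr : trace (C.bulkState lam ε U) = 1 := by
    rw [bulkState, trace_mul_comm, ← Matrix.mul_assoc, h3, Matrix.one_mul,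
      trace_recoveredA (C.enc_isometry ε), trace_rotState lam hU hlam1]
  have hsum : ∑ x, bulkSpec m lam x = 1 := by
    simp only [bulkSpec, Fintype.sum_prod_type, Finset.sum_const, nsmul_eq_mul, ← Finset.mul_sum,
      Finset.card_univ, ← Finset.sum_div, hlam1]
    simp
  have h4 : (diagonal fun x => (Real.log (bulkSpec m lam x) : ℂ)) =
      ((diagonal fun i => (Real.log (lam i) : ℂ)) ⊗ₖ (1 : Matrix (Bits m) (Bits m) ℂ)) -
        ((Real.log (2 ^ m) : ℝ) : ℂ) • 1 := by
    rw [← diagonal_one, diagonal_kronecker_diagonal, ← diagonal_one, ← diagonal_smul, diagonal_sub]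
    congr 1
    ext x
    rw [bulkSpec, Real.log_div (hlam x.1).ne' (by positivity)]
    simp
  have h5 : traceSnd (C.bulkState lam ε U) = Uᴴ * channel (C.skewEnc ε) (rotState lam U) * U := by
    have h6 : (U ⊗ₖ (1 : Matrix (Bits m) (Bits m) ℂ))ᴴ =
        Uᴴ ⊗ₖ (1 : Matrix (Bits m) (Bits m) ℂ) := by
      rw [conjTranspose_kronecker, conjTranspose_one]
    have h7 := traceSnd_kronecker_conj Uᴴ (B := (1 : Matrix (Bits m) (Bits m) ℂ))
      (by rw [conjTranspose_one, Matrix.one_mul])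
      (recoveredA (C.enc ε) (C.skewRec ε) (rotState lam U))
    rw [← h6, conjTranspose_conjTranspose, conjTranspose_conjTranspose, traceSnd_recoveredA] at h7
    exact h7
  rw [h4, mul_sub, trace_sub, trace_mul_kronecker_one, h5, Matrix.mul_smul, Matrix.mul_one,
    trace_smul, htr, hsum] at h1
  rw [bulkState, entropy_conj_unitary h0 hUU] at h1
  rw [h1, linPart, bulkState]
  simp only [Complex.sub_re, smul_eq_mul, mul_one, Complex.ofReal_re, Complex.one_re]
  ring

/-- A local recovery only conjugates the state on A, so the entropy on A₁A₂ may be evaluated with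
`skewRec` instead of the given recovery. This decouples the bulk term from the choice of recovery
and leaves a difference of linear parts. -/
theorem sCorr_eq {lam : Bits n → ℝ} (hlam : ∀ i, 0 < lam i) (hlam1 : ∑ i, lam i = 1) (ε : ℝ)
    (R : Recovery n m) {U : Matrix (Bits n) (Bits n) ℂ} (hU : U ∈ unitaryGroup (Bits n) ℂ) :
    C.sCorr ε R (rotState lam U) = kleinDiv (bulkSpec m lam) (C.bulkState lam ε U) -
      kleinDiv lam (Uᴴ * channel (R.op * C.enc ε) (rotState lam U) * U) +
      (linPart lam (C.skewEnc ε) U - linPart lam (R.op * C.enc ε) U) := by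
  rw [C.sCorr_eq_entropy hlam hlam1 ε R hU,
    entropy_recoveredA (C.enc ε) R (C.skewRec ε) (rotState_isHermitian lam U)]
  linarith [C.neg_entropy_channel hlam1 ε R hU, C.neg_entropy_recoveredA hlam hlam1 ε hU]

theorem exists_eq_rotState {σ : Matrix (Bits n) (Bits n) ℂ} (hσ : σ.IsHermitian) :
    ∃ V : unitaryGroup (Bits n) ℂ,
      σ = rotState hσ.eigenvalues (V : Matrix (Bits n) (Bits n) ℂ) := by
  have h := hσ.spectral_theorem
  rw [Unitary.conjStarAlgAut_apply] at h
  exact ⟨hσ.eigenvectorUnitary, h⟩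

theorem rotState_mul (lam : Bits n → ℝ) (U V : Matrix (Bits n) (Bits n) ℂ) :
    rotState lam (U * V) = U * rotState lam V * Uᴴ := by
  simp only [rotState, conjTranspose_mul, Matrix.mul_assoc]

/-- The averaged correction only depends on the spectrum of the logical state. -/
theorem avgSCorr_eq (ε : ℝ) (R : Recovery n m) {σ : Matrix (Bits n) (Bits n) ℂ}
    (hσ : σ.IsHermitian) : C.avgSCorr ε R σ = ∫ U : unitaryGroup (Bits n) ℂ,
      C.sCorr ε R (rotState hσ.eigenvalues (U : Matrix (Bits n) (Bits n) ℂ)) ∂haar := by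
  obtain ⟨V, hV⟩ := exists_eq_rotState hσ
  generalize hσ.eigenvalues = lam at hV ⊢
  rw [avgSCorr, ← integral_haar_mul_right (fun U : unitaryGroup (Bits n) ℂ =>
    C.sCorr ε R (rotState lam (U : Matrix (Bits n) (Bits n) ℂ))) V]
  refine integral_congr_ae (.of_forall fun U => ?_)
  simp only [Submonoid.coe_mul, rotState_mul, ← hV]

/-- Only entropies enter, and the output entropy on A₁ is blind to the conjugation by `u`. -/
theorem sCorr_localUnitary {lam : Bits n → ℝ} (hlam : ∀ i, 0 < lam i) (hlam1 : ∑ i, lam i = 1)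
    (ε : ℝ) {R R' : Recovery n m} {u U : Matrix (Bits n) (Bits n) ℂ}
    (hu : u ∈ unitaryGroup (Bits n) ℂ) (hU : U ∈ unitaryGroup (Bits n) ℂ)
    (h : channel (R'.op * C.enc ε) (rotState lam U) =
      uᴴ * channel (R.op * C.enc ε) (rotState lam U) * u) :
    C.sCorr ε R' (rotState lam U) = C.sCorr ε R (rotState lam U) := by
  rw [C.sCorr_eq_entropy hlam hlam1 ε R hU, C.sCorr_eq_entropy hlam hlam1 ε R' hU, h,
    entropy_conj_unitary (channel_isHermitian _ (rotState_isHermitian lam U)) hu,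
    entropy_recoveredA (C.enc ε) R R' (rotState_isHermitian lam U)]

end SkewedStabilizerCode

end SkewedCode

/-! ### Correcting optimal recoveries by a unitary on A₁ -/

namespace SkewedCode

section LocalCorrection

variable {n m : ℕ}

theorem block_kronecker_one_mul (u : Matrix (Bits n) (Bits n) ℂ) (Y : Matrix (Phys n m) (Bits n) ℂ)
    (q : Bits m × Bits m) :
    block (((u ⊗ₖ (1 : Matrix (Bits m) (Bits m) ℂ)) ⊗ₖ (1 : Matrix (Bits m) (Bits m) ℂ)) * Y) q =
      u * block Y q := by
  ext i j
  simp only [block, of_apply, mul_apply, kroneckerMap_apply, Fintype.sum_prod_type, one_apply,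
    mul_ite, mul_one, mul_zero, ite_mul, zero_mul, Finset.sum_ite_eq, Finset.mem_univ, if_true]

theorem channel_kronecker_one_mul (u : Matrix (Bits n) (Bits n) ℂ)
    (Y : Matrix (Phys n m) (Bits n) ℂ) (σ : Matrix (Bits n) (Bits n) ℂ) :
    channel (((u ⊗ₖ (1 : Matrix (Bits m) (Bits m) ℂ)) ⊗ₖ (1 : Matrix (Bits m) (Bits m) ℂ)) * Y) σ =
      u * channel Y σ * uᴴ := by
  simp only [channel, block_kronecker_one_mul, conjTranspose_mul, Finset.mul_sum, Finset.sum_mul,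
    Matrix.mul_assoc]

theorem fid_eq (Y : Matrix (Phys n m) (Bits n) ℂ) :
    fid Y = ((2 : ℝ) ^ n)⁻¹ ^ 2 * ∑ q, Complex.normSq (trace (block Y q)) := by
  have h : Complex.normSq ((2 : ℂ) ^ n)⁻¹ = ((2 : ℝ) ^ n)⁻¹ ^ 2 := by
    rw [Complex.normSq_inv, map_pow, inv_pow, ← pow_mul, mul_comm n 2, pow_mul]
    norm_num
  simp only [fid, meanBlock, map_mul, h, Finset.mul_sum]

/-- When the deficit is not small the recovery is returned unchanged, so that a corrected recovery
is available for every ε. -/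
theorem exists_corrected_recovery (V : Matrix (Phys n m) (Bits n) ℂ)
    (R : Recovery n m) (i : Bits n × Bits n) {h : ℝ} (hY : (R.op * V)ᴴ * (R.op * V) = 1)
    (hh : h = 1 - (chState_posSemidef (R.op * V)).isHermitian.eigenvalues i) :
    ∃ R' : Recovery n m, (∃ u ∈ unitaryGroup (Bits n) ℂ, ∀ σ,
      channel (R'.op * V) σ = uᴴ * channel (R.op * V) σ * u) ∧
      (2 * 2 ^ n * h ≤ 1 / 2 → 1 - fid (R'.op * V) ≤ h + 70 * (2 ^ n) ^ 4 * h ^ 2 ∧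
        ∀ σ, hsSq σ ≤ 1 → hsSq (channel (R'.op * V) σ - σ) ≤ 70 * (2 ^ n) ^ 4 * h ^ 2) := by
  by_cases hs : 2 * 2 ^ n * h ≤ 1 / 2
  · obtain ⟨u, hu, h1, h2⟩ := exists_unitary_correction hY i hh hs
    have hu' : u ∈ unitaryGroup (Bits n) ℂ := mem_unitaryGroup_iff'.mpr hu
    obtain ⟨R', hR'⟩ : ∃ R' : Recovery n m, R' = (⟨uᴴ ⊗ₖ (1 : Matrix (Bits m) (Bits m) ℂ),
        SkewedStabilizerCode.kronecker_one_mem (conjTranspose_mem_unitaryGroup hu')⟩ * R.1, R.2) := ⟨_, rfl⟩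
    have hop : R'.op * V = ((uᴴ ⊗ₖ (1 : Matrix (Bits m) (Bits m) ℂ)) ⊗ₖ
          (1 : Matrix (Bits m) (Bits m) ℂ)) * (R.op * V) := by
      rw [hR', ← Matrix.mul_assoc, Recovery.op, Recovery.op, ← mul_kronecker_mul, Matrix.one_mul]
      rfl
    refine ⟨R', ⟨u, hu', fun σ => ?_⟩, fun _ => ⟨?_, fun σ hσ => ?_⟩⟩
    · rw [hop, channel_kronecker_one_mul, conjTranspose_conjTranspose]
    · rw [hop, fid_eq]
      simp only [block_kronecker_one_mul]
      exact h1
    · rw [hop, channel_kronecker_one_mul, conjTranspose_conjTranspose]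
      exact h2 σ hσ
  · exact ⟨R, ⟨1, one_mem _, fun σ => by simp⟩, fun h => absurd h hs⟩

end LocalCorrection

namespace SkewedStabilizerCode

variable {n m : ℕ} (C : SkewedStabilizerCode n m)

/-- Optimal recoveries are, up to a local unitary on `A₁`, of maximal entanglement fidelity at
second order. -/
theorem exists_corrected_optimal {R : ℝ → Recovery n m}
    (hR : ∀ ε, IsOptimalRecovery (C.enc ε) (R ε)) : ∃ (R' : ℝ → Recovery n m) (B : ℝ),
      (∀ ε, ∃ u ∈ unitaryGroup (Bits n) ℂ, ∀ σ,
        channel ((R' ε).op * C.enc ε) σ = uᴴ * channel ((R ε).op * C.enc ε) σ * u) ∧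
      Tendsto (fun ε => (ε ^ 2)⁻¹ * (1 - fid ((R' ε).op * C.enc ε))) (𝓝[≠] 0) (𝓝 C.gap) ∧
      ∀ᶠ ε in 𝓝[≠] (0 : ℝ), ∀ σ, hsSq σ ≤ 1 →
        hsSq (channel ((R' ε).op * C.enc ε) σ - σ) ≤ B * ε ^ 4 := by
  have hmax : ∀ ε, ∃ i, ∀ j,
      (chState_posSemidef ((R ε).op * C.enc ε)).isHermitian.eigenvalues j ≤
        (chState_posSemidef ((R ε).op * C.enc ε)).isHermitian.eigenvalues i := fun ε =>
    Finite.exists_max _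
  choose i hi using hmax
  obtain ⟨h, hh⟩ : ∃ h : ℝ → ℝ, ∀ ε,
      h ε = 1 - (chState_posSemidef ((R ε).op * C.enc ε)).isHermitian.eigenvalues (i ε) :=
    ⟨_, fun _ => rfl⟩
  have h0 : ∀ ε, 0 ≤ h ε := fun ε => by
    rw [hh]
    exact sub_nonneg.mpr (eigenvalues_le_one (chState_posSemidef _)
      (trace_chState (C.op_mul_enc_isometry (R ε) ε)) _)
  have hle : ∀ c > 0, ∀ᶠ ε in 𝓝[≠] (0 : ℝ), h ε ≤ ε ^ 2 * (C.gap + c) := fun c hc =>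
    (C.eventually_one_sub_eigenvalue_le hc).mono fun ε hε => by
      rw [hh]
      exact hε (R ε) (hR ε) (i ε) (hi ε)
  choose R' hconj hgood using fun ε => exists_corrected_recovery (C.enc ε) (R ε) (i ε)
    (C.op_mul_enc_isometry (R ε) ε) (hh ε)
  set G := C.gap with hG
  have hG0 : 0 ≤ G := C.gap_nonneg
  have hsmall : ∀ a > 0, ∀ A : ℝ, ∀ᶠ ε in 𝓝[≠] (0 : ℝ), A * ε ^ 2 ≤ a := by
    intro a ha A
    have h1 : Tendsto (fun ε : ℝ => A * ε ^ 2) (𝓝[≠] 0) (𝓝 (A * 0 ^ 2)) :=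
      ((continuous_const.mul (continuous_pow 2)).tendsto 0).mono_left nhdsWithin_le_nhds
    rw [zero_pow two_ne_zero, mul_zero] at h1
    exact (h1.eventually (gt_mem_nhds ha)).mono fun _ h => h.le
  have hs : ∀ᶠ ε in 𝓝[≠] (0 : ℝ), 2 * 2 ^ n * h ε ≤ 1 / 2 := by
    filter_upwards [hle 1 one_pos, hsmall (1 / 2) (by norm_num) (2 * 2 ^ n * (G + 1))] with ε h1 h2
    calc 2 * 2 ^ n * h ε ≤ 2 * 2 ^ n * (ε ^ 2 * (G + 1)) := by gcongr
      _ = 2 * 2 ^ n * (G + 1) * ε ^ 2 := by ring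
      _ ≤ _ := h2
  have hsq : ∀ᶠ ε in 𝓝[≠] (0 : ℝ), 70 * (2 ^ n) ^ 4 * h ε ^ 2 ≤
      70 * (2 ^ n) ^ 4 * (G + 1) ^ 2 * ε ^ 4 := by
    filter_upwards [hle 1 one_pos] with ε h1
    calc 70 * (2 ^ n) ^ 4 * h ε ^ 2 ≤ 70 * (2 ^ n) ^ 4 * (ε ^ 2 * (G + 1)) ^ 2 := by
          have := h0 ε
          gcongr
      _ = _ := by ring
  refine ⟨R', 70 * (2 ^ n) ^ 4 * (G + 1) ^ 2, hconj, ?_, ?_⟩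
  -- The lower bound holds for every recovery, including the corrected one; the upper bound comes
  -- from the eigenvalue deficit.
  · refine tendsto_of_eventually_between
      (fun c hc => (C.eventually_le_one_sub_fid hc).mono fun ε hε => hε (R' ε)) fun c hc => ?_
    filter_upwards [hle (c / 2) (by positivity), hs, hsq,
      hsmall (c / 2) (by positivity) (70 * (2 ^ n) ^ 4 * (G + 1) ^ 2)] with ε h1 h2 h3 h4
    have h5 := (hgood ε h2).1
    nlinarith [mul_le_mul_of_nonneg_right h4 (sq_nonneg ε)]
  · filter_upwards [hs, hsq] with ε h2 h3 σ hσ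
    exact ((hgood ε h2).2 σ hσ).trans h3

end SkewedStabilizerCode

end SkewedCode

/-! ### Haar averages of the linear part and of the A₁ form -/

namespace SkewedCode

theorem trace_mul_diagonal_mul_diagonal {k : Type} [Fintype k] [DecidableEq k] (M : Matrix k k ℂ)
    (a b : k → ℝ) : (trace (M * (diagonal fun i => (a i : ℂ)) * Mᴴ * diagonal fun i => (b i : ℂ))).re
      = ∑ i, ∑ j, a j * b i * Complex.normSq (M i j) := by
  have h : trace (M * (diagonal fun i => (a i : ℂ)) * Mᴴ * diagonal fun i => (b i : ℂ)) =
      ((∑ i, ∑ j, a j * b i * Complex.normSq (M i j) : ℝ) : ℂ) := by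
    simp only [trace, diag, mul_diagonal, Complex.ofReal_sum, Complex.ofReal_mul]
    simp only [mul_apply (N := Mᴴ), mul_diagonal, conjTranspose_apply, Finset.sum_mul,
      Complex.star_def]
    refine Finset.sum_congr rfl fun i _ => Finset.sum_congr rfl fun j _ => ?_
    rw [← Complex.mul_conj]
    ring
  rw [h, Complex.ofReal_re]

/-- If `f ε = O(ε ^ 4)` then `f ε / ε ^ 2` tends to zero. -/
theorem tendsto_inv_sq_mul_of_abs_le {f : ℝ → ℝ} {B : ℝ}
    (h : ∀ᶠ ε in 𝓝[≠] (0 : ℝ), |f ε| ≤ B * ε ^ 4) :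
    Tendsto (fun ε => (ε ^ 2)⁻¹ * f ε) (𝓝[≠] 0) (𝓝 0) := by
  have h1 : Tendsto (fun ε : ℝ => B * ε ^ 2) (𝓝[≠] 0) (𝓝 0) := by
    have h2 : Tendsto (fun ε : ℝ => B * ε ^ 2) (𝓝[≠] 0) (𝓝 (B * 0 ^ 2)) :=
      ((continuous_const.mul (continuous_pow 2)).tendsto 0).mono_left nhdsWithin_le_nhds
    rwa [zero_pow two_ne_zero, mul_zero] at h2
  refine squeeze_zero_norm' ?_ h1
  filter_upwards [h, self_mem_nhdsWithin] with ε h2 h3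
  have h4 : (0 : ℝ) < ε ^ 2 := by
    have : ε ≠ 0 := h3
    positivity
  rw [Real.norm_eq_abs, abs_mul, abs_of_pos (inv_pos.mpr h4), inv_mul_le_iff₀ h4]
  calc _ ≤ _ := h2
    _ = _ := by ring

namespace SkewedStabilizerCode

variable {n m : ℕ} (C : SkewedStabilizerCode n m)

theorem linPart_eq_sum (lam : Bits n → ℝ) (Y : Matrix (Phys n m) (Bits n) ℂ)
    (U : Matrix (Bits n) (Bits n) ℂ) : linPart lam Y U = ∑ q, ∑ i, ∑ j,
      lam j * Real.log (lam i) * Complex.normSq ((Uᴴ * block Y q * U) i j) := by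
  have h : Uᴴ * channel Y (rotState lam U) * U = ∑ q, (Uᴴ * block Y q * U) *
      (diagonal fun i => (lam i : ℂ)) * (Uᴴ * block Y q * U)ᴴ := by
    simp only [channel, rotState, conjTranspose_mul, conjTranspose_conjTranspose, Finset.mul_sum,
      Finset.sum_mul, Matrix.mul_assoc]
  rw [linPart, h, Finset.sum_mul, trace_sum, Complex.re_sum]
  exact Finset.sum_congr rfl fun q _ => trace_mul_diagonal_mul_diagonal _ _ _

theorem continuous_linPart (lam : Bits n → ℝ) (Y : Matrix (Phys n m) (Bits n) ℂ) :
    Continuous fun U : unitaryGroup (Bits n) ℂ =>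
      linPart lam Y (U : Matrix (Bits n) (Bits n) ℂ) := by
  simp only [linPart_eq_sum]
  refine continuous_finsetSum _ fun q _ => continuous_finsetSum _ fun i _ =>
    continuous_finsetSum _ fun j _ => continuous_const.mul ?_
  exact Complex.continuous_normSq.comp (continuous_conj_unitary_apply (block Y q) i j)

/-- The averaged linear part is an affine function of the entanglement fidelity. -/
theorem exists_integral_linPart (lam : Bits n → ℝ) : ∃ a b : ℝ,
    ∀ Y : Matrix (Phys n m) (Bits n) ℂ, Yᴴ * Y = 1 →
      ∫ U : unitaryGroup (Bits n) ℂ, linPart lam Y (U : Matrix (Bits n) (Bits n) ℂ) ∂haar =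
        a + b * (1 - fid Y) := by
  let w : Bits n → Bits n → ℝ := fun i j => lam j * Real.log (lam i)
  let s : Bits n → Bits n → ℝ := fun i j => if i = j then
    ((2 : ℝ) ^ n) ^ 2 / (Fintype.card (Bits n) * (Fintype.card (Bits n) + 1)) else
    -(((2 : ℝ) ^ n) ^ 2 / Fintype.card (Bits n)) / ((Fintype.card (Bits n) : ℝ) ^ 2 - 1)
  let t : Bits n → Bits n → ℝ := fun i j => if i = j then
    (2 : ℝ) ^ n / (Fintype.card (Bits n) * (Fintype.card (Bits n) + 1)) else
    (2 : ℝ) ^ n / ((Fintype.card (Bits n) : ℝ) ^ 2 - 1)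
  refine ⟨∑ i, ∑ j, (w i j * t i j + w i j * s i j), -∑ i, ∑ j, w i j * s i j, fun Y hY => ?_⟩
  -- Two invariants of the Kraus operators enter the average: their total squared norm, which
  -- isometry fixes to be 2^n, and this one, which is the fidelity.
  have h1 : ∑ q, Complex.normSq (trace (block Y q)) = ((2 : ℝ) ^ n) ^ 2 * fid Y := by
    rw [fid_eq, ← mul_assoc, ← mul_pow, mul_inv_cancel₀ (by positivity), one_pow, one_mul]
  simp only [linPart_eq_sum]
  rw [integral_sum_normSq_conj (block Y) w, ← hsSq_eq_sum_block, hsSq_of_isometry hY, h1,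
    neg_mul, Finset.sum_mul, ← sub_eq_add_neg, ← Finset.sum_sub_distrib]
  refine Finset.sum_congr rfl fun i _ => ?_
  rw [Finset.sum_mul, ← Finset.sum_sub_distrib]
  refine Finset.sum_congr rfl fun j _ => ?_
  simp only [s, t]
  split_ifs <;> ring

theorem continuous_rotState (lam : Bits n → ℝ) : Continuous fun U : unitaryGroup (Bits n) ℂ =>
    rotState lam (U : Matrix (Bits n) (Bits n) ℂ) := by
  unfold rotState
  have h : Continuous fun U : unitaryGroup (Bits n) ℂ => (U : Matrix (Bits n) (Bits n) ℂ) :=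
    continuous_subtype_val
  fun_prop

theorem continuous_kleinDiv_channel {lam : Bits n → ℝ} (hlam : ∀ i, 0 < lam i)
    (Y : Matrix (Phys n m) (Bits n) ℂ) : Continuous fun U : unitaryGroup (Bits n) ℂ =>
      kleinDiv lam ((U : Matrix (Bits n) (Bits n) ℂ)ᴴ *
        channel Y (rotState lam (U : Matrix (Bits n) (Bits n) ℂ)) * U) := by
  rw [← continuousOn_univ]
  refine continuousOn_kleinDiv hlam (Continuous.continuousOn ?_) fun U _ =>
    isHermitian_conjTranspose_mul_mul _ (channel_isHermitian Y (rotState_isHermitian lam _))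
  have h : Continuous fun U : unitaryGroup (Bits n) ℂ => (U : Matrix (Bits n) (Bits n) ℂ) :=
    continuous_subtype_val
  have h2 := continuous_rotState lam
  have h3 : Continuous fun U : unitaryGroup (Bits n) ℂ =>
      channel Y (rotState lam (U : Matrix (Bits n) (Bits n) ℂ)) := by
    unfold channel
    fun_prop
  fun_prop

theorem sum_sq_le_one {k : Type} [Fintype k] {lam : k → ℝ} (hlam : ∀ i, 0 < lam i)
    (hlam1 : ∑ i, lam i = 1) : ∑ i, lam i ^ 2 ≤ 1 := by
  rw [← hlam1]
  refine Finset.sum_le_sum fun i _ => ?_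
  have h : lam i ≤ 1 := by
    rw [← hlam1]
    exact Finset.single_le_sum (fun j _ => (hlam j).le) (Finset.mem_univ i)
  nlinarith [hlam i]

/-- The form is quadratic in a deviation of squared norm O(ε⁴), uniformly in U, hence negligible at
order ε². -/
theorem tendsto_integral_kleinDiv_channel {lam : Bits n → ℝ} (hlam : ∀ i, 0 < lam i)
    (hlam1 : ∑ i, lam i = 1) {Y : ℝ → Matrix (Phys n m) (Bits n) ℂ} {B : ℝ}
    (hY : ∀ᶠ ε in 𝓝[≠] (0 : ℝ), ∀ σ, hsSq σ ≤ 1 → hsSq (channel (Y ε) σ - σ) ≤ B * ε ^ 4) :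
    Tendsto (fun ε => (ε ^ 2)⁻¹ * ∫ U : unitaryGroup (Bits n) ℂ,
      kleinDiv lam ((U : Matrix (Bits n) (Bits n) ℂ)ᴴ *
        channel (Y ε) (rotState lam (U : Matrix (Bits n) (Bits n) ℂ)) * U) ∂haar)
      (𝓝[≠] 0) (𝓝 0) := by
  -- The input and, for small ε, the deviation have squared norm at most 1, so the output has
  -- squared norm at most 2 + 2.
  obtain ⟨K, hK0, hK⟩ := exists_abs_kleinDiv_le hlam 4
  refine tendsto_inv_sq_mul_of_abs_le (B := K * B) ?_
  have hsmall : ∀ᶠ ε in 𝓝[≠] (0 : ℝ), B * ε ^ 4 ≤ 1 := by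
    have h1 : Tendsto (fun ε : ℝ => B * ε ^ 4) (𝓝[≠] 0) (𝓝 (B * 0 ^ 4)) :=
      ((continuous_const.mul (continuous_pow 4)).tendsto 0).mono_left nhdsWithin_le_nhds
    rw [zero_pow (by norm_num), mul_zero] at h1
    exact (h1.eventually (gt_mem_nhds one_pos)).mono fun _ h => h.le
  filter_upwards [hY, hsmall] with ε h1 h2
  rw [← Real.norm_eq_abs]
  refine (norm_integral_le_of_norm_le_const (C := K * B * ε ^ 4)
    (.of_forall fun U => ?_)).trans (by simp)
  obtain ⟨U, hU⟩ := U
  set σ := rotState lam U with hσ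
  have h3 : hsSq σ ≤ 1 := by
    rw [hσ, hsSq_rotState lam hU]
    exact sum_sq_le_one hlam hlam1
  have h4 := h1 σ h3
  have h5 : hsSq (channel (Y ε) σ) ≤ 4 := by
    have := hsSq_add_le (channel (Y ε) σ - σ) σ
    rw [sub_add_cancel] at this
    linarith
  have h6 := hK (Uᴴ * channel (Y ε) σ * U)
    (isHermitian_conjTranspose_mul_mul _ (channel_isHermitian _ (rotState_isHermitian lam U)))
    (by rwa [hsSq_conj_unitary hU])
  rw [← conj_rotState lam hU, ← sub_mul, ← mul_sub, hsSq_conj_unitary hU] at h6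
  rw [Real.norm_eq_abs]
  calc _ ≤ _ := h6
    _ ≤ K * (B * ε ^ 4) := mul_le_mul_of_nonneg_left h4 hK0
    _ = _ := by ring

end SkewedStabilizerCode

end SkewedCode

/-! ### Haar average of the bulk quadratic form -/

namespace SkewedCode

theorem hsSq_conj_one_add_sub_le {k : Type} [Fintype k] [DecidableEq k] (M Z : Matrix k k ℂ) :
    hsSq (M * Z * Mᴴ - Z) ≤ 2 * hsSq Z * (hsSq M + 1) * hsSq (M - 1) := by
  have h : M * Z * Mᴴ - Z = (M - 1) * Z * Mᴴ + Z * (M - 1)ᴴ := by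
    rw [conjTranspose_sub, conjTranspose_one]
    noncomm_ring
  have h1 : hsSq ((M - 1) * Z * Mᴴ) ≤ hsSq (M - 1) * hsSq Z * hsSq M := by
    refine (hsSq_mul_le _ _).trans ?_
    rw [hsSq_conjTranspose]
    exact mul_le_mul_of_nonneg_right (hsSq_mul_le _ _) (hsSq_nonneg _)
  have h2 : hsSq (Z * (M - 1)ᴴ) ≤ hsSq Z * hsSq (M - 1) := by
    refine (hsSq_mul_le _ _).trans ?_
    rw [hsSq_conjTranspose]
  rw [h]
  refine (hsSq_add_le _ _).trans ?_
  linarith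

namespace SkewedStabilizerCode

variable {n m : ℕ} (C : SkewedStabilizerCode n m)

theorem smul_rotState_kronecker_eq (lam : Bits n → ℝ) (U : Matrix (Bits n) (Bits n) ℂ) :
    ((2 : ℂ) ^ m)⁻¹ • (rotState lam U ⊗ₖ (1 : Matrix (Bits m) (Bits m) ℂ)) =
      rotState (bulkSpec m lam) (U ⊗ₖ (1 : Matrix (Bits m) (Bits m) ℂ)) :=
  smul_rotState_kronecker lam U

theorem recoveredA_skewRec (lam : Bits n → ℝ) (ε : ℝ) (U : Matrix (Bits n) (Bits n) ℂ) :
    recoveredA (C.enc ε) (C.skewRec ε) (rotState lam U) = C.skewEncOp ε *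
      rotState (bulkSpec m lam) (U ⊗ₖ (1 : Matrix (Bits m) (Bits m) ℂ)) * (C.skewEncOp ε)ᴴ := by
  rw [recoveredA_eq C.flat_χ, ← smul_rotState_kronecker_eq, Matrix.mul_smul, Matrix.smul_mul]
  rfl

theorem eventually_hsSq_skewEncOp_sub_one_le : ∃ b : ℝ, 0 ≤ b ∧
    ∀ᶠ ε in 𝓝[≠] (0 : ℝ), hsSq (C.skewEncOp ε - 1) ≤ b * ε ^ 2 := by
  have h1 := (continuous_hsSq.tendsto _).comp C.tendsto_skewEncOp_slope
  have h0 := hsSq_nonneg ((2 : ℂ)⁻¹ • C.D)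
  refine ⟨hsSq ((2 : ℂ)⁻¹ • C.D) + 1, by linarith, ?_⟩
  filter_upwards [h1.eventually (gt_mem_nhds (lt_add_one _)), self_mem_nhdsWithin] with ε h2 h3
  have h4 : (0 : ℝ) < ε ^ 2 := by
    have : ε ≠ 0 := h3
    positivity
  have h5 : hsSq (ε⁻¹ • (C.skewEncOp ε - 1)) = (ε ^ 2)⁻¹ * hsSq (C.skewEncOp ε - 1) := by
    rw [← Complex.coe_smul, hsSq_smul, Complex.normSq_ofReal, sq, mul_inv]
  rw [Function.comp_apply, h5, inv_mul_lt_iff₀ h4] at h2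
  linarith

theorem bulkState_sub_eq (lam : Bits n → ℝ) (ε : ℝ) {U : Matrix (Bits n) (Bits n) ℂ}
    (hU : U ∈ unitaryGroup (Bits n) ℂ) :
    C.bulkState lam ε U - (diagonal fun x => (bulkSpec m lam x : ℂ)) =
      (U ⊗ₖ (1 : Matrix (Bits m) (Bits m) ℂ))ᴴ *
        (recoveredA (C.enc ε) (C.skewRec ε) (rotState lam U) -
          ((2 : ℂ) ^ m)⁻¹ • (rotState lam U ⊗ₖ (1 : Matrix (Bits m) (Bits m) ℂ))) *
        (U ⊗ₖ (1 : Matrix (Bits m) (Bits m) ℂ)) := by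
  rw [mul_sub, sub_mul, smul_rotState_kronecker_eq, conj_rotState _ (kronecker_one_mem hU),
    bulkState]

/-- The recovered state is uniformly close to the exact one. -/
theorem exists_hsSq_bulkState_sub_le (lam : Bits n → ℝ) : ∃ b : ℝ, ∀ᶠ ε in 𝓝[≠] (0 : ℝ),
    ∀ U ∈ unitaryGroup (Bits n) ℂ,
      hsSq (C.bulkState lam ε U - (diagonal fun x => (bulkSpec m lam x : ℂ))) ≤ b * ε ^ 2 := by
  obtain ⟨b, hb, h⟩ := C.eventually_hsSq_skewEncOp_sub_one_le
  set s := ∑ x, bulkSpec m lam x ^ 2 with hs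
  have hs0 : 0 ≤ s := Finset.sum_nonneg fun _ _ => sq_nonneg _
  set I := hsSq (1 : Matrix (Bits n × Bits m) (Bits n × Bits m) ℂ)
  refine ⟨2 * s * ((2 * b + 2 * I) + 1) * b, ?_⟩
  have h1 : ∀ᶠ ε in 𝓝[≠] (0 : ℝ), ε ^ 2 ≤ 1 := by
    have h2 : Tendsto (fun ε : ℝ => ε ^ 2) (𝓝[≠] 0) (𝓝 (0 ^ 2)) :=
      ((continuous_pow 2).tendsto 0).mono_left nhdsWithin_le_nhds
    rw [zero_pow two_ne_zero] at h2
    exact (h2.eventually (gt_mem_nhds one_pos)).mono fun _ h => h.le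
  filter_upwards [h, h1] with ε h2 h3 U hU
  rw [C.bulkState_sub_eq lam ε hU, hsSq_conj_unitary (kronecker_one_mem hU), recoveredA_skewRec,
    smul_rotState_kronecker_eq]
  refine (hsSq_conj_one_add_sub_le _ _).trans ?_
  rw [hsSq_rotState _ (kronecker_one_mem hU), ← hs]
  have h4 : hsSq (C.skewEncOp ε) ≤ 2 * b + 2 * I := by
    have h5 := hsSq_add_le (C.skewEncOp ε - 1) 1
    rw [sub_add_cancel] at h5
    nlinarith
  have h0 := hsSq_nonneg (C.skewEncOp ε)
  have h0' := hsSq_nonneg (C.skewEncOp ε - 1)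
  have hI : 0 ≤ I := hsSq_nonneg _
  calc 2 * s * (hsSq (C.skewEncOp ε) + 1) * hsSq (C.skewEncOp ε - 1) ≤
      2 * s * ((2 * b + 2 * I) + 1) * (b * ε ^ 2) := by gcongr
    _ = _ := by ring

/-- The blocks of `D` labelled by the basis of `A₂`. -/
def blockD (q : Bits m × Bits m) : Matrix (Bits n) (Bits n) ℂ :=
  Matrix.of fun i j => C.D (i, q.1) (j, q.2)

theorem conj_kronecker_one_apply (U : Matrix (Bits n) (Bits n) ℂ) (x y : Bits n × Bits m) :
    ((U ⊗ₖ (1 : Matrix (Bits m) (Bits m) ℂ))ᴴ * C.D * (U ⊗ₖ (1 : Matrix (Bits m) (Bits m) ℂ))) x y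
      = (Uᴴ * C.blockD (x.2, y.2) * U) x.1 y.1 := by
  rw [conjTranspose_kronecker, conjTranspose_one]
  simp only [mul_apply, kroneckerMap_apply, Fintype.sum_prod_type, one_apply, mul_ite, mul_one,
    mul_zero, ite_mul, zero_mul, Finset.sum_ite_eq, Finset.sum_ite_eq', Finset.mem_univ, if_true,
    blockD, of_apply]

/-- The derivative is half the anticommutator of D with σ ⊗ 1/d_χ. In the eigenbasis of σ it
multiplies the blocks of D by (λ_i + λ_j)/(2 d_χ), the source of the factor (λ_i + λ_j)² in `f₂`. -/
theorem tendsto_bulkState_slope (lam : Bits n → ℝ) {U : Matrix (Bits n) (Bits n) ℂ}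
    (hU : U ∈ unitaryGroup (Bits n) ℂ) :
    Tendsto (fun ε : ℝ => ε⁻¹ • (C.bulkState lam ε U - diagonal fun x => (bulkSpec m lam x : ℂ)))
      (𝓝[≠] 0) (𝓝 (Matrix.of fun x y => (((lam x.1 + lam y.1) / (2 * 2 ^ m) : ℝ) : ℂ) *
        (Uᴴ * C.blockD (x.2, y.2) * U) x.1 y.1)) := by
  have h1 := tendsto_matrix_mul (tendsto_matrix_mul
    (tendsto_const_nhds (x := (U ⊗ₖ (1 : Matrix (Bits m) (Bits m) ℂ))ᴴ))
    (C.tendsto_recoveredA_skewRec_slope (rotState lam U)))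
    (tendsto_const_nhds (x := U ⊗ₖ (1 : Matrix (Bits m) (Bits m) ℂ)))
  have h2 : (U ⊗ₖ (1 : Matrix (Bits m) (Bits m) ℂ))ᴴ * (((2 : ℂ) ^ m)⁻¹ • ((2 : ℂ)⁻¹ •
      (C.D * (rotState lam U ⊗ₖ (1 : Matrix (Bits m) (Bits m) ℂ)) +
        (rotState lam U ⊗ₖ (1 : Matrix (Bits m) (Bits m) ℂ)) * C.D))) *
      (U ⊗ₖ (1 : Matrix (Bits m) (Bits m) ℂ)) =
      Matrix.of fun x y => (((lam x.1 + lam y.1) / (2 * 2 ^ m) : ℝ) : ℂ) *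
        (Uᴴ * C.blockD (x.2, y.2) * U) x.1 y.1 := by
    have hW : (U ⊗ₖ (1 : Matrix (Bits m) (Bits m) ℂ))ᴴ *
      (U ⊗ₖ (1 : Matrix (Bits m) (Bits m) ℂ)) = 1 :=
      mem_unitaryGroup_iff'.mp (kronecker_one_mem hU)
    have hcomm : ((2 : ℂ) ^ m)⁻¹ • ((2 : ℂ)⁻¹ •
      (C.D * (rotState lam U ⊗ₖ (1 : Matrix (Bits m) (Bits m) ℂ)) +
        (rotState lam U ⊗ₖ (1 : Matrix (Bits m) (Bits m) ℂ)) * C.D)) = (2 : ℂ)⁻¹ •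
      (C.D * rotState (bulkSpec m lam) (U ⊗ₖ (1 : Matrix (Bits m) (Bits m) ℂ)) +
        rotState (bulkSpec m lam) (U ⊗ₖ (1 : Matrix (Bits m) (Bits m) ℂ)) * C.D) := by
      rw [smul_comm, ← smul_rotState_kronecker_eq, Matrix.mul_smul, Matrix.smul_mul, ← smul_add]
    rw [hcomm]
    have hconj : ∀ x y, ((U ⊗ₖ (1 : Matrix (Bits m) (Bits m) ℂ))ᴴ * C.D *
        (U ⊗ₖ (1 : Matrix (Bits m) (Bits m) ℂ))) x y = (Uᴴ * C.blockD (x.2, y.2) * U) x.1 y.1 :=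
      C.conj_kronecker_one_apply U
    generalize U ⊗ₖ (1 : Matrix (Bits m) (Bits m) ℂ) = Z at hW hconj ⊢
    have h3 : Zᴴ * ((2 : ℂ)⁻¹ • (C.D * rotState (bulkSpec m lam) Z +
        rotState (bulkSpec m lam) Z * C.D)) * Z = (2 : ℂ)⁻¹ • ((Zᴴ * C.D * Z) *
          (diagonal fun x => (bulkSpec m lam x : ℂ)) * (Zᴴ * Z) +
        (Zᴴ * Z) * (diagonal fun x => (bulkSpec m lam x : ℂ)) * (Zᴴ * C.D * Z)) := by
      simp only [rotState, Matrix.mul_smul, Matrix.smul_mul, mul_add, add_mul, Matrix.mul_assoc]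
    rw [h3, hW, Matrix.mul_one, Matrix.one_mul]
    ext x y
    rw [Matrix.smul_apply, Matrix.add_apply, mul_diagonal, diagonal_mul, hconj, of_apply, bulkSpec,
      bulkSpec, smul_eq_mul]
    push_cast
    field_simp
    ring
  rw [h2] at h1
  refine h1.congr fun ε => ?_
  rw [C.bulkState_sub_eq lam ε hU, Matrix.mul_smul, Matrix.smul_mul]

theorem sum_normSq_mul_kleinSlope {lam : Bits n → ℝ} (hlam : ∀ i, 0 < lam i)
    (B : Bits m × Bits m → Matrix (Bits n) (Bits n) ℂ) :
    ∑ x : Bits n × Bits m, ∑ y : Bits n × Bits m,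
      Complex.normSq (Matrix.of (fun x y : Bits n × Bits m =>
        (((lam x.1 + lam y.1) / (2 * 2 ^ m) : ℝ) : ℂ) * B (x.2, y.2) x.1 y.1) x y) *
        kleinSlope (bulkSpec m lam x) (bulkSpec m lam y) =
    ∑ q, ∑ i, ∑ j, ((lam i + lam j) ^ 2 / (4 * 2 ^ m) * kleinSlope (lam i) (lam j)) *
      Complex.normSq (B q i j) := by
  have h : ∀ x y : Bits n × Bits m, Complex.normSq (Matrix.of (fun x y : Bits n × Bits m =>
        (((lam x.1 + lam y.1) / (2 * 2 ^ m) : ℝ) : ℂ) * B (x.2, y.2) x.1 y.1) x y) *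
        kleinSlope (bulkSpec m lam x) (bulkSpec m lam y) =
      ((lam x.1 + lam y.1) ^ 2 / (4 * 2 ^ m) * kleinSlope (lam x.1) (lam y.1)) *
        Complex.normSq (B (x.2, y.2) x.1 y.1) := by
    intro x y
    rw [of_apply, Complex.normSq_mul, Complex.normSq_ofReal, bulkSpec, bulkSpec,
      kleinSlope_div (hlam _) (hlam _) (by positivity)]
    field_simp
    ring
  simp only [h]
  simp only [Fintype.sum_prod_type]
  rw [Finset.sum_comm]
  refine Finset.sum_congr rfl fun a _ => ?_
  rw [Finset.sum_congr rfl fun i _ => Finset.sum_comm, Finset.sum_comm]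

theorem continuous_kleinDiv_bulkState {lam : Bits n → ℝ} (hlam : ∀ i, 0 < lam i) (ε : ℝ) :
    Continuous fun U : unitaryGroup (Bits n) ℂ =>
      kleinDiv (bulkSpec m lam) (C.bulkState lam ε (U : Matrix (Bits n) (Bits n) ℂ)) := by
  have hU : Continuous fun U : unitaryGroup (Bits n) ℂ => (U : Matrix (Bits n) (Bits n) ℂ) :=
    continuous_subtype_val
  have h : Continuous fun U : unitaryGroup (Bits n) ℂ =>
      (U : Matrix (Bits n) (Bits n) ℂ) ⊗ₖ (1 : Matrix (Bits m) (Bits m) ℂ) := by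
    refine continuous_matrix fun x y => ?_
    simp only [kroneckerMap_apply]
    exact (hU.matrix_elem x.1 y.1).mul continuous_const
  have h2 : Continuous fun U : unitaryGroup (Bits n) ℂ =>
      rotState (bulkSpec m lam)
        ((U : Matrix (Bits n) (Bits n) ℂ) ⊗ₖ (1 : Matrix (Bits m) (Bits m) ℂ)) := by
    unfold rotState
    fun_prop
  have h3 : Continuous fun U : unitaryGroup (Bits n) ℂ =>
      C.bulkState lam ε (U : Matrix (Bits n) (Bits n) ℂ) := by
    unfold bulkState
    simp only [recoveredA_skewRec]
    fun_prop
  have hp : ∀ x, 0 < bulkSpec m lam x := fun x => div_pos (hlam x.1) (by positivity)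
  have h4 : ContinuousOn (fun U : unitaryGroup (Bits n) ℂ =>
      kleinDiv (bulkSpec m lam) (C.bulkState lam ε (U : Matrix (Bits n) (Bits n) ℂ))) Set.univ :=
    continuousOn_kleinDiv hp h3.continuousOn
      fun U _ => C.bulkState_isHermitian lam ε (U : Matrix (Bits n) (Bits n) ℂ)
  exact continuousOn_univ.mp h4

/-- Dominated convergence: the pointwise limit is `tendsto_kleinDiv`, and the O(ε²) bound on the
deviation, uniform in U, provides a constant majorant. -/
theorem tendsto_integral_kleinDiv_bulkState {lam : Bits n → ℝ} (hlam : ∀ i, 0 < lam i) :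
    Tendsto (fun ε => (ε ^ 2)⁻¹ * ∫ U : unitaryGroup (Bits n) ℂ,
      kleinDiv (bulkSpec m lam) (C.bulkState lam ε (U : Matrix (Bits n) (Bits n) ℂ)) ∂haar)
      (𝓝[≠] 0) (𝓝 (∫ U : unitaryGroup (Bits n) ℂ, ∑ q, ∑ i, ∑ j,
        ((lam i + lam j) ^ 2 / (4 * 2 ^ m) * kleinSlope (lam i) (lam j)) * Complex.normSq
          (((U : Matrix (Bits n) (Bits n) ℂ)ᴴ * C.blockD q * U) i j) ∂haar)) := by
  have hp : ∀ x, 0 < bulkSpec m lam x := fun x => div_pos (hlam x.1) (by positivity)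
  obtain ⟨b, hb⟩ := C.exists_hsSq_bulkState_sub_le lam
  set s := ∑ x, bulkSpec m lam x ^ 2 with hs
  obtain ⟨K, hK0, hK⟩ := exists_abs_kleinDiv_le hp (2 * 1 + 2 * s)
  have hdiag : hsSq (diagonal fun x => (bulkSpec m lam x : ℂ)) = s := by
    have h := hsSq_rotState (bulkSpec m lam) (one_mem (unitaryGroup (Bits n × Bits m) ℂ))
    rwa [rotState, conjTranspose_one, Matrix.one_mul, Matrix.mul_one] at h
  have hsmall : ∀ᶠ ε in 𝓝[≠] (0 : ℝ), b * ε ^ 2 ≤ 1 := by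
    have h1 : Tendsto (fun ε : ℝ => b * ε ^ 2) (𝓝[≠] 0) (𝓝 (b * 0 ^ 2)) :=
      ((continuous_const.mul (continuous_pow 2)).tendsto 0).mono_left nhdsWithin_le_nhds
    rw [zero_pow two_ne_zero, mul_zero] at h1
    exact (h1.eventually (gt_mem_nhds one_pos)).mono fun _ h => h.le
  simp only [← integral_const_mul]
  refine tendsto_integral_filter_of_dominated_convergence (fun _ => K * b)
    (.of_forall fun ε => (continuous_const.mul
      (C.continuous_kleinDiv_bulkState hlam ε)).aestronglyMeasurable) ?_ (integrable_const _)
    (.of_forall fun U => ?_)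
  · filter_upwards [hb, hsmall, self_mem_nhdsWithin] with ε h1 h2 h3
    refine .of_forall fun U => ?_
    have h4 := h1 U U.2
    have h5 : hsSq (C.bulkState lam ε (U : Matrix (Bits n) (Bits n) ℂ)) ≤ 2 * 1 + 2 * s := by
      have h6 := hsSq_add_le (C.bulkState lam ε (U : Matrix (Bits n) (Bits n) ℂ) -
        diagonal fun x => (bulkSpec m lam x : ℂ)) (diagonal fun x => (bulkSpec m lam x : ℂ))
      rw [sub_add_cancel, hdiag] at h6
      linarith
    have h7 := hK _ (C.bulkState_isHermitian lam ε _) h5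
    have h8 : (0 : ℝ) < ε ^ 2 := by
      have : ε ≠ 0 := h3
      positivity
    rw [Real.norm_eq_abs, abs_mul, abs_of_pos (inv_pos.mpr h8), inv_mul_le_iff₀ h8]
    calc _ ≤ _ := h7
      _ ≤ K * (b * ε ^ 2) := mul_le_mul_of_nonneg_left h4 hK0
      _ = _ := by ring
  · have h1 := tendsto_kleinDiv hp (fun ε => C.bulkState_isHermitian lam ε U)
      (C.tendsto_bulkState_slope lam U.2)
    have h2 := sum_normSq_mul_kleinSlope (m := m) hlam fun q =>
      (U : Matrix (Bits n) (Bits n) ℂ)ᴴ * C.blockD q * U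
    beta_reduce at h2
    rw [h2] at h1
    exact h1

end SkewedStabilizerCode

end SkewedCode

/-! ### Assembling the averaged correction -/

namespace SkewedCode

theorem integral_sub_add_sub {X : Type*} [MeasurableSpace X] {μ : Measure X} {f g u v : X → ℝ}
    (hf : Integrable f μ) (hg : Integrable g μ) (hu : Integrable u μ) (hv : Integrable v μ) :
    ∫ x, (f x - g x + (u x - v x)) ∂μ =
      ((∫ x, f x ∂μ) - ∫ x, g x ∂μ) + ((∫ x, u x ∂μ) - ∫ x, v x ∂μ) := by
  rw [← integral_sub hf hg, ← integral_sub hu hv]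
  exact integral_add (hf.sub hg) (hu.sub hv)

namespace SkewedStabilizerCode

variable {n m : ℕ} (C : SkewedStabilizerCode n m)

theorem sum_hsSq_blockD : ∑ q, hsSq (C.blockD q) = hsSq C.D := by
  simp only [hsSq, blockD, of_apply, Fintype.sum_prod_type]
  rw [Finset.sum_comm' (t' := Finset.univ) (s' := fun _ => Finset.univ) (by simp)]
  rw [Finset.sum_congr rfl fun a _ => Finset.sum_comm, Finset.sum_comm]
  refine Finset.sum_congr rfl fun i _ => ?_
  rw [Finset.sum_comm]
  exact Finset.sum_congr rfl fun a _ => Finset.sum_comm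

theorem sum_normSq_trace_blockD :
    ∑ q, Complex.normSq (trace (C.blockD q)) = hsSq (traceFst C.D) := by
  simp only [hsSq, blockD, traceFst, trace, diag, of_apply, Fintype.sum_prod_type]

/-- The part of the averaged correction that does not depend on the logical state. -/
noncomputable def areaShift : ℝ :=
  C.c₂ / 2 * (2 - 2 / Fintype.card (Bits n)) + (hsSq C.D + hsSq (traceFst C.D)) /
    (Fintype.card (Bits n) * (Fintype.card (Bits n) + 1)) / (2 * 2 ^ m)

theorem c₂_div_two : C.c₂ / 2 = Fintype.card (Bits n) / (4 * 2 ^ m) *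
    ((hsSq C.D - hsSq (traceFst C.D) / Fintype.card (Bits n)) /
      ((Fintype.card (Bits n) : ℝ) ^ 2 - 1)) := by
  have h1 : (Fintype.card (Bits n) : ℝ) = 2 ^ n := by simp
  have h2 : (traceFst C.D)ᴴ = traceFst C.D := by
    rw [← traceFst_conjTranspose, C.D_isHermitian.eq]
  rw [c₂, hsSq_eq_re C.D, hsSq_eq_re (traceFst C.D), h1, h2, C.D_isHermitian.eq]
  generalize (trace (C.D * C.D)).re = a
  generalize (trace (traceFst C.D * traceFst C.D)).re = b
  -- For n = 0 both sides vanish, by the convention for division by zero.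
  by_cases h3 : ((2 : ℝ) ^ n) ^ 2 - 1 = 0
  · rw [h3]
    simp
  · field_simp
    ring

/-- Symmetrizing in i and j turns the slopes into `logSlope`, hence the off-diagonal part into `f₂`.
A diagonal term is λ_i X/(2e), and these add up to a constant because the eigenvalues sum to 1. This
is why the remaining shift does not depend on the logical state. -/
theorem sum_kleinSlope_mul {k : Type} [Fintype k] [DecidableEq k] {lam : k → ℝ}
    (hlam : ∀ i, 0 < lam i) (hlam1 : ∑ i, lam i = 1) {e : ℝ} (he : 0 < e) (X Y : ℝ) :
    ∑ i, ∑ j, ((lam i + lam j) ^ 2 / (4 * e) * kleinSlope (lam i) (lam j)) *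
      (if i = j then X else Y) =
    X / (2 * e) + Fintype.card k / (4 * e) * Y * (f₂ lam + 2 - 2 / Fintype.card k) := by
  set w : k → k → ℝ := fun i j => (lam i + lam j) ^ 2 / (4 * e) * kleinSlope (lam i) (lam j) with hw
  set t : k → k → ℝ := fun i j => if i = j then X else Y with ht
  have ht' : ∀ i j, t j i = t i j := fun i j => by
    simp only [ht, eq_comm]
  have hk : (Fintype.card k : ℝ) ≠ 0 := by
    have : Nonempty k := by
      by_contra hc
      rw [not_nonempty_iff] at hc
      simp at hlam1
    exact_mod_cast Fintype.card_ne_zero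
  have hwt : ∀ i j, (w i j + w j i) * t i j / 2 = (if i = j then lam i * (X / (2 * e)) else 0) +
      Fintype.card k / (4 * e) * Y * (if i = j then 0 else
        1 / (2 * (Fintype.card k : ℝ)) * ((lam i + lam j) ^ 2 * logSlope (lam i) (lam j))) := by
    intro i j
    have h1 : w i j + w j i = (lam i + lam j) ^ 2 / (4 * e) * logSlope (lam i) (lam j) := by
      rw [hw, ← kleinSlope_add_swap (hlam i) (hlam j)]
      ring
    rw [h1, ht]
    by_cases h : i = j
    · subst h
      have := (hlam i).ne'
      simp only [if_true, logSlope]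
      field_simp
      ring
    · simp only [if_neg h]
      field_simp
      ring
  have hsym : ∑ i, ∑ j, w i j * t i j = ∑ i, ∑ j, (w i j + w j i) * t i j / 2 := by
    have h1 : ∑ i, ∑ j, w j i * t i j = ∑ i, ∑ j, w i j * t i j := by
      rw [Finset.sum_comm]
      simp only [ht']
    simp only [add_mul, add_div, Finset.sum_add_distrib, ← Finset.sum_div]
    rw [h1]
    ring
  rw [hsym]
  simp only [hwt, Finset.sum_add_distrib, ← Finset.mul_sum, Finset.sum_ite_eq, Finset.mem_univ,
    if_true, ← Finset.sum_mul]
  rw [hlam1, f₂]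
  ring

theorem integral_bulk_eq {lam : Bits n → ℝ} (hlam : ∀ i, 0 < lam i) (hlam1 : ∑ i, lam i = 1) :
    ∫ U : unitaryGroup (Bits n) ℂ, ∑ q, ∑ i, ∑ j,
        ((lam i + lam j) ^ 2 / (4 * 2 ^ m) * kleinSlope (lam i) (lam j)) * Complex.normSq
          (((U : Matrix (Bits n) (Bits n) ℂ)ᴴ * C.blockD q * U) i j) ∂haar =
      C.c₂ / 2 * f₂ lam + C.areaShift := by
  rw [integral_sum_normSq_conj C.blockD fun i j =>
    (lam i + lam j) ^ 2 / (4 * 2 ^ m) * kleinSlope (lam i) (lam j), sum_hsSq_blockD,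
    sum_normSq_trace_blockD, sum_kleinSlope_mul hlam hlam1 (by positivity), ← c₂_div_two, areaShift]
  ring

/-- Replace the optimal recovery by its corrected version, at no cost in entropy. The two linear
parts average to the same affine function of infidelities that are both `gap` · ε² + o(ε²), so they
cancel; the form on A₁ is negligible and only the bulk form survives. -/
theorem tendsto_avgSCorr {R : ℝ → Recovery n m} (hR : ∀ ε, IsOptimalRecovery (C.enc ε) (R ε))
    {σ : Matrix (Bits n) (Bits n) ℂ} (hσ : σ.PosDef) (hσ1 : σ.trace = 1) :
    Tendsto (fun ε => (ε ^ 2)⁻¹ * C.avgSCorr ε (R ε) σ) (𝓝[≠] 0)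
      (𝓝 (C.c₂ / 2 * f₂ hσ.isHermitian.eigenvalues + C.areaShift)) := by
  have havg := fun ε => C.avgSCorr_eq ε (R ε) hσ.isHermitian
  have hlam : ∀ i, 0 < hσ.isHermitian.eigenvalues i := hσ.eigenvalues_pos
  have hlam1 := sum_eigenvalues_eq_one hσ.isHermitian hσ1
  generalize hσ.isHermitian.eigenvalues = lam at havg hlam hlam1 ⊢
  obtain ⟨R', B, hconj, hfid, hclose⟩ := C.exists_corrected_optimal hR
  obtain ⟨a, b, hlin⟩ := exists_integral_linPart (m := m) lam
  have hsplit : ∀ ε, C.avgSCorr ε (R ε) σ =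
      (∫ U : unitaryGroup (Bits n) ℂ,
        kleinDiv (bulkSpec m lam) (C.bulkState lam ε (U : Matrix (Bits n) (Bits n) ℂ)) ∂haar) -
      (∫ U : unitaryGroup (Bits n) ℂ, kleinDiv lam ((U : Matrix (Bits n) (Bits n) ℂ)ᴴ *
        channel ((R' ε).op * C.enc ε) (rotState lam (U : Matrix (Bits n) (Bits n) ℂ)) * U) ∂haar) +
      (b * (1 - fid (C.skewEnc ε)) - b * (1 - fid ((R' ε).op * C.enc ε))) := by
    intro ε
    have h1 : ∀ U : unitaryGroup (Bits n) ℂ, C.sCorr ε (R ε)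
        (rotState lam (U : Matrix (Bits n) (Bits n) ℂ)) =
        kleinDiv (bulkSpec m lam) (C.bulkState lam ε (U : Matrix (Bits n) (Bits n) ℂ)) -
        kleinDiv lam ((U : Matrix (Bits n) (Bits n) ℂ)ᴴ *
          channel ((R' ε).op * C.enc ε) (rotState lam (U : Matrix (Bits n) (Bits n) ℂ)) * U) +
        (linPart lam (C.skewEnc ε) (U : Matrix (Bits n) (Bits n) ℂ) -
          linPart lam ((R' ε).op * C.enc ε) (U : Matrix (Bits n) (Bits n) ℂ)) := by
      intro U
      obtain ⟨u, hu, h⟩ := hconj ε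
      rw [← C.sCorr_localUnitary hlam hlam1 ε hu U.2 (h _), C.sCorr_eq hlam hlam1 ε (R' ε) U.2]
    have i1 := integrable_haar (C.continuous_kleinDiv_bulkState hlam ε)
    have i2 := integrable_haar (continuous_kleinDiv_channel hlam ((R' ε).op * C.enc ε))
    have i3 := integrable_haar (continuous_linPart lam (C.skewEnc ε))
    have i4 := integrable_haar (continuous_linPart lam ((R' ε).op * C.enc ε))
    rw [havg ε, integral_congr_ae (.of_forall h1), integral_sub_add_sub i1 i2 i3 i4,
      hlin _ (C.skewEnc_isometry ε),
      hlin _ (C.op_mul_enc_isometry (R' ε) ε)]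
    ring
  have t1 := C.tendsto_integral_kleinDiv_bulkState hlam
  rw [C.integral_bulk_eq hlam hlam1] at t1
  have t2 := tendsto_integral_kleinDiv_channel hlam hlam1 hclose
  have t3 := ((C.tendsto_one_sub_fid_skewEnc.const_mul b).sub (hfid.const_mul b))
  have t4 := (t1.sub t2).add t3
  rw [sub_zero, sub_self, add_zero] at t4
  refine t4.congr fun ε => ?_
  rw [hsplit]
  ring

end SkewedStabilizerCode

end SkewedCode

theorem mainTheorem1 (n m : ℕ) (hn : 1 ≤ n) (C : SkewedCode.SkewedStabilizerCode n m) :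
    ∃ K : ℝ, ∀ (α : ℝ), 1 < α → ∀ (L : List SkewedCode.Party),
      (L = [.A₁, .A₂, .Abar] ∨ L = [.r, .A₁, .A₂, .Abar]) →
      -- the minimization defining the non-local magic is well posed at order `ε ^ 2`
      (∀ (l : List SkewedCode.Party) (T : SkewedCode.Party → SkewedCode.Party →
          Matrix ((Fin n ⊕ Fin n ⊕ Fin m ⊕ Fin m) → Fin 2)
            ((Fin n ⊕ Fin n ⊕ Fin m ⊕ Fin m) → Fin 2) ℂ),
        l.Perm L → SkewedCode.IsTwoLocal (SkewedCode.party n m) T →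
          ∃ c : ℝ, Tendsto (SkewedCode.scaledMagic α l T C.choiState) (𝓝[≠] 0) (𝓝 c)) ∧
      IsLeast (SkewedCode.magicCoeffs α (SkewedCode.party n m) L C.choiState)
        (SkewedCode.nonlocalMagicCoeff α (SkewedCode.party n m) L C.choiState) ∧
      -- the coupling is the non-local magic up to a prefactor
      C.c₂ = (α - 1) / α * (1 - 1 / ((2 : ℝ) ^ n) ^ 2)⁻¹ *
        SkewedCode.nonlocalMagicCoeff α (SkewedCode.party n m) L C.choiState ∧
      -- the averaged proto-area correction, for every choice of optimal recoveries
      ∀ (σ : Matrix (SkewedCode.Bits n) (SkewedCode.Bits n) ℂ) (hσ : σ.PosDef), σ.trace = 1 →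
        ∀ R : ℝ → SkewedCode.Recovery n m,
          (∀ ε, SkewedCode.IsOptimalRecovery (C.enc ε) (R ε)) →
          (fun ε : ℝ => C.avgSCorr ε (R ε) σ -
            ((α - 1) / (2 * α) * (1 - 1 / ((2 : ℝ) ^ n) ^ 2)⁻¹ *
                SkewedCode.nonlocalMagic α (SkewedCode.party n m) L C.choiState ε *
                SkewedCode.f₂ hσ.isHermitian.eigenvalues + K * ε ^ 2))
            =o[𝓝[≠] 0] (fun ε : ℝ => ε ^ 2) := by
  -- The prefactor (α−1)/(2α) undoes the factor 2α/(α−1) in the magic, so neither c₂ nor the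
  -- constant K depends on α.
  refine ⟨C.areaShift, fun α hα L hL => ⟨fun l T hl hT => ⟨_, C.tendsto_scaledMagic hα
    (SkewedCode.SkewedStabilizerCode.nodup_of_perm hL hl) hT⟩, ?_, ?_, fun σ hσ hσ1 R hR => ?_⟩⟩
  · rw [C.nonlocalMagicCoeff_eq hα hL]
    exact C.isLeast_magicCoeffs hα hL
  · have h1 : α - 1 ≠ 0 := by linarith
    have h2 : α ≠ 0 := by linarith
    rw [C.nonlocalMagicCoeff_eq hα hL, C.c₂_eq hn]
    field_simp
  · have h1 : α - 1 ≠ 0 := by linarith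
    have h2 : α ≠ 0 := by linarith
    have h3 : ∀ ε : ℝ, (α - 1) / (2 * α) * (1 - 1 / ((2 : ℝ) ^ n) ^ 2)⁻¹ *
        SkewedCode.nonlocalMagic α (SkewedCode.party n m) L C.choiState ε *
        SkewedCode.f₂ hσ.isHermitian.eigenvalues + C.areaShift * ε ^ 2 =
        ε ^ 2 * (C.c₂ / 2 * SkewedCode.f₂ hσ.isHermitian.eigenvalues + C.areaShift) := by
      intro ε
      rw [SkewedCode.nonlocalMagic, C.nonlocalMagicCoeff_eq hα hL, C.c₂_eq hn]
      generalize (1 - 1 / ((2 : ℝ) ^ n) ^ 2)⁻¹ = z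
      field_simp
    rw [isLittleO_iff_tendsto' (by
      filter_upwards [self_mem_nhdsWithin] with ε hε h
      exact absurd (pow_eq_zero_iff two_ne_zero |>.mp h) hε)]
    have h4 := (C.tendsto_avgSCorr hR hσ hσ1).sub_const
      (C.c₂ / 2 * SkewedCode.f₂ hσ.isHermitian.eigenvalues + C.areaShift)
    rw [sub_self] at h4
    refine h4.congr' ?_
    filter_upwards [self_mem_nhdsWithin] with ε hε
    have h5 : ε ≠ 0 := hε
    rw [h3]
    field_simp
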